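/- Work over $\mathbb{C}$. Let $m,n\ge 0$ and $N\ge 2$ be integers. Let $T$ be the index set of $\mathfrak{gl}(m|n)$ ($m$ even and $n$ odd indices, $\tilde a\in\mathbb Z/2$ denoting the parity of $a$), and let $\Pi=\{1,\dots,N\}\times T$ with the parity of $(u,a)$ equal to $\tilde a$, so that $\mathfrak g:=\mathfrak{gl}(\Pi)\cong\mathfrak{gl}(Nm|Nn)$ consists of $N\times N$ block matrices with blocks in $\mathfrak{gl}(m|n)$. Let $(x|y)=\mathrm{str}(xy)$; let $f\in\mathfrak g$ have identity blocks directly below the block diagonal and zero blocks elsewhere; let $h$ be diagonal, equal to $N-2u+1$ on the $u$-th block, and put $\mathfrak g_i=\{x:[h,x]=2ix\}$, $\mathfrak p=\bigoplus_{i<1}\mathfrak g_i$, $\mathfrak n=\bigoplus_{i\ge 1/2}\mathfrak g_i$. Let $\mathcal V(\mathfrak g)=S(\mathbb C[\partial]\otimes\mathfrak g)$ be the superalgebra of differential polynomials in the elements $q_{ij}$ ($i,j\in\Pi$) corresponding to the elementary matrices $e_{ij}$, with the affine Poisson vertex superalgebra (PVsA) bracket of level $-1$, determined by $\{x_\lambda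 y\}_{\rm Aff}=[x,y]-\lambda(x|y)$ for $x,y\in\mathfrak g$. Let $\rho:\mathcal V(\mathfrak g)\to\mathcal V(\mathfrak p)\subseteq\mathcal V(\mathfrak g)$ be the homomorphism of differential superalgebras with $\rho(x)=\pi_{\mathfrak p}(x)+(f|x)$ for $x\in\mathfrak g$, where $\pi_{\mathfrak p}$ is the projection along $\bigoplus_{i\ge1}\mathfrak g_i$. The rectangular $\mathcal W$-superalgebra is $$\mathcal W=\mathcal W(\mathfrak{gl}(Nm|Nn),f)=\{a\in\mathcal V(\mathfrak p)\ :\ \rho\{\nu_\lambda a\}_{\rm Aff}=0\ \text{ for all }\nu\in\mathfrak n\},\qquad \{a_\lambda b\}_{\mathcal W}=\rho\{a_\lambda b\}_{\rm Aff}.$$ Multiply even matrix pseudo-differential operators by $(A\star B)_{ij}=\sum_sA_{is}B_{sj}$. Let $A(\partial)$ be the operator over $\mathcal V(\mathfrak g)$ with entries $A_{ij}(\partial)=\delta_{ij}\partial+(-1)^{\tilde\imath}q_{ij}$ ($i,j\in\Pi$), let $I,J\subset\Pi$ be the sets of indices of the last and of the first block, both identified with $T$, and put $$L(\partial)=(-1)^{N-1}\,|\rho(A(\partial))|_{IJ},\qquad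 |X|_{IJ}:=\big((X^{\rm inv})_{JI}\big)^{\rm inv},$$ with inverses taken for $\star$. **Theorem.** The operator $L(\partial)$ is well defined (all the inverses exist and are unique) and is an even matrix differential operator, monic of order $N$. All coefficients of its entries lie in $\mathcal W$, and $L(\partial)$ is a super Adler-type operator on $\mathcal W$, that is, for all $i,j,h,k\in T$, $$\{L_{ij}(z)_\lambda L_{hk}(w)\}_{\mathcal W}=(-1)^{\tilde\imath\tilde\jmath+\tilde\imath\tilde h+\tilde\jmath\tilde h}\Big(L_{hj}(z)\,\iota_z(z-w-\lambda-\partial)^{-1}L_{ik}(w)-L_{hj}(w+\lambda+\partial)\,\iota_z(z-w-\lambda-\partial)^{-1}(L_{ik})^*(\lambda-z)\Big).$$ Here $L_{ij}(z)$ is the symbol of $L_{ij}(\partial)$, $(\sum_ka_k\partial^k)^*=\sum_k(-\partial)^ka_k$, $\iota_z(z-w-\lambda-\partial)^{-1}=\sum_{t\ge0}z^{-t-1}(w+\lambda+\partial)^t$, and in each product the operators act on the last factor. In other words, $\mathcal W$ is the Adler-type PVsA associated with $L(\partial)$: $\mathcal W$ is a differential subalgebra of $\mathcal V(\mathfrak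 p)$ and a PVsA for $\{\,{}_\lambda\,\}_{\mathcal W}$; it is generated as a differential superalgebra by the coefficients of the entries of $L(\partial)$; writing $L(\partial)=\mathbb 1\,\partial^N+\sum_{k<N}\sum_{i,j}e_{ij}\otimes w_{ij;k}\,\partial^k$, the elements $w_{ij;k}$ ($i,j\in T$, $0\le k<N$) are differentially algebraically independent; and its $\lambda$-brackets are given by the displayed identity. -/

import Mathlib

/-! Poisson vertex superalgebras, rectangular W-superalgebras of `gl(Nm|Nn)` and matrix super
Adler-type operators, over the complex numbers.  Parities are elements of `ZMod 2`. -/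

namespace SuperPVA

open Polynomial

noncomputable section

/-- The sign `(-1)^a` of a parity `a`. -/
def sgn (a : ZMod 2) : ℂ := if a = 0 then 1 else -1

theorem sgn_zero : sgn 0 = 1 := by simp [sgn]

theorem sgn_add (a b : ZMod 2) : sgn (a + b) = sgn a * sgn b := by
  have h : ∀ a : ZMod 2, a = 0 ∨ a = 1 := by decide
  have h11 : (1 : ZMod 2) + 1 = 0 := by decide
  rcases h a with rfl | rfl <;> rcases h b with rfl | rfl <;> simp [sgn, h11]

theorem sgn_mul_self (a : ZMod 2) : sgn a * sgn a = 1 := by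
  unfold sgn; split_ifs <;> norm_num

/-! ### Differential superalgebras -/

/-- A (unital, associative, supercommutative) differential superalgebra with an even derivation.
The `ℤ/2`-grading is given by its parity involution: the even (odd) part is the eigenspace of
`parity` for the eigenvalue `1` (`-1`). -/
class DiffSuperalgebra (V : Type*) [Ring V] [Algebra ℂ V] where
  parity : V →ₐ[ℂ] V
  der : V →ₗ[ℂ] V
  parity_parity : ∀ a, parity (parity a) = a
  supercomm : ∀ (i j : ZMod 2) (a b : V), parity a = sgn i • a → parity b = sgn j • b →
    a * b = sgn (i * j) • (b * a)
  der_mul : ∀ a b, der (a * b) = der a * b + a * der b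
  parity_der : ∀ a, parity (der a) = der (parity a)

section General

variable {V : Type*} [Ring V] [Algebra ℂ V] [DiffSuperalgebra V]

/-- The parity involution. -/
def par : V →ₐ[ℂ] V := DiffSuperalgebra.parity

/-- The even derivation `∂`. -/
def der : V →ₗ[ℂ] V := DiffSuperalgebra.der

/-- `a` is homogeneous of parity `i` (the zero element has both parities). -/
def IsHomog (i : ZMod 2) (a : V) : Prop := par a = sgn i • a

/-- The component of parity `i` of an element. -/
def homComp (i : ZMod 2) (a : V) : V := (2⁻¹ : ℂ) • (a + sgn i • par a)

/-- A polynomial in the even indeterminate `λ` is homogeneous of parity `i`. -/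
def IsHomogPoly (i : ZMod 2) (P : V[X]) : Prop := ∀ n, IsHomog i (P.coeff n)

/-- Apply a linear map to the coefficients of a polynomial in `λ`. -/
def coeffMap (T : V →ₗ[ℂ] V) : V[X] →ₗ[ℂ] V[X] :=
  Polynomial.lsum fun n => ((Polynomial.monomial n : V →ₗ[V] V[X]).restrictScalars ℂ) ∘ₗ T

/-- The operator `λ + ∂` on `V[λ]`. -/
def lamD : V[X] →ₗ[ℂ] V[X] := LinearMap.mulLeft ℂ (X : V[X]) + coeffMap der

/-- `P ↦ ∑ₙ (-λ-∂)ⁿ pₙ` for `P = ∑ₙ λⁿ pₙ`; so `{b _{-λ-∂} a}` is `subNeg {b _λ a}`. -/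
def subNeg : V[X] →ₗ[ℂ] V[X] :=
  Polynomial.lsum fun n => ((-lamD) ^ n) ∘ₗ ((Polynomial.monomial 0 : V →ₗ[V] V[X]).restrictScalars ℂ)

/-- `{a _{λ+∂} c}_→ b = ∑ₙ (a_(n) c) (λ+∂)ⁿ b`, where `P = {a _λ c}`. -/
def arrow (P : V[X]) (b : V) : V[X] := P.sum fun n p => C p * (lamD ^ n) (C b)

/-- `B` is a `λ`-bracket on the differential superalgebra with underlying set `W`:
an even bilinear operation with values in `W[λ]` which is sesquilinear and satisfies both Leibniz
rules. -/
structure IsLambdaBracket (W : Set V) (B : V → V → V[X]) : Prop where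
  mem : ∀ a ∈ W, ∀ b ∈ W, ∀ n, (B a b).coeff n ∈ W
  add_left : ∀ a ∈ W, ∀ b ∈ W, ∀ c ∈ W, B (a + b) c = B a c + B b c
  add_right : ∀ a ∈ W, ∀ b ∈ W, ∀ c ∈ W, B a (b + c) = B a b + B a c
  smul_left : ∀ (r : ℂ), ∀ a ∈ W, ∀ b ∈ W, B (r • a) b = r • B a b
  smul_right : ∀ (r : ℂ), ∀ a ∈ W, ∀ b ∈ W, B a (r • b) = r • B a b
  even : ∀ i j, ∀ a ∈ W, ∀ b ∈ W, IsHomog i a → IsHomog j b → IsHomogPoly (i + j) (B a b)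
  sesq_left : ∀ a ∈ W, ∀ b ∈ W, B (der a) b = -(X * B a b)
  sesq_right : ∀ a ∈ W, ∀ b ∈ W, B a (der b) = lamD (B a b)
  leibniz_left : ∀ i j, ∀ a ∈ W, ∀ b ∈ W, ∀ c ∈ W, IsHomog i a → IsHomog j b →
    B a (b * c) = B a b * C c + sgn (i * j) • (C b * B a c)
  leibniz_right : ∀ i j k, ∀ a ∈ W, ∀ b ∈ W, ∀ c ∈ W, IsHomog i a → IsHomog j b → IsHomog k c →
    B (a * b) c = sgn (j * k) • arrow (B a c) b + sgn (i * (j + k)) • arrow (B b c) a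

/-- `W` is (the underlying set of) a differential sub-superalgebra. -/
def IsDiffSubalgebra (W : Set V) : Prop :=
  (∃ S : Subalgebra ℂ V, (S : Set V) = W) ∧ (∀ a ∈ W, par a ∈ W) ∧ ∀ a ∈ W, der a ∈ W

/-- `W`, a differential sub-superalgebra of `V`, is a Poisson vertex superalgebra for `B`.
The Jacobi identity is an identity in `V[λ][μ]`: the inner variable is `λ`, the outer one `μ`. -/
structure IsPVsA (W : Set V) (B : V → V → V[X]) : Prop where
  subalgebra : IsDiffSubalgebra W
  bracket : IsLambdaBracket W B
  skew : ∀ i j, ∀ a ∈ W, ∀ b ∈ W, IsHomog i a → IsHomog j b →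
    B a b = -(sgn (i * j) • subNeg (B b a))
  jacobi : ∀ i j k, ∀ a ∈ W, ∀ b ∈ W, ∀ c ∈ W, IsHomog i a → IsHomog j b → IsHomog k c →
    ((B b c).sum fun n p => monomial n (B a p) : V[X][X]) =
      ((B a b).sum fun n p => C (X ^ n) * ((B p c).sum fun k r => C (C r) * (C X + X) ^ k)) +
      sgn (i * j) • (B a c).sum fun n p => C (X ^ n) * (B b p).map C

/-! Helper facts: the operators above respect parity. -/

theorem isHomog_homComp (i : ZMod 2) (a : V) : IsHomog i (homComp i a) := by
  have h : par (par a) = a := DiffSuperalgebra.parity_parity a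
  simp only [IsHomog, homComp, map_smul, map_add, h]
  rw [smul_comm (sgn i), smul_add (sgn i), smul_smul (sgn i), sgn_mul_self, one_smul, add_comm]

/-- The parity involution on `V[λ]`. -/
def parPoly : V[X] →ₐ[ℂ] V[X] := Polynomial.mapAlgHom par

theorem coeff_parPoly (P : V[X]) (n : ℕ) : (parPoly P).coeff n = par (P.coeff n) := by
  simp [parPoly, Polynomial.coeff_map]

theorem isHomogPoly_iff (i : ZMod 2) (P : V[X]) :
    IsHomogPoly i P ↔ parPoly P = sgn i • P := by
  simp [IsHomogPoly, IsHomog, Polynomial.ext_iff, coeff_parPoly]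

set_option linter.unusedSectionVars false in
theorem coeff_coeffMap (T : V →ₗ[ℂ] V) (P : V[X]) (n : ℕ) :
    (coeffMap T P).coeff n = T (P.coeff n) := by
  induction P using Polynomial.induction_on' with
  | add P Q hP hQ => simp [hP, hQ]
  | monomial m a =>
    simp only [coeffMap, Polynomial.lsum_apply]
    rw [Polynomial.sum_monomial_index _ _ (by simp)]
    simp only [LinearMap.comp_apply, LinearMap.restrictScalars_apply, Polynomial.coeff_monomial]
    split_ifs <;> simp

theorem parPoly_lamD (P : V[X]) : parPoly (lamD P) = lamD (parPoly P) := by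
  have hX : parPoly (X : V[X]) = X := by simp [parPoly]
  have hd : parPoly (coeffMap der P) = coeffMap der (parPoly P) := by
    ext n
    rw [coeff_parPoly, coeff_coeffMap, coeff_coeffMap, coeff_parPoly]
    exact DiffSuperalgebra.parity_der _
  simp [lamD, hX, hd]

theorem parPoly_lamD_pow (n : ℕ) (P : V[X]) : parPoly ((lamD ^ n) P) = (lamD ^ n) (parPoly P) := by
  induction n with
  | zero => simp
  | succ n ih => rw [pow_succ', Module.End.mul_apply, parPoly_lamD, ih, Module.End.mul_apply]

theorem parPoly_neg_lamD_pow (n : ℕ) (P : V[X]) :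
    parPoly (((-lamD) ^ n) P) = ((-lamD) ^ n) (parPoly P) := by
  induction n with
  | zero => simp
  | succ n ih =>
    rw [pow_succ', Module.End.mul_apply, LinearMap.neg_apply, map_neg, parPoly_lamD, ih,
      Module.End.mul_apply, LinearMap.neg_apply]

theorem subNeg_monomial (n : ℕ) (a : V) : subNeg (monomial n a) = ((-lamD) ^ n) (C a) := by
  simp only [subNeg, Polynomial.lsum_apply]
  rw [Polynomial.sum_monomial_index _ _ (by simp)]
  rfl

theorem parPoly_subNeg (P : V[X]) : parPoly (subNeg P) = subNeg (parPoly P) := by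
  induction P using Polynomial.induction_on' with
  | add P Q hP hQ => simp [hP, hQ]
  | monomial n a =>
    have h1 : parPoly (monomial n a) = monomial n (par a) := by simp [parPoly]
    have h2 : parPoly (C a) = C (par a) := by simp [parPoly]
    rw [h1, subNeg_monomial, subNeg_monomial, parPoly_neg_lamD_pow, h2]

theorem C_mul_homog {i j : ZMod 2} {a : V} {P : V[X]} (ha : IsHomog i a) (hP : IsHomogPoly j P) :
    C a * P = sgn (i * j) • (P * C a) := by
  ext n
  rw [Polynomial.coeff_C_mul, Polynomial.coeff_smul, Polynomial.coeff_mul_C]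
  exact DiffSuperalgebra.supercomm i j _ _ ha (hP n)

end General

/-! ### Free supercommutative algebras and superalgebras of differential polynomials -/

section Free

variable {Y : Type*}

/-- Supercommutation of the generators `x ∈ Y` of parities `p x`
(for `x = y` odd this says `x² = 0`). -/
inductive SuperRel (p : Y → ZMod 2) : FreeAlgebra ℂ Y → FreeAlgebra ℂ Y → Prop
  | swap (x y : Y) : SuperRel p (FreeAlgebra.ι ℂ x * FreeAlgebra.ι ℂ y)
      (sgn (p x * p y) • (FreeAlgebra.ι ℂ y * FreeAlgebra.ι ℂ x))

/-- The free supercommutative algebra `S(U)`, for `U` the vector superspace with basis `Y`, the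
basis element `x` having parity `p x`. -/
def SuperPoly (p : Y → ZMod 2) : Type _ := RingQuot (SuperRel p)

instance (p : Y → ZMod 2) : Ring (SuperPoly p) := inferInstanceAs (Ring (RingQuot (SuperRel p)))

instance (p : Y → ZMod 2) : Algebra ℂ (SuperPoly p) :=
  inferInstanceAs (Algebra ℂ (RingQuot (SuperRel p)))

namespace SuperPoly

variable {p : Y → ZMod 2} {A : Type*} [Ring A] [Algebra ℂ A]

/-- The generators. -/
def gen (p : Y → ZMod 2) (x : Y) : SuperPoly p :=
  RingQuot.mkAlgHom ℂ (SuperRel p) (FreeAlgebra.ι ℂ x)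

theorem gen_swap (x y : Y) : gen p x * gen p y = sgn (p x * p y) • (gen p y * gen p x) := by
  have h := RingQuot.mkAlgHom_rel ℂ (SuperRel.swap (p := p) x y)
  rw [map_mul, map_smul, map_mul] at h
  exact h

/-- The universal property. -/
def lift (g : Y → A) (hg : ∀ x y, g x * g y = sgn (p x * p y) • (g y * g x)) :
    SuperPoly p →ₐ[ℂ] A :=
  RingQuot.liftAlgHom ℂ ⟨FreeAlgebra.lift ℂ g, by
    rintro _ _ ⟨x, y⟩
    simpa using hg x y⟩

theorem lift_gen (g : Y → A) (hg : ∀ x y, g x * g y = sgn (p x * p y) • (g y * g x)) (x : Y) :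
    lift g hg (gen p x) = g x := by
  unfold lift gen
  erw [RingQuot.liftAlgHom_mkAlgHom_apply]
  simp

@[elab_as_elim]
theorem induction {P : SuperPoly p → Prop} (hc : ∀ r : ℂ, P (algebraMap ℂ _ r))
    (hg : ∀ x, P (gen p x)) (hadd : ∀ a b, P a → P b → P (a + b))
    (hmul : ∀ a b, P a → P b → P (a * b)) (a : SuperPoly p) : P a := by
  obtain ⟨a, rfl⟩ := RingQuot.mkAlgHom_surjective ℂ (SuperRel p) a
  induction a using FreeAlgebra.induction with
  | grade0 r => rw [AlgHom.commutes]; exact hc r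
  | grade1 x => exact hg x
  | mul a b ha hb => rw [map_mul]; exact hmul _ _ ha hb
  | add a b ha hb => rw [map_add]; exact hadd _ _ ha hb

/-- The parity involution. -/
def parity (p : Y → ZMod 2) : SuperPoly p →ₐ[ℂ] SuperPoly p :=
  lift (fun x => sgn (p x) • gen p x) (fun x y => by
    simp only [smul_mul_smul_comm, gen_swap x y, smul_smul]
    congr 1
    ring)

theorem parity_gen (x : Y) : parity p (gen p x) = sgn (p x) • gen p x := lift_gen _ _ x

theorem parity_parity (a : SuperPoly p) : parity p (parity p a) = a := by
  induction a using induction with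
  | hc r => simp
  | hg x => rw [parity_gen, map_smul, parity_gen, smul_smul, sgn_mul_self, one_smul]
  | hadd a b ha hb => simp [ha, hb]
  | hmul a b ha hb => simp [ha, hb]

/-- The identity for `i = 0`, the parity involution for `i = 1`. -/
def twist (p : Y → ZMod 2) (i : ZMod 2) : SuperPoly p →ₐ[ℂ] SuperPoly p :=
  if i = 0 then AlgHom.id ℂ _ else parity p

theorem twist_homog {i j : ZMod 2} {a : SuperPoly p} (h : parity p a = sgn j • a) :
    twist p i a = sgn (i * j) • a := by
  have hi : ∀ i : ZMod 2, i = 0 ∨ i = 1 := by decide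
  rcases hi i with rfl | rfl
  · simp [twist, sgn_zero]
  · simp [twist, h]

theorem gen_mul (x : Y) (b : SuperPoly p) : gen p x * b = twist p (p x) b * gen p x := by
  induction b using induction with
  | hc r => rw [AlgHom.commutes, Algebra.commutes]
  | hg y => rw [gen_swap, twist_homog (parity_gen y), smul_mul_assoc]
  | hadd a b ha hb => rw [mul_add, ha, hb, map_add, add_mul]
  | hmul a b ha hb => rw [← mul_assoc, ha, mul_assoc, hb, map_mul, mul_assoc]

theorem supercomm (i j : ZMod 2) (a b : SuperPoly p) (ha : parity p a = sgn i • a)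
    (hb : parity p b = sgn j • b) : a * b = sgn (i * j) • (b * a) := by
  have key : ∀ a, a * b = b * twist p j a := by
    intro a
    induction a using induction with
    | hc r => rw [AlgHom.commutes, Algebra.commutes]
    | hg x =>
      rw [gen_mul, twist_homog hb, twist_homog (parity_gen x), smul_mul_assoc, mul_smul_comm,
        mul_comm (p x) j]
    | hadd a b ha hb => rw [add_mul, ha, hb, map_add, mul_add]
    | hmul a c ha hc => rw [mul_assoc, hc, ← mul_assoc, ha, map_mul, mul_assoc]
  rw [key, twist_homog ha, mul_smul_comm, mul_comm i j]

/-- Auxiliary homomorphism `a ↦ (φ₁ a, D a; 0, φ₂ a)` to triangular matrices, where `φ₁`, `φ₂` are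
the homomorphisms extending `g₁`, `g₂` and `D` is the extension of `d` with
`D (a b) = φ₁ a * D b + D a * φ₂ b`. -/
def triHom (g₁ g₂ d : Y → A) (h₁ : ∀ x y, g₁ x * g₁ y = sgn (p x * p y) • (g₁ y * g₁ x))
    (h₂ : ∀ x y, g₂ x * g₂ y = sgn (p x * p y) • (g₂ y * g₂ x))
    (hd : ∀ x y, g₁ x * d y + d x * g₂ y = sgn (p x * p y) • (g₁ y * d x + d y * g₂ x)) :
    SuperPoly p →ₐ[ℂ] Matrix (Fin 2) (Fin 2) A :=
  lift (fun x => !![g₁ x, d x; 0, g₂ x]) (fun x y => by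
    ext i j
    fin_cases i <;> fin_cases j <;> simp [Matrix.mul_apply, h₁ x y, h₂ x y, hd x y])

theorem triHom_gen (g₁ g₂ d : Y → A) (h₁ h₂ hd) (x : Y) :
    triHom (p := p) g₁ g₂ d h₁ h₂ hd (gen p x) = !![g₁ x, d x; 0, g₂ x] := lift_gen _ _ x

theorem triHom_diag (g₁ g₂ d : Y → A) (h₁ h₂ hd) (a : SuperPoly p) :
    triHom g₁ g₂ d h₁ h₂ hd a 1 0 = 0 ∧ triHom g₁ g₂ d h₁ h₂ hd a 0 0 = lift g₁ h₁ a ∧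
      triHom g₁ g₂ d h₁ h₂ hd a 1 1 = lift g₂ h₂ a := by
  induction a using induction with
  | hc r => simp [AlgHom.commutes, Matrix.algebraMap_matrix_apply]
  | hg x => simp [triHom_gen, lift_gen]
  | hadd a b ha hb => simp [ha, hb]
  | hmul a b ha hb => simp [ha, hb, Matrix.mul_apply]

theorem triHom_mul (g₁ g₂ d : Y → A) (h₁ h₂ hd) (a b : SuperPoly p) :
    triHom g₁ g₂ d h₁ h₂ hd (a * b) 0 1 = lift g₁ h₁ a * triHom g₁ g₂ d h₁ h₂ hd b 0 1 +
      triHom g₁ g₂ d h₁ h₂ hd a 0 1 * lift g₂ h₂ b := by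
  simp [Matrix.mul_apply, triHom_diag]

theorem lift_gen_self (h) (a : SuperPoly p) : lift (p := p) (gen p) h a = a := by
  induction a using induction with
  | hc r => simp
  | hg x => exact lift_gen _ _ x
  | hadd a b ha hb => simp [ha, hb]
  | hmul a b ha hb => simp [ha, hb]

end SuperPoly
end Free

section DiffPoly

variable {ι : Type*}

/-- The superalgebra of differential polynomials `ℂ[u_i^{(n)} | i ∈ ι, n ∈ ℕ]`, the generator
`u_i^{(n)} = ∂ⁿ u_i` having parity `p i`. -/
def DiffPoly (p : ι → ZMod 2) : Type _ := SuperPoly fun x : ι × ℕ => p x.1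

variable {p : ι → ZMod 2}

namespace DiffPoly

instance : Ring (DiffPoly p) := inferInstanceAs (Ring (SuperPoly fun x : ι × ℕ => p x.1))

instance : Algebra ℂ (DiffPoly p) :=
  inferInstanceAs (Algebra ℂ (SuperPoly fun x : ι × ℕ => p x.1))

/-- The generator `u_i^{(n)}`. -/
def gen (p : ι → ZMod 2) (i : ι) (n : ℕ) : DiffPoly p := SuperPoly.gen (fun x : ι × ℕ => p x.1) (i, n)

theorem gen_swap (i j : ι) (m n : ℕ) :
    gen p i m * gen p j n = sgn (p i * p j) • (gen p j n * gen p i m) :=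
  SuperPoly.gen_swap (p := fun x : ι × ℕ => p x.1) (i, m) (j, n)

@[elab_as_elim]
theorem induction {P : DiffPoly p → Prop} (hc : ∀ r : ℂ, P (algebraMap ℂ _ r))
    (hg : ∀ i n, P (gen p i n)) (hadd : ∀ a b, P a → P b → P (a + b))
    (hmul : ∀ a b, P a → P b → P (a * b)) (a : DiffPoly p) : P a :=
  SuperPoly.induction (p := fun x : ι × ℕ => p x.1) hc (fun x => hg x.1 x.2) hadd hmul a

/-- The homomorphism to triangular matrices whose upper right entry is `∂`. -/
def derHom : DiffPoly p →ₐ[ℂ] Matrix (Fin 2) (Fin 2) (DiffPoly p) :=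
  SuperPoly.triHom (p := fun x : ι × ℕ => p x.1) (fun x => gen p x.1 x.2) (fun x => gen p x.1 x.2)
    (fun x => gen p x.1 (x.2 + 1)) (fun _ _ => gen_swap _ _ _ _) (fun _ _ => gen_swap _ _ _ _)
    (fun x y => by
      rw [gen_swap x.1 y.1 x.2 (y.2 + 1), gen_swap x.1 y.1 (x.2 + 1) y.2, smul_add, add_comm])

/-- The derivation `∂` with `∂ u_i^{(n)} = u_i^{(n+1)}`. -/
def derivation : DiffPoly p →ₗ[ℂ] DiffPoly p where
  toFun a := derHom a 0 1
  map_add' a b := by simp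
  map_smul' r a := by simp

theorem derivation_gen (i : ι) (n : ℕ) : derivation (gen p i n) = gen p i (n + 1) := by
  have h := SuperPoly.triHom_gen (p := fun x : ι × ℕ => p x.1) (fun x => gen p x.1 x.2)
    (fun x => gen p x.1 x.2) (fun x => gen p x.1 (x.2 + 1)) (fun _ _ => gen_swap _ _ _ _)
    (fun _ _ => gen_swap _ _ _ _) (fun x y => by
      rw [gen_swap x.1 y.1 x.2 (y.2 + 1), gen_swap x.1 y.1 (x.2 + 1) y.2, smul_add, add_comm]) (i, n)
  exact congrFun (congrFun h 0) 1

theorem derivation_mul (a b : DiffPoly p) :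
    derivation (a * b) = derivation a * b + a * derivation b := by
  have h := SuperPoly.triHom_mul (p := fun x : ι × ℕ => p x.1) (fun x => gen p x.1 x.2)
    (fun x => gen p x.1 x.2) (fun x => gen p x.1 (x.2 + 1)) (fun _ _ => gen_swap _ _ _ _)
    (fun _ _ => gen_swap _ _ _ _) (fun x y => by
      rw [gen_swap x.1 y.1 x.2 (y.2 + 1), gen_swap x.1 y.1 (x.2 + 1) y.2, smul_add, add_comm]) a b
  have hl : ∀ (h) (a : DiffPoly p), SuperPoly.lift (p := fun x : ι × ℕ => p x.1)
      (fun x => gen p x.1 x.2) h a = a :=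
    fun h a => SuperPoly.lift_gen_self (p := fun x : ι × ℕ => p x.1) h a
  erw [hl, hl] at h
  rw [add_comm]
  exact h

/-- The parity involution. -/
def parity (p : ι → ZMod 2) : DiffPoly p →ₐ[ℂ] DiffPoly p :=
  SuperPoly.parity fun x : ι × ℕ => p x.1

theorem parity_gen (i : ι) (n : ℕ) : parity p (gen p i n) = sgn (p i) • gen p i n :=
  SuperPoly.parity_gen (p := fun x : ι × ℕ => p x.1) (i, n)

theorem derivation_algebraMap (r : ℂ) : derivation (algebraMap ℂ (DiffPoly p) r) = 0 := by
  have h : derivation (1 : DiffPoly p) = 0 := by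
    have := derivation_mul (1 : DiffPoly p) 1
    simpa using this
  rw [Algebra.algebraMap_eq_smul_one, map_smul, h, smul_zero]

theorem parity_derivation (a : DiffPoly p) : parity p (derivation a) = derivation (parity p a) := by
  induction a using induction with
  | hc r => rw [AlgHom.commutes, derivation_algebraMap, map_zero]
  | hg i n => rw [derivation_gen, parity_gen, parity_gen, map_smul, derivation_gen]
  | hadd a b ha hb => simp [ha, hb]
  | hmul a b ha hb => simp [derivation_mul, ha, hb]

instance : DiffSuperalgebra (DiffPoly p) where
  parity := parity p
  der := derivation
  parity_parity a := SuperPoly.parity_parity (p := fun x : ι × ℕ => p x.1) a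
  supercomm i j a b := SuperPoly.supercomm (p := fun x : ι × ℕ => p x.1) i j a b
  der_mul := derivation_mul
  parity_der := parity_derivation

theorem isHomog_gen (i : ι) (n : ℕ) : IsHomog (p i) (gen p i n) := parity_gen i n

/-! #### Twisted derivations and the `λ`-bracket determined by its values on generators -/

/-- `a ↦ (φ₁ a, D a; 0, a)` with `φ₁ a = (-1)^{k ã} a`, and `D` as in `twDer`. -/
def twHom (k : ZMod 2) (d : ι × ℕ → (DiffPoly p)[X]) (hd : ∀ x, IsHomogPoly (k + p x.1) (d x)) :
    DiffPoly p →ₐ[ℂ] Matrix (Fin 2) (Fin 2) (DiffPoly p)[X] :=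
  SuperPoly.triHom (p := fun x : ι × ℕ => p x.1) (fun x => sgn (k * p x.1) • C (gen p x.1 x.2))
    (fun x => C (gen p x.1 x.2)) d
    (fun x y => by
      simp only [smul_mul_smul_comm, ← C_mul, gen_swap x.1 y.1, smul_smul, ← smul_C]
      congr 1
      ring)
    (fun x y => by simp only [← C_mul, gen_swap x.1 y.1, ← smul_C])
    (fun x y => by
      rw [smul_mul_assoc, smul_mul_assoc, C_mul_homog (isHomog_gen x.1 x.2) (hd y),
        C_mul_homog (isHomog_gen y.1 y.2) (hd x), smul_add, smul_smul, smul_smul, smul_smul,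
        add_comm]
      congr 1
      · rw [← sgn_add, ← sgn_add,
          show p x.1 * p y.1 + k * p y.1 + p y.1 * (k + p x.1) =
            (k * p y.1 + k * p y.1) + (p x.1 * p y.1 + p x.1 * p y.1) by ring,
          CharTwo.add_self_eq_zero, CharTwo.add_self_eq_zero, add_zero, sgn_zero, one_smul]
      · rw [← sgn_add, show k * p x.1 + p x.1 * (k + p y.1) =
            (k * p x.1 + k * p x.1) + p x.1 * p y.1 by ring,
          CharTwo.add_self_eq_zero, zero_add])

/-- The twisted derivation `D : V → V[λ]` of parity `k` with `D u_i^{(n)} = d (i, n)`: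
`D (a b) = (-1)^{k ã} a D b + (D a) b`. -/
def twDer (k : ZMod 2) (d : ι × ℕ → (DiffPoly p)[X]) (hd : ∀ x, IsHomogPoly (k + p x.1) (d x)) :
    DiffPoly p →ₗ[ℂ] (DiffPoly p)[X] where
  toFun a := twHom k d hd a 0 1
  map_add' a b := by simp
  map_smul' r a := by simp

theorem twDer_gen (k : ZMod 2) (d : ι × ℕ → (DiffPoly p)[X]) (hd) (i : ι) (n : ℕ) :
    twDer k d hd (gen p i n) = d (i, n) := by
  have h : twHom k d hd (gen p i n) = _ :=
    SuperPoly.triHom_gen (p := fun x : ι × ℕ => p x.1) _ _ _ _ _ _ (i, n)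
  exact congrFun (congrFun h 0) 1

/-- The identity for `k = 0`, the parity involution for `k = 1`. -/
def twist (k : ZMod 2) : DiffPoly p →ₐ[ℂ] DiffPoly p :=
  SuperPoly.twist (fun x : ι × ℕ => p x.1) k

theorem twDer_mul (k : ZMod 2) (d : ι × ℕ → (DiffPoly p)[X]) (hd) (a b : DiffPoly p) :
    twDer k d hd (a * b) = C (twist k a) * twDer k d hd b + twDer k d hd a * C b := by
  have h : twHom k d hd (a * b) 0 1 = _ :=
    SuperPoly.triHom_mul (p := fun x : ι × ℕ => p x.1) _ _ _ _ _ _ a b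
  have h1 : ∀ (h) (a : DiffPoly p), SuperPoly.lift (p := fun x : ι × ℕ => p x.1)
      (fun x => C (gen p x.1 x.2)) h a = C a := by
    intro h a
    induction a using induction with
    | hc r => erw [AlgHom.commutes]; rfl
    | hg i n => exact SuperPoly.lift_gen _ h (i, n)
    | hadd a b ha hb => erw [map_add, ha, hb, C_add]
    | hmul a b ha hb => erw [map_mul, ha, hb, C_mul]
  have h2 : ∀ (h) (a : DiffPoly p), SuperPoly.lift (p := fun x : ι × ℕ => p x.1)
      (fun x => sgn (k * p x.1) • C (gen p x.1 x.2)) h a = C (twist k a) := by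
    intro h a
    induction a using induction with
    | hc r => erw [AlgHom.commutes, AlgHom.commutes]; rfl
    | hg i n =>
      have : twist k (gen p i n) = sgn (k * p i) • gen p i n :=
        SuperPoly.twist_homog (p := fun x : ι × ℕ => p x.1) (parity_gen i n)
      rw [this, ← smul_C]
      exact SuperPoly.lift_gen _ h (i, n)
    | hadd a b ha hb => erw [map_add, ha, hb, map_add, C_add]
    | hmul a b ha hb => erw [map_mul, ha, hb, map_mul, C_mul]
  erw [h1, h2] at h
  exact h

theorem twDer_algebraMap (k : ZMod 2) (d : ι × ℕ → (DiffPoly p)[X]) (hd) (r : ℂ) :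
    twDer k d hd (algebraMap ℂ _ r) = 0 := by
  have h : twDer k d hd 1 = 0 := by
    have := twDer_mul k d hd 1 1
    simpa using this
  rw [Algebra.algebraMap_eq_smul_one, map_smul, h, smul_zero]

theorem parPoly_twDer (k : ZMod 2) (d : ι × ℕ → (DiffPoly p)[X]) (hd) (a : DiffPoly p) :
    parPoly (twDer k d hd a) = sgn k • twDer k d hd (par a) := by
  have hC : ∀ a : DiffPoly p, parPoly (C a) = C (par a) := fun a => by simp [parPoly]
  have ht : ∀ a : DiffPoly p, par (twist k a) = twist k (par a) := by
    intro a
    have hk : ∀ k : ZMod 2, k = 0 ∨ k = 1 := by decide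
    rcases hk k with rfl | rfl <;> rfl
  induction a using induction with
  | hc r => rw [AlgHom.commutes, twDer_algebraMap, map_zero, smul_zero]
  | hg i n =>
    have h : par (gen p i n) = sgn (p i) • gen p i n := isHomog_gen i n
    rw [h, map_smul, twDer_gen, (isHomogPoly_iff _ _).1 (hd (i, n)), smul_smul, sgn_add]
  | hadd a b ha hb => simp [ha, hb]
  | hmul a b ha hb =>
    rw [twDer_mul, map_add, map_mul, map_mul, ha, hb, hC, hC, map_mul, twDer_mul, ht, smul_add,
      mul_smul_comm, smul_mul_assoc]

theorem isHomogPoly_twDer (k : ZMod 2) (d : ι × ℕ → (DiffPoly p)[X]) (hd) {j : ZMod 2}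
    {a : DiffPoly p} (ha : IsHomog j a) : IsHomogPoly (k + j) (twDer k d hd a) := by
  rw [isHomogPoly_iff, parPoly_twDer, ha, map_smul, smul_smul, sgn_add]

variable (b : ι → ι → (DiffPoly p)[X]) (hb : ∀ i j, IsHomogPoly (p i + p j) (b i j))

/-- `{u_i _λ g}`: the derivation in `g` with `{u_i _λ u_j^{(n)}} = (λ+∂)ⁿ {u_i _λ u_j}`,
where `{u_i _λ u_j} = b i j`. -/
def bracketGen (i : ι) : DiffPoly p →ₗ[ℂ] (DiffPoly p)[X] :=
  twDer (p i) (fun x => (lamD ^ x.2) (b i x.1)) fun x => by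
    rw [isHomogPoly_iff, parPoly_lamD_pow, (isHomogPoly_iff _ _).1 (hb i x.1), map_smul]

theorem isHomogPoly_bracketGen (i : ι) {k : ZMod 2} {f : DiffPoly p} (hf : IsHomog k f) :
    IsHomogPoly (p i + k) (bracketGen b hb i f) := isHomogPoly_twDer _ _ _ hf

/-- `{f_k _λ g}` for `f_k` the component of parity `k` of `f`: the derivation in `g` with
`{f_k _λ u_j^{(n)}} = (λ+∂)ⁿ {f_k _λ u_j}`, where `{f_k _λ u_j}` is given by skew-symmetry,
`{f_k _λ u_j} = -(-1)^{k ũ_j} {u_j _{-λ-∂} f_k}`. -/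
def bracketHom (k : ZMod 2) (f : DiffPoly p) : DiffPoly p →ₗ[ℂ] (DiffPoly p)[X] :=
  twDer k (fun x => (lamD ^ x.2)
    (-(sgn (k * p x.1) • subNeg (bracketGen b hb x.1 (homComp k f))))) fun x => by
    have h := (isHomogPoly_iff _ _).1 (isHomogPoly_bracketGen b hb x.1 (isHomog_homComp k f))
    rw [isHomogPoly_iff, parPoly_lamD_pow, map_neg, map_smul, parPoly_subNeg, h, map_smul,
      smul_comm, ← smul_neg, map_smul, add_comm]

/-- The `λ`-bracket on `ℂ[u_i^{(n)}]` with `{u_i _λ u_j} = b i j`, for values `b` which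
satisfy skew-symmetry, extended to all differential polynomials by sesquilinearity,
skew-symmetry and the Leibniz rules. -/
def bracket (f g : DiffPoly p) : (DiffPoly p)[X] :=
  bracketHom b hb 0 f g + bracketHom b hb 1 f g

end DiffPoly
end DiffPoly

/-! ### The affine Poisson vertex superalgebra of `gl(S)` -/

section Affine

variable {S : Type*} [Fintype S] [DecidableEq S] (π : S → ZMod 2)

/-- The parity of the elementary matrix `e_{ij}`. -/
def glPar : S × S → ZMod 2 := fun x => π x.1 + π x.2

/-- The elementary matrix `e_{ij}`. -/
def eMat (x : S × S) : Matrix S S ℂ := Matrix.single x.1 x.2 1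

/-- The Lie superalgebra bracket `[e_{ij}, e_{hk}]` of `gl(S)`. -/
def glBracket (x y : S × S) : Matrix S S ℂ :=
  eMat x * eMat y - sgn (glPar π x * glPar π y) • (eMat y * eMat x)

/-- The supertrace form `(a|b) = str(ab)`. -/
def strForm (a b : Matrix S S ℂ) : ℂ := ∑ i, sgn (π i) * (a * b) i i

/-- The differential superalgebra `𝒱(gl(S))`, with generators `q_{ij}` corresponding to `e_{ij}`. -/
abbrev AffV := DiffPoly (glPar π)

/-- The embedding `gl(S) → 𝒱(gl(S))`, `e_{ij} ↦ q_{ij}`. -/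
def qMat (a : Matrix S S ℂ) : AffV π := ∑ x : S × S, a x.1 x.2 • DiffPoly.gen (glPar π) x 0

/-- `[a,b] + κ λ (a|b)` for `a = e_{ij}`, `b = e_{hk}`. -/
def affValue (κ : ℂ) (x y : S × S) : (AffV π)[X] :=
  C (qMat π (glBracket π x y)) + (κ * strForm π (eMat x) (eMat y)) • X

theorem strForm_eMat (a : Matrix S S ℂ) (x : S × S) :
    strForm π a (eMat x) = sgn (π x.2) * a x.2 x.1 := by
  rw [strForm, Finset.sum_eq_single x.2]
  · simp [eMat]
  · intro i _ hi
    simp [eMat, Matrix.mul_single_apply_of_ne _ _ _ _ _ hi]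
  · simp

theorem isHomogPoly_affValue (κ : ℂ) (x y : S × S) :
    IsHomogPoly (glPar π x + glPar π y) (affValue π κ x y) := by
  have hq : ∀ z : S × S, qMat π (eMat z) = DiffPoly.gen (glPar π) z 0 := by
    intro z
    rw [qMat, Finset.sum_eq_single z]
    · simp [eMat]
    · intro w _ hw
      have : ¬ (z.1 = w.1 ∧ z.2 = w.2) := fun h => hw (Prod.ext h.1.symm h.2.symm)
      simp [eMat, this]
    · simp
  have hs : ∀ a b, qMat π (a - b) = qMat π a - qMat π b := by
    intro a b
    simp [qMat, sub_smul, Finset.sum_sub_distrib]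
  have hc : ∀ (r : ℂ) a, qMat π (r • a) = r • qMat π a := by
    intro r a
    simp [qMat, mul_smul, Finset.smul_sum]
  have h0 : qMat π (0 : Matrix S S ℂ) = 0 := by simp [qMat]
  have hm : ∀ z w : S × S, par (qMat π (eMat z * eMat w)) =
      sgn (glPar π z + glPar π w) • qMat π (eMat z * eMat w) := by
    intro z w
    by_cases h : z.2 = w.1
    · have : eMat z * eMat w = eMat (z.1, w.2) := by
        simp [eMat, h]
      rw [this, hq, show par (DiffPoly.gen (glPar π) (z.1, w.2) 0) = _ from
        DiffPoly.isHomog_gen _ _]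
      congr 2
      simp only [glPar]
      rw [h, show π z.1 + π w.1 + (π w.1 + π w.2) = π z.1 + π w.2 + (π w.1 + π w.1) by ring,
        CharTwo.add_self_eq_zero, add_zero]
    · have : eMat z * eMat w = 0 := by
        simp [eMat, Matrix.single_mul_single_of_ne _ _ _ _ h]
      rw [this, h0]
      simp
  have hf : sgn (glPar π x + glPar π y) * strForm π (eMat x) (eMat y) =
      strForm π (eMat x) (eMat y) := by
    rw [strForm_eMat]
    by_cases h : x.1 = y.2 ∧ x.2 = y.1
    · simp only [glPar, h.1, h.2]
      rw [add_comm (π y.2), CharTwo.add_self_eq_zero, sgn_zero, one_mul]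
    · simp [eMat, h]
  rw [isHomogPoly_iff, affValue, map_add, map_smul, smul_add, smul_smul]
  congr 1
  · have : ∀ a : AffV π, parPoly (C a) = C (par a) := fun a => by simp [parPoly]
    rw [this, smul_C, glBracket, hs, hc, map_sub, map_smul, hm, hm, smul_sub, smul_comm,
      add_comm (glPar π y)]
  · rw [mul_left_comm, hf]
    simp [parPoly]

/-- The `λ`-bracket of the affine Poisson vertex superalgebra `𝒱^κ(gl(S))` of level `κ`. -/
def affBracket (κ : ℂ) : AffV π → AffV π → (AffV π)[X] :=
  DiffPoly.bracket (affValue π κ) (isHomogPoly_affValue π κ)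

end Affine

/-! ### Matrix pseudo-differential operators and quasi-determinants -/

section PDO

/-- Matrix pseudo-differential operators `∑_{k ≤ M} a_k ∂^k` of size `I × J` over `V`. -/
@[ext]
structure MatPDO (I J V : Type*) [Zero V] where
  coeff : ℤ → Matrix I J V
  bdd : ∃ M, ∀ n, M < n → coeff n = 0

namespace MatPDO

variable {I J K V : Type*} [Ring V] [Algebra ℂ V] [DiffSuperalgebra V]

/-- The `⋆`-product of even matrix pseudo-differential operators,
`(A ⋆ B)_{ij} = ∑_s A_{is} B_{sj}`, with `∂^k b = ∑_{l ≥ 0} (k choose l) b^{(l)} ∂^{k-l}`. -/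
def star [Fintype J] (A : MatPDO I J V) (B : MatPDO J K V) : MatPDO I K V where
  coeff n := ∑ᶠ x : ℤ × ℕ, Ring.choose x.1 x.2 •
    (A.coeff x.1 * (B.coeff (n - x.1 + x.2)).map (der ^ x.2 : Module.End ℂ V))
  bdd := by
    obtain ⟨M, hM⟩ := A.bdd
    obtain ⟨M', hM'⟩ := B.bdd
    refine ⟨M + M', fun n hn => finsum_eq_zero_of_forall_eq_zero fun x => ?_⟩
    rcases lt_or_ge M x.1 with h | h
    · simp [hM _ h]
    · have : M' < n - x.1 + x.2 := by omega
      rw [hM' _ this, Matrix.map_zero _ (map_zero _), Matrix.mul_zero, smul_zero]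

/-- The identity matrix. -/
def one [DecidableEq I] : MatPDO I I V where
  coeff n := if n = 0 then 1 else 0
  bdd := ⟨0, fun n hn => by simp [hn.ne']⟩

/-- Scalar multiples. -/
def smul (c : ℂ) (A : MatPDO I J V) : MatPDO I J V where
  coeff n := c • A.coeff n
  bdd := by
    obtain ⟨M, hM⟩ := A.bdd
    exact ⟨M, fun n hn => by rw [hM n hn, smul_zero]⟩

/-- The submatrix with rows and columns given by `r` and `c`. -/
def sub {I' J' : Type*} (A : MatPDO I J V) (r : I' → I) (c : J' → J) : MatPDO I' J' V where
  coeff n := (A.coeff n).submatrix r c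
  bdd := by
    obtain ⟨M, hM⟩ := A.bdd
    exact ⟨M, fun n hn => by rw [hM n hn, Matrix.submatrix_zero]; rfl⟩

/-- Apply an algebra homomorphism to all coefficients. -/
def mapCoeff (φ : V →ₐ[ℂ] V) (A : MatPDO I J V) : MatPDO I J V where
  coeff n := (A.coeff n).map φ
  bdd := by
    obtain ⟨M, hM⟩ := A.bdd
    exact ⟨M, fun n hn => by rw [hM n hn, Matrix.map_zero _ (map_zero φ)]⟩

/-- `B` is the `⋆`-inverse of `A`. -/
def IsStarInv [Fintype I] [Fintype J] [DecidableEq I] [DecidableEq J]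
    (A : MatPDO I J V) (B : MatPDO J I V) : Prop := A.star B = one ∧ B.star A = one

/-- `Q` is the quasi-determinant `|A|_{JK} = ((A^inv)_{KJ})^inv`, where the index subsets `J`, `K`
are given by the injections `r`, `c`. -/
def IsQuasidet [Fintype I] [Fintype J] [Fintype K] [DecidableEq I] [DecidableEq J] [DecidableEq K]
    (A : MatPDO I I V) (r : J → I) (c : K → I) (Q : MatPDO J K V) : Prop :=
  ∃ B : MatPDO I I V, IsStarInv A B ∧ IsStarInv (B.sub c r) Q

/-- `A` is even: its `ij`-entry has parity `ĩ + j̃`. -/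
def IsEven (π : I → ZMod 2) (A : MatPDO I I V) : Prop :=
  ∀ n i j, IsHomog (π i + π j) (A.coeff n i j)

/-- `A` is monic of order `N`. -/
def IsMonic [DecidableEq I] (N : ℤ) (A : MatPDO I I V) : Prop :=
  A.coeff N = 1 ∧ ∀ n, N < n → A.coeff n = 0

/-- `A` is a differential operator. -/
def IsDifferential (A : MatPDO I J V) : Prop := ∀ n < 0, A.coeff n = 0

/-- The scalar entry `A_{ij}(∂)`, as its family of coefficients. -/
def entry (A : MatPDO I J V) (i : I) (j : J) : ℤ → V := fun n => A.coeff n i j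

end MatPDO

/-! ### The super Adler identity

A scalar pseudo-differential operator `a(∂) = ∑_k a_k ∂^k` is represented by `k ↦ a_k`.  -/

section Adler

variable {V : Type*} [Ring V] [Algebra ℂ V] [DiffSuperalgebra V]

/-- The coefficient of `z^q` in `a^*(λ-z) = ∑_k (z-λ-∂)^k a_k` (expanded for large `z`). -/
def adjCoeff (a : ℤ → V) (q : ℤ) : V[X] :=
  ∑ᶠ c : ℕ, Ring.choose (q + c) c • ((-lamD) ^ c) (C (a (q + c)))

/-- The coefficient of `w^s` in `a(w+λ+∂) (w+λ+∂)^t P` (expanded for large `w`). -/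
def shiftCoeff (a : ℤ → V) (t : ℕ) (P : V[X]) (s : ℤ) : V[X] :=
  ∑ᶠ c : ℕ, Ring.choose (s + c) c • (C (a (s + c - t)) * (lamD ^ c) P)

/-- The coefficient of `z^r w^s` in `a(w+λ+∂) ι_z(z-w-λ-∂)⁻¹ b^*(λ-z)`, where
`ι_z(z-w-λ-∂)⁻¹ = ∑_{t ≥ 0} z^{-t-1} (w+λ+∂)^t`. -/
def adlerStar (a b : ℤ → V) (r s : ℤ) : V[X] :=
  ∑ᶠ t : ℕ, shiftCoeff a t (adjCoeff b (r + t + 1)) s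

/-- The coefficient of `z^r w^s` in `a(z) ι_z(z-w-λ-∂)⁻¹ b(w)`. -/
def adlerPlain (a b : ℤ → V) (r s : ℤ) : V[X] :=
  ∑ᶠ t : ℕ, C (a (r + t + 1)) *
    ∑ c ∈ Finset.range (t + 1), (t.choose c) • (lamD ^ c) (C (b (s - (t - c : ℕ))))

/-- `A(∂)` is a matrix super Adler-type operator for the bracket `B`: it is even, and
`{A_{ij}(z) _λ A_{hk}(w)} = (-1)^{ĩj̃+ĩh̃+j̃h̃} (A_{hj}(z) ι_z(z-w-λ-∂)⁻¹ A_{ik}(w)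
  - A_{hj}(w+λ+∂) ι_z(z-w-λ-∂)⁻¹ (A_{ik})^*(λ-z))`,
stated for the coefficients of all `z^r w^s`. -/
def IsSATO {I : Type*} (π : I → ZMod 2) (B : V → V → V[X]) (A : MatPDO I I V) : Prop :=
  A.IsEven π ∧ ∀ (i j h k : I) (r s : ℤ),
    B (A.coeff r i j) (A.coeff s h k) =
      sgn (π i * π j + π i * π h + π j * π h) •
        (adlerPlain (A.entry h j) (A.entry i k) r s - adlerStar (A.entry h j) (A.entry i k) r s)

/-- The differential subalgebra generated by the coefficients of the entries of `A`. -/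
def diffClosure {I J : Type*} (A : MatPDO I J V) : Subalgebra ℂ V :=
  Algebra.adjoin ℂ {v | ∃ (l : ℕ) (k : ℤ) (i : I) (j : J),
    v = (der ^ l : Module.End ℂ V) (A.coeff k i j)}

/-- The elements `v x`, where `v x` has parity `p x`, are differentially algebraically
independent. -/
def DiffAlgIndep {Y : Type*} (p : Y → ZMod 2) (v : Y → V) : Prop :=
  ∃ φ : DiffPoly p →ₐ[ℂ] V,
    (∀ x n, φ (DiffPoly.gen p x n) = (der ^ n : Module.End ℂ V) (v x)) ∧ Function.Injective φ

/-- `W`, with the bracket `B`, is the Adler-type Poisson vertex superalgebra associated with the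
monic matrix differential operator `A` of order `N`: it is a Poisson vertex superalgebra, freely
generated as a differential superalgebra by the coefficients of `A` (other than the leading one),
whose `λ`-brackets are given by the super Adler identity. -/
structure IsAdlerTypePVsA {I : Type*} (π : I → ZMod 2) (W : Set V) (B : V → V → V[X]) (N : ℕ)
    (A : MatPDO I I V) : Prop where
  pvsa : IsPVsA W B
  generated : (diffClosure A : Set V) = W
  indep : DiffAlgIndep (fun x : Fin N × I × I => π x.2.1 + π x.2.2)
    (fun x => A.coeff (x.1 : ℕ) x.2.1 x.2.2)
  sato : IsSATO π B A

end Adler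
end PDO

/-! ### The rectangular W-superalgebra of `gl(Nm|Nn)` -/

section Rectangular

variable (m n N : ℕ)

/-- The index set of `gl(m|n)`: the `m` indices `inl a` are even, the `n` indices `inr b` odd. -/
abbrev GlIdx := Fin m ⊕ Fin n

/-- The index set of `gl(Nm|Nn)`: an index is a pair (number `u` of the block, position within the
block).  The blocks are numbered from `0`. -/
abbrev RIdx := Fin N × GlIdx m n

/-- Parity on the indices of `gl(m|n)`. -/
def innerPar : GlIdx m n → ZMod 2 := Sum.elim (fun _ => 0) (fun _ => 1)

/-- Parity on the indices of `gl(Nm|Nn)`. -/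
def rectPar : RIdx m n N → ZMod 2 := fun x => innerPar m n x.2

/-- The rectangular nilpotent `f`: identity blocks just below the block diagonal. -/
def nilF : Matrix (RIdx m n N) (RIdx m n N) ℂ :=
  Matrix.of fun x y => if (x.1 : ℕ) = y.1 + 1 ∧ x.2 = y.2 then 1 else 0

/-- The diagonal entries of the element `h` of the `sl₂`-triple of `f`: `N-1, N-3, …, 1-N`. -/
def hEntry (x : RIdx m n N) : ℤ := N - 1 - 2 * (x.1 : ℕ)

/-- `e_{xy}` lies in `𝔤_d`, with `2 d = hDeg (x, y)`, i.e. `[h, e_{xy}] = 2 d e_{xy}`. -/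
def hDeg (x : RIdx m n N × RIdx m n N) : ℤ := hEntry m n N x.1 - hEntry m n N x.2

/-- The differential superalgebra `𝒱(gl(Nm|Nn))`. -/
abbrev RectV := AffV (rectPar m n N)

/-- The subalgebra `𝒱(𝔭)`, where `𝔭 = 𝔤_{<1}`. -/
def subVp : Subalgebra ℂ (RectV m n N) :=
  Algebra.adjoin ℂ {v | ∃ x k, hDeg m n N x < 2 ∧ v = DiffPoly.gen _ x k}

/-- `ρ(∂^k q_x)`, where `ρ(a) = π_𝔭(a) + (f|a)` for `a ∈ 𝔤`. -/
def rhoGen (x : (RIdx m n N × RIdx m n N) × ℕ) : RectV m n N :=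
  (if hDeg m n N x.1 < 2 then DiffPoly.gen _ x.1 x.2 else 0) +
    if x.2 = 0 then algebraMap ℂ _ (strForm (rectPar m n N) (nilF m n N) (eMat x.1)) else 0

theorem isHomog_rhoGen (x : (RIdx m n N × RIdx m n N) × ℕ) :
    IsHomog (glPar (rectPar m n N) x.1) (rhoGen m n N x) := by
  have h1 : par (if hDeg m n N x.1 < 2 then DiffPoly.gen _ x.1 x.2 else 0 : RectV m n N) =
      sgn (glPar (rectPar m n N) x.1) •
        (if hDeg m n N x.1 < 2 then DiffPoly.gen _ x.1 x.2 else 0 : RectV m n N) := by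
    split_ifs
    · exact DiffPoly.isHomog_gen _ _
    · simp
  have h2 : sgn (glPar (rectPar m n N) x.1) *
      strForm (rectPar m n N) (nilF m n N) (eMat x.1) =
      strForm (rectPar m n N) (nilF m n N) (eMat x.1) := by
    rw [strForm_eMat]
    by_cases h : x.1.2.2 = x.1.1.2
    · have : glPar (rectPar m n N) x.1 = 0 := by
        simp only [glPar, rectPar, h]
        exact CharTwo.add_self_eq_zero _
      rw [this, sgn_zero, one_mul]
    · simp [nilF, h]
  rw [IsHomog, rhoGen, map_add, h1, smul_add]
  congr 1
  split_ifs
  · rw [AlgHom.commutes, Algebra.algebraMap_eq_smul_one, smul_smul, h2]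
  · simp

/-- The differential superalgebra homomorphism `ρ : 𝒱(𝔤) → 𝒱(𝔭) ⊆ 𝒱(𝔤)`. -/
def rho : RectV m n N →ₐ[ℂ] RectV m n N :=
  SuperPoly.lift (p := fun x : (RIdx m n N × RIdx m n N) × ℕ => glPar (rectPar m n N) x.1)
    (rhoGen m n N) fun x y => DiffSuperalgebra.supercomm _ _ _ _
      (isHomog_rhoGen m n N x) (isHomog_rhoGen m n N y)

/-- `ρ` applied to the coefficients of the affine `λ`-bracket of level `κ`. -/
def wBracket (κ : ℂ) (a b : RectV m n N) : (RectV m n N)[X] :=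
  coeffMap (rho m n N).toLinearMap (affBracket (rectPar m n N) κ a b)

/-- The classical W-superalgebra `𝒲^κ(gl(Nm|Nn), f)`: all `a ∈ 𝒱(𝔭)` such that
`ρ {ν _λ a} = 0` for all `ν ∈ 𝔫 = 𝔤_{≥1/2}`.  Its `λ`-bracket is `wBracket`. -/
def wAlg (κ : ℂ) : Set (RectV m n N) :=
  {a | a ∈ subVp m n N ∧ ∀ ν : Matrix (RIdx m n N) (RIdx m n N) ℂ,
    (∀ x y, ν x y ≠ 0 → 1 ≤ hDeg m n N (x, y)) → wBracket m n N κ (qMat _ ν) a = 0}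

/-- The operator `A(∂)` with entries `δ_{ij} ∂ + (-1)^ĩ q_{ij}`. -/
def affOp : MatPDO (RIdx m n N) (RIdx m n N) (RectV m n N) where
  coeff k := if k = 1 then 1 else if k = 0 then
    Matrix.of fun i j => sgn (rectPar m n N i) • DiffPoly.gen _ (i, j) 0 else 0
  bdd := ⟨1, fun k hk => by
    rw [if_neg (by omega), if_neg (by omega)]⟩

/-- `L(∂) = (-1)^{N-1} |ρ(A(∂))|_{IJ}`, where `I` consists of the indices of the last block and `J`
of those of the first block, both identified with the index set of `gl(m|n)`. -/
def IsRectOperator (hN : 2 ≤ N) (L : MatPDO (GlIdx m n) (GlIdx m n) (RectV m n N)) : Prop :=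
  ∃ Q, MatPDO.IsQuasidet ((affOp m n N).mapCoeff (rho m n N))
    (fun t : GlIdx m n => ((⟨N - 1, by omega⟩, t) : RIdx m n N))
    (fun t : GlIdx m n => ((⟨0, by omega⟩, t) : RIdx m n N)) Q ∧ L = Q.smul ((-1) ^ (N - 1))

end Rectangular

end
end SuperPVA

open SuperPVA

namespace SuperPVA

open Polynomial

noncomputable section

set_option linter.unusedSectionVars false

/-! ### Actions of differential operators on differential modules -/

section General

variable {V : Type*} [Ring V] [Algebra ℂ V] [DiffSuperalgebra V]

/-! Poisson structure. A twisted derivation of an algebra of differential polynomials is determined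
by its values on generators (`DiffPoly.derivation_ext`), so sesquilinearity, the right Leibniz rule
and skew-symmetry are checked on generators. For the Jacobi identity, the supercommutator of two
brackets is again a derivation, and skew-symmetry moves the three arguments around
(`DiffPoly.jacobiAt_of_gen`); for `gl` this leaves associativity of the matrix product and
supercyclicity of the supertrace. On W, an outer bracket with an element of W does not distinguish
`a` from `ρ a` (`wBilin_rho_right`, `wBilin_rho_left`), so the axioms, and closure under the
bracket, follow by applying ρ to the affine identities.

The operator. ρ(A(∂)) is block Hessenberg: ∂ + B with B block lower triangular up to identity blocks
just above the diagonal. Solving block by block gives a column ψ equal to 1 in the first block and a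
row χ equal to 1 in the last block, such that (∂+B)ψ lives in the last block and χ(∂+B) in the first
one. Evaluating χ(∂+B)ψ in two ways shows that both defects agree, and multiplying by the inverse of
∂+B identifies the defect with the quasi-determinant (`isQuasidet_hessOp`). Up to the sign ε =
(-1)^(N-1) it is L.

The brackets. Differentiating the equation of ψ and pairing with χ gives δL = ε χ ∘ δB ∘ ψ for a
derivation δ. Since B is only the image under ρ of the matrix of generators, L is replaced by the
lift ε χ ∘ A ∘ ψ, whose variation involves the brackets of the generators themselves
(`outerMap_wBilin_rectLift`). If δ is the bracket with a generator `q_ij`, this is a commutator with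
an elementary matrix sandwiched between χ and ψ, and their equations leave only boundary terms,
present only for i in the last block or j in the first one (`IsHessPair.variation`). Elements of 𝔫
see no boundary, so the coefficients of L lie in W. Inserting the boundary formula a second time,
the bracket of two entries becomes, up to sign, θ(z) L*(λ-z) - L(z) ξ(z). Here, with D = w+λ+∂, θ(z)
= ε Σ χ(D) ψ(z) and ξ(z) = ε Σ χ*(λ-z) ψ(w) satisfy θ(z)(z-D) = L(z) - L(D) and (z-D)ξ(z) = L*(λ-z)
- L(w). Eliminating gives the Adler expression (`IsHessPair.sum_theta_sub_xi_closed`).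

Free generation. Put the generators of 𝔭 outside the last block row equal to zero. Under this
restriction the coefficients of L become the generators of the last row up to sign, which gives
independence. Conversely, an element of W with zero restriction vanishes: on its component of lowest
degree in the remaining generators, brackets with 𝔫 act through combinations of partial derivatives
that can be solved by descending induction on the block row, so all these partial derivatives vanish
and Euler's identity kills the component (`comp_eq_zero_of_mem_wAlg`). Hence every element of W is
the differential polynomial in the coefficients of L prescribed by its restriction. -/

theorem der_mul (a b : V) : der (a * b) = der a * b + a * der b := DiffSuperalgebra.der_mul a b

theorem par_der (a : V) : par (der a) = der (par a) := DiffSuperalgebra.parity_der a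

theorem par_par (a : V) : par (par a) = a := DiffSuperalgebra.parity_parity a

theorem der_one : der (1 : V) = 0 := by simpa using der_mul (1 : V) 1

theorem der_algebraMap (r : ℂ) : der (algebraMap ℂ V r) = 0 := by
  rw [Algebra.algebraMap_eq_smul_one, map_smul, der_one, smul_zero]

theorem coeffMap_monomial (T : V →ₗ[ℂ] V) (n : ℕ) (a : V) :
    coeffMap T (monomial n a) = monomial n (T a) := by
  ext k
  rw [coeff_coeffMap, coeff_monomial, coeff_monomial]
  split_ifs <;> simp

theorem lamD_apply (P : V[X]) : lamD P = X * P + coeffMap der P := rfl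

theorem lamD_C (a : V) : lamD (C a) = X * C a + C (der a) := by
  rw [lamD_apply, ← monomial_zero_left, coeffMap_monomial, monomial_zero_left, monomial_zero_left]

theorem coeff_lamD (P : V[X]) (n : ℕ) : (lamD P).coeff n = (X * P).coeff n + der (P.coeff n) := by
  rw [lamD_apply, coeff_add, coeff_coeffMap]

theorem coeffMap_der_mul (P Q : V[X]) :
    coeffMap der (P * Q) = coeffMap der P * Q + P * coeffMap der Q := by
  ext n
  simp only [coeff_add, coeff_coeffMap, coeff_mul, map_sum, der_mul, Finset.sum_add_distrib]

theorem lamD_mul_right (P Q : V[X]) : lamD (P * Q) = lamD P * Q + P * coeffMap der Q := by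
  simp only [lamD_apply, coeffMap_der_mul, add_mul, mul_assoc, add_assoc]

theorem lamD_mul_left (P Q : V[X]) : lamD (P * Q) = coeffMap der P * Q + P * lamD Q := by
  rw [lamD_apply, lamD_apply, coeffMap_der_mul, mul_add, ← mul_assoc P X, ← X_mul (p := P),
    mul_assoc]
  abel

theorem coeffMap_C (T : V →ₗ[ℂ] V) (a : V) : coeffMap T (C a) = C (T a) := by
  rw [← monomial_zero_left, coeffMap_monomial, monomial_zero_left]

theorem coeffMap_der_X : coeffMap der (X : V[X]) = 0 := by
  rw [← monomial_one_one_eq_X, coeffMap_monomial, der_one, map_zero]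

theorem lamD_X_mul (P : V[X]) : lamD (X * P) = X * lamD P := by
  rw [lamD_mul_left, coeffMap_der_X, zero_mul, zero_add]

theorem lamD_smul_V (v : V) (P : V[X]) : lamD (v • P) = der v • P + v • lamD P := by
  rw [smul_eq_C_mul, smul_eq_C_mul, smul_eq_C_mul, lamD_mul_left, coeffMap_C]

theorem lamD_pow_X_mul (n : ℕ) (P : V[X]) : (lamD ^ n) (X * P) = X * (lamD ^ n) P := by
  induction n with
  | zero => simp
  | succ n ih => rw [pow_succ', Module.End.mul_apply, ih, Module.End.mul_apply, lamD_X_mul]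

theorem negLamD_pow_X_mul (n : ℕ) (P : V[X]) : ((-lamD) ^ n) (X * P) = X * ((-lamD) ^ n) P := by
  induction n with
  | zero => simp
  | succ n ih =>
    rw [pow_succ', Module.End.mul_apply, ih, Module.End.mul_apply, LinearMap.neg_apply,
      LinearMap.neg_apply, lamD_X_mul, mul_neg]

theorem subNeg_C (a : V) : subNeg (C a) = C a := by
  rw [← monomial_zero_left, subNeg_monomial]; simp

theorem subNeg_X_mul (P : V[X]) : subNeg (X * P) = -lamD (subNeg P) := by
  induction P using Polynomial.induction_on' with
  | add P Q hP hQ => simp [mul_add, hP, hQ]; abel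
  | monomial n a =>
    rw [X_mul_monomial, subNeg_monomial, subNeg_monomial, pow_succ', Module.End.mul_apply]; rfl

theorem subNeg_lamD (P : V[X]) : subNeg (lamD P) = -(X * subNeg P) := by
  induction P using Polynomial.induction_on' with
  | add P Q hP hQ => simp [mul_add, hP, hQ]; abel
  | monomial n a =>
    rw [lamD_apply, map_add, subNeg_X_mul, coeffMap_monomial, subNeg_monomial, subNeg_monomial]
    have : -lamD (((-lamD) ^ n) (C a)) = ((-lamD) ^ n) (-lamD (C a)) := by
      rw [← LinearMap.neg_apply, ← Module.End.mul_apply, ← pow_succ', pow_succ,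
        Module.End.mul_apply, LinearMap.neg_apply]
    rw [this, lamD_C, neg_add, map_add, map_neg, map_neg, negLamD_pow_X_mul]
    abel

theorem subNeg_negLamD_pow (n : ℕ) (P : V[X]) :
    subNeg (((-lamD) ^ n) P) = X ^ n * subNeg P := by
  induction n with
  | zero => simp
  | succ n ih =>
    rw [pow_succ', Module.End.mul_apply, LinearMap.neg_apply, map_neg, subNeg_lamD, ih, neg_neg,
      ← mul_assoc, ← pow_succ']

theorem subNeg_lamD_pow (n : ℕ) (P : V[X]) :
    subNeg ((lamD ^ n) P) = (-X) ^ n * subNeg P := by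
  induction n with
  | zero => simp
  | succ n ih =>
    rw [pow_succ', Module.End.mul_apply, subNeg_lamD, ih, pow_succ' (-X), neg_mul, neg_mul,
      mul_assoc]

/-- The substitution turns λ into -λ-∂ and, by `subNeg_lamD`, turns the operator -λ-∂ back into
multiplication by λ. -/
theorem subNeg_subNeg (P : V[X]) : subNeg (subNeg P) = P := by
  induction P using Polynomial.induction_on' with
  | add P Q hP hQ => simp [hP, hQ]
  | monomial n a =>
    rw [subNeg_monomial, subNeg_negLamD_pow, subNeg_C, ← C_mul_X_pow_eq_monomial, X_pow_mul]

section Act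

variable {M : Type*} [AddCommGroup M] [Module V M] [Module ℂ M] [IsScalarTower ℂ V M]

/-- The action of the differential operator `∑ₙ aₙ ∂ⁿ`, given by its symbol `∑ₙ aₙ Xⁿ`, on a
left module on which `∂` acts as `D`. -/
def act (D : Module.End ℂ M) : V[X] →ₗ[ℂ] M →ₗ[ℂ] M :=
  Polynomial.lsum fun n =>
    { toFun := fun v => ((Algebra.lsmul ℂ ℂ M) v).comp (D ^ n)
      map_add' := fun a b => by ext; simp
      map_smul' := fun r a => by ext; simp }

theorem act_monomial (D : Module.End ℂ M) (n : ℕ) (v : V) (x : M) :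
    act D (monomial n v) x = v • (D ^ n) x := by
  simp only [act, Polynomial.lsum_apply]
  rw [Polynomial.sum_monomial_index _ _ (by simp)]
  simp

theorem act_C (D : Module.End ℂ M) (v : V) (x : M) : act D (C v) x = v • x := by
  rw [← monomial_zero_left, act_monomial]; simp

theorem act_one (D : Module.End ℂ M) (x : M) : act D (1 : V[X]) x = x := by
  rw [← C_1, act_C, one_smul]

theorem act_eq_sum (D : Module.End ℂ M) (P : V[X]) (x : M) :
    act D P x = P.sum fun n v => v • (D ^ n) x := by
  simp only [act, Polynomial.lsum_apply, Polynomial.sum]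
  simp

theorem act_mul_X_pow (D : Module.End ℂ M) (P : V[X]) (n : ℕ) (x : M) :
    act D (P * X ^ n) x = act D P ((D ^ n) x) := by
  induction P using Polynomial.induction_on' with
  | add P Q hP hQ => simp [add_mul, hP, hQ]
  | monomial k v =>
    rw [monomial_mul_X_pow, act_monomial, act_monomial, ← Module.End.mul_apply, ← pow_add]

theorem act_C_mul (D : Module.End ℂ M) (v : V) (P : V[X]) (x : M) :
    act D (C v * P) x = v • act D P x := by
  induction P using Polynomial.induction_on' with
  | add P Q hP hQ => simp [mul_add, hP, hQ]
  | monomial k w => rw [C_mul_monomial, act_monomial, act_monomial, mul_smul]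

theorem act_lamD {D : Module.End ℂ M} (hD : ∀ (v : V) x, D (v • x) = der v • x + v • D x)
    (P : V[X]) (x : M) : act D (lamD P) x = D (act D P x) := by
  induction P using Polynomial.induction_on' with
  | add P Q hP hQ => simp [hP, hQ]
  | monomial n v =>
    rw [lamD_apply, coeffMap_monomial, X_mul_monomial, map_add, LinearMap.add_apply, act_monomial,
      act_monomial, act_monomial, hD, add_comm, pow_succ', Module.End.mul_apply]

theorem act_lamD_pow {D : Module.End ℂ M} (hD : ∀ (v : V) x, D (v • x) = der v • x + v • D x)
    (n : ℕ) (P : V[X]) (x : M) : act D ((lamD ^ n) P) x = (D ^ n) (act D P x) := by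
  induction n with
  | zero => simp
  | succ n ih => rw [pow_succ', Module.End.mul_apply, act_lamD hD, ih, pow_succ',
      Module.End.mul_apply]

/-- The action is compatible with composition of operators. -/
theorem act_act {D : Module.End ℂ M} (hD : ∀ (v : V) x, D (v • x) = der v • x + v • D x)
    (P Q : V[X]) (x : M) : act D (act lamD P Q) x = act D P (act D Q x) := by
  induction P using Polynomial.induction_on' with
  | add P P' hP hP' => simp [hP, hP']
  | monomial n v =>
    rw [act_monomial, act_monomial, smul_eq_C_mul, act_C_mul, act_lamD_pow hD]

end Act

/-- The arrow is the action of a differential operator in which ∂ acts as λ+∂; this makes the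
composition rule `act_act` available for the Leibniz rules. -/
theorem arrow_eq_act (P : V[X]) (b : V) : arrow P b = act lamD P (C b) := by
  rw [act_eq_sum, arrow]
  simp only [smul_eq_C_mul]

theorem act_lamD_X_mul (P Q : V[X]) : act lamD (X * P) Q = act lamD P (lamD Q) := by
  have := act_mul_X_pow lamD P 1 Q
  rwa [pow_one, ← X_mul, pow_one] at this

/-- `∑ₙ (-λ-∂)ⁿ pₙ b` in terms of `∑ₙ (-λ-∂)ⁿ pₙ`. -/
theorem subNeg_mul_C (P : V[X]) (b : V) : subNeg (P * C b) = arrow (subNeg P) b := by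
  induction P using Polynomial.induction_on' with
  | add P Q hP hQ => rw [add_mul, map_add, hP, hQ]; simp [arrow_eq_act]
  | monomial n a =>
    rw [subNeg_monomial, arrow_eq_act]
    induction n generalizing b with
    | zero =>
      simp only [monomial_zero_left, pow_zero, Module.End.one_apply]
      rw [← C_mul, subNeg_C, act_C, smul_eq_C_mul, C_mul]
    | succ n ih =>
      rw [pow_succ', Module.End.mul_apply, LinearMap.neg_apply, map_neg, LinearMap.neg_apply,
        act_lamD lamD_smul_V, ← ih, ← X_mul_monomial, mul_assoc, subNeg_X_mul]

theorem arrow_add_left (P Q : V[X]) (b : V) : arrow (P + Q) b = arrow P b + arrow Q b := by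
  simp [arrow_eq_act]

theorem arrow_smul_left (r : ℂ) (P : V[X]) (b : V) : arrow (r • P) b = r • arrow P b := by
  simp [arrow_eq_act]

theorem arrow_C_mul (a : V) (P : V[X]) (b : V) : arrow (C a * P) b = C a * arrow P b := by
  rw [arrow_eq_act, act_C_mul, smul_eq_C_mul, arrow_eq_act]

end General

/-! ### Homogeneous components -/

theorem sgn_congr {a b : ZMod 2} (h : a = b) : sgn a = sgn b := by rw [h]

theorem zmod2_cases (a : ZMod 2) : a = 0 ∨ a = 1 := by revert a; decide

theorem sgn_one : sgn 1 = -1 := by simp [sgn]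

section General

variable {V : Type*} [Ring V] [Algebra ℂ V] [DiffSuperalgebra V]

theorem IsHomog.add {i : ZMod 2} {a b : V} (ha : IsHomog i a) (hb : IsHomog i b) :
    IsHomog i (a + b) := by
  simp only [IsHomog] at *; rw [map_add, ha, hb, smul_add]

theorem IsHomog.smul {i : ZMod 2} {a : V} (r : ℂ) (ha : IsHomog i a) : IsHomog i (r • a) := by
  simp only [IsHomog] at *; rw [map_smul, ha, smul_comm]

theorem IsHomog.neg {i : ZMod 2} {a : V} (ha : IsHomog i a) : IsHomog i (-a) := by
  simp only [IsHomog] at *; rw [map_neg, ha, smul_neg]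

theorem IsHomog.sub {i : ZMod 2} {a b : V} (ha : IsHomog i a) (hb : IsHomog i b) :
    IsHomog i (a - b) := by rw [sub_eq_add_neg]; exact ha.add hb.neg

theorem isHomog_zero (i : ZMod 2) : IsHomog i (0 : V) := by simp [IsHomog]

theorem isHomog_one : IsHomog 0 (1 : V) := by simp [IsHomog, sgn_zero]

theorem IsHomog.mul {i j : ZMod 2} {a b : V} (ha : IsHomog i a) (hb : IsHomog j b) :
    IsHomog (i + j) (a * b) := by
  simp only [IsHomog] at *
  rw [map_mul, ha, hb, smul_mul_smul_comm, sgn_add]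

theorem IsHomog.der {i : ZMod 2} {a : V} (ha : IsHomog i a) : IsHomog i (der a) := by
  simp only [IsHomog] at *
  rw [par_der, ha, map_smul]

theorem IsHomog.sum {α : Type*} {i : ZMod 2} (s : Finset α) {f : α → V}
    (h : ∀ x ∈ s, IsHomog i (f x)) : IsHomog i (∑ x ∈ s, f x) := by
  simp only [IsHomog] at *
  rw [map_sum, Finset.smul_sum]
  exact Finset.sum_congr rfl h

theorem homComp_add_homComp (a : V) : homComp 0 a + homComp 1 a = a := by
  simp only [homComp, sgn_zero, sgn_one]
  module

theorem IsHomog.homComp_self {i : ZMod 2} {a : V} (ha : IsHomog i a) : homComp i a = a := by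
  rw [homComp, show SuperPVA.par a = _ from ha, smul_smul, sgn_mul_self]
  module

theorem IsHomog.homComp_ne {i j : ZMod 2} (hij : i ≠ j) {a : V} (ha : IsHomog i a) :
    homComp j a = 0 := by
  have : sgn j * sgn i = -1 := by
    rcases zmod2_cases i with rfl | rfl <;> rcases zmod2_cases j with rfl | rfl <;>
      simp_all [sgn]
  rw [homComp, show SuperPVA.par a = _ from ha, smul_smul, this]
  module

/-- The identity for `k = 0`, the parity involution for `k = 1`. -/
def twistAut (k : ZMod 2) : V →ₐ[ℂ] V := if k = 0 then AlgHom.id ℂ V else par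

theorem twistAut_homog (k : ZMod 2) {i : ZMod 2} {a : V} (ha : IsHomog i a) :
    twistAut k a = sgn (k * i) • a := by
  rcases zmod2_cases k with rfl | rfl
  · simp [twistAut, sgn_zero]
  · have h : par a = _ := ha
    simpa [twistAut] using h

/-- Writing the sign rule through an automorphism avoids a homogeneity assumption on `d`; this is
why Leibniz rules below are stated with `twistAut`. -/
theorem twistAut_mul_comm {k : ZMod 2} {q : V} (hq : IsHomog k q) (d : V) :
    twistAut k d * q = q * d := by
  have h : ∀ j (d : V), IsHomog j d → SuperPVA.twistAut k d * q = q * d := by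
    intro j d hd
    rw [twistAut_homog k hd, smul_mul_assoc]
    exact (DiffSuperalgebra.supercomm _ _ _ _ hq hd).symm
  rw [← homComp_add_homComp d, map_add, add_mul, mul_add, h 0 _ (isHomog_homComp _ _),
    h 1 _ (isHomog_homComp _ _)]

theorem C_twistAut_mul_comm {k : ZMod 2} {Q : V[X]} (hQ : IsHomogPoly k Q) (d : V) :
    C (twistAut k d) * Q = Q * C d := by
  ext n
  rw [coeff_C_mul, coeff_mul_C, twistAut_mul_comm (hQ n)]

theorem twistAut_twistAut (i j : ZMod 2) (a : V) :
    twistAut i (twistAut j a) = twistAut (i + j) a := by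
  rcases zmod2_cases i with rfl | rfl <;> rcases zmod2_cases j with rfl | rfl
  · simp [twistAut]
  · simp [twistAut]
  · simp [twistAut]
  · have : (1 : ZMod 2) + 1 = 0 := rfl
    simp [this, twistAut, par_par]

theorem der_twistAut (k : ZMod 2) (a : V) : der (twistAut k a) = twistAut k (der a) := by
  rcases zmod2_cases k with rfl | rfl
  · simp [twistAut]
  · simp [twistAut, par_der]

theorem IsHomogPoly.lamD {i : ZMod 2} {P : V[X]} (h : IsHomogPoly i P) :
    IsHomogPoly i (lamD P) := by
  rw [isHomogPoly_iff] at *; rw [parPoly_lamD, h, map_smul]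

theorem IsHomogPoly.lamD_pow {i : ZMod 2} {P : V[X]} (h : IsHomogPoly i P) (n : ℕ) :
    IsHomogPoly i ((SuperPVA.lamD ^ n) P) := by
  rw [isHomogPoly_iff] at *; rw [parPoly_lamD_pow, h, map_smul]

theorem IsHomogPoly.subNeg {i : ZMod 2} {P : V[X]} (h : IsHomogPoly i P) :
    IsHomogPoly i (subNeg P) := by
  rw [isHomogPoly_iff] at *; rw [parPoly_subNeg, h, map_smul]

theorem IsHomogPoly.smul {i : ZMod 2} {P : V[X]} (r : ℂ) (h : IsHomogPoly i P) :
    IsHomogPoly i (r • P) := fun n => by rw [coeff_smul]; exact (h n).smul r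

theorem IsHomogPoly.add {i : ZMod 2} {P Q : V[X]} (h : IsHomogPoly i P) (h' : IsHomogPoly i Q) :
    IsHomogPoly i (P + Q) := fun n => by rw [coeff_add]; exact (h n).add (h' n)

theorem IsHomogPoly.neg {i : ZMod 2} {P : V[X]} (h : IsHomogPoly i P) :
    IsHomogPoly i (-P) := fun n => by rw [coeff_neg]; exact (h n).neg

theorem IsHomog.C {i : ZMod 2} {a : V} (h : IsHomog i a) : IsHomogPoly i (C a) := fun n => by
  rw [coeff_C]; split_ifs
  exacts [h, isHomog_zero i]

theorem subNeg_arrow (P : V[X]) (b : V) : subNeg (arrow P b) = subNeg P * C b := by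
  rw [← subNeg_subNeg P, ← subNeg_mul_C, subNeg_subNeg, subNeg_subNeg]

/-- The factor `d` has to pass `b`, which the arrow puts to its right, and the twist records the
resulting sign. -/
theorem arrow_mul_C {j : ZMod 2} {b : V} (hb : IsHomog j b) (P : V[X]) (d : V) :
    arrow (P * C (twistAut j d)) b = arrow P b * C d := by
  induction P using Polynomial.induction_on' with
  | add P Q hP hQ => simp [add_mul, arrow_add_left, hP, hQ]
  | monomial n a =>
    rw [monomial_mul_C, arrow_eq_act, arrow_eq_act, act_monomial, act_monomial, smul_eq_C_mul,
      smul_eq_C_mul, C_mul, mul_assoc, mul_assoc, C_twistAut_mul_comm (hb.C.lamD_pow n)]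

end General

/-! ### The λ-bracket determined by its values on generators -/

namespace DiffPoly

variable {ι : Type*} {p : ι → ZMod 2}

theorem par_gen (i : ι) (n : ℕ) : par (gen p i n) = sgn (p i) • gen p i n := isHomog_gen i n

theorem der_gen (i : ι) (n : ℕ) : der (gen p i n) = gen p i (n + 1) := derivation_gen i n

theorem twist_eq (k : ZMod 2) (a : DiffPoly p) : twist k a = twistAut k a := by
  rcases zmod2_cases k with rfl | rfl <;> rfl

/-- Two derivations along the same pair of linear maps which agree on the generators are equal. -/
theorem derivation_ext {R : Type*} [Ring R] [Algebra ℂ R] (φ ψ D D' : DiffPoly p →ₗ[ℂ] R)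
    (h1 : φ 1 = 1) (h2 : ψ 1 = 1)
    (hD : ∀ i j a b, IsHomog i a → IsHomog j b → D (a * b) = φ a * D b + D a * ψ b)
    (hD' : ∀ i j a b, IsHomog i a → IsHomog j b → D' (a * b) = φ a * D' b + D' a * ψ b)
    (h : ∀ i n, D (gen p i n) = D' (gen p i n)) : D = D' := by
  -- The product rule is assumed for homogeneous factors only; splitting both factors into parity
  -- components removes the restriction.
  have key : ∀ E : DiffPoly p →ₗ[ℂ] R,
      (∀ i j a b, IsHomog i a → IsHomog j b → E (a * b) = φ a * E b + E a * ψ b) →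
      ∀ a b, E (a * b) = φ a * E b + E a * ψ b := by
    intro E hE a b
    have h3 : ∀ i a, IsHomog i a → E (a * b) = φ a * E b + E a * ψ b := by
      intro i a ha
      rw [← homComp_add_homComp b]
      simp only [mul_add, map_add, hE i _ a _ ha (isHomog_homComp _ b)]
      abel
    rw [← homComp_add_homComp a]
    simp only [add_mul, map_add, h3 _ _ (isHomog_homComp _ a)]
    abel
  -- The product rule at 1·1 forces the value 0 on 1, hence on scalars.
  have one : ∀ E : DiffPoly p →ₗ[ℂ] R,
      (∀ a b, E (a * b) = φ a * E b + E a * ψ b) → E 1 = 0 := by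
    intro E hE
    have := hE 1 1
    simpa [h1, h2] using this
  ext a
  induction a using induction with
  | hc r =>
    rw [Algebra.algebraMap_eq_smul_one, map_smul, map_smul, one D (key D hD), one D' (key D' hD')]
  | hg i n => exact h i n
  | hadd a b ha hb => simp [ha, hb]
  | hmul a b ha hb => rw [key D hD, key D' hD', ha, hb]

/-- A version of `derivation_ext` for derivations with values in polynomials. -/
theorem twisted_derivation_ext (k : ZMod 2) (D D' : DiffPoly p →ₗ[ℂ] (DiffPoly p)[X])
    (hD : ∀ i j a b, IsHomog i a → IsHomog j b →
      D (a * b) = C (twistAut k a) * D b + D a * C b)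
    (hD' : ∀ i j a b, IsHomog i a → IsHomog j b →
      D' (a * b) = C (twistAut k a) * D' b + D' a * C b)
    (h : ∀ i n, D (gen p i n) = D' (gen p i n)) : D = D' :=
  derivation_ext ((CAlgHom.comp (twistAut k)).toLinearMap) (CAlgHom.toLinearMap) D D'
    (by simp) (by simp) hD hD' h

variable (b : ι → ι → (DiffPoly p)[X]) (hb : ∀ i j, IsHomogPoly (p i + p j) (b i j))

theorem bracketGen_gen (i j : ι) (n : ℕ) : bracketGen b hb i (gen p j n) = (lamD ^ n) (b i j) :=
  twDer_gen _ _ _ j n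

theorem bracketGen_mul (i : ι) (f g : DiffPoly p) : bracketGen b hb i (f * g) =
    C (twistAut (p i) f) * bracketGen b hb i g + bracketGen b hb i f * C g := by
  rw [← twist_eq]; exact twDer_mul _ _ _ f g

theorem bracketHom_mul (k : ZMod 2) (f g h : DiffPoly p) : bracketHom b hb k f (g * h) =
    C (twistAut k g) * bracketHom b hb k f h + bracketHom b hb k f g * C h := by
  rw [← twist_eq]; exact twDer_mul _ _ _ g h

theorem bracketHom_gen (k : ZMod 2) (f : DiffPoly p) (j : ι) (n : ℕ) :
    bracketHom b hb k f (gen p j n) = (lamD ^ n)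
      (-(sgn (k * p j) • subNeg (bracketGen b hb j (homComp k f)))) := twDer_gen _ _ _ j n

theorem homComp_map_add (k : ZMod 2) (f g : DiffPoly p) :
    homComp k (f + g) = homComp k f + homComp k g := by
  simp only [homComp, map_add]; module

theorem homComp_map_smul (k : ZMod 2) (r : ℂ) (f : DiffPoly p) :
    homComp k (r • f) = r • homComp k f := by
  simp only [homComp, map_smul]; module

/-- Additivity in the first slot is not visible from the construction; it holds because both sides
are twisted derivations in the second slot which agree on generators. -/
theorem bracketHom_add (k : ZMod 2) (f g : DiffPoly p) :
    bracketHom b hb k (f + g) = bracketHom b hb k f + bracketHom b hb k g := by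
  refine twisted_derivation_ext k _ _ (fun _ _ _ _ _ _ => bracketHom_mul _ _ _ _ _ _)
    (fun _ _ x y _ _ => ?_) (fun i n => ?_)
  · simp only [LinearMap.add_apply, bracketHom_mul, mul_add, add_mul]; abel
  · simp only [LinearMap.add_apply, bracketHom_gen, homComp_map_add, map_add, smul_add, neg_add]

theorem bracketHom_smul (k : ZMod 2) (r : ℂ) (f : DiffPoly p) :
    bracketHom b hb k (r • f) = r • bracketHom b hb k f := by
  refine twisted_derivation_ext k _ _ (fun _ _ _ _ _ _ => bracketHom_mul _ _ _ _ _ _)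
    (fun _ _ x y _ _ => ?_) (fun i n => ?_)
  · simp only [LinearMap.smul_apply, bracketHom_mul, smul_add, mul_smul_comm, smul_mul_assoc]
  · simp only [LinearMap.smul_apply, bracketHom_gen, homComp_map_smul, map_smul, map_neg, smul_neg,
      smul_comm r]

/-- The `λ`-bracket as a bilinear map. -/
def bracketBilin : DiffPoly p →ₗ[ℂ] DiffPoly p →ₗ[ℂ] (DiffPoly p)[X] where
  toFun f := bracketHom b hb 0 f + bracketHom b hb 1 f
  map_add' f g := by rw [bracketHom_add, bracketHom_add]; abel
  map_smul' r f := by rw [bracketHom_smul, bracketHom_smul, smul_add]; rfl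

/-- Only the component of parity `k` enters, so of the two summands of the bracket just one survives
on a homogeneous left argument. -/
theorem bracketHom_of_homComp (k : ZMod 2) (f : DiffPoly p) (h : homComp k f = 0) :
    bracketHom b hb k f = 0 := by
  refine twisted_derivation_ext k _ _ (fun _ _ _ _ _ _ => bracketHom_mul _ _ _ _ _ _)
    (fun _ _ x y _ _ => by simp) (fun i n => ?_)
  simp [bracketHom_gen, h]

theorem bracketBilin_homog {k : ZMod 2} {f : DiffPoly p} (hf : IsHomog k f) :
    bracketBilin b hb f = bracketHom b hb k f := by
  show bracketHom b hb 0 f + bracketHom b hb 1 f = _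
  rcases zmod2_cases k with rfl | rfl
  · rw [bracketHom_of_homComp b hb 1 f (hf.homComp_ne (by decide)), add_zero]
  · rw [bracketHom_of_homComp b hb 0 f (hf.homComp_ne (by decide)), zero_add]

local notation "⟪" f "," g "⟫" => bracketBilin b hb f g

/-- The left Leibniz rule. -/
theorem bracketBilin_mul {k : ZMod 2} {f : DiffPoly p} (hf : IsHomog k f) (g h : DiffPoly p) :
    ⟪f, g * h⟫ = C (twistAut k g) * ⟪f, h⟫ + ⟪f, g⟫ * C h := by
  rw [bracketBilin_homog b hb hf, bracketHom_mul]

theorem bracketBilin_gen {k : ZMod 2} {f : DiffPoly p} (hf : IsHomog k f) (j : ι) (n : ℕ) :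
    ⟪f, gen p j n⟫ = (lamD ^ n) (-(sgn (k * p j) • subNeg (bracketGen b hb j f))) := by
  rw [bracketBilin_homog b hb hf, bracketHom_gen, hf.homComp_self]

theorem isHomogPoly_bracketBilin {i j : ZMod 2} {f g : DiffPoly p} (hf : IsHomog i f)
    (hg : IsHomog j g) : IsHomogPoly (i + j) ⟪f, g⟫ := by
  rw [bracketBilin_homog b hb hf]
  exact isHomogPoly_twDer _ _ _ hg

/-- An identity between bilinear expressions holds if it holds for homogeneous left arguments. -/
theorem homog_ext_left {M : Type*} [AddCommGroup M] [Module ℂ M] (F G : DiffPoly p →ₗ[ℂ] M)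
    (h : ∀ i f, IsHomog i f → F f = G f) (f : DiffPoly p) : F f = G f := by
  rw [← homComp_add_homComp f, map_add, map_add, h _ _ (isHomog_homComp _ f),
    h _ _ (isHomog_homComp _ f)]

/-- The defect of sesquilinearity is itself a twisted derivation in `g`: both ∂ and λ+∂ satisfy
Leibniz rules and the mixed terms cancel. On generators it vanishes by construction. -/
theorem bracketBilin_der_right (f g : DiffPoly p) : ⟪f, der g⟫ = lamD ⟪f, g⟫ := by
  refine homog_ext_left ((bracketBilin b hb).flip (der g)) (lamD ∘ₗ (bracketBilin b hb).flip g)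
    (fun k f hf => ?_) f
  show ⟪f, der g⟫ = lamD ⟪f, g⟫
  have : bracketBilin b hb f ∘ₗ der - lamD ∘ₗ bracketBilin b hb f = 0 := by
    refine twisted_derivation_ext k _ _ (fun _ _ x y _ _ => ?_)
      (fun _ _ x y _ _ => by simp) (fun i n => ?_)
    · simp only [LinearMap.sub_apply, LinearMap.comp_apply, der_mul, map_add,
        bracketBilin_mul b hb hf, lamD_mul_right (⟪f, x⟫), lamD_mul_left (C (twistAut k x)),
        coeffMap_C, der_twistAut]
      noncomm_ring
    · simp only [LinearMap.sub_apply, LinearMap.comp_apply, der_gen, bracketBilin_gen b hb hf,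
        LinearMap.zero_apply, pow_succ', Module.End.mul_apply, sub_self]
  have := LinearMap.congr_fun this g
  exact sub_eq_zero.1 this

theorem bracketGen_der (i : ι) (g : DiffPoly p) :
    bracketGen b hb i (der g) = lamD (bracketGen b hb i g) := by
  have : bracketGen b hb i ∘ₗ der - lamD ∘ₗ bracketGen b hb i = 0 := by
    refine twisted_derivation_ext (p i) _ _ (fun _ _ x y _ _ => ?_)
      (fun _ _ x y _ _ => by simp) (fun j n => ?_)
    · simp only [LinearMap.sub_apply, LinearMap.comp_apply, der_mul, map_add,
        bracketGen_mul b hb, lamD_mul_right (bracketGen b hb i x),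
        lamD_mul_left (C (twistAut (p i) x)), coeffMap_C, der_twistAut]
      noncomm_ring
    · simp only [LinearMap.sub_apply, LinearMap.comp_apply, der_gen, bracketGen_gen b hb,
        LinearMap.zero_apply, pow_succ', Module.End.mul_apply, sub_self]
  have := LinearMap.congr_fun this g
  exact sub_eq_zero.1 this

/-- On generators the left argument enters through the skew-symmetry formula, where the substitution
turns λ+∂ into -λ; comparison of derivations does the rest. -/
theorem bracketBilin_der_left (f g : DiffPoly p) : ⟪der f, g⟫ = -(X * ⟪f, g⟫) := by
  refine homog_ext_left ((bracketBilin b hb).flip g ∘ₗ der)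
    (-(LinearMap.mulLeft ℂ (X : (DiffPoly p)[X]) ∘ₗ (bracketBilin b hb).flip g))
    (fun k f hf => ?_) f
  show ⟪der f, g⟫ = -(X * ⟪f, g⟫)
  have : bracketBilin b hb (der f) =
      -(LinearMap.mulLeft ℂ (X : (DiffPoly p)[X]) ∘ₗ bracketBilin b hb f) := by
    refine twisted_derivation_ext k _ _ (fun _ _ x y _ _ => bracketBilin_mul b hb hf.der x y)
      (fun _ _ x y _ _ => ?_) (fun j n => ?_)
    · simp only [LinearMap.neg_apply, LinearMap.comp_apply, LinearMap.mulLeft_apply,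
        bracketBilin_mul b hb hf, mul_add, ← mul_assoc, X_mul_C]
      noncomm_ring
    · simp only [LinearMap.neg_apply, LinearMap.comp_apply, LinearMap.mulLeft_apply,
        bracketBilin_gen b hb hf, bracketBilin_gen b hb hf.der, bracketGen_der, subNeg_lamD,
        ← lamD_pow_X_mul, smul_neg, neg_neg, mul_smul_comm, map_neg]
  exact LinearMap.congr_fun this g

/-- The right Leibniz rule. -/
theorem bracketBilin_mul_left {i j : ZMod 2} {f g : DiffPoly p} (hf : IsHomog i f)
    (hg : IsHomog j g) (h : DiffPoly p) : ⟪f * g, h⟫ =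
      arrow ⟪f, twistAut j h⟫ g + sgn (i * j) • arrow ⟪g, twistAut i h⟫ f := by
  -- As functions of `h` both sides are twisted derivations of parity `i + j`. On a generator, the
  -- identity is the image under `subNeg` of the left Leibniz rule for `bracketGen`.
  have key : bracketBilin b hb (f * g) =
      (act lamD).flip (C g) ∘ₗ bracketBilin b hb f ∘ₗ (twistAut j).toLinearMap +
      sgn (i * j) • ((act lamD).flip (C f) ∘ₗ bracketBilin b hb g ∘ₗ (twistAut i).toLinearMap) := by
    refine twisted_derivation_ext (i + j) _ _
      (fun _ _ x y _ _ => bracketBilin_mul b hb (hf.mul hg) x y)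
      (fun _ _ x y _ _ => ?_) (fun k n => ?_)
    · simp only [LinearMap.add_apply, LinearMap.comp_apply, LinearMap.flip_apply,
        AlgHom.toLinearMap_apply, map_mul, LinearMap.smul_apply, bracketBilin_mul b hb hf,
        bracketBilin_mul b hb hg, ← arrow_eq_act, arrow_add_left, arrow_C_mul, arrow_mul_C hf,
        arrow_mul_C hg, twistAut_twistAut, add_comm j i, mul_add, add_mul, smul_add,
        mul_smul_comm, smul_mul_assoc]
      abel
    · have hk := isHomog_gen (p := p) k n
      simp only [LinearMap.add_apply, LinearMap.comp_apply, LinearMap.flip_apply,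
        AlgHom.toLinearMap_apply, LinearMap.smul_apply, twistAut_homog _ hk, map_smul,
        bracketBilin_gen b hb hf, bracketBilin_gen b hb hg, bracketBilin_gen b hb (hf.mul hg),
        bracketGen_mul]
      rw [twistAut_homog _ hf, ← smul_C, smul_mul_assoc,
        C_mul_homog hf (isHomogPoly_bracketGen b hb k hg), map_add, map_smul, map_smul,
        subNeg_mul_C, subNeg_mul_C]
      simp only [map_neg, map_smul, map_add, LinearMap.neg_apply, LinearMap.smul_apply,
        arrow_eq_act, act_lamD_pow (D := lamD (V := DiffPoly p)) lamD_smul_V,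
        smul_add, smul_neg, smul_smul, neg_add, ← sgn_add]
      rw [add_comm]
      congr 3 <;> refine sgn_congr ?_ <;> generalize p k = c <;> clear hf hg <;> revert i j c <;> decide
  rw [arrow_eq_act, arrow_eq_act]
  exact LinearMap.congr_fun key h

/-- `b` is skew-symmetric. -/
def IsSkewValue (b : ι → ι → (DiffPoly p)[X]) : Prop :=
  ∀ i j, b i j = -(sgn (p i * p j) • subNeg (b j i))

variable {b}

/-- The construction prescribes brackets with a generator on the right. Skew-symmetry of the values
`b` is what makes the bracket with a generator on the left the derivation one started from. -/
theorem bracketBilin_gen_left (hs : IsSkewValue b) (i : ι) (n : ℕ) (g : DiffPoly p) :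
    ⟪gen p i n, g⟫ = (-X) ^ n * bracketGen b hb i g := by
  have hi := isHomog_gen (p := p) i n
  have : bracketBilin b hb (gen p i n) =
      LinearMap.mulLeft ℂ ((-X : (DiffPoly p)[X]) ^ n) ∘ₗ bracketGen b hb i := by
    refine twisted_derivation_ext (p i) _ _ (fun _ _ x y _ _ => bracketBilin_mul b hb hi x y)
      (fun _ _ x y _ _ => ?_) (fun j m => ?_)
    · have hX : ∀ c : DiffPoly p, (-X) ^ n * C c = C c * (-X) ^ n := fun c => by
        rcases Nat.even_or_odd n with h | h
        · rw [h.neg_pow, X_pow_mul_C]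
        · rw [h.neg_pow, neg_mul, X_pow_mul_C, mul_neg]
      simp only [LinearMap.comp_apply, LinearMap.mulLeft_apply, bracketGen_mul, mul_add,
        ← mul_assoc, hX]
    · have hX : ∀ Q : (DiffPoly p)[X], (lamD ^ m) ((-X) ^ n * Q) = (-X) ^ n * (lamD ^ m) Q := by
        intro Q
        induction n generalizing Q with
        | zero => simp
        | succ n ih =>
          rw [pow_succ, mul_assoc, ih (isHomog_gen i n), mul_assoc, neg_mul, map_neg,
            lamD_pow_X_mul, neg_mul]
      rw [bracketBilin_gen b hb hi, LinearMap.comp_apply, LinearMap.mulLeft_apply, bracketGen_gen,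
        bracketGen_gen, subNeg_lamD_pow, hs i j, ← hX, mul_neg, mul_smul_comm]
  exact LinearMap.congr_fun this g

/-- Skew-symmetry of the `λ`-bracket. -/
theorem bracketBilin_skew' (hs : IsSkewValue b) {i : ZMod 2} {f : DiffPoly p} (hf : IsHomog i f) (g : DiffPoly p) :
    ⟪f, g⟫ = -subNeg ⟪twistAut i g, f⟫ := by
  -- The right-hand side is a derivation in `g` by the right Leibniz rule, because `subNeg`
  -- exchanges arrows and products. On generators both sides reduce to the defining formula.
  have : bracketBilin b hb f =
      -(subNeg ∘ₗ (bracketBilin b hb).flip f ∘ₗ (twistAut i).toLinearMap) := by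
    refine twisted_derivation_ext i _ _ (fun _ _ x y _ _ => bracketBilin_mul b hb hf x y)
      (fun j k x y hx hy => ?_) (fun j n => ?_)
    · simp only [LinearMap.neg_apply, LinearMap.comp_apply, LinearMap.flip_apply,
        AlgHom.toLinearMap_apply, twistAut_homog _ (hx.mul hy), bracketBilin_mul_left b hb hx hy,
        twistAut_homog _ hf, twistAut_homog _ hx, twistAut_homog _ hy, map_smul, map_add,
        arrow_smul_left, subNeg_arrow, ← smul_C, smul_mul_assoc, mul_neg,
        neg_mul, mul_smul_comm]
      rw [C_mul_homog hx (isHomogPoly_bracketBilin b hb hy hf).subNeg]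
      simp only [smul_add, smul_smul, ← sgn_add, neg_add]
      rw [add_comm]
      congr 3 <;> refine sgn_congr ?_ <;> clear hf hx hy <;> revert i j k <;> decide
    · have hj := isHomog_gen (p := p) j n
      simp only [LinearMap.neg_apply, LinearMap.comp_apply, LinearMap.flip_apply,
        AlgHom.toLinearMap_apply, twistAut_homog _ hj, map_smul]
      rw [bracketBilin_gen b hb hf, bracketBilin_gen_left hb hs, map_neg, map_smul]
      have : ∀ Q : (DiffPoly p)[X], subNeg ((-X) ^ n * Q) = (lamD ^ n) (subNeg Q) := by
        intro Q
        conv_lhs => rw [← subNeg_subNeg Q, ← subNeg_lamD_pow, subNeg_subNeg]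
      rw [this]
  exact LinearMap.congr_fun this g

theorem bracketBilin_skew (hs : IsSkewValue b) {i j : ZMod 2} {f g : DiffPoly p} (hf : IsHomog i f)
    (hg : IsHomog j g) : ⟪f, g⟫ = -(sgn (i * j) • subNeg ⟪g, f⟫) := by
  rw [bracketBilin_skew' hb hs hf, twistAut_homog _ hg, map_smul, LinearMap.smul_apply, map_smul]

end DiffPoly

/-! ### Polynomials in two even variables

In `V[X][X]` the outer variable is `μ` (or `z`, or `w`) and the inner variable is `λ`. -/

section TwoVariables

variable {V : Type*} [Ring V] [Algebra ℂ V] [DiffSuperalgebra V]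

/-- Instance search does not find this one through the ring `V[X][X]`. -/
instance polyPolyHasDistribNeg {V : Type*} [Ring V] : HasDistribNeg V[X][X] where
  neg := Neg.neg
  neg_neg := neg_neg
  mul_neg F G := mul_neg F G
  neg_mul F G := neg_mul F G

/-- The operator `λ + μ + ∂`. -/
def bigD : Module.End ℂ V[X][X] :=
  LinearMap.mulLeft ℂ (X : V[X][X]) +
    Polynomial.lsum fun n => ((monomial n : V[X] →ₗ[V[X]] V[X][X]).restrictScalars ℂ) ∘ₗ lamD

/-- Apply a linear map `V → V[λ]` to the coefficients of a polynomial in `μ`. -/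
def outerMap (F : V →ₗ[ℂ] V[X]) : V[X] →ₗ[ℂ] V[X][X] :=
  Polynomial.lsum fun n => ((monomial n : V[X] →ₗ[V[X]] V[X][X]).restrictScalars ℂ) ∘ₗ F

/-- `∑ₙ λⁿ pₙ ↦ ∑ₙ λⁿ G pₙ`. -/
def innerMap (G : V →ₗ[ℂ] V[X][X]) : V[X] →ₗ[ℂ] V[X][X] :=
  Polynomial.lsum fun n => LinearMap.mulLeft ℂ (C (X ^ n) : V[X][X]) ∘ₗ G

/-- `P(λ) ↦ P(λ + μ)`. -/
def shift : V[X] →ₗ[ℂ] V[X][X] :=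
  Polynomial.lsum fun n => LinearMap.mulRight ℂ ((C X + X) ^ n : V[X][X]) ∘ₗ
    ((CAlgHom.comp CAlgHom : V →ₐ[ℂ] V[X][X]).toLinearMap)

/-- `P(λ) ↦ P(μ)`. -/
def toOuter : V[X] →ₗ[ℂ] V[X][X] := (Polynomial.mapAlgHom CAlgHom).toLinearMap

/-- `∑ₙ μⁿ Fₙ(λ) ↦ ∑ₙ (-λ-μ-∂)ⁿ Fₙ(λ)`. -/
def subNegOuter : V[X][X] →ₗ[ℂ] V[X][X] :=
  Polynomial.lsum fun n => ((-bigD) ^ n) ∘ₗ (CAlgHom : V[X] →ₐ[ℂ] V[X][X]).toLinearMap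

/-- The exchange of the two variables. -/
def swapVars : V[X][X] →+* V[X][X] :=
  Polynomial.eval₂RingHom' (mapRingHom C) (C X) fun a => by
    induction a using Polynomial.induction_on' with
    | add P Q hP hQ => rw [map_add]; exact hP.add_left hQ
    | monomial n a =>
      rw [coe_mapRingHom, map_monomial]
      rw [← C_mul_X_pow_eq_monomial]
      refine Commute.mul_left ?_ (X_pow_mul_C _ _ )
      show C (C a) * C X = C X * C (C a)
      rw [← C_mul, ← C_mul, X_mul_C]

theorem outerMap_monomial (F : V →ₗ[ℂ] V[X]) (n : ℕ) (a : V) :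
    outerMap F (monomial n a) = monomial n (F a) := by
  simp only [outerMap, lsum_apply]; rw [sum_monomial_index _ _ (by simp)]; rfl

theorem outerMap_C (F : V →ₗ[ℂ] V[X]) (a : V) : outerMap F (C a) = C (F a) :=
  outerMap_monomial F 0 a

theorem outerMap_eq_sum (F : V →ₗ[ℂ] V[X]) (P : V[X]) :
    outerMap F P = P.sum fun n p => monomial n (F p) := by
  simp only [outerMap, lsum_apply]; rfl

theorem coeff_outerMap (F : V →ₗ[ℂ] V[X]) (P : V[X]) (n : ℕ) :
    (outerMap F P).coeff n = F (P.coeff n) := by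
  induction P using Polynomial.induction_on' with
  | add P Q hP hQ => simp [hP, hQ]
  | monomial m a =>
    rw [outerMap_monomial, coeff_monomial, coeff_monomial]; split_ifs <;> simp

theorem innerMap_monomial (G : V →ₗ[ℂ] V[X][X]) (n : ℕ) (a : V) :
    innerMap G (monomial n a) = C (X ^ n) * G a := by
  simp only [innerMap, lsum_apply]; rw [sum_monomial_index _ _ (by simp)]; rfl

theorem innerMap_eq_sum (G : V →ₗ[ℂ] V[X][X]) (P : V[X]) :
    innerMap G P = P.sum fun n p => C (X ^ n) * G p := by
  simp only [innerMap, lsum_apply]; rfl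

theorem shift_monomial (n : ℕ) (a : V) :
    shift (monomial n a) = C (C a) * (C X + X) ^ n := by
  simp only [shift, lsum_apply]; rw [sum_monomial_index _ _ (by simp)]; rfl

theorem shift_eq_sum (P : V[X]) : shift P = P.sum fun k r => C (C r) * (C X + X) ^ k := by
  simp only [shift, lsum_apply]; rfl

theorem toOuter_apply (P : V[X]) : toOuter P = P.map C := rfl

theorem toOuter_monomial (n : ℕ) (a : V) : toOuter (monomial n a) = monomial n (C a) := by
  rw [toOuter_apply, map_monomial]

theorem subNegOuter_monomial (n : ℕ) (a : V[X]) :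
    subNegOuter (monomial n a) = ((-bigD) ^ n) (C a) := by
  simp only [subNegOuter, lsum_apply]; rw [sum_monomial_index _ _ (by simp)]; rfl

theorem bigD_monomial (n : ℕ) (P : V[X]) :
    bigD (monomial n P) = X * monomial n P + monomial n (lamD P) := by
  rw [bigD, LinearMap.add_apply, lsum_apply, sum_monomial_index _ _ (by simp)]; rfl

theorem coeff_bigD (F : V[X][X]) (n : ℕ) :
    (bigD F).coeff n = (X * F).coeff n + lamD (F.coeff n) := by
  induction F using Polynomial.induction_on' with
  | add P Q hP hQ => simp only [map_add, coeff_add, hP, hQ, mul_add]; abel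
  | monomial m a =>
    rw [bigD_monomial, coeff_add, coeff_monomial, coeff_monomial]; split_ifs <;> simp

theorem bigD_C (P : V[X]) : bigD (C P) = X * C P + C (lamD P) := by
  rw [← monomial_zero_left, bigD_monomial, monomial_zero_left, monomial_zero_left]

theorem X_mul_CX : (X : V[X][X]) * C X = C X * X := X_mul_C _

theorem bigD_X_mul (F : V[X][X]) : bigD (X * F) = X * bigD F := by
  induction F using Polynomial.induction_on' with
  | add P Q hP hQ => simp only [mul_add, map_add, hP, hQ]
  | monomial m a =>
    simp only [X_mul_monomial, bigD_monomial, mul_add]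

theorem bigD_CX_mul (F : V[X][X]) : bigD (C X * F) = C X * bigD F := by
  induction F using Polynomial.induction_on' with
  | add P Q hP hQ => simp only [mul_add, map_add, hP, hQ]
  | monomial m a =>
    rw [C_mul_monomial, bigD_monomial, bigD_monomial, mul_add, X_mul_monomial, X_mul_monomial,
      C_mul_monomial, C_mul_monomial, lamD_X_mul]

theorem bigD_CC_mul (v : V) (F : V[X][X]) :
    bigD (C (C v) * F) = C (C (der v)) * F + C (C v) * bigD F := by
  induction F using Polynomial.induction_on' with
  | add P Q hP hQ => simp only [mul_add, map_add, hP, hQ]; abel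
  | monomial m a =>
    rw [C_mul_monomial, bigD_monomial, bigD_monomial, mul_add, X_mul_monomial, X_mul_monomial,
      C_mul_monomial, C_mul_monomial, C_mul_monomial, lamD_mul_left, map_add, coeffMap_C]
    abel

theorem smul_eq_CC_mul (v : V) (F : V[X][X]) : v • F = C (C v) * F := by
  ext n : 1
  rw [coeff_smul, coeff_C_mul, smul_eq_C_mul]

theorem bigD_smul_V (v : V) (F : V[X][X]) : bigD (v • F) = der v • F + v • bigD F := by
  simp only [smul_eq_CC_mul, bigD_CC_mul]

theorem bigD_toOuter (P : V[X]) : bigD (toOuter P) = C X * toOuter P + toOuter (lamD P) := by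
  induction P using Polynomial.induction_on' with
  | add P Q hP hQ => simp only [mul_add, map_add, hP, hQ]; abel
  | monomial m a =>
    rw [toOuter_monomial, bigD_monomial, lamD_C, lamD_apply (monomial m a), coeffMap_monomial,
      X_mul_monomial, map_add toOuter, X_mul_monomial, toOuter_monomial, toOuter_monomial,
      C_mul_monomial, map_add (monomial m)]
    abel

theorem toOuter_C (a : V) : toOuter (C a) = C (C a) := by rw [toOuter_apply, map_C]

theorem toOuter_C_mul (P : V[X]) (a : V) : toOuter (C a * P) = C (C a) * toOuter P := by
  rw [toOuter_apply, Polynomial.map_mul, map_C]; rfl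

theorem toOuter_X_mul (P : V[X]) : toOuter (X * P) = X * toOuter P := by
  rw [toOuter_apply, Polynomial.map_mul, map_X]; rfl

theorem neg_bigD_pow (n : ℕ) (F : V[X][X]) :
    ((-bigD) ^ (n + 1)) F = -bigD (((-bigD) ^ n) F) := by
  rw [pow_succ', Module.End.mul_apply, LinearMap.neg_apply]

theorem neg_bigD_pow_CX_mul (n : ℕ) (F : V[X][X]) :
    ((-bigD) ^ n) (C X * F) = C X * ((-bigD) ^ n) F := by
  induction n with
  | zero => simp
  | succ n ih => rw [neg_bigD_pow, ih, bigD_CX_mul, neg_bigD_pow, mul_neg]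

theorem subNegOuter_X_mul (F : V[X][X]) : subNegOuter (X * F) = -bigD (subNegOuter F) := by
  induction F using Polynomial.induction_on' with
  | add P Q hP hQ => simp only [mul_add, map_add, hP, hQ]; abel
  | monomial m a => rw [X_mul_monomial, subNegOuter_monomial, subNegOuter_monomial, neg_bigD_pow]

theorem subNegOuter_CX_mul (F : V[X][X]) : subNegOuter (C X * F) = C X * subNegOuter F := by
  induction F using Polynomial.induction_on' with
  | add P Q hP hQ => simp only [mul_add, map_add, hP, hQ]
  | monomial m a =>
    rw [C_mul_monomial, subNegOuter_monomial, subNegOuter_monomial, C_mul, neg_bigD_pow_CX_mul]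

theorem shift_X_mul (P : V[X]) : shift (X * P) = (C X + X) * shift P := by
  induction P using Polynomial.induction_on' with
  | add P Q hP hQ => simp only [mul_add, map_add, hP, hQ]
  | monomial m a =>
    have : (C X + X) * C (C a) = C (C a) * (C X + X : V[X][X]) := by
      rw [add_mul, mul_add, X_mul_C, ← C_mul, ← C_mul, X_mul_C]
    rw [X_mul_monomial, shift_monomial, shift_monomial, pow_succ', ← mul_assoc, ← mul_assoc, this]

theorem shift_C (a : V) : shift (C a) = C (C a) := by
  rw [← monomial_zero_left, shift_monomial]; simp

theorem shift_C_mul (a : V) (P : V[X]) : shift (C a * P) = C (C a) * shift P := by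
  induction P using Polynomial.induction_on' with
  | add P Q hP hQ => simp only [mul_add, map_add, hP, hQ]
  | monomial m b =>
    rw [C_mul_monomial, shift_monomial, shift_monomial, C_mul, C_mul, mul_assoc]

theorem shift_mul_C (P : V[X]) (a : V) : shift (P * C a) = shift P * C (C a) := by
  induction P using Polynomial.induction_on' with
  | add P Q hP hQ => simp only [add_mul, map_add, hP, hQ]
  | monomial m b =>
    have : (C X + X) ^ m * C (C a) = C (C a) * (C X + X : V[X][X]) ^ m := by
      refine Commute.pow_left ?_ m
      show (C X + X) * C (C a) = C (C a) * (C X + X)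
      rw [add_mul, mul_add, X_mul_C, ← C_mul, ← C_mul, X_mul_C]
    rw [monomial_mul_C, shift_monomial, shift_monomial, C_mul, C_mul, mul_assoc, mul_assoc, this]

theorem bigD_shiftVar_mul (F : V[X][X]) : bigD ((C X + X) * F) = (C X + X) * bigD F := by
  rw [add_mul, map_add, bigD_X_mul, bigD_CX_mul, add_mul]

theorem shift_lamD (P : V[X]) : shift (lamD P) = bigD (shift P) := by
  induction P using Polynomial.induction_on' with
  | add P Q hP hQ => simp only [map_add, hP, hQ]
  | monomial m a =>
    induction m with
    | zero =>
      rw [monomial_zero_left, lamD_C, map_add, shift_X_mul, shift_C, shift_C, bigD_C, lamD_C,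
        add_mul, map_add, C_mul]
      abel
    | succ m ih => rw [← X_mul_monomial, lamD_X_mul, shift_X_mul, shift_X_mul, ih,
        bigD_shiftVar_mul]

theorem shift_negLamD_pow (n : ℕ) (P : V[X]) :
    shift (((-lamD) ^ n) P) = ((-bigD) ^ n) (shift P) := by
  induction n with
  | zero => simp
  | succ n ih =>
    rw [pow_succ', Module.End.mul_apply, LinearMap.neg_apply, map_neg, shift_lamD, ih,
      neg_bigD_pow]

/-- Replacing μ by -λ-μ-∂ converts a polynomial in μ into the skew image in the variable λ+μ. With
`subNegOuter_shift`, the reverse statement, this interchanges two terms of the Jacobi identity when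
its last two arguments are swapped. -/
theorem subNegOuter_toOuter (P : V[X]) : subNegOuter (toOuter P) = shift (subNeg P) := by
  induction P using Polynomial.induction_on' with
  | add P Q hP hQ => simp only [map_add, hP, hQ]
  | monomial m a =>
    rw [toOuter_monomial, subNegOuter_monomial, subNeg_monomial, shift_negLamD_pow, shift_C]

theorem subNegOuter_shift (P : V[X]) : subNegOuter (shift P) = toOuter (subNeg P) := by
  induction P using Polynomial.induction_on' with
  | add P Q hP hQ => simp only [map_add, hP, hQ]
  | monomial m a =>
    induction m with
    | zero =>
      rw [monomial_zero_left, shift_C, subNeg_C, toOuter_C, ← monomial_zero_left,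
        subNegOuter_monomial]
      rfl
    | succ m ih =>
      rw [← X_mul_monomial, shift_X_mul, add_mul, map_add, subNegOuter_X_mul, subNegOuter_CX_mul,
        ih, bigD_toOuter, subNeg_X_mul, map_neg]
      abel

theorem swapVars_X : swapVars (X : V[X][X]) = C X := by simp [swapVars]

theorem swapVars_C (P : V[X]) : swapVars (C P) = toOuter P := by
  simp [swapVars, toOuter_apply]

theorem swapVars_toOuter (P : V[X]) : swapVars (toOuter P) = C P := by
  induction P using Polynomial.induction_on' with
  | add P Q hP hQ => simp only [map_add, hP, hQ]
  | monomial m a =>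
    rw [toOuter_monomial, ← C_mul_X_pow_eq_monomial, map_mul, map_pow, swapVars_X, swapVars_C,
      toOuter_C, ← C_pow, ← C_mul, C_mul_X_pow_eq_monomial]

theorem swapVars_CX : swapVars (C X : V[X][X]) = X := by
  rw [swapVars_C, toOuter_apply, map_X]

theorem swapVars_CC (v : V) : swapVars (C (C v)) = C (C v) := by rw [swapVars_C, toOuter_C]

theorem swapVars_smul (r : ℂ) (F : V[X][X]) : swapVars (r • F) = r • swapVars F := by
  have : ∀ F : V[X][X], r • F = C (C (algebraMap ℂ V r)) * F := fun F => by
    rw [← smul_eq_CC_mul, algebraMap_smul]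
  rw [this, map_mul, swapVars_CC, this]

theorem swapVars_outerMap (F : V →ₗ[ℂ] V[X]) (P : V[X]) :
    swapVars (outerMap F P) = innerMap (toOuter ∘ₗ F) P := by
  induction P using Polynomial.induction_on' with
  | add P Q hP hQ => simp only [map_add, hP, hQ]
  | monomial m a =>
    rw [outerMap_monomial, ← C_mul_X_pow_eq_monomial, map_mul, map_pow, swapVars_X, swapVars_C,
      innerMap_monomial, LinearMap.comp_apply, toOuter_apply]
    have : ∀ Q : V[X], Q.map C * C X = C X * Q.map (C : V →+* V[X]) := by
      intro Q
      ext n : 1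
      rw [coeff_mul_C, coeff_C_mul, X_mul]
    rw [← C_pow]
    have h2 : ∀ Q : V[X], Q.map C * C (X ^ m) = C (X ^ m) * Q.map (C : V →+* V[X]) := by
      intro Q
      ext n : 1
      rw [coeff_mul_C, coeff_C_mul, X_pow_mul]
    rw [h2]

theorem swapVars_swapVars (F : V[X][X]) : swapVars (swapVars F) = F := by
  induction F using Polynomial.induction_on' with
  | add P Q hP hQ => simp only [map_add, hP, hQ]
  | monomial m a =>
    rw [← C_mul_X_pow_eq_monomial, map_mul, map_pow, map_mul, map_pow, swapVars_X, swapVars_C,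
      swapVars_CX, swapVars_toOuter]

theorem swapVars_shift (P : V[X]) : swapVars (shift P) = shift P := by
  induction P using Polynomial.induction_on' with
  | add P Q hP hQ => simp only [map_add, hP, hQ]
  | monomial m a =>
    rw [shift_monomial, map_mul, map_pow, map_add, swapVars_X, swapVars_CX, swapVars_CC, add_comm]

theorem innerMap_X_mul (G : V →ₗ[ℂ] V[X][X]) (P : V[X]) :
    innerMap G (X * P) = C X * innerMap G P := by
  induction P using Polynomial.induction_on' with
  | add P Q hP hQ => simp only [mul_add, map_add, hP, hQ]
  | monomial m a =>
    rw [X_mul_monomial, innerMap_monomial, innerMap_monomial, pow_succ', C_mul, mul_assoc]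

theorem innerMap_C (G : V →ₗ[ℂ] V[X][X]) (a : V) : innerMap G (C a) = G a := by
  rw [← monomial_zero_left, innerMap_monomial]; simp

theorem innerMap_lamD (G : V →ₗ[ℂ] V[X][X]) (P : V[X]) :
    innerMap G (lamD P) = C X * innerMap G P + innerMap (G ∘ₗ der) P := by
  have : ∀ Q, innerMap G (coeffMap der Q) = innerMap (G ∘ₗ der) Q := by
    intro Q
    induction Q using Polynomial.induction_on' with
    | add P Q hP hQ => simp only [map_add, hP, hQ]
    | monomial m a => rw [coeffMap_monomial, innerMap_monomial, innerMap_monomial]; rfl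
  rw [lamD_apply, map_add, innerMap_X_mul, this]

theorem innerMap_mulLeft (G : V →ₗ[ℂ] V[X][X]) {T : V[X][X] →ₗ[ℂ] V[X][X]}
    (hT : ∀ F, T (C X * F) = C X * T F) (P : V[X]) : innerMap (T ∘ₗ G) P = T (innerMap G P) := by
  have h : ∀ n F, T (C (X ^ n) * F) = C (X ^ n) * T F := by
    intro n F
    induction n with
    | zero => simp
    | succ n ih => rw [pow_succ', C_mul, mul_assoc, hT, ih, mul_assoc]
  induction P using Polynomial.induction_on' with
  | add P Q hP hQ => simp only [map_add, hP, hQ]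
  | monomial m a => rw [innerMap_monomial, innerMap_monomial, h]; rfl

/-- Since G(∂a) = -(λ+μ)G(a), the operator λ+∂ on the argument acts after G as λ-(λ+μ) = -μ.
Substituting -λ-∂ for λ therefore exchanges the two variables. -/
theorem innerMap_subNeg (G : V →ₗ[ℂ] V[X][X]) (hG : ∀ a, G (der a) = -((C X + X) * G a))
    (hs : ∀ a, swapVars (G a) = G a) (P : V[X]) :
    innerMap G (subNeg P) = swapVars (innerMap G P) := by
  have hder : G ∘ₗ der = -(LinearMap.mulLeft ℂ (C X + X : V[X][X]) ∘ₗ G) := by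
    ext1 a; exact hG a
  have h1 : ∀ F : V[X][X], (C X + X) * (C X * F) = C X * ((C X + X) * F) := by
    intro F
    rw [add_mul, add_mul, mul_add, ← mul_assoc X, X_mul_CX, mul_assoc]
  have hlam : ∀ Q, innerMap G (lamD Q) = -(X * innerMap G Q) := by
    intro Q
    rw [innerMap_lamD, hder, ← LinearMap.neg_comp,
      innerMap_mulLeft G (T := -(LinearMap.mulLeft ℂ (C X + X : V[X][X]))) (fun F => by
        simp only [LinearMap.neg_apply, LinearMap.mulLeft_apply, h1, mul_neg])]
    simp only [LinearMap.neg_apply, LinearMap.mulLeft_apply, add_mul]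
    abel
  induction P using Polynomial.induction_on' with
  | add P Q hP hQ => simp only [map_add, hP, hQ]
  | monomial m a =>
    rw [subNeg_monomial, innerMap_monomial, map_mul, swapVars_C, hs, toOuter_apply,
      Polynomial.map_pow, map_X]
    induction m with
    | zero => simp [innerMap_C]
    | succ m ih =>
      rw [pow_succ', Module.End.mul_apply, LinearMap.neg_apply, map_neg, hlam, ih, neg_neg,
        pow_succ', mul_assoc]

theorem outerMap_lamD {F : V →ₗ[ℂ] V[X]} (hF : ∀ a, F (der a) = lamD (F a)) (P : V[X]) :
    outerMap F (lamD P) = bigD (outerMap F P) := by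
  induction P using Polynomial.induction_on' with
  | add P Q hP hQ => simp only [map_add, hP, hQ]
  | monomial m a =>
    rw [lamD_apply, coeffMap_monomial, X_mul_monomial, map_add, outerMap_monomial,
      outerMap_monomial, outerMap_monomial, bigD_monomial, X_mul_monomial, hF]

theorem outerMap_subNeg {F : V →ₗ[ℂ] V[X]} (hF : ∀ a, F (der a) = lamD (F a)) (P : V[X]) :
    outerMap F (subNeg P) = subNegOuter (outerMap F P) := by
  induction P using Polynomial.induction_on' with
  | add P Q hP hQ => simp only [map_add, hP, hQ]
  | monomial m a =>
    rw [subNeg_monomial, outerMap_monomial, subNegOuter_monomial]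
    induction m with
    | zero => simp [outerMap_C]
    | succ m ih =>
      rw [pow_succ', Module.End.mul_apply, LinearMap.neg_apply, map_neg, outerMap_lamD hF, ih,
        neg_bigD_pow]

theorem outerMap_C_mul {F : V →ₗ[ℂ] V[X]} {φ : V →ₐ[ℂ] V}
    (hF : ∀ a b, F (a * b) = C (φ a) * F b + F a * C b) (a : V) (P : V[X]) :
    outerMap F (C a * P) = C (C (φ a)) * outerMap F P + C (F a) * toOuter P := by
  induction P using Polynomial.induction_on' with
  | add P Q hP hQ => simp only [mul_add, map_add, hP, hQ]; abel
  | monomial m b =>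
    rw [C_mul_monomial, outerMap_monomial, outerMap_monomial, toOuter_monomial, hF, map_add,
      C_mul_monomial, C_mul_monomial]

theorem outerMap_mul_C {F : V →ₗ[ℂ] V[X]} {φ : V →ₐ[ℂ] V}
    (hF : ∀ a b, F (a * b) = C (φ a) * F b + F a * C b) (a : V) (P : V[X]) :
    outerMap F (P * C a) =
      toOuter (P.map (φ : V →+* V)) * C (F a) + outerMap F P * C (C a) := by
  induction P using Polynomial.induction_on' with
  | add P Q hP hQ =>
    simp only [add_mul, map_add, Polynomial.map_add, hP, hQ]; abel
  | monomial m b =>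
    rw [monomial_mul_C, outerMap_monomial, outerMap_monomial, map_monomial, toOuter_monomial, hF,
      map_add, monomial_mul_C, monomial_mul_C]
    rfl

end TwoVariables

namespace DiffPoly

variable {ι : Type*} {p : ι → ZMod 2}
variable (b : ι → ι → (DiffPoly p)[X]) (hb : ∀ i j, IsHomogPoly (p i + p j) (b i j))

local notation "⟪" f "," g "⟫" => bracketBilin b hb f g

/-! ### The Jacobi identity -/

/-- The term `{f _λ {g _μ h}}`. -/
def nested (f g : DiffPoly p) : DiffPoly p →ₗ[ℂ] (DiffPoly p)[X][X] :=
  outerMap (bracketBilin b hb f) ∘ₗ bracketBilin b hb g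

/-- The term `{{f _λ g} _{λ+μ} h}`. -/
def nestedLeft (f g h : DiffPoly p) : (DiffPoly p)[X][X] :=
  innerMap (shift ∘ₗ (bracketBilin b hb).flip h) ⟪f, g⟫

/-- The Jacobi identity for elements `f`, `g` of parities `i`, `j`. -/
def JacobiAt (i j : ZMod 2) (f g h : DiffPoly p) : Prop :=
  nested b hb f g h = nestedLeft b hb f g h + sgn (i * j) • swapVars (nested b hb g f h)

variable {i j k : ZMod 2} {f g h : DiffPoly p}

theorem bracketBilin_twistAut (l : ZMod 2) (hf : IsHomog i f) (x : DiffPoly p) :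
    ⟪f, twistAut l x⟫ = sgn (i * l) • (⟪f, x⟫).map ((twistAut l : DiffPoly p →ₐ[ℂ] DiffPoly p) : DiffPoly p →+* DiffPoly p) := by
  have key : ∀ j x, IsHomog j x → ⟪f, twistAut l x⟫ =
      sgn (i * l) • (⟪f, x⟫).map ((twistAut l : DiffPoly p →ₐ[ℂ] DiffPoly p) : DiffPoly p →+* DiffPoly p) := by
    intro j x hx
    rw [twistAut_homog _ hx, map_smul]
    ext n : 1
    rw [coeff_smul, coeff_smul, coeff_map]
    have := twistAut_homog l (isHomogPoly_bracketBilin b hb hf hx n)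
    rw [RingHom.coe_coe, this, smul_smul, ← sgn_add]
    congr 1
    refine sgn_congr ?_
    clear hf hx this; revert i j l; decide
  rw [← homComp_add_homComp x, map_add, map_add, map_add, Polynomial.map_add, smul_add,
    key _ _ (isHomog_homComp 0 x), key _ _ (isHomog_homComp 1 x)]

/-- Besides the two terms of a derivation there are two cross terms. They also occur in
`swapVars_nested_mul`, with the sign moved from one to the other, so they cancel in the
supercommutator. -/
theorem nested_mul (hf : IsHomog i f) (hg : IsHomog j g) (x y : DiffPoly p) :
    nested b hb f g (x * y) = C (C (twistAut (i + j) x)) * nested b hb f g y +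
      sgn (i * j) • (C ((⟪f, x⟫).map ((twistAut j : DiffPoly p →ₐ[ℂ] DiffPoly p) : DiffPoly p →+* DiffPoly p)) * toOuter ⟪g, y⟫) +
      toOuter ((⟪g, x⟫).map ((twistAut i : DiffPoly p →ₐ[ℂ] DiffPoly p) : DiffPoly p →+* DiffPoly p)) * C ⟪f, y⟫ +
      nested b hb f g x * C (C y) := by
  simp only [nested, LinearMap.comp_apply]
  rw [bracketBilin_mul b hb hg, map_add, outerMap_C_mul (bracketBilin_mul b hb hf),
    outerMap_mul_C (bracketBilin_mul b hb hf), twistAut_twistAut, bracketBilin_twistAut b hb j hf,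
    ← smul_C, smul_mul_assoc]
  abel

theorem swapVars_nested_mul (hf : IsHomog i f) (hg : IsHomog j g) (x y : DiffPoly p) :
    swapVars (nested b hb g f (x * y)) =
      C (C (twistAut (i + j) x)) * swapVars (nested b hb g f y) +
      sgn (i * j) • (toOuter ((⟪g, x⟫).map
        ((twistAut i : DiffPoly p →ₐ[ℂ] DiffPoly p) : DiffPoly p →+* DiffPoly p)) * C ⟪f, y⟫) +
      C ((⟪f, x⟫).map ((twistAut j : DiffPoly p →ₐ[ℂ] DiffPoly p) : DiffPoly p →+* DiffPoly p)) *
        toOuter ⟪g, y⟫ + swapVars (nested b hb g f x) * C (C y) := by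
  rw [nested_mul b hb hg hf]
  simp only [map_add, map_mul, swapVars_smul, swapVars_C, swapVars_toOuter, toOuter_C]
  rw [add_comm j i, mul_comm j i]

/-- Here `U` and `W` play the role of the cross terms of two composed derivations; they cancel
because the sign `s` squares to 1. -/
theorem sub_smul_mul_aux {R : Type*} [Ring R] [Algebra ℂ R] {s : ℂ} (hs : s * s = 1)
    (A B T T' S S' U W : R) : (A * T + s • U + W + T' * B) - s • (A * S + s • W + U + S' * B) =
      A * (T - s • S) + (T' - s • S') * B := by
  simp only [smul_add, smul_smul, hs, one_smul, mul_sub, sub_mul, mul_smul_comm, smul_mul_assoc]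
  abel

theorem coeff_homog_sum_congr {P : (DiffPoly p)[X]} {l : ZMod 2} (hP : IsHomogPoly l P)
    {G G' : DiffPoly p →ₗ[ℂ] (DiffPoly p)[X][X]} (h : ∀ a, IsHomog l a → G a = G' a) :
    innerMap G P = innerMap G' P := by
  rw [innerMap_eq_sum, innerMap_eq_sum]
  exact Finset.sum_congr rfl fun n _ => by simp only [h _ (hP n)]

theorem nestedLeft_mul (hf : IsHomog i f) (hg : IsHomog j g) (x y : DiffPoly p) :
    nestedLeft b hb f g (x * y) = C (C (twistAut (i + j) x)) * nestedLeft b hb f g y +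
      nestedLeft b hb f g x * C (C y) := by
  have hP := isHomogPoly_bracketBilin b hb hf hg
  have h1 : innerMap (shift ∘ₗ (bracketBilin b hb).flip (x * y)) ⟪f, g⟫ =
      innerMap (LinearMap.mulLeft ℂ (C (C (twistAut (i + j) x))) ∘ₗ shift ∘ₗ
        (bracketBilin b hb).flip y + LinearMap.mulRight ℂ (C (C y)) ∘ₗ shift ∘ₗ
        (bracketBilin b hb).flip x) ⟪f, g⟫ := by
    refine coeff_homog_sum_congr hP fun a ha => ?_
    simp only [LinearMap.add_apply, LinearMap.comp_apply, LinearMap.flip_apply,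
      LinearMap.mulLeft_apply, LinearMap.mulRight_apply, bracketBilin_mul b hb ha, map_add,
      shift_C_mul, shift_mul_C]
  have h2 : ∀ (G G' : DiffPoly p →ₗ[ℂ] (DiffPoly p)[X][X]) P,
      innerMap (G + G') P = innerMap G P + innerMap G' P := by
    intro G G' P
    simp only [innerMap_eq_sum, LinearMap.add_apply, mul_add, Polynomial.sum,
      Finset.sum_add_distrib]
  rw [nestedLeft, h1, h2, innerMap_mulLeft, innerMap_mulLeft]
  · rfl
  · intro F; simp only [LinearMap.mulRight_apply, mul_assoc]
  · intro F
    simp only [LinearMap.mulLeft_apply]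
    rw [← mul_assoc, ← mul_assoc, ← C_mul, ← C_mul, X_mul_C]

/-- The Jacobi identity holds for all `h` if it holds for the generators. -/
theorem JacobiAt.of_gen (hf : IsHomog i f) (hg : IsHomog j g)
    (H : ∀ k, JacobiAt b hb i j f g (gen p k 0)) (h : DiffPoly p) : JacobiAt b hb i j f g h := by
  let R : DiffPoly p →ₗ[ℂ] (DiffPoly p)[X][X] :=
    { toFun := fun h => nestedLeft b hb f g h
      map_add' := fun x y => by
        simp only [nestedLeft, map_add, LinearMap.comp_add, innerMap_eq_sum, LinearMap.add_apply,
          mul_add, Polynomial.sum, Finset.sum_add_distrib]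
      map_smul' := fun r x => by
        simp only [nestedLeft, map_smul, LinearMap.comp_smul, innerMap_eq_sum,
          LinearMap.smul_apply, mul_smul_comm, Polynomial.sum, Finset.smul_sum, RingHom.id_apply] }
  let S : (DiffPoly p)[X][X] →ₗ[ℂ] (DiffPoly p)[X][X] :=
    { toFun := swapVars
      map_add' := map_add _
      map_smul' := fun r x => swapVars_smul r x }
  have hS : S ∘ₗ nested b hb g f =
      innerMap (toOuter ∘ₗ bracketBilin b hb g) ∘ₗ bracketBilin b hb f := by
    ext1 x; exact swapVars_outerMap _ _
  -- Each of the three Jacobi terms intertwines ∂ with λ+μ+∂, so the identity on underived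
  -- generators propagates to their derivatives.
  have hD1 : ∀ x, nested b hb f g (der x) = bigD (nested b hb f g x) := fun x => by
    simp only [nested, LinearMap.comp_apply]
    rw [bracketBilin_der_right, outerMap_lamD (bracketBilin_der_right b hb f)]
  have hD2 : ∀ x, R (der x) = bigD (R x) := fun x => by
    show innerMap (shift ∘ₗ (bracketBilin b hb).flip (der x)) ⟪f, g⟫ =
      bigD (innerMap (shift ∘ₗ (bracketBilin b hb).flip x) ⟪f, g⟫)
    rw [← innerMap_mulLeft _ bigD_CX_mul]
    congr 2
    ext1 a
    simp only [LinearMap.comp_apply, LinearMap.flip_apply, bracketBilin_der_right, shift_lamD]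
  have hD3 : ∀ x, S (nested b hb g f (der x)) = bigD (S (nested b hb g f x)) := fun x => by
    have h1 : ∀ x, S (nested b hb g f x) =
        innerMap (toOuter ∘ₗ bracketBilin b hb g) (bracketBilin b hb f x) :=
      fun x => LinearMap.congr_fun hS x
    have h2 : (toOuter ∘ₗ bracketBilin b hb g) ∘ₗ der =
        (bigD - LinearMap.mulLeft ℂ (C X)) ∘ₗ (toOuter ∘ₗ bracketBilin b hb g) := by
      ext1 a
      simp only [LinearMap.comp_apply, bracketBilin_der_right, LinearMap.sub_apply, bigD_toOuter,
        LinearMap.mulLeft_apply]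
      abel
    rw [h1, h1, bracketBilin_der_right, innerMap_lamD, h2, innerMap_mulLeft]
    · simp
    · intro F
      simp only [LinearMap.sub_apply, bigD_CX_mul, LinearMap.mulLeft_apply, mul_sub]
  -- The supercommutator of the brackets with `f` and `g` and the bracket with {f _λ g} are
  -- derivations in `h` along the same twist.
  have key : nested b hb f g - sgn (i * j) • (S ∘ₗ nested b hb g f) = R := by
    refine derivation_ext ((CAlgHom.comp (CAlgHom.comp (twistAut (i + j)))).toLinearMap)
      ((CAlgHom.comp CAlgHom).toLinearMap) _ _ (by simp) (by simp) (fun _ _ x y _ _ => ?_)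
      (fun _ _ x y _ _ => nestedLeft_mul b hb hf hg x y) (fun k n => ?_)
    · simp only [LinearMap.sub_apply, LinearMap.smul_apply, LinearMap.comp_apply]
      rw [nested_mul b hb hf hg]
      have := swapVars_nested_mul b hb hf hg x y
      exact (congrArg (fun F => _ - sgn (i * j) • F) this).trans
        (sub_smul_mul_aux (sgn_mul_self _) _ _ _ _ _ _ _ _)
    · induction n with
      | zero =>
        have := H k
        rw [JacobiAt] at this
        simp only [LinearMap.sub_apply, LinearMap.smul_apply, LinearMap.comp_apply]
        rw [this]
        exact add_sub_cancel_right _ _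
      | succ n ih =>
        simp only [LinearMap.sub_apply, LinearMap.smul_apply, LinearMap.comp_apply] at ih ⊢
        rw [← der_gen, hD1, hD2, hD3, ← ih, map_sub, map_smul]
  have := LinearMap.congr_fun key h
  simp only [LinearMap.sub_apply, LinearMap.smul_apply, LinearMap.comp_apply] at this
  exact sub_eq_iff_eq_add.1 this

variable {b}

/-- Skew-symmetry in `f`, `g` exchanges λ and μ in the iterated bracket on the left
(`innerMap_subNeg`); the other two terms trade places. -/
theorem JacobiAt.swap_left (hs : IsSkewValue b) (hf : IsHomog i f) (hg : IsHomog j g)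
    (H : JacobiAt b hb i j f g h) : JacobiAt b hb j i g f h := by
  have h1 : nestedLeft b hb g f h = -(sgn (j * i) • swapVars (nestedLeft b hb f g h)) := by
    rw [nestedLeft, bracketBilin_skew hb hs hg hf, map_neg, map_smul, innerMap_subNeg]
    · rfl
    · intro a
      simp only [LinearMap.comp_apply, LinearMap.flip_apply, bracketBilin_der_left, map_neg,
        shift_X_mul]
    · intro a
      simp only [LinearMap.comp_apply, swapVars_shift]
  rw [JacobiAt] at *
  rw [h1, H, map_add, swapVars_smul, swapVars_swapVars, smul_add, smul_smul, mul_comm j i,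
    sgn_mul_self, one_smul]
  abel

/-- Apply μ ↦ -λ-μ-∂ to the identity for (f, h, g). The term on the left is skew-symmetry in the
inner bracket, and the two terms on the right are transformed into each other up to sign. -/
theorem JacobiAt.swap_right (hs : IsSkewValue b) (hf : IsHomog i f) (hg : IsHomog j g)
    (hh : IsHomog k h) (H : JacobiAt b hb i k f h g) : JacobiAt b hb i j f g h := by
  have e1 : nested b hb f g h = -(sgn (j * k) • subNegOuter (nested b hb f h g)) := by
    simp only [nested, LinearMap.comp_apply]
    rw [bracketBilin_skew hb hs hg hh, map_neg, map_smul,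
      outerMap_subNeg (bracketBilin_der_right b hb f)]
  have e2 : subNegOuter (nestedLeft b hb f h g) =
      -(sgn ((i + k) * j) • swapVars (nested b hb g f h)) := by
    simp only [nested, LinearMap.comp_apply]
    rw [nestedLeft, ← innerMap_mulLeft _ subNegOuter_CX_mul, swapVars_outerMap, ← LinearMap.smul_apply,
      ← LinearMap.neg_apply]
    have : -(sgn ((i + k) * j) • innerMap (toOuter ∘ₗ bracketBilin b hb g)) =
        innerMap (-(sgn ((i + k) * j) • (toOuter ∘ₗ bracketBilin b hb g))) := by
      ext P : 1
      simp only [innerMap_eq_sum, Polynomial.sum, LinearMap.neg_apply, LinearMap.smul_apply,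
        Finset.smul_sum, mul_neg, mul_smul_comm, Finset.sum_neg_distrib]
    rw [this]
    refine coeff_homog_sum_congr (isHomogPoly_bracketBilin b hb hf hh) fun a ha => ?_
    simp only [LinearMap.comp_apply, LinearMap.flip_apply, LinearMap.neg_apply,
      LinearMap.smul_apply, subNegOuter_shift]
    rw [bracketBilin_skew hb hs hg ha, map_neg, map_smul, smul_neg, smul_smul, mul_comm j,
      sgn_mul_self, one_smul, neg_neg]
  have e3 : subNegOuter (swapVars (nested b hb h f g)) =
      -(sgn (k * (i + j)) • nestedLeft b hb f g h) := by
    simp only [nested, LinearMap.comp_apply]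
    rw [nestedLeft, swapVars_outerMap, ← innerMap_mulLeft _ subNegOuter_CX_mul,
      ← LinearMap.smul_apply, ← LinearMap.neg_apply]
    have : -(sgn (k * (i + j)) • innerMap (shift ∘ₗ (bracketBilin b hb).flip h)) =
        innerMap (-(sgn (k * (i + j)) • (shift ∘ₗ (bracketBilin b hb).flip h))) := by
      ext P : 1
      simp only [innerMap_eq_sum, Polynomial.sum, LinearMap.neg_apply, LinearMap.smul_apply,
        Finset.smul_sum, mul_neg, mul_smul_comm, Finset.sum_neg_distrib]
    rw [this]
    refine coeff_homog_sum_congr (isHomogPoly_bracketBilin b hb hf hg) fun a ha => ?_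
    simp only [LinearMap.comp_apply, LinearMap.flip_apply, LinearMap.neg_apply,
      LinearMap.smul_apply, subNegOuter_toOuter]
    rw [bracketBilin_skew hb hs ha hh, map_neg, map_smul, smul_neg, smul_smul, mul_comm k,
      sgn_mul_self, one_smul, neg_neg]
  rw [JacobiAt] at *
  rw [e1, H, map_add, map_smul, e2, e3]
  simp only [smul_add, smul_neg, neg_add, neg_neg, smul_smul, ← sgn_add]
  rw [add_comm]
  congr 1
  · conv_rhs => rw [← one_smul ℂ (nestedLeft b hb f g h), ← sgn_zero]
    congr 1
    refine sgn_congr ?_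
    clear H hf hg hh e1 e2 e3; revert i j k; decide
  · congr 1
    refine sgn_congr ?_
    clear H hf hg hh e1 e2 e3; revert i j k; decide

/-- The Jacobi identity follows from the Jacobi identity for the generators. -/
theorem jacobiAt_of_gen (hs : IsSkewValue b)
    (H : ∀ x y z, JacobiAt b hb (p x) (p y) (gen p x 0) (gen p y 0) (gen p z 0))
    (hf : IsHomog i f) (hg : IsHomog j g) : JacobiAt b hb i j f g h := by
  have hp := fun x => isHomog_gen (p := p) x 0
  -- A generator is replaced by an arbitrary element one slot at a time: the third slot is handled
  -- by the derivation property, and the swaps bring the other slots there.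
  have ext : ∀ x i g, IsHomog i g →
      (∀ k h, IsHomog k h → JacobiAt b hb i k g h (gen p x 0)) := by
    intro x i g hg k h hh
    have h1 : ∀ j f k h, IsHomog j f → IsHomog k h → JacobiAt b hb (p x) j (gen p x 0) f h := by
      intro j f k h hf _
      refine JacobiAt.of_gen b hb (hp x) hf (fun y => ?_) h
      refine JacobiAt.swap_right hb hs (hp x) hf (hp y) ?_
      exact JacobiAt.of_gen b hb (hp x) (hp y) (fun z => H x y z) _
    exact JacobiAt.swap_right hb hs hg hh (hp x)
      (JacobiAt.swap_left hb hs (hp x) hg (h1 _ _ _ _ hg hh))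
  exact JacobiAt.of_gen b hb hf hg (fun x => ext x i f hf j g hg) h

end DiffPoly

/-! ### The affine Poisson vertex superalgebra -/

section Affine

variable {S : Type*} [Fintype S] [DecidableEq S] (π : S → ZMod 2)

/-- `qMat` as a linear map. -/
def qLin : Matrix S S ℂ →ₗ[ℂ] AffV π where
  toFun := qMat π
  map_add' a b := by simp [qMat, add_smul, Finset.sum_add_distrib]
  map_smul' r a := by simp [qMat, mul_smul, Finset.smul_sum]

theorem qLin_apply (a : Matrix S S ℂ) : qLin π a = qMat π a := rfl

theorem qLin_eMat (z : S × S) : qLin π (eMat z) = DiffPoly.gen (glPar π) z 0 := by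
  rw [qLin_apply, qMat, Finset.sum_eq_single z]
  · simp [eMat]
  · intro w _ hw
    have : ¬ (z.1 = w.1 ∧ z.2 = w.2) := fun h => hw (Prod.ext h.1.symm h.2.symm)
    simp [eMat, this]
  · simp

theorem eMat_mul (x y : S × S) :
    eMat x * eMat y = if x.2 = y.1 then eMat (x.1, y.2) else 0 := by
  split_ifs with h
  · simp [eMat, h]
  · simp [eMat, Matrix.single_mul_single_of_ne _ _ _ _ h]

theorem glPar_mul {x y : S × S} (h : x.2 = y.1) : glPar π (x.1, y.2) = glPar π x + glPar π y := by
  simp only [glPar, h]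
  generalize π x.1 = a; generalize π y.1 = b; generalize π y.2 = c
  revert a b c; decide

/-- The supertrace. -/
def strLin : Matrix S S ℂ →ₗ[ℂ] ℂ where
  toFun a := ∑ i, sgn (π i) * a i i
  map_add' a b := by simp [mul_add, Finset.sum_add_distrib]
  map_smul' r a := by simp [Finset.mul_sum, mul_left_comm]

theorem strForm_eq (a b : Matrix S S ℂ) : strForm π a b = strLin π (a * b) := rfl

theorem strLin_eMat_mul_comm (x y : S × S) :
    strLin π (eMat x * eMat y) = sgn (glPar π x * glPar π y) * strLin π (eMat y * eMat x) := by
  rw [← strForm_eq, ← strForm_eq, strForm_eMat, strForm_eMat]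
  by_cases h : x.1 = y.2 ∧ x.2 = y.1
  · simp only [glPar, eMat, h.1, h.2, Matrix.single_apply_same, mul_one, ← sgn_add]
    refine sgn_congr ?_
    generalize π y.1 = a; generalize π y.2 = b
    revert a b; decide
  · have h' : ¬ (y.1 = x.2 ∧ y.2 = x.1) := fun h' => h ⟨h'.2.symm, h'.1.symm⟩
    simp [eMat, h, h']

theorem strLin_supercyclic (x y z : S × S) : strLin π (eMat x * (eMat y * eMat z)) =
    sgn (glPar π x * (glPar π y + glPar π z)) * strLin π (eMat y * eMat z * eMat x) := by
  rw [eMat_mul y z]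
  split_ifs with h
  · rw [strLin_eMat_mul_comm, glPar_mul π h]
  · simp

/-- The supercommutator is skew; the form is supersymmetric, and its factor λ changes sign under λ ↦
-λ-∂ since the coefficient is constant. -/
theorem isSkewValue_affValue (κ : ℂ) : DiffPoly.IsSkewValue (affValue π κ) := by
  intro x y
  have hX : subNeg (X : (AffV π)[X]) = -X := by
    have := subNeg_X_mul (1 : (AffV π)[X])
    rwa [mul_one, ← C_1, subNeg_C, lamD_C, der_one, C_0, add_zero, C_1, mul_one] at this
  have h1 : glBracket π x y = -(sgn (glPar π x * glPar π y) • glBracket π y x) := by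
    simp only [glBracket, smul_sub, smul_smul, mul_comm (glPar π y), sgn_mul_self, one_smul]
    abel
  have h2 : ∀ a, subNeg (C a : (AffV π)[X]) = C a := subNeg_C
  rw [affValue, affValue, map_add, map_smul, hX, h2, strForm_eq, strLin_eMat_mul_comm,
    ← strForm_eq, ← qLin_apply, h1, map_neg, map_smul, C_neg, ← smul_C, qLin_apply, smul_add,
    smul_neg, smul_neg, smul_smul, neg_add, neg_neg, mul_left_comm]

variable (κ : ℂ)

/-- The bilinear map underlying the affine `λ`-bracket. -/
def affBilin : AffV π →ₗ[ℂ] AffV π →ₗ[ℂ] (AffV π)[X] :=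
  DiffPoly.bracketBilin (affValue π κ) (isHomogPoly_affValue π κ)

local notation "𝐪" => fun x => DiffPoly.gen (glPar π) x 0

theorem affBilin_gen_gen (x y : S × S) :
    affBilin π κ (DiffPoly.gen (glPar π) x 0) (DiffPoly.gen (glPar π) y 0) = affValue π κ x y := by
  rw [affBilin, DiffPoly.bracketBilin_gen_left _ (isSkewValue_affValue π κ), pow_zero, one_mul,
    DiffPoly.bracketGen_gen, pow_zero, Module.End.one_apply]

theorem affBilin_gen_mul (x y z : S × S) :
    affBilin π κ (DiffPoly.gen (glPar π) x 0) (qLin π (eMat y * eMat z)) =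
      C (qLin π (eMat x * (eMat y * eMat z) - sgn (glPar π x * (glPar π y + glPar π z)) •
        (eMat y * eMat z * eMat x))) + (κ * strLin π (eMat x * (eMat y * eMat z))) • X := by
  rw [eMat_mul y z]
  split_ifs with h
  · rw [qLin_eMat, affBilin_gen_gen, affValue, glBracket, glPar_mul π h, strForm_eq, qLin_apply]
  · simp

theorem affBilin_mul_gen (x y z : S × S) :
    affBilin π κ (qLin π (eMat x * eMat y)) (DiffPoly.gen (glPar π) z 0) =
      C (qLin π (eMat x * eMat y * eMat z - sgn ((glPar π x + glPar π y) * glPar π z) •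
        (eMat z * (eMat x * eMat y)))) + (κ * strLin π (eMat x * eMat y * eMat z)) • X := by
  rw [eMat_mul x y]
  split_ifs with h
  · rw [qLin_eMat, affBilin_gen_gen, affValue, glBracket, glPar_mul π h, strForm_eq, qLin_apply]
  · simp

theorem affBilin_one_right (a : AffV π) : affBilin π κ a 1 = 0 := by
  refine DiffPoly.homog_ext_left ((affBilin π κ).flip 1) 0 (fun i f hf => ?_) a
  have := DiffPoly.bracketBilin_mul (affValue π κ) (isHomogPoly_affValue π κ) hf 1 1
  simpa [affBilin] using this

theorem affBilin_one_left (a : AffV π) : affBilin π κ 1 a = 0 := by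
  rw [affBilin, DiffPoly.bracketBilin_skew' _ (isSkewValue_affValue π κ) isHomog_one, ← affBilin,
    affBilin_one_right, map_zero, neg_zero]

/-- By `jacobiAt_of_gen` only elementary matrices matter. After expansion into triple matrix
products, the part free of λ and μ is associativity, and the coefficients of λ and μ are compared by
supercyclicity of the supertrace; central terms drop out of the outer brackets. -/
theorem jacobiAt_affine {i j : ZMod 2} {f g : AffV π} (hf : IsHomog i f) (hg : IsHomog j g)
    (h : AffV π) :
    DiffPoly.JacobiAt (affValue π κ) (isHomogPoly_affValue π κ) i j f g h := by
  refine DiffPoly.jacobiAt_of_gen _ (isSkewValue_affValue π κ) (fun x y z => ?_) hf hg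
  have hval : ∀ x y, affValue π κ x y = C (qLin π (eMat x * eMat y)) -
      sgn (glPar π x * glPar π y) • C (qLin π (eMat y * eMat x)) +
      (κ * strLin π (eMat x * eMat y)) • X := by
    intro x y
    rw [affValue, strForm_eq, ← qLin_apply, glBracket, map_sub, map_smul, C_sub, smul_C]
  have hn : ∀ x y z, DiffPoly.nested (affValue π κ) (isHomogPoly_affValue π κ)
      (DiffPoly.gen (glPar π) x 0) (DiffPoly.gen (glPar π) y 0) (DiffPoly.gen (glPar π) z 0) =
      C (affBilin π κ (DiffPoly.gen (glPar π) x 0) (qLin π (eMat y * eMat z)) -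
        sgn (glPar π y * glPar π z) •
          affBilin π κ (DiffPoly.gen (glPar π) x 0) (qLin π (eMat z * eMat y))) := by
    intro x y z
    simp only [DiffPoly.nested, LinearMap.comp_apply]
    rw [← affBilin, affBilin_gen_gen, hval, map_add, map_sub, map_smul, map_smul, ← monomial_one_one_eq_X,
      outerMap_monomial, affBilin_one_right, map_zero, smul_zero, add_zero, outerMap_C, outerMap_C,
      C_sub, smul_C]
  have hl : DiffPoly.nestedLeft (affValue π κ) (isHomogPoly_affValue π κ)
      (DiffPoly.gen (glPar π) x 0) (DiffPoly.gen (glPar π) y 0) (DiffPoly.gen (glPar π) z 0) =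
      shift (affBilin π κ (qLin π (eMat x * eMat y)) (DiffPoly.gen (glPar π) z 0) -
        sgn (glPar π x * glPar π y) •
          affBilin π κ (qLin π (eMat y * eMat x)) (DiffPoly.gen (glPar π) z 0)) := by
    rw [DiffPoly.nestedLeft, ← affBilin, affBilin_gen_gen, hval, map_add, map_sub, map_smul,
      map_smul, ← monomial_one_one_eq_X, innerMap_monomial, LinearMap.comp_apply,
      LinearMap.flip_apply, affBilin_one_left, map_zero, mul_zero, smul_zero, add_zero, innerMap_C,
      innerMap_C, map_sub, map_smul]
    rfl
  have hshift : shift (X : (AffV π)[X]) = C X + X := by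
    have := shift_X_mul (1 : (AffV π)[X])
    rwa [mul_one, ← C_1, shift_C, C_1, C_1, mul_one] at this
  have houter : toOuter (X : (AffV π)[X]) = X := by rw [toOuter_apply, map_X]
  rw [DiffPoly.JacobiAt, hn, hn, hl, swapVars_C]
  set s := sgn (glPar π x * glPar π y) with hs
  set t := sgn (glPar π y * glPar π z) with ht
  set u := sgn (glPar π x * glPar π z) with hu
  have hss : s * s = 1 := sgn_mul_self _
  have hyx : sgn (glPar π y * glPar π x) = s := by rw [mul_comm]
  have hzx : sgn (glPar π z * glPar π x) = u := by rw [mul_comm]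
  have hzy : sgn (glPar π z * glPar π y) = t := by rw [mul_comm]
  -- Two supercyclic rotations express every supertrace that occurs through `E1` and `E2`; what
  -- remains is linear algebra in these and in the matrix products.
  have c1 : strLin π (eMat y * (eMat x * eMat z)) = s * t * strLin π (eMat x * (eMat z * eMat y)) := by
    rw [strLin_supercyclic, mul_add, sgn_add, hyx, mul_assoc (eMat x)]
  have c2 : strLin π (eMat x * (eMat y * eMat z)) = s * u * strLin π (eMat y * (eMat z * eMat x)) := by
    rw [strLin_supercyclic, mul_add, sgn_add, mul_assoc (eMat y)]
  simp only [affBilin_gen_mul, affBilin_mul_gen, mul_add, add_mul, sgn_add, hyx, ← hs,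
    ← ht, ← hu, map_sub, map_smul, mul_assoc (eMat _)]
  rw [c1, c2]
  set E1 := strLin π (eMat x * (eMat z * eMat y))
  set E2 := strLin π (eMat y * (eMat z * eMat x))
  simp only [map_add, map_sub, map_smul, smul_sub, smul_add, ← smul_C, smul_smul, hshift,
    houter, shift_C, toOuter_C]
  match_scalars
  · ring
  · ring
  · linear_combination (t * κ * E1) * hss
  · linear_combination t * hss
  · ring
  · linear_combination (-(u * t)) * hss
  · ring
  · ring

theorem affBilin_skew' {i : ZMod 2} {f : AffV π} (hf : IsHomog i f) (g : AffV π) :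
    affBilin π κ f g = -subNeg (affBilin π κ (twistAut i g) f) :=
  DiffPoly.bracketBilin_skew' _ (isSkewValue_affValue π κ) hf g

end Affine

/-! ### Homomorphisms of differential superalgebras -/

section DiffHom

variable {V : Type*} [Ring V] [Algebra ℂ V] [DiffSuperalgebra V]

theorem coeffMap_algHom (φ : V →ₐ[ℂ] V) (P : V[X]) :
    coeffMap φ.toLinearMap P = P.map (φ : V →+* V) := by
  ext n; rw [coeff_coeffMap, coeff_map]; rfl

theorem coeffMap_algHom_mul (φ : V →ₐ[ℂ] V) (P Q : V[X]) :
    coeffMap φ.toLinearMap (P * Q) = coeffMap φ.toLinearMap P * coeffMap φ.toLinearMap Q := by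
  simp only [coeffMap_algHom, Polynomial.map_mul]

theorem coeffMap_algHom_C (φ : V →ₐ[ℂ] V) (a : V) :
    coeffMap φ.toLinearMap (C a) = C (φ a) := by rw [coeffMap_C]; rfl

theorem coeffMap_algHom_X (φ : V →ₐ[ℂ] V) : coeffMap φ.toLinearMap (X : V[X]) = X := by
  rw [coeffMap_algHom, map_X]

variable {φ : V →ₐ[ℂ] V}

theorem coeffMap_lamD (hφ : ∀ a, φ (der a) = der (φ a)) (P : V[X]) :
    coeffMap φ.toLinearMap (lamD P) = lamD (coeffMap φ.toLinearMap P) := by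
  have : coeffMap φ.toLinearMap (coeffMap der P) = coeffMap der (coeffMap φ.toLinearMap P) := by
    ext n; simp only [coeff_coeffMap]; exact hφ _
  rw [lamD_apply, map_add, coeffMap_algHom_mul, coeffMap_algHom_X, this, lamD_apply]

theorem coeffMap_lamD_pow (hφ : ∀ a, φ (der a) = der (φ a)) (n : ℕ) (P : V[X]) :
    coeffMap φ.toLinearMap ((lamD ^ n) P) = (lamD ^ n) (coeffMap φ.toLinearMap P) := by
  induction n with
  | zero => simp
  | succ n ih => rw [pow_succ', Module.End.mul_apply, coeffMap_lamD hφ, ih, Module.End.mul_apply]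

theorem coeffMap_subNeg (hφ : ∀ a, φ (der a) = der (φ a)) (P : V[X]) :
    coeffMap φ.toLinearMap (subNeg P) = subNeg (coeffMap φ.toLinearMap P) := by
  induction P using Polynomial.induction_on' with
  | add P Q hP hQ => simp only [map_add, hP, hQ]
  | monomial n a =>
    rw [coeffMap_monomial, subNeg_monomial, subNeg_monomial]
    induction n with
    | zero => simp [coeffMap_C]
    | succ n ih =>
      rw [pow_succ', Module.End.mul_apply, LinearMap.neg_apply, map_neg, coeffMap_lamD hφ, ih,
        Module.End.mul_apply, LinearMap.neg_apply]

theorem coeffMap_arrow (hφ : ∀ a, φ (der a) = der (φ a)) (P : V[X]) (b : V) :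
    coeffMap φ.toLinearMap (arrow P b) = arrow (coeffMap φ.toLinearMap P) (φ b) := by
  induction P using Polynomial.induction_on' with
  | add P Q hP hQ => simp only [map_add, arrow_add_left, hP, hQ]
  | monomial n a =>
    rw [coeffMap_monomial, arrow_eq_act, arrow_eq_act, act_monomial, act_monomial, smul_eq_C_mul,
      smul_eq_C_mul, coeffMap_algHom_mul, coeffMap_lamD_pow hφ, coeffMap_algHom_C,
      coeffMap_algHom_C]
    rfl

end DiffHom

/-! ### Algebra homomorphisms applied to polynomials in two variables -/

section DiffHomTwo

variable {V : Type*} [Ring V] [Algebra ℂ V] [DiffSuperalgebra V]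

/-- Apply an algebra homomorphism to the coefficients of a polynomial in two variables. -/
def mapTwo (φ : V →ₐ[ℂ] V) : V[X][X] →ₐ[ℂ] V[X][X] := Polynomial.mapAlgHom (Polynomial.mapAlgHom φ)

variable (φ : V →ₐ[ℂ] V)

theorem mapTwo_monomial (n : ℕ) (P : V[X]) :
    mapTwo φ (monomial n P) = monomial n (coeffMap φ.toLinearMap P) := by
  simp [mapTwo, coeffMap_algHom]

theorem mapTwo_outerMap (F : V →ₗ[ℂ] V[X]) (P : V[X]) :
    mapTwo φ (outerMap F P) = outerMap (coeffMap φ.toLinearMap ∘ₗ F) P := by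
  induction P using Polynomial.induction_on' with
  | add P Q hP hQ => simp only [map_add, hP, hQ]
  | monomial n a => rw [outerMap_monomial, outerMap_monomial, mapTwo_monomial]; rfl

theorem mapTwo_C (P : V[X]) : mapTwo φ (C P) = C (coeffMap φ.toLinearMap P) := by
  rw [← monomial_zero_left, mapTwo_monomial, monomial_zero_left]

theorem mapTwo_X : mapTwo φ (X : V[X][X]) = X := by simp [mapTwo]

theorem mapTwo_innerMap (G : V →ₗ[ℂ] V[X][X]) (P : V[X]) :
    mapTwo φ (innerMap G P) = innerMap ((mapTwo φ).toLinearMap ∘ₗ G) P := by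
  induction P using Polynomial.induction_on' with
  | add P Q hP hQ => simp only [map_add, hP, hQ]
  | monomial n a =>
    rw [innerMap_monomial, innerMap_monomial, map_mul, mapTwo_C, coeffMap_algHom,
      Polynomial.map_pow, map_X]
    rfl

theorem mapTwo_shift (P : V[X]) : mapTwo φ (shift P) = shift (coeffMap φ.toLinearMap P) := by
  induction P using Polynomial.induction_on' with
  | add P Q hP hQ => simp only [map_add, hP, hQ]
  | monomial n a =>
    rw [coeffMap_monomial, shift_monomial, shift_monomial, map_mul, map_pow, map_add, mapTwo_C,
      mapTwo_C, mapTwo_X, coeffMap_algHom_C, coeffMap_algHom_X]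
    rfl

theorem mapTwo_toOuter (P : V[X]) : mapTwo φ (toOuter P) = toOuter (coeffMap φ.toLinearMap P) := by
  induction P using Polynomial.induction_on' with
  | add P Q hP hQ => simp only [map_add, hP, hQ]
  | monomial n a =>
    rw [coeffMap_monomial, toOuter_monomial, toOuter_monomial, mapTwo_monomial, coeffMap_algHom_C]
    rfl

theorem outerMap_coeffMap (T : V →ₗ[ℂ] V) (F : V →ₗ[ℂ] V[X]) (P : V[X]) :
    outerMap F (coeffMap T P) = outerMap (F ∘ₗ T) P := by
  induction P using Polynomial.induction_on' with
  | add P Q hP hQ => simp only [map_add, hP, hQ]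
  | monomial n a => rw [coeffMap_monomial, outerMap_monomial, outerMap_monomial]; rfl

theorem innerMap_coeffMap (T : V →ₗ[ℂ] V) (G : V →ₗ[ℂ] V[X][X]) (P : V[X]) :
    innerMap G (coeffMap T P) = innerMap (G ∘ₗ T) P := by
  induction P using Polynomial.induction_on' with
  | add P Q hP hQ => simp only [map_add, hP, hQ]
  | monomial n a => rw [coeffMap_monomial, innerMap_monomial, innerMap_monomial]; rfl

end DiffHomTwo

theorem DiffPoly.algHom_ext {ι : Type*} {p : ι → ZMod 2} {R : Type*} [Ring R] [Algebra ℂ R]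
    {φ ψ : DiffPoly p →ₐ[ℂ] R} (h : ∀ i n, φ (DiffPoly.gen p i n) = ψ (DiffPoly.gen p i n)) :
    φ = ψ := by
  ext a
  induction a using DiffPoly.induction with
  | hc r => simp
  | hg i n => exact h i n
  | hadd a b ha hb => simp [ha, hb]
  | hmul a b ha hb => simp [ha, hb]

theorem DiffPoly.lin_ext_of_der {ι : Type*} {p : ι → ZMod 2} {M : Type*} [AddCommGroup M]
    [Module ℂ M] {F G : DiffPoly p →ₗ[ℂ] M} {T : M →ₗ[ℂ] M} (hF : ∀ a, F (der a) = T (F a))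
    (hG : ∀ a, G (der a) = T (G a)) {i : ι} (h : F (DiffPoly.gen p i 0) = G (DiffPoly.gen p i 0))
    (n : ℕ) : F (DiffPoly.gen p i n) = G (DiffPoly.gen p i n) := by
  induction n with
  | zero => exact h
  | succ n ih => rw [← DiffPoly.der_gen, hF, hG, ih]

/-! ### The rectangular W-superalgebra -/

section Rectangular

variable (m n N : ℕ)

local notation "Π'" => rectPar m n N
local notation "ρ" => rho m n N

variable {m n N}

theorem rho_gen (x : RIdx m n N × RIdx m n N) (k : ℕ) :
    ρ (DiffPoly.gen _ x k) = rhoGen m n N (x, k) := SuperPoly.lift_gen _ _ (x, k)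

theorem strForm_nilF_of_ne {x : RIdx m n N × RIdx m n N} (h : hDeg m n N x ≠ 2) :
    strForm Π' (nilF m n N) (eMat x) = 0 := by
  rw [strForm_eMat, nilF, Matrix.of_apply, if_neg, mul_zero]
  rintro ⟨h1, -⟩
  apply h
  simp only [hDeg, hEntry, h1]; push_cast; ring

theorem rho_gen_of_lt {x : RIdx m n N × RIdx m n N} (h : hDeg m n N x < 2) (k : ℕ) :
    ρ (DiffPoly.gen _ x k) = DiffPoly.gen _ x k := by
  rw [rho_gen, rhoGen, if_pos h, strForm_nilF_of_ne (ne_of_lt h), map_zero, ite_self, add_zero]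

theorem rho_gen_of_ge {x : RIdx m n N × RIdx m n N} (h : 2 ≤ hDeg m n N x) (k : ℕ) :
    ρ (DiffPoly.gen _ x k) = algebraMap ℂ _
      (if k = 0 then strForm Π' (nilF m n N) (eMat x) else 0) := by
  rw [rho_gen, rhoGen, if_neg (not_lt.2 h), zero_add]
  split_ifs <;> simp

theorem rho_der (a : RectV m n N) : ρ (der a) = der (ρ a) := by
  have : (ρ).toLinearMap ∘ₗ der = der ∘ₗ (ρ).toLinearMap := by
    refine DiffPoly.derivation_ext (ρ).toLinearMap (ρ).toLinearMap _ _ (by simp) (by simp)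
      (fun _ _ a b _ _ => ?_) (fun _ _ a b _ _ => ?_) (fun x k => ?_)
    · simp [der_mul, add_comm]
    · simp [der_mul, add_comm]
    · simp only [LinearMap.comp_apply, AlgHom.toLinearMap_apply, DiffPoly.der_gen]
      rcases lt_or_ge (hDeg m n N x) 2 with h | h
      · rw [rho_gen_of_lt h, rho_gen_of_lt h, DiffPoly.der_gen]
      · rw [rho_gen_of_ge h, rho_gen_of_ge h, der_algebraMap]; simp
  exact LinearMap.congr_fun this a

theorem rho_rho (a : RectV m n N) : ρ (ρ a) = ρ a := by
  have : (ρ).comp (ρ) = ρ := by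
    refine DiffPoly.algHom_ext fun x k => ?_
    rw [AlgHom.comp_apply]
    rcases lt_or_ge (hDeg m n N x) 2 with h | h
    · rw [rho_gen_of_lt h, rho_gen_of_lt h]
    · rw [rho_gen_of_ge h, AlgHom.commutes]
  exact DFunLike.congr_fun this a

theorem rho_par (a : RectV m n N) : ρ (par a) = par (ρ a) := by
  have : (ρ).comp par = par.comp (ρ) := by
    refine DiffPoly.algHom_ext fun x k => ?_
    rw [AlgHom.comp_apply, AlgHom.comp_apply, DiffPoly.par_gen, map_smul, rho_gen]
    exact (isHomog_rhoGen m n N (x, k)).symm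
  exact DFunLike.congr_fun this a

theorem rho_twistAut (k : ZMod 2) (a : RectV m n N) : ρ (twistAut k a) = twistAut k (ρ a) := by
  rcases zmod2_cases k with rfl | rfl
  · simp [twistAut]
  · simpa [twistAut] using rho_par a

theorem IsHomog.rho {i : ZMod 2} {a : RectV m n N} (h : IsHomog i a) : IsHomog i (ρ a) := by
  rw [IsHomog] at *
  rw [← rho_par, h, map_smul]

theorem rho_homComp (i : ZMod 2) (a : RectV m n N) : ρ (homComp i a) = homComp i (ρ a) := by
  simp only [homComp, map_smul, map_add, rho_par]

/-- ρ is an idempotent with image 𝒱(𝔭), so membership becomes an equation. -/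
theorem mem_subVp_iff {a : RectV m n N} : a ∈ subVp m n N ↔ ρ a = a := by
  constructor
  · intro ha
    refine Algebra.adjoin_induction (p := fun a _ => ρ a = a) ?_ ?_ ?_ ?_ ha
    · rintro _ ⟨x, k, hx, rfl⟩; exact rho_gen_of_lt hx k
    · intro r; simp
    · intro a b _ _ ha hb; rw [map_add, ha, hb]
    · intro a b _ _ ha hb; rw [map_mul, ha, hb]
  · have : ∀ a, ρ a ∈ subVp m n N := by
      intro a
      induction a using DiffPoly.induction with
      | hc r => rw [AlgHom.commutes]; exact Subalgebra.algebraMap_mem _ _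
      | hg x k =>
        rcases lt_or_ge (hDeg m n N x) 2 with h | h
        · rw [rho_gen_of_lt h]; exact Algebra.subset_adjoin ⟨x, k, h, rfl⟩
        · rw [rho_gen_of_ge h]; exact Subalgebra.algebraMap_mem _ _
      | hadd a b ha hb => rw [map_add]; exact add_mem ha hb
      | hmul a b ha hb => rw [map_mul]; exact mul_mem ha hb
    intro h; rw [← h]; exact this a

variable (κ : ℂ)

/-- The bracket `wBracket` as a bilinear map. -/
def wBilin : RectV m n N →ₗ[ℂ] RectV m n N →ₗ[ℂ] (RectV m n N)[X] :=
  (affBilin Π' κ).compr₂ (coeffMap (ρ).toLinearMap)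

theorem wBracket_eq (a b : RectV m n N) : wBracket m n N κ a b = wBilin κ a b := rfl

theorem wBilin_apply (a b : RectV m n N) :
    wBilin κ a b = coeffMap (ρ).toLinearMap (affBilin Π' κ a b) := rfl

theorem wBilin_mul {i : ZMod 2} {f : RectV m n N} (hf : IsHomog i f) (g h : RectV m n N) :
    wBilin κ f (g * h) = C (ρ (twistAut i g)) * wBilin κ f h + wBilin κ f g * C (ρ h) := by
  rw [wBilin_apply, affBilin, DiffPoly.bracketBilin_mul _ _ hf, map_add, coeffMap_algHom_mul,
    coeffMap_algHom_mul, coeffMap_algHom_C, coeffMap_algHom_C]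
  rfl

theorem wBilin_der_right (f g : RectV m n N) : wBilin κ f (der g) = lamD (wBilin κ f g) := by
  rw [wBilin_apply, affBilin, DiffPoly.bracketBilin_der_right, coeffMap_lamD rho_der]
  rfl

theorem wBilin_der_left (f g : RectV m n N) : wBilin κ (der f) g = -(X * wBilin κ f g) := by
  rw [wBilin_apply, affBilin, DiffPoly.bracketBilin_der_left, map_neg, coeffMap_algHom_mul,
    coeffMap_algHom_X]
  rfl

theorem wBilin_skew' {i : ZMod 2} {f : RectV m n N} (hf : IsHomog i f) (g : RectV m n N) :
    wBilin κ f g = -subNeg (wBilin κ (twistAut i g) f) := by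
  rw [wBilin_apply, affBilin_skew' _ _ hf, map_neg, coeffMap_subNeg rho_der]
  rfl

theorem wBilin_skew {i j : ZMod 2} {f g : RectV m n N} (hf : IsHomog i f) (hg : IsHomog j g) :
    wBilin κ f g = -(sgn (i * j) • subNeg (wBilin κ g f)) := by
  rw [wBilin_skew' κ hf, twistAut_homog _ hg, map_smul, LinearMap.smul_apply, map_smul]

theorem isHomogPoly_wBilin {i j : ZMod 2} {f g : RectV m n N} (hf : IsHomog i f)
    (hg : IsHomog j g) : IsHomogPoly (i + j) (wBilin κ f g) := fun k => by
  rw [wBilin_apply, coeff_coeffMap]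
  exact (DiffPoly.isHomogPoly_bracketBilin _ _ hf hg k).rho

theorem wBilin_par {i : ZMod 2} {f : RectV m n N} (hf : IsHomog i f) (g : RectV m n N) :
    wBilin κ f (par g) = sgn i • coeffMap par.toLinearMap (wBilin κ f g) := by
  have h := DiffPoly.bracketBilin_twistAut (affValue Π' κ) (isHomogPoly_affValue Π' κ) 1 hf g
  have h1 : (twistAut 1 : RectV m n N →ₐ[ℂ] RectV m n N) = par := by simp [twistAut]
  rw [h1, mul_one] at h
  rw [wBilin_apply, affBilin, h, map_smul, wBilin_apply, affBilin]
  congr 1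
  ext k
  simp only [coeff_coeffMap, coeff_map, AlgHom.toLinearMap_apply, RingHom.coe_coe, rho_par]

theorem wBilin_algebraMap (f : RectV m n N) (r : ℂ) : wBilin κ f (algebraMap ℂ _ r) = 0 := by
  rw [Algebra.algebraMap_eq_smul_one, map_smul, wBilin_apply, affBilin_one_right, map_zero,
    smul_zero]

/-- A derivation `ρ {f _λ ·}` factors through `ρ` if it kills the generators of degree `≥ 2`. -/
theorem wBilin_rho_of_gen {i : ZMod 2} {f : RectV m n N} (hf : IsHomog i f)
    (h : ∀ x, 2 ≤ hDeg m n N x → wBilin κ f (DiffPoly.gen _ x 0) = 0) (g : RectV m n N) :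
    wBilin κ f (ρ g) = wBilin κ f g := by
  have : wBilin κ f ∘ₗ (ρ).toLinearMap = wBilin κ f := by
    refine DiffPoly.derivation_ext
      ((CAlgHom.comp ((ρ).comp (twistAut i))).toLinearMap)
      ((CAlgHom.comp (ρ)).toLinearMap) _ _ (by simp) (by simp) (fun _ _ a b _ _ => ?_)
      (fun _ _ a b _ _ => wBilin_mul κ hf a b) (fun x k => ?_)
    · simp only [LinearMap.comp_apply, AlgHom.toLinearMap_apply, map_mul, wBilin_mul κ hf,
        rho_twistAut, rho_rho]
      rw [← rho_twistAut]; rfl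
    · refine DiffPoly.lin_ext_of_der (T := lamD) (fun a => ?_) (wBilin_der_right κ f) ?_ k
      · simp only [LinearMap.comp_apply, AlgHom.toLinearMap_apply, rho_der, wBilin_der_right]
      · simp only [LinearMap.comp_apply, AlgHom.toLinearMap_apply]
        -- ρ fixes the generators of 𝔭 and sends the others to scalars, which every bracket kills;
        -- this is exactly where the hypothesis enters.
        rcases lt_or_ge (hDeg m n N x) 2 with hx | hx
        · rw [rho_gen_of_lt hx]
        · rw [rho_gen_of_ge hx, wBilin_algebraMap, h x hx]
  exact LinearMap.congr_fun this g

theorem hDeg_mul {x y : RIdx m n N × RIdx m n N} (h : x.2 = y.1) :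
    hDeg m n N (x.1, y.2) = hDeg m n N x + hDeg m n N y := by
  simp only [hDeg, h]; ring

/-- The product has at least twice the degree of 𝔤₁, whereas f pairs nontrivially with 𝔤₁ only. -/
theorem rho_qLin_eMat_mul {x y : RIdx m n N × RIdx m n N} (hx : 2 ≤ hDeg m n N x)
    (hy : 2 ≤ hDeg m n N y) : ρ (qLin Π' (eMat x * eMat y)) = 0 := by
  rw [eMat_mul]
  split_ifs with h
  · have hd := hDeg_mul h
    rw [qLin_eMat, rho_gen_of_ge (by omega), if_pos rfl, strForm_nilF_of_ne (by omega), map_zero]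
  · simp

theorem wBilin_gen_gen_of_ge {x y : RIdx m n N × RIdx m n N} (hx : 2 ≤ hDeg m n N x)
    (hy : 2 ≤ hDeg m n N y) :
    wBilin κ (DiffPoly.gen _ x 0) (DiffPoly.gen _ y 0) = 0 := by
  have hs : strForm Π' (eMat x) (eMat y) = 0 := by
    rw [strForm_eMat]
    have : ¬ (x.1 = y.2 ∧ x.2 = y.1) := by
      rintro ⟨h1, h2⟩
      simp only [hDeg, h1, h2] at hx hy
      omega
    simp [eMat, this]
  rw [wBilin_apply, affBilin_gen_gen, affValue, hs, mul_zero, zero_smul, add_zero,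
    coeffMap_algHom_C, ← qLin_apply, glBracket, map_sub, map_smul, map_sub, map_smul,
    rho_qLin_eMat_mul hx hy, rho_qLin_eMat_mul hy hx, smul_zero, sub_zero, C_0]

/-- Brackets inside 𝔤_{≥1} vanish after ρ, hence the condition defining W sees only the image of its
argument under ρ. -/
theorem wBilin_gen_rho {x : RIdx m n N × RIdx m n N} (hx : 2 ≤ hDeg m n N x) (g : RectV m n N) :
    wBilin κ (DiffPoly.gen _ x 0) (ρ g) = wBilin κ (DiffPoly.gen _ x 0) g :=
  wBilin_rho_of_gen κ (DiffPoly.isHomog_gen _ _) (fun _ hy => wBilin_gen_gen_of_ge κ hx hy) g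

/-- The grading of a rectangular nilpotent is even, so 𝔤_{≥1/2} coincides with 𝔤_{≥1}. -/
theorem two_le_hDeg {x : RIdx m n N × RIdx m n N} (h : 1 ≤ hDeg m n N x) : 2 ≤ hDeg m n N x := by
  simp only [hDeg, hEntry] at *; omega

theorem mem_wAlg_iff {a : RectV m n N} : a ∈ wAlg m n N κ ↔
    ρ a = a ∧ ∀ x, 2 ≤ hDeg m n N x → wBilin κ (DiffPoly.gen _ x 0) a = 0 := by
  show a ∈ subVp m n N ∧ _ ↔ _
  rw [mem_subVp_iff]
  refine and_congr_right fun _ => ⟨fun h x hx => ?_, fun h ν hν => ?_⟩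
  · have := h (eMat x) fun y z hyz => ?_
    · rwa [← qLin_apply, qLin_eMat] at this
    · have : x = (y, z) := by
        by_contra hne
        apply hyz
        have : ¬ (x.1 = y ∧ x.2 = z) := fun h => hne (Prod.ext h.1 h.2)
        simp [eMat, this]
      rw [← this]; omega
  · rw [wBracket_eq, qMat, map_sum, LinearMap.sum_apply]
    refine Finset.sum_eq_zero fun x _ => ?_
    rw [map_smul, LinearMap.smul_apply]
    by_cases hx : ν x.1 x.2 = 0
    · rw [hx, zero_smul]
    · rw [h x (two_le_hDeg (hν _ _ hx)), smul_zero]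

theorem par_mem_wAlg {a : RectV m n N} (h : a ∈ wAlg m n N κ) : par a ∈ wAlg m n N κ := by
  rw [mem_wAlg_iff] at *
  refine ⟨by rw [rho_par, h.1], fun x hx => ?_⟩
  rw [wBilin_par κ (DiffPoly.isHomog_gen _ _), h.2 x hx, map_zero, smul_zero]

theorem add_mem_wAlg {a b : RectV m n N} (ha : a ∈ wAlg m n N κ) (hb : b ∈ wAlg m n N κ) :
    a + b ∈ wAlg m n N κ := by
  rw [mem_wAlg_iff] at *
  exact ⟨by rw [map_add, ha.1, hb.1], fun x hx => by rw [map_add, ha.2 x hx, hb.2 x hx, add_zero]⟩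

theorem smul_mem_wAlg {a : RectV m n N} (r : ℂ) (ha : a ∈ wAlg m n N κ) :
    r • a ∈ wAlg m n N κ := by
  rw [mem_wAlg_iff] at *
  exact ⟨by rw [map_smul, ha.1], fun x hx => by rw [map_smul, ha.2 x hx, smul_zero]⟩

theorem mul_mem_wAlg {a b : RectV m n N} (ha : a ∈ wAlg m n N κ) (hb : b ∈ wAlg m n N κ) :
    a * b ∈ wAlg m n N κ := by
  rw [mem_wAlg_iff] at *
  refine ⟨by rw [map_mul, ha.1, hb.1], fun x hx => ?_⟩
  rw [wBilin_mul κ (DiffPoly.isHomog_gen _ _), ha.2 x hx, hb.2 x hx, mul_zero, zero_mul, add_zero]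

theorem der_mem_wAlg {a : RectV m n N} (ha : a ∈ wAlg m n N κ) : der a ∈ wAlg m n N κ := by
  rw [mem_wAlg_iff] at *
  exact ⟨by rw [rho_der, ha.1], fun x hx => by rw [wBilin_der_right, ha.2 x hx, map_zero]⟩

theorem algebraMap_mem_wAlg (r : ℂ) : algebraMap ℂ (RectV m n N) r ∈ wAlg m n N κ := by
  rw [mem_wAlg_iff]
  exact ⟨by simp, fun x _ => wBilin_algebraMap κ _ r⟩

theorem homComp_mem_wAlg (i : ZMod 2) {a : RectV m n N} (ha : a ∈ wAlg m n N κ) :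
    homComp i a ∈ wAlg m n N κ :=
  smul_mem_wAlg κ _ (add_mem_wAlg κ ha (smul_mem_wAlg κ _ (par_mem_wAlg κ ha)))

/-- The W-superalgebra as a subalgebra. -/
def wSubalgebra : Subalgebra ℂ (RectV m n N) where
  carrier := wAlg m n N κ
  mul_mem' := mul_mem_wAlg κ
  add_mem' := add_mem_wAlg κ
  algebraMap_mem' := algebraMap_mem_wAlg κ

/-- By skew-symmetry, the invariance of `ρ f` under 𝔫 says that the bracket with `f` kills the
generators of degree at least 2 after ρ, which is the criterion `wBilin_rho_of_gen`. -/
theorem wBilin_rho_right {f : RectV m n N} (hf : ρ f ∈ wAlg m n N κ) (g : RectV m n N) :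
    wBilin κ f (ρ g) = wBilin κ f g := by
  have key : ∀ i f, IsHomog i f → ρ f ∈ wAlg m n N κ → wBilin κ f (ρ g) = wBilin κ f g := by
    intro i f hi hf
    refine wBilin_rho_of_gen κ hi (fun x hx => ?_) g
    rw [wBilin_skew κ hi (DiffPoly.isHomog_gen _ _), ← wBilin_gen_rho κ hx,
      ((mem_wAlg_iff κ).1 hf).2 x hx, map_zero, smul_zero, neg_zero]
  rw [← homComp_add_homComp f, map_add, LinearMap.add_apply, LinearMap.add_apply,
    key 0 _ (isHomog_homComp 0 f), key 1 _ (isHomog_homComp 1 f)]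
  · rw [rho_homComp]; exact homComp_mem_wAlg κ _ hf
  · rw [rho_homComp]; exact homComp_mem_wAlg κ _ hf

theorem wBilin_rho_left {g : RectV m n N} (hg : ρ g ∈ wAlg m n N κ) (f : RectV m n N) :
    wBilin κ (ρ f) g = wBilin κ f g := by
  have key : ∀ i j f g, IsHomog i f → IsHomog j g → ρ g ∈ wAlg m n N κ →
      wBilin κ (ρ f) g = wBilin κ f g := by
    intro i j f g hf hg hW
    rw [wBilin_skew κ hf.rho hg, wBilin_skew κ hf hg, wBilin_rho_right κ hW]
  have h0 : ρ (homComp 0 g) ∈ wAlg m n N κ := by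
    rw [rho_homComp]; exact homComp_mem_wAlg κ _ hg
  have h1 : ρ (homComp 1 g) ∈ wAlg m n N κ := by
    rw [rho_homComp]; exact homComp_mem_wAlg κ _ hg
  rw [← homComp_add_homComp f, ← homComp_add_homComp g]
  simp only [map_add, LinearMap.add_apply]
  rw [key _ _ _ _ (isHomog_homComp 0 f) (isHomog_homComp 0 g) h0,
    key _ _ _ _ (isHomog_homComp 1 f) (isHomog_homComp 0 g) h0,
    key _ _ _ _ (isHomog_homComp 0 f) (isHomog_homComp 1 g) h1,
    key _ _ _ _ (isHomog_homComp 1 f) (isHomog_homComp 1 g) h1]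

/-- The image under `ρ` of the Jacobi identity. -/
theorem rho_jacobi {i j : ZMod 2} {f g : RectV m n N} (hf : IsHomog i f) (hg : IsHomog j g)
    (h : RectV m n N) : outerMap (wBilin κ f) (affBilin Π' κ g h) =
      innerMap (shift ∘ₗ (wBilin κ).flip h) (affBilin Π' κ f g) +
      sgn (i * j) • innerMap (toOuter ∘ₗ wBilin κ g) (affBilin Π' κ f h) := by
  have := congrArg (mapTwo (ρ)) (jacobiAt_affine Π' κ hf hg h)
  rw [map_add, map_smul, DiffPoly.nested, DiffPoly.nested, DiffPoly.nestedLeft,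
    LinearMap.comp_apply, LinearMap.comp_apply, swapVars_outerMap, mapTwo_outerMap,
    mapTwo_innerMap, mapTwo_innerMap] at this
  have h1 : (mapTwo (ρ)).toLinearMap ∘ₗ shift ∘ₗ (DiffPoly.bracketBilin (affValue Π' κ)
      (isHomogPoly_affValue Π' κ)).flip h = shift ∘ₗ (wBilin κ).flip h := by
    ext1 a; exact mapTwo_shift _ _
  have h2 : (mapTwo (ρ)).toLinearMap ∘ₗ toOuter ∘ₗ DiffPoly.bracketBilin (affValue Π' κ)
      (isHomogPoly_affValue Π' κ) g = toOuter ∘ₗ wBilin κ g := by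
    ext1 a; exact mapTwo_toOuter _ _
  rw [h1, h2] at this
  exact this

/-- The inner brackets here carry a ρ that the affine identity lacks. For arguments in W the outer
brackets do not notice it, so `rho_jacobi` suffices. -/
theorem wBilin_jacobi {i j : ZMod 2} {f g h : RectV m n N} (hf : IsHomog i f) (hg : IsHomog j g)
    (hfW : f ∈ wAlg m n N κ) (hgW : g ∈ wAlg m n N κ) (hhW : h ∈ wAlg m n N κ) :
    outerMap (wBilin κ f) (wBilin κ g h) =
      innerMap (shift ∘ₗ (wBilin κ).flip h) (wBilin κ f g) +
      sgn (i * j) • innerMap (toOuter ∘ₗ wBilin κ g) (wBilin κ f h) := by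
  have h0 : ∀ {a : RectV m n N}, a ∈ wAlg m n N κ → ρ a ∈ wAlg m n N κ := fun {a} ha => by
    rwa [((mem_wAlg_iff κ).1 ha).1]
  have e1 : wBilin κ f ∘ₗ (ρ).toLinearMap = wBilin κ f := by
    ext1 a; exact wBilin_rho_right κ (h0 hfW) a
  have e2 : wBilin κ g ∘ₗ (ρ).toLinearMap = wBilin κ g := by
    ext1 a; exact wBilin_rho_right κ (h0 hgW) a
  have e3 : (wBilin κ).flip h ∘ₗ (ρ).toLinearMap = (wBilin κ).flip h := by
    ext1 a; exact wBilin_rho_left κ (h0 hhW) a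
  rw [wBilin_apply κ g h, wBilin_apply κ f g, wBilin_apply κ f h, outerMap_coeffMap,
    innerMap_coeffMap, innerMap_coeffMap, e1, LinearMap.comp_assoc, e3, LinearMap.comp_assoc, e2,
    rho_jacobi κ hf hg]

/-- In the Jacobi identity for ν ∈ 𝔫, `a`, `b`, both terms on the right contain ρ{ν _λ a} or ρ{ν _λ
b} in the inner slot and therefore vanish. -/
theorem wBilin_coeff_mem {a b : RectV m n N} (ha : a ∈ wAlg m n N κ) (hb : b ∈ wAlg m n N κ)
    (k : ℕ) : (wBilin κ a b).coeff k ∈ wAlg m n N κ := by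
  have key : ∀ i a, IsHomog i a → a ∈ wAlg m n N κ → (wBilin κ a b).coeff k ∈ wAlg m n N κ := by
    intro i a hi ha
    have hra : ρ a ∈ wAlg m n N κ := by rwa [((mem_wAlg_iff κ).1 ha).1]
    have hrb : ρ b ∈ wAlg m n N κ := by rwa [((mem_wAlg_iff κ).1 hb).1]
    rw [mem_wAlg_iff]
    refine ⟨by rw [wBilin_apply, coeff_coeffMap]; exact rho_rho _, fun x hx => ?_⟩
    have hJ := rho_jacobi κ (DiffPoly.isHomog_gen (p := glPar Π') x 0) hi b
    have e3 : (wBilin κ).flip b ∘ₗ (ρ).toLinearMap = (wBilin κ).flip b := by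
      ext1 a; exact wBilin_rho_left κ hrb a
    have e1 : wBilin κ a ∘ₗ (ρ).toLinearMap = wBilin κ a := by
      ext1 g; exact wBilin_rho_right κ hra g
    -- The outer brackets are precomposed with ρ so that the inner affine brackets become the ones
    -- annihilated by the invariance of `a` and `b`.
    rw [← e3, ← LinearMap.comp_assoc, ← innerMap_coeffMap, ← wBilin_apply,
      ((mem_wAlg_iff κ).1 ha).2 x hx, ← e1, ← LinearMap.comp_assoc, ← innerMap_coeffMap,
      ← wBilin_apply, ((mem_wAlg_iff κ).1 hb).2 x hx, map_zero, map_zero, smul_zero,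
      add_zero] at hJ
    have := congrArg (fun F => F.coeff k) hJ
    rw [wBilin_apply κ a b, coeff_coeffMap]
    simp only [coeff_outerMap, coeff_zero] at this
    rw [AlgHom.toLinearMap_apply, wBilin_gen_rho κ hx, this]
  rw [← homComp_add_homComp a, map_add, LinearMap.add_apply, coeff_add]
  exact add_mem_wAlg κ (key 0 _ (isHomog_homComp _ _) (homComp_mem_wAlg κ _ ha))
    (key 1 _ (isHomog_homComp _ _) (homComp_mem_wAlg κ _ ha))

/-- The W-superalgebra is a Poisson vertex superalgebra. -/
theorem isPVsA_wAlg : IsPVsA (wAlg m n N κ) (wBracket m n N κ) where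
  subalgebra := ⟨⟨wSubalgebra κ, rfl⟩, fun _ h => par_mem_wAlg κ h, fun _ h => der_mem_wAlg κ h⟩
  bracket :=
    { mem := fun a ha b hb k => wBilin_coeff_mem κ ha hb k
      add_left := fun a _ b _ c _ => by simp only [wBracket_eq, map_add, LinearMap.add_apply]
      add_right := fun a _ b _ c _ => by simp only [wBracket_eq, map_add]
      smul_left := fun r a _ b _ => by simp only [wBracket_eq, map_smul, LinearMap.smul_apply]
      smul_right := fun r a _ b _ => by simp only [wBracket_eq, map_smul]
      even := fun i j a _ b _ ha hb => isHomogPoly_wBilin κ ha hb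
      sesq_left := fun a _ b _ => wBilin_der_left κ a b
      sesq_right := fun a _ b _ => wBilin_der_right κ a b
      leibniz_left := fun i j a _ b hb c hc hi hj => by
        rw [wBracket_eq, wBilin_mul κ hi, twistAut_homog _ hj, map_smul,
          ((mem_wAlg_iff κ).1 hb).1, ((mem_wAlg_iff κ).1 hc).1, ← smul_C, smul_mul_assoc,
          add_comm]
        rfl
      leibniz_right := fun i j k a ha b hb c _ hi hj hk => by
        rw [wBracket_eq, wBilin_apply, affBilin, DiffPoly.bracketBilin_mul_left _ _ hi hj,
          map_add, map_smul, coeffMap_arrow rho_der, coeffMap_arrow rho_der,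
          ((mem_wAlg_iff κ).1 ha).1, ((mem_wAlg_iff κ).1 hb).1, twistAut_homog _ hk,
          twistAut_homog _ hk, map_smul, map_smul, map_smul, map_smul, arrow_smul_left,
          arrow_smul_left, smul_smul, ← sgn_add, ← mul_add]
        rfl }
  skew := fun i j a _ b _ hi hj => wBilin_skew κ hi hj
  jacobi := fun i j k a ha b hb c hc hi hj _ => by
    have := wBilin_jacobi κ hi hj ha hb hc
    rw [outerMap_eq_sum, innerMap_eq_sum, innerMap_eq_sum] at this
    simp only [LinearMap.comp_apply, LinearMap.flip_apply, shift_eq_sum, toOuter_apply] at this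
    exact this

end Rectangular

/-! ### The algebra of matrix pseudo-differential operators -/

namespace MatPDO

section Seq

variable {I J K H V : Type*} [Ring V] [Algebra ℂ V] [DiffSuperalgebra V]

/-- The derivation on the entries of a matrix. -/
def derMat : Matrix I J V →ₗ[ℂ] Matrix I J V := (der : V →ₗ[ℂ] V).mapMatrix

theorem derMat_mul [Fintype J] (A : Matrix I J V) (B : Matrix J K V) :
    derMat (A * B) = derMat A * B + A * derMat B := by
  ext i k
  simp [derMat, Matrix.mul_apply, der_mul, Finset.sum_add_distrib]

theorem map_der_pow (l : ℕ) (A : Matrix I J V) :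
    A.map (der ^ l : Module.End ℂ V) = (derMat ^ l : Module.End ℂ (Matrix I J V)) A := by
  induction l with
  | zero => ext; simp
  | succ l ih =>
    rw [pow_succ' derMat, Module.End.mul_apply, ← ih]
    ext i j
    simp [derMat, pow_succ', Module.End.mul_apply]

/-- The coefficients of `∂^k ∘ b`, for a sequence `b` representing `∑ⱼ bⱼ ∂^{-j}`. -/
def derPow (k : ℤ) (b : ℕ → Matrix I J V) (d : ℕ) : Matrix I J V :=
  ∑ p ∈ Finset.HasAntidiagonal.antidiagonal d, Ring.choose k p.1 • (derMat ^ p.1 : Module.End ℂ _) (b p.2)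

/-- `b + ∂(b) ∂⁻¹`, for a sequence `b` representing `∑ⱼ bⱼ ∂^{-j}`. -/
def derShift (b : ℕ → Matrix I J V) : ℕ → Matrix I J V
  | 0 => b 0
  | d + 1 => b (d + 1) + derMat (b d)

/-- The coefficients of the product of `∑ᵢ aᵢ ∂^{M-i}` and `∑ⱼ bⱼ ∂^{-j}`. -/
def seqMul [Fintype J] (M : ℤ) (a : ℕ → Matrix I J V) (b : ℕ → Matrix J K V) (d : ℕ) :
    Matrix I K V :=
  ∑ p ∈ Finset.HasAntidiagonal.antidiagonal d, a p.1 * derPow (M - p.1) b p.2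

theorem derPow_zero (b : ℕ → Matrix I J V) : derPow 0 b = b := by
  ext1 d
  rw [derPow, Finset.sum_eq_single (0, d)]
  · simp
  · intro p hp hne
    rcases Nat.eq_zero_or_pos p.1 with h | h
    · exact absurd (Prod.ext h (by simpa [h] using hp)) hne
    · rw [Ring.choose_zero_pos ℤ h, zero_smul]
  · simp

/-- Pascal's rule for generalised binomial coefficients, valid for negative `k` as well. -/
theorem derPow_succ (k : ℤ) (b : ℕ → Matrix I J V) :
    derPow (k + 1) b = derShift (derPow k b) := by
  ext1 d
  cases d with
  | zero => simp [derPow, derShift]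
  | succ d =>
    rw [derPow, derShift, Finset.Nat.sum_antidiagonal_succ, derPow,
      Finset.Nat.sum_antidiagonal_succ, derPow, map_sum, add_assoc, ← Finset.sum_add_distrib]
    congr 1
    · simp
    · refine Finset.sum_congr rfl fun p _ => ?_
      rw [Ring.choose_succ_succ, add_smul, add_comm, map_zsmul, pow_succ' derMat,
        Module.End.mul_apply]

/-- Composition with ∂ can be undone coefficient by coefficient; this is what lets identities
descend from ∂^(k+1) to ∂^k and reach negative exponents. -/
theorem derShift_injective : Function.Injective (derShift : (ℕ → Matrix I J V) → _) := by
  intro b c h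
  ext1 d
  induction d with
  | zero => exact congrFun h 0
  | succ d ih =>
    have := congrFun h (d + 1)
    simp only [derShift, ih] at this
    exact add_right_cancel this

theorem derShift_seqMul [Fintype J] (M : ℤ) (a : ℕ → Matrix I J V) (b : ℕ → Matrix J K V) :
    derShift (seqMul M a b) = seqMul (M + 1) (derShift a) b := by
  ext1 d
  have h : ∀ i : ℕ, derPow (M + 1 - i) b = derShift (derPow (M - i) b) := fun i => by
    rw [← derPow_succ]; congr 1; ring
  cases d with
  | zero => simp [seqMul, derShift, h]
  | succ d =>
    have e1 : ∑ p ∈ Finset.HasAntidiagonal.antidiagonal (d + 1), a p.1 * derPow (M + 1 - p.1) b p.2 =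
        ∑ p ∈ Finset.HasAntidiagonal.antidiagonal (d + 1), a p.1 * derPow (M - p.1) b p.2 +
        ∑ p ∈ Finset.HasAntidiagonal.antidiagonal d, a p.1 * derMat (derPow (M - p.1) b p.2) := by
      rw [Finset.Nat.sum_antidiagonal_succ', Finset.Nat.sum_antidiagonal_succ']
      simp only [h, derShift, Matrix.mul_add, Finset.sum_add_distrib]
      abel
    have e2 : ∑ p ∈ Finset.HasAntidiagonal.antidiagonal (d + 1), derShift a p.1 * derPow (M + 1 - p.1) b p.2 =
        ∑ p ∈ Finset.HasAntidiagonal.antidiagonal (d + 1), a p.1 * derPow (M + 1 - p.1) b p.2 +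
        ∑ p ∈ Finset.HasAntidiagonal.antidiagonal d, derMat (a p.1) * derPow (M - p.1) b p.2 := by
      rw [Finset.Nat.sum_antidiagonal_succ, Finset.Nat.sum_antidiagonal_succ, add_assoc,
        ← Finset.sum_add_distrib]
      congr 1
      refine Finset.sum_congr rfl fun p _ => ?_
      rw [derShift, Matrix.add_mul]
      have : M + 1 - ((p.1 + 1 : ℕ) : ℤ) = M - p.1 := by push_cast; ring
      rw [this]
    rw [derShift, seqMul, seqMul, seqMul, e2, e1, map_sum]
    simp only [derMat_mul, Finset.sum_add_distrib]
    abel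

/-- Case k = 1 is the Leibniz rule `derShift_seqMul`. Induction runs upwards directly and downwards
by cancelling one `derShift`. -/
theorem derPow_seqMul [Fintype J] (k M : ℤ) (a : ℕ → Matrix I J V) (b : ℕ → Matrix J K V) :
    derPow k (seqMul M a b) = seqMul (M + k) (derPow k a) b := by
  induction k using Int.induction_on with
  | zero => rw [derPow_zero, derPow_zero, add_zero]
  | succ k ih => rw [derPow_succ, ih, derShift_seqMul, ← derPow_succ, add_assoc]
  | pred k ih =>
    apply derShift_injective
    rw [derShift_seqMul, ← derPow_succ, ← derPow_succ, sub_add_cancel, ih]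
    congr 1; ring

theorem sum_antidiagonal_assoc {R : Type*} [AddCommMonoid R] (f : ℕ → ℕ → ℕ → R) (d : ℕ) :
    ∑ p ∈ Finset.HasAntidiagonal.antidiagonal d, ∑ q ∈ Finset.HasAntidiagonal.antidiagonal p.2, f p.1 q.1 q.2 =
      ∑ p ∈ Finset.HasAntidiagonal.antidiagonal d, ∑ q ∈ Finset.HasAntidiagonal.antidiagonal p.1, f q.1 q.2 p.2 := by
  rw [Finset.sum_sigma', Finset.sum_sigma']
  refine Finset.sum_nbij' (fun x => ⟨(x.1.1 + x.2.1, x.2.2), (x.1.1, x.2.1)⟩)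
    (fun x => ⟨(x.2.1, x.2.2 + x.1.2), (x.2.2, x.1.2)⟩) ?_ ?_ ?_ ?_ ?_
  · rintro ⟨⟨a, b⟩, ⟨c, e⟩⟩ h; simp at h ⊢; omega
  · rintro ⟨⟨a, b⟩, ⟨c, e⟩⟩ h; simp at h ⊢; omega
  · rintro ⟨⟨a, b⟩, ⟨c, e⟩⟩ h
    simp only [Finset.mem_sigma, Finset.HasAntidiagonal.mem_antidiagonal] at h
    obtain ⟨h1, h2⟩ := h
    subst h2; rfl
  · rintro ⟨⟨a, b⟩, ⟨c, e⟩⟩ h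
    simp only [Finset.mem_sigma, Finset.HasAntidiagonal.mem_antidiagonal] at h
    obtain ⟨h1, h2⟩ := h
    subst h2; rfl
  · rintro ⟨⟨a, b⟩, ⟨c, e⟩⟩ h; rfl

/-- Associativity against the single operators a_i ∂^(M-i) is `derPow_seqMul`; the general case only
regroups a triple sum. -/
theorem seqMul_assoc [Fintype J] [Fintype K] (M M' : ℤ) (a : ℕ → Matrix I J V)
    (b : ℕ → Matrix J K V) (c : ℕ → Matrix K H V) :
    seqMul M a (seqMul M' b c) = seqMul (M + M') (seqMul M a b) c := by
  ext1 d
  simp only [seqMul, derPow_seqMul, Matrix.mul_sum, Matrix.sum_mul]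
  rw [sum_antidiagonal_assoc (fun i j e => a i * (derPow (M - i) b j *
    derPow (M' + (M - i) - j) c e))]
  refine Finset.sum_congr rfl fun p _ => Finset.sum_congr rfl fun q hq => ?_
  rw [Finset.HasAntidiagonal.mem_antidiagonal] at hq
  rw [Matrix.mul_assoc, ← hq, show M' + (M - (q.1 : ℤ)) - q.2 = M + M' - ((q.1 + q.2 : ℕ) : ℤ) by
    push_cast; ring]

theorem derPow_leading (k : ℤ) (b : ℕ → Matrix I J V) : derPow k b 0 = b 0 := by
  simp [derPow]

end Seq

/-! ### Associativity, unit and inverses for the ⋆-product -/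

section Star

variable {I J K H V : Type*} [Ring V] [Algebra ℂ V] [DiffSuperalgebra V]

/-- The coefficients of an operator of order at most `M`, beginning with the one of `∂^M`. -/
def seq (M : ℤ) (A : MatPDO I J V) (i : ℕ) : Matrix I J V := A.coeff (M - i)

/-- The operator has order at most `M`. -/
def OrdLe (M : ℤ) (A : MatPDO I J V) : Prop := ∀ n, M < n → A.coeff n = 0

theorem exists_ordLe (A : MatPDO I J V) : ∃ M, OrdLe M A := A.bdd

theorem OrdLe.mono {M M' : ℤ} {A : MatPDO I J V} (h : OrdLe M A) (hM : M ≤ M') : OrdLe M' A :=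
  fun n hn => h n (by omega)

theorem ext_seq {M : ℤ} {A B : MatPDO I J V} (hA : OrdLe M A) (hB : OrdLe M B)
    (h : seq M A = seq M B) : A = B := by
  ext1
  ext1 n
  rcases lt_or_ge M n with hn | hn
  · rw [hA n hn, hB n hn]
  · have := congrFun h (M - n).toNat
    rw [seq, seq] at this
    rwa [show M - ((M - n).toNat : ℤ) = n by omega] at this

/-- The operator with given coefficients `∑ᵢ aᵢ ∂^{M-i}`. -/
def ofSeq (M : ℤ) (a : ℕ → Matrix I J V) : MatPDO I J V where
  coeff n := if n ≤ M then a (M - n).toNat else 0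
  bdd := ⟨M, fun n hn => if_neg (by omega)⟩

theorem seq_ofSeq (M : ℤ) (a : ℕ → Matrix I J V) : seq M (ofSeq M a) = a := by
  ext1 i
  simp only [seq, ofSeq]
  rw [if_pos (by omega)]
  congr 1
  omega

theorem ordLe_ofSeq (M : ℤ) (a : ℕ → Matrix I J V) : OrdLe M (ofSeq M a) :=
  fun n hn => if_neg (by omega)

variable [Fintype J]

theorem OrdLe.star {M M' : ℤ} {A : MatPDO I J V} {B : MatPDO J K V} (hA : OrdLe M A)
    (hB : OrdLe M' B) : OrdLe (M + M') (A.star B) := by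
  refine fun n hn => finsum_eq_zero_of_forall_eq_zero fun x => ?_
  rcases lt_or_ge M x.1 with h | h
  · simp [hA _ h]
  · have : M' < n - x.1 + x.2 := by omega
    rw [hB _ this, Matrix.map_zero _ (map_zero _), Matrix.mul_zero, smul_zero]

/-- Counting coefficients downwards from bounds on the orders turns the formal sum of `star` into a
finite convolution, for which associativity was proved. -/
theorem seq_star {M M' : ℤ} {A : MatPDO I J V} {B : MatPDO J K V} (hA : OrdLe M A)
    (hB : OrdLe M' B) : seq (M + M') (A.star B) = seqMul M (seq M A) (seq M' B) := by
  ext1 d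
  rw [seq, star]
  classical
  -- The nested pair records the position i in the first factor, the number l of derivatives and the
  -- position in the second factor; `g` returns the summation index (M - i, l) of `star`.
  let g : (Σ _ : ℕ × ℕ, ℕ × ℕ) → ℤ × ℕ := fun x => (M - x.1.1, x.2.1)
  let s : Finset (Σ _ : ℕ × ℕ, ℕ × ℕ) :=
    (Finset.HasAntidiagonal.antidiagonal d).sigma fun p => Finset.HasAntidiagonal.antidiagonal p.2
  have hg : Set.InjOn g s := by
    rintro ⟨⟨a, b⟩, ⟨c, e⟩⟩ h ⟨⟨a', b'⟩, ⟨c', e'⟩⟩ h' hh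
    simp only [s, g, Finset.coe_sigma, Set.mem_sigma_iff, Finset.mem_coe,
      Finset.HasAntidiagonal.mem_antidiagonal, Prod.mk.injEq] at h h' hh
    have h1 : a = a' := by omega
    have h2 : c = c' := hh.2
    have h3 : b = b' := by omega
    have h4 : e = e' := by omega
    subst h1 h2 h3 h4; rfl
  dsimp only
  rw [finsum_eq_sum_of_support_subset (s := s.image g), Finset.sum_image hg, seqMul,
    Finset.sum_sigma]
  · refine Finset.sum_congr rfl fun p hp => ?_
    rw [derPow, Matrix.mul_sum]
    refine Finset.sum_congr rfl fun q hq => ?_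
    rw [Finset.HasAntidiagonal.mem_antidiagonal] at hp hq
    rw [Matrix.mul_smul, ← map_der_pow]
    simp only [g, seq]
    congr 4
    omega
  · intro x hx
    rw [Function.mem_support] at hx
    have h1 : x.1 ≤ M := by
      by_contra h
      exact hx (by simp [hA _ (not_le.1 h)])
    have h2 : M + M' - d - x.1 + x.2 ≤ M' := by
      by_contra h
      apply hx
      rw [hB _ (not_le.1 h), Matrix.map_zero _ (map_zero _), Matrix.mul_zero, smul_zero]
    rw [Finset.mem_coe, Finset.mem_image]
    refine ⟨⟨((M - x.1).toNat, d - (M - x.1).toNat), (x.2, d - (M - x.1).toNat - x.2)⟩, ?_, ?_⟩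
    · simp only [s, Finset.mem_sigma, Finset.HasAntidiagonal.mem_antidiagonal]; omega
    · simp only [g]
      ext
      · simp only; omega
      · rfl

theorem star_assoc [Fintype K] (A : MatPDO I J V) (B : MatPDO J K V) (C : MatPDO K H V) :
    (A.star B).star C = A.star (B.star C) := by
  obtain ⟨M, hA⟩ := A.exists_ordLe
  obtain ⟨M', hB⟩ := B.exists_ordLe
  obtain ⟨M'', hC⟩ := C.exists_ordLe
  refine ext_seq (M := M + M' + M'') ((hA.star hB).star hC)
    ((hA.star (hB.star hC)).mono (by omega)) ?_
  rw [seq_star (hA.star hB) hC, seq_star hA hB, ← seqMul_assoc, ← seq_star hB hC,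
    ← seq_star hA (hB.star hC), add_assoc]

theorem ordLe_one [DecidableEq I] : OrdLe 0 (one : MatPDO I I V) := fun _ hn => if_neg hn.ne'

theorem seq_one [DecidableEq I] (i : ℕ) :
    seq 0 (one : MatPDO I I V) i = if i = 0 then 1 else 0 := by
  simp only [seq, one]
  congr 1
  simp

theorem derMat_one [DecidableEq I] : derMat (1 : Matrix I I V) = 0 := by
  ext i j
  rw [derMat, LinearMap.mapMatrix_apply, Matrix.map_apply, Matrix.one_apply]
  split_ifs <;> simp [der_one]

theorem derPow_seq_one [DecidableEq I] (k : ℤ) :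
    derPow k (seq 0 (one : MatPDO I I V)) = seq 0 one := by
  ext1 d
  rw [derPow, Finset.sum_eq_single (0, d)]
  · simp
  · intro p hp hne
    rcases Nat.eq_zero_or_pos p.1 with h | h
    · exact absurd (Prod.ext h (by simpa [h] using hp)) hne
    · obtain ⟨l, hl⟩ := Nat.exists_eq_succ_of_ne_zero h.ne'
      rw [seq_one, hl, pow_succ, Module.End.mul_apply]
      split_ifs <;> simp [derMat_one]
  · simp

theorem star_one [DecidableEq J] (A : MatPDO I J V) : A.star one = A := by
  obtain ⟨M, hA⟩ := A.exists_ordLe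
  refine ext_seq (M := M + 0) (hA.star ordLe_one) (by rwa [add_zero]) ?_
  rw [seq_star hA ordLe_one, add_zero]
  ext1 d
  rw [seqMul, Finset.sum_eq_single (d, 0)]
  · rw [derPow_leading, seq_one, if_pos rfl, Matrix.mul_one]
  · intro p hp hne
    rw [derPow_seq_one, seq_one, if_neg, Matrix.mul_zero]
    intro h
    exact hne (Prod.ext (by simpa [h] using hp) h)
  · simp

theorem one_star [DecidableEq J] (A : MatPDO J K V) : (one : MatPDO J J V).star A = A := by
  obtain ⟨M, hA⟩ := A.exists_ordLe
  refine ext_seq (M := 0 + M) (ordLe_one.star hA) (by rwa [zero_add]) ?_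
  rw [seq_star ordLe_one hA, zero_add]
  ext1 d
  rw [seqMul, Finset.sum_eq_single (0, d)]
  · rw [seq_one, if_pos rfl, Matrix.one_mul, Nat.cast_zero, sub_zero, derPow_zero]
  · intro p hp hne
    rw [seq_one, if_neg, Matrix.zero_mul]
    intro h
    exact hne (Prod.ext h (by simpa [h] using hp))
  · simp

theorem IsStarInv.unique [Fintype K] [DecidableEq J] [DecidableEq K] {A : MatPDO J K V} {B B' : MatPDO K J V}
    (h : IsStarInv A B) (h' : IsStarInv A B') : B = B' := by
  rw [← star_one B, ← h'.1, ← star_assoc, h.2, one_star]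

/-- The coefficients of the right inverse of a monic operator with coefficients `a`. -/
def invSeq [DecidableEq J] (M : ℤ) (a : ℕ → Matrix J J V) : ℕ → Matrix J J V
  | 0 => 1
  | d + 1 => -(∑ p : Fin (d + 1), Ring.choose M (d + 1 - p : ℕ) •
      (derMat ^ (d + 1 - p : ℕ) : Module.End ℂ _) (invSeq M a p) +
      ∑ q : Fin (d + 1), a (q + 1) * ∑ r : Fin (d - q + 1), Ring.choose (M - (q + 1 : ℕ)) (d - q - r : ℕ) •
        (derMat ^ (d - q - r : ℕ) : Module.End ℂ _) (invSeq M a r))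
  decreasing_by all_goals omega

theorem derPow_eq_range (k : ℤ) (b : ℕ → Matrix I J V) (d : ℕ) :
    derPow k b d = ∑ r : Fin (d + 1), Ring.choose k (d - r : ℕ) •
      (derMat ^ (d - r : ℕ) : Module.End ℂ _) (b r) := by
  rw [derPow, ← Finset.Nat.sum_antidiagonal_swap,
    Finset.Nat.sum_antidiagonal_eq_sum_range_succ_mk, Finset.sum_range]
  rfl

/-- In the equation for the coefficient of index d, the unknown of index d occurs only once,
multiplied by the leading coefficient 1; the recursion solves for it. -/
theorem seqMul_invSeq [DecidableEq J] (M : ℤ) (a : ℕ → Matrix J J V) (ha : a 0 = 1) (d : ℕ) :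
    seqMul M a (invSeq M a) d = if d = 0 then 1 else 0 := by
  cases d with
  | zero => simp [seqMul, derPow, ha, invSeq]
  | succ d =>
    rw [if_neg (by omega), seqMul, Finset.Nat.sum_antidiagonal_succ, ha,
      Matrix.one_mul, derPow_eq_range, Fin.sum_univ_castSucc, Fin.val_last, invSeq,
      Finset.Nat.sum_antidiagonal_eq_sum_range_succ_mk, Finset.sum_range]
    simp only [derPow_eq_range, Nat.cast_zero, sub_zero, Fin.val_castSucc, Nat.sub_self,
      Ring.choose_zero_right, pow_zero, Module.End.one_apply, one_smul]
    abel

/-- A monic matrix pseudo-differential operator is invertible. -/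
theorem IsMonic.exists_isStarInv [DecidableEq J] {M : ℤ} {A : MatPDO J J V} (hA : IsMonic M A) :
    ∃ B, IsStarInv A B := by
  -- Only right inverses are constructed. Being monic, the right inverse has a right inverse in
  -- turn, which must be the original operator, so the inverse is two-sided.
  have key : ∀ (M : ℤ) (A : MatPDO J J V), IsMonic M A →
      ∃ B, IsMonic (-M) B ∧ A.star B = one := by
    intro M A hA
    have h0 : seq M A 0 = 1 := by simpa [seq] using hA.1
    refine ⟨ofSeq (-M) (invSeq M (seq M A)), ⟨?_, ordLe_ofSeq _ _⟩, ?_⟩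
    · have := congrFun (seq_ofSeq (-M) (invSeq M (seq M A))) 0
      simpa [seq, invSeq] using this
    · have hA' : OrdLe M A := hA.2
      refine ext_seq (M := M + -M) (hA'.star (ordLe_ofSeq _ _)) (ordLe_one.mono (by omega)) ?_
      rw [seq_star hA' (ordLe_ofSeq _ _), seq_ofSeq, add_neg_cancel]
      ext1 d
      rw [seq_one]
      exact seqMul_invSeq M _ h0 d
  obtain ⟨B, hB, hAB⟩ := key M A hA
  obtain ⟨C, -, hBC⟩ := key _ B hB
  have : A = C := by rw [← one_star C, ← hAB, star_assoc, hBC, star_one]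
  exact ⟨B, hAB, by rw [this, hBC]⟩

end Star

/-! ### Differential operators given by polynomial symbols -/

section OfPoly

variable {I J K V : Type*} [Ring V] [Algebra ℂ V] [DiffSuperalgebra V]

/-- The coefficients of a polynomial, with integer indices. -/
def coeffZ {R : Type*} [Ring R] (n : ℤ) : R[X] →ₗ[R] R := if 0 ≤ n then lcoeff R n.toNat else 0

theorem coeffZ_natCast {R : Type*} [Ring R] (n : ℕ) (P : R[X]) : coeffZ (n : ℤ) P = P.coeff n := by simp [coeffZ]

theorem coeffZ_of_neg {R : Type*} [Ring R] {n : ℤ} (hn : n < 0) (P : R[X]) : coeffZ n P = 0 := by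
  simp [coeffZ, not_le.2 hn]

theorem coeffZ_lamD (n : ℤ) (P : V[X]) :
    coeffZ n (lamD P) = coeffZ (n - 1) P + der (coeffZ n P) := by
  rcases lt_or_ge n 0 with hn | hn
  · rw [coeffZ_of_neg hn, coeffZ_of_neg hn, coeffZ_of_neg (by omega), map_zero, add_zero]
  · obtain ⟨k, rfl⟩ := Int.eq_ofNat_of_zero_le hn
    rw [coeffZ_natCast, coeffZ_natCast, coeff_lamD]
    cases k with
    | zero => rw [coeffZ_of_neg (by simp)]; simp
    | succ k =>
      rw [coeff_X_mul, ← coeffZ_natCast]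
      simp

theorem sum_range_choose_smul_succ {M : Type*} [AddCommMonoid M] (k : ℕ) (f : ℕ → M) :
    ∑ l ∈ Finset.range (k + 2), (k + 1).choose l • f l =
      ∑ l ∈ Finset.range (k + 1), k.choose l • f l +
      ∑ l ∈ Finset.range (k + 1), k.choose l • f (l + 1) := by
  rw [Finset.sum_range_succ' _ (k + 1), Finset.sum_range_succ' (fun l => k.choose l • f l)]
  simp only [Nat.choose_succ_succ, add_smul, Finset.sum_add_distrib]
  rw [Finset.sum_range_succ (fun l => k.choose (l + 1) • f (l + 1)), Nat.choose_succ_self,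
    zero_smul, add_zero, add_comm (∑ l ∈ Finset.range (k + 1), _), add_right_comm]
  simp

/-- Any operator of the form "variable plus T on coefficients" obeys the binomial formula. It is
used for λ+∂, for w+λ+∂ and for z-λ-∂. -/
theorem coeffZ_pow {R : Type*} [Ring R] [Algebra ℂ R] {D : Module.End ℂ R[X]} {T : Module.End ℂ R}
    (h : ∀ n P, coeffZ n (D P) = coeffZ (n - 1) P + T (coeffZ n P)) (k : ℕ) (n : ℤ) (P : R[X]) :
    coeffZ n ((D ^ k) P) = ∑ l ∈ Finset.range (k + 1),
      k.choose l • (T ^ l) (coeffZ (n - k + l) P) := by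
  induction k generalizing n with
  | zero => simp
  | succ k ih =>
    rw [pow_succ', Module.End.mul_apply, h, ih, ih, sum_range_choose_smul_succ, map_sum]
    congr 1
    · refine Finset.sum_congr rfl fun l _ => ?_
      rw [show n - 1 - (k : ℤ) + l = n - (k + 1 : ℕ) + l by push_cast; ring]
    · refine Finset.sum_congr rfl fun l _ => ?_
      rw [map_nsmul, pow_succ', Module.End.mul_apply,
        show n - ((k + 1 : ℕ) : ℤ) + (l + 1 : ℕ) = n - k + l by push_cast; ring]

theorem coeffZ_lamD_pow (k : ℕ) (n : ℤ) (P : V[X]) :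
    coeffZ n ((lamD ^ k) P) = ∑ l ∈ Finset.range (k + 1),
      k.choose l • (der ^ l : Module.End ℂ V) (coeffZ (n - k + l) P) :=
  coeffZ_pow coeffZ_lamD k n P

theorem coeffZ_act_lamD {M : ℕ} (n : ℤ) {P : V[X]} (hP : P.natDegree < M) (Q : V[X]) :
    coeffZ n (act lamD P Q) = ∑ k ∈ Finset.range M, ∑ l ∈ Finset.range M,
      k.choose l • (P.coeff k * (der ^ l : Module.End ℂ V) (coeffZ (n - k + l) Q)) := by
  rw [act_eq_sum, sum_over_range' _ (by simp) _ hP, map_sum]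
  refine Finset.sum_congr rfl fun k hk => ?_
  rw [map_smul, coeffZ_lamD_pow, smul_eq_mul, Finset.mul_sum]
  refine Finset.sum_subset_zero_on_sdiff ?_ ?_ ?_
  · intro l hl; simp at hl hk ⊢; omega
  · intro l hl
    rw [Nat.choose_eq_zero_of_lt (by simp at hl; omega), zero_smul]
  · intro l _
    rw [mul_smul_comm]

variable [Fintype I] [Fintype J] [Fintype K]

/-- The matrix differential operator with given symbols of its entries. -/
def ofPoly (P : I → J → V[X]) : MatPDO I J V where
  coeff n := Matrix.of fun i j => coeffZ n (P i j)
  bdd := by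
    refine ⟨((Finset.univ.sup fun x : I × J => (P x.1 x.2).natDegree : ℕ) : ℤ), fun n hn => ?_⟩
    ext i j
    have h : (P i j).natDegree ≤ _ :=
      Finset.le_sup (f := fun x : I × J => (P x.1 x.2).natDegree) (Finset.mem_univ (i, j))
    obtain ⟨k, rfl⟩ := Int.eq_ofNat_of_zero_le (le_trans (Int.natCast_nonneg _) hn.le)
    rw [Matrix.of_apply, Matrix.zero_apply, coeffZ_natCast]
    exact coeff_eq_zero_of_natDegree_lt (by omega)

theorem coeff_ofPoly (P : I → J → V[X]) (n : ℤ) (i : I) (j : J) :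
    (ofPoly P).coeff n i j = coeffZ n (P i j) := rfl

/-- On symbols, composition is the action in which ∂ becomes λ+∂ on the second symbol; the
generalised binomials reduce to ordinary ones because the first factor has no negative powers. -/
theorem ofPoly_star_ofPoly (P : I → J → V[X]) (Q : J → K → V[X]) :
    (ofPoly P).star (ofPoly Q) = ofPoly fun i k => ∑ j, act lamD (P i j) (Q j k) := by
  ext n i k
  obtain ⟨M, hM⟩ : ∃ M : ℕ, ∀ i j, (P i j).natDegree < M := by
    refine ⟨(Finset.univ.sup fun x : I × J => (P x.1 x.2).natDegree) + 1, fun i j => ?_⟩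
    exact Nat.lt_succ_of_le
      (Finset.le_sup (f := fun x : I × J => (P x.1 x.2).natDegree) (Finset.mem_univ (i, j)))
  rw [coeff_ofPoly, map_sum, star]
  dsimp only
  let g : ℕ × ℕ → ℤ × ℕ := fun x => (x.1, x.2)
  have hg : Function.Injective g := fun x y h => by
    simp only [g, Prod.mk.injEq, Nat.cast_inj] at h; exact Prod.ext h.1 h.2
  rw [finsum_eq_sum_of_support_subset
    (s := (Finset.range M ×ˢ Finset.range M).map ⟨g, hg⟩), Finset.sum_map, Finset.sum_product]
  · simp only [Matrix.sum_apply, Matrix.smul_apply, Matrix.mul_apply, Function.Embedding.coeFn_mk,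
      g, Matrix.map_apply, coeff_ofPoly, coeffZ_natCast, Ring.choose_natCast, Finset.smul_sum]
    simp only [coeffZ_act_lamD n (hM _ _), natCast_zsmul]
    symm
    rw [Finset.sum_comm]
    exact Finset.sum_congr rfl fun _ _ => Finset.sum_comm
  · intro x hx
    rw [Function.mem_support] at hx
    have h0 : 0 ≤ x.1 := by
      by_contra h
      apply hx
      have : (ofPoly P).coeff x.1 = 0 := by
        ext i j; exact coeffZ_of_neg (not_le.1 h) _
      rw [this, Matrix.zero_mul, smul_zero]
    obtain ⟨⟨a, l⟩, rfl⟩ : ∃ y, g y = x := ⟨(x.1.toNat, x.2), Prod.ext (by simp [g, h0]) rfl⟩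
    have h1 : a < M := by
      by_contra h
      apply hx
      have : (ofPoly P).coeff (g (a, l)).1 = 0 := by
        ext i j
        rw [coeff_ofPoly, coeffZ_natCast, Matrix.zero_apply]
        exact coeff_eq_zero_of_natDegree_lt (by have := hM i j; omega)
      rw [this, Matrix.zero_mul, smul_zero]
    have h2 : l ≤ a := by
      by_contra h
      apply hx
      simp only [g]
      rw [Ring.choose_natCast, Nat.choose_eq_zero_of_lt (by omega), Nat.cast_zero, zero_smul]
    rw [Finset.coe_map]
    exact ⟨(a, l), by simp; omega, rfl⟩

theorem ofPoly_one [DecidableEq I] :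
    ofPoly (fun i j : I => if i = j then (1 : V[X]) else 0) = one := by
  ext n i j
  rw [coeff_ofPoly]
  show _ = (if n = 0 then (1 : Matrix I I V) else 0) i j
  rcases lt_or_ge n 0 with hn | hn
  · rw [coeffZ_of_neg hn, if_neg hn.ne, Matrix.zero_apply]
  · obtain ⟨k, rfl⟩ := Int.eq_ofNat_of_zero_le hn
    rw [coeffZ_natCast]
    by_cases hij : i = j <;> by_cases hk : k = 0 <;> simp [hij, hk, coeff_one, Matrix.one_apply]

end OfPoly

end MatPDO

/-! ### Quasi-determinants of Hessenberg operators -/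

section Hessenberg

variable {V : Type*} [Ring V] [Algebra ℂ V] [DiffSuperalgebra V]
variable {T : Type*} [Fintype T] [DecidableEq T]

theorem act_lamD_X (P : V[X]) : act lamD (X : V[X]) P = lamD P := by
  rw [← mul_one (X : V[X]), act_lamD_X_mul, act_one]

theorem lamD_pow_one (n : ℕ) : (lamD ^ n) (1 : V[X]) = X ^ n := by
  induction n with
  | zero => simp
  | succ n ih =>
    rw [pow_succ, Module.End.mul_apply, ← C_1, lamD_C, der_one, C_0, add_zero, lamD_pow_X_mul,
      C_1, ih, ← pow_succ']

theorem act_lamD_one (P : V[X]) : act lamD P 1 = P := by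
  rw [act_eq_sum]
  conv_rhs => rw [← sum_C_mul_X_pow_eq P]
  simp only [lamD_pow_one, smul_eq_C_mul]

theorem act_lamD_mul_X (P Q : V[X]) : act lamD P (X * Q) = X * act lamD P Q := by
  induction P using Polynomial.induction_on' with
  | add P P' hP hP' => simp [hP, hP', mul_add]
  | monomial n v =>
    rw [act_monomial, act_monomial, lamD_pow_X_mul, smul_eq_C_mul, smul_eq_C_mul,
      ← mul_assoc, ← X_mul, mul_assoc]

theorem act_lamD_right_X (P : V[X]) : act lamD P X = X * P := by
  have := act_lamD_mul_X P 1
  rwa [mul_one, act_lamD_one] at this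

/-- The solution `ψ` of `(∂ + Q + E) ψ = 0`, where `Q` is block lower triangular and `E` has
identity blocks just above the block diagonal, with `ψ₀ = 1`. -/
def psi (Q : ℕ → ℕ → T → T → V) : ℕ → T → T → V[X]
  | 0 => fun i b => if i = b then 1 else 0
  | u + 1 => fun i b =>
    -(lamD (psi Q u i b) + ∑ v : Fin (u + 1), ∑ j, C (Q u v i j) * psi Q v j b)

/-- The solution `χ` of `χ (∂ + Q + E) = 0`, where `χ` is normalised to be `1` at the last of the
`N` blocks; the blocks are numbered backwards, beginning with the last one. -/
def chi (Q : ℕ → ℕ → T → T → V) (N : ℕ) : ℕ → T → T → V[X]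
  | 0 => fun a j => if a = j then 1 else 0
  | t + 1 => fun a j =>
    -(X * chi Q N t a j + ∑ s : Fin (t + 1), ∑ h,
      act lamD (chi Q N s a h) (C (Q (N - 1 - s) (N - 1 - t) h j)))

/-- The symbol of `∂ + Q + E`. -/
def hessOp (Q : ℕ → ℕ → T → T → V) {N : ℕ} (x y : Fin N × T) : V[X] :=
  (if x = y then X else 0) +
    (if (y.1 : ℕ) ≤ x.1 then C (Q x.1 y.1 x.2 y.2) else 0) +
    if (y.1 : ℕ) = x.1 + 1 ∧ x.2 = y.2 then 1 else 0

theorem sum_fin_ite_le {M : Type*} [AddCommMonoid M] {N u : ℕ} (hu : u < N) (F : ℕ → M) :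
    ∑ v : Fin N, (if (v : ℕ) ≤ u then F v else 0) = ∑ v : Fin (u + 1), F v := by
  rw [Fin.sum_univ_eq_sum_range (fun v => if v ≤ u then F v else 0), Fin.sum_univ_eq_sum_range,
    ← Finset.sum_filter]
  congr 1
  ext v
  simp only [Finset.mem_filter, Finset.mem_range]
  omega

theorem sum_fin_ite_eq {M : Type*} [AddCommMonoid M] {N u : ℕ} (F : ℕ → M) :
    ∑ v : Fin N, (if (v : ℕ) = u then F v else 0) = if u < N then F u else 0 := by
  rw [Fin.sum_univ_eq_sum_range (fun v => if v = u then F v else 0), Finset.sum_ite_eq']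
  simp

variable (Q : ℕ → ℕ → T → T → V)

/-- Row `u` of the system involves the block `u + 1` only through the identity above the diagonal,
and the recursion for `psi` solves it for that block. In the last row this block is missing, which
leaves the defect -ψ_N. -/
theorem hessOp_psi {N : ℕ} (x : Fin N × T) (b : T) :
    ∑ y : Fin N × T, act lamD (hessOp Q x y) (psi Q y.1 y.2 b) =
      if (x.1 : ℕ) + 1 = N then -psi Q N x.2 b else 0 := by
  obtain ⟨u, i⟩ := x
  have h1 : ∑ y : Fin N × T, act lamD (if (u, i) = y then (X : V[X]) else 0) (psi Q y.1 y.2 b) =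
      lamD (psi Q u i b) := by
    rw [Finset.sum_eq_single (u, i)]
    · rw [if_pos rfl, act_lamD_X]
    · intro y _ hy
      rw [if_neg (Ne.symm hy), map_zero, LinearMap.zero_apply]
    · simp
  have h2 : ∑ y : Fin N × T, act lamD (if (y.1 : ℕ) ≤ u then C (Q u y.1 i y.2) else 0)
      (psi Q y.1 y.2 b) = ∑ v : Fin (u + 1), ∑ j, C (Q u v i j) * psi Q v j b := by
    rw [Fintype.sum_prod_type, ← sum_fin_ite_le u.2 (fun v => ∑ j, C (Q u v i j) * psi Q v j b)]
    refine Finset.sum_congr rfl fun v _ => ?_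
    split_ifs
    · simp only [act_C, smul_eq_C_mul]
    · simp
  have h3 : ∑ y : Fin N × T, act lamD (if (y.1 : ℕ) = u + 1 ∧ i = y.2 then (1 : V[X]) else 0)
      (psi Q y.1 y.2 b) = if (u : ℕ) + 1 < N then psi Q (u + 1) i b else 0 := by
    rw [Fintype.sum_prod_type, ← sum_fin_ite_eq (fun v => psi Q v i b)]
    refine Finset.sum_congr rfl fun v _ => ?_
    by_cases hv : (v : ℕ) = u + 1
    · rw [if_pos hv, Finset.sum_eq_single i]
      · rw [if_pos ⟨hv, rfl⟩, act_one]
      · intro j _ hj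
        rw [if_neg (fun h => hj h.2.symm), map_zero, LinearMap.zero_apply]
      · simp
    · simp [hv]
  simp only [hessOp, map_add, LinearMap.add_apply, Finset.sum_add_distrib]
  rw [h1, h2, h3]
  have hp : psi Q (u + 1) i b = -(lamD (psi Q u i b) +
    ∑ v : Fin (u + 1), ∑ j, C (Q u v i j) * psi Q v j b) := by rw [psi]
  have := u.2
  split_ifs with ha hb hb
  · omega
  · rw [hp, add_neg_cancel]
  · rw [add_zero, eq_neg_iff_add_eq_zero,
      show psi Q N i b = psi Q (u + 1) i b by rw [hb], hp, add_neg_cancel]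
  · omega

/-- The transpose of `hessOp_psi`: column `v` is solved for the block above it. The index `N - 1 -
x.1` appears because `chi` counts blocks from the last one. -/
theorem chi_hessOp {N : ℕ} (a : T) (y : Fin N × T) :
    ∑ x : Fin N × T, act lamD (chi Q N (N - 1 - x.1) a x.2) (hessOp Q x y) =
      if (y.1 : ℕ) = 0 then -chi Q N N a y.2 else 0 := by
  obtain ⟨v, j⟩ := y
  have hv := v.2
  have h1 : ∑ x : Fin N × T, act lamD (chi Q N (N - 1 - x.1) a x.2)
      (if x = (v, j) then X else 0) = X * chi Q N (N - 1 - v) a j := by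
    rw [Finset.sum_eq_single (v, j)]
    · rw [if_pos rfl, act_lamD_right_X]
    · intro y _ hy
      rw [if_neg hy, map_zero]
    · simp
  have h2 : ∑ x : Fin N × T, act lamD (chi Q N (N - 1 - x.1) a x.2)
      (if (v : ℕ) ≤ x.1 then C (Q x.1 v x.2 j) else 0) =
      ∑ s : Fin (N - 1 - v + 1), ∑ h,
      act lamD (chi Q N s a h) (C (Q (N - 1 - s) (N - 1 - (N - 1 - v)) h j)) := by
    -- The order of the blocks is reversed to match the backward numbering in the recursion.
    rw [Fintype.sum_prod_type, ← sum_fin_ite_le (show N - 1 - (v : ℕ) < N by omega) (fun s => ∑ h,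
      act lamD (chi Q N s a h) (C (Q (N - 1 - s) (N - 1 - (N - 1 - v)) h j))),
      ← Equiv.sum_comp Fin.revPerm]
    refine Finset.sum_congr rfl fun s _ => ?_
    have hs := s.2
    simp only [Fin.revPerm_apply, Fin.val_rev]
    rw [show N - 1 - (N - ((s : ℕ) + 1)) = s by omega, show N - 1 - (N - 1 - (v : ℕ)) = v by omega,
      show N - ((s : ℕ) + 1) = N - 1 - s by omega]
    by_cases hle : (s : ℕ) ≤ N - 1 - v
    · rw [if_pos hle]
      simp only [if_pos (show (v : ℕ) ≤ N - 1 - s by omega)]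
    · rw [if_neg hle]
      simp only [if_neg (show ¬ (v : ℕ) ≤ N - 1 - s by omega), map_zero, Finset.sum_const_zero]
  have h3 : ∑ x : Fin N × T, act lamD (chi Q N (N - 1 - x.1) a x.2)
      (if (v : ℕ) = x.1 + 1 ∧ x.2 = j then (1 : V[X]) else 0) =
      if (v : ℕ) = 0 then 0 else chi Q N (N - 1 - v + 1) a j := by
    rcases Nat.eq_zero_or_pos (v : ℕ) with h0 | h0
    · rw [if_pos h0]
      refine Finset.sum_eq_zero fun x _ => ?_
      rw [if_neg (by omega), map_zero]
    · rw [if_neg h0.ne', Finset.sum_eq_single (⟨v - 1, by omega⟩, j)]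
      · rw [if_pos ⟨by simp only; omega, rfl⟩, act_lamD_one]
        congr 2
        simp only; omega
      · intro x _ hx
        rw [if_neg, map_zero]
        rintro ⟨ha, hb⟩
        exact hx (Prod.ext (Fin.ext (by simp only; omega)) hb)
      · simp
  simp only [hessOp, map_add, Finset.sum_add_distrib]
  rw [h1, h2, h3]
  have hp : chi Q N (N - 1 - v + 1) a j = -(X * chi Q N (N - 1 - v) a j +
      ∑ s : Fin (N - 1 - v + 1), ∑ h,
      act lamD (chi Q N s a h) (C (Q (N - 1 - s) (N - 1 - (N - 1 - v)) h j))) := by rw [chi]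
  split_ifs with ha
  · rw [add_zero, ← neg_eq_iff_eq_neg, ← hp]
    congr 1
    omega
  · rw [hp, add_neg_cancel]

/-- Associativity of χ(∂+Q+E)ψ: one bracketing leaves the first block, where ψ is 1, the other the
last block, where χ is 1. -/
theorem chi_eq_psi {N : ℕ} (hN : 0 < N) (a b : T) : chi Q N N a b = psi Q N a b := by
  have h : ∑ y : Fin N × T, act lamD (∑ x : Fin N × T,
      act lamD (chi Q N (N - 1 - x.1) a x.2) (hessOp Q x y)) (psi Q y.1 y.2 b) =
      ∑ x : Fin N × T, act lamD (chi Q N (N - 1 - x.1) a x.2)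
        (∑ y : Fin N × T, act lamD (hessOp Q x y) (psi Q y.1 y.2 b)) := by
    simp only [map_sum, LinearMap.sum_apply, act_act (D := lamD (V := V)) lamD_smul_V]
    exact Finset.sum_comm
  simp only [chi_hessOp, hessOp_psi] at h
  rw [Finset.sum_eq_single ((⟨0, hN⟩ : Fin N), b), Finset.sum_eq_single
    ((⟨N - 1, by omega⟩ : Fin N), a)] at h
  · rw [if_pos rfl, if_pos (by simp only; omega)] at h
    simp only [psi, chi, Nat.sub_self, if_true] at h
    rw [act_lamD_one, act_one] at h
    simpa using h
  · rintro ⟨u, i⟩ _ hne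
    by_cases hu : (u : ℕ) + 1 = N
    · have hi : a ≠ i := fun hi => hne (Prod.ext (Fin.ext (by simp only; omega)) hi.symm)
      simp only [show N - 1 - (u : ℕ) = 0 by omega, chi, if_neg hi]
      simp
    · simp only [if_neg hu, map_zero]
  · simp
  · rintro ⟨u, i⟩ _ hne
    by_cases hu : (u : ℕ) = 0
    · have hi : i ≠ b := fun hi => hne (Prod.ext (Fin.ext hu) hi)
      simp only [hu, psi, if_neg hi, map_zero]
    · simp only [if_neg hu, map_zero, LinearMap.zero_apply]
  · simp

/-- Each step of the recursion contributes one factor -∂; the terms with entries of `Q` have lower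
order. -/
theorem coeff_psi (u : ℕ) (i b : T) : (psi Q u i b).coeff u = (if i = b then (-1) ^ u else 0) ∧
    ∀ k, u < k → (psi Q u i b).coeff k = 0 := by
  induction u using Nat.strong_induction_on generalizing i b with
  | _ u ih =>
    cases u with
    | zero =>
      refine ⟨?_, fun k hk => ?_⟩
      · simp only [psi]
        split_ifs <;> simp
      · simp only [psi]
        split_ifs
        · rw [coeff_one, if_neg (by omega)]
        · simp
    | succ u =>
      have hs : ∀ k, u < k →
          (∑ v : Fin (u + 1), ∑ j, C (Q u v i j) * psi Q v j b).coeff k = 0 := by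
        intro k hk
        simp only [finsetSum_coeff, coeff_C_mul]
        refine Finset.sum_eq_zero fun v _ => Finset.sum_eq_zero fun j _ => ?_
        rw [(ih v (by omega) j b).2 k (by omega), mul_zero]
      have hl : ∀ k, u < k → (lamD (psi Q u i b)).coeff k = (psi Q u i b).coeff (k - 1) := by
        intro k hk
        obtain ⟨l, rfl⟩ := Nat.exists_eq_succ_of_ne_zero (show k ≠ 0 by omega)
        rw [coeff_lamD, coeff_X_mul, (ih u (by omega) i b).2 _ hk, map_zero, add_zero]
        rfl
      refine ⟨?_, fun k hk => ?_⟩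
      · rw [psi, coeff_neg, coeff_add, hs _ (by omega), hl _ (by omega), Nat.add_sub_cancel,
          (ih u (by omega) i b).1, add_zero]
        split_ifs <;> simp [pow_succ]
      · rw [psi, coeff_neg, coeff_add, hs _ (by omega), hl _ (by omega),
          (ih u (by omega) i b).2 _ (by omega)]
        simp

theorem IsHomogPoly.C_mul {i j : ZMod 2} {a : V} {P : V[X]} (ha : IsHomog i a)
    (hP : IsHomogPoly j P) : IsHomogPoly (i + j) (C a * P) := fun n => by
  rw [coeff_C_mul]; exact ha.mul (hP n)

theorem isHomogPoly_sum {α : Type*} {i : ZMod 2} (s : Finset α) {f : α → V[X]}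
    (h : ∀ x ∈ s, IsHomogPoly i (f x)) : IsHomogPoly i (∑ x ∈ s, f x) := fun n => by
  rw [finsetSum_coeff]; exact IsHomog.sum s fun x hx => h x hx n

theorem isHomogPoly_ite_one {π : T → ZMod 2} (i j : T) :
    IsHomogPoly (π i + π j) (if i = j then (1 : V[X]) else 0) := fun n => by
  split_ifs with h
  · rw [h, CharTwo.add_self_eq_zero, coeff_one]
    split_ifs
    · exact isHomog_one
    · exact isHomog_zero _
  · exact isHomog_zero _

theorem zmod2_add_cancel (a b c : ZMod 2) : a + b + (b + c) = a + c := by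
  revert a b c; decide

theorem IsHomogPoly.act {i j : ZMod 2} {P P' : V[X]} (hP : IsHomogPoly i P)
    (hP' : IsHomogPoly j P') : IsHomogPoly (i + j) (SuperPVA.act SuperPVA.lamD P P') := by
  rw [act_eq_sum, sum_def]
  refine isHomogPoly_sum _ fun k _ => ?_
  rw [smul_eq_C_mul]
  exact IsHomogPoly.C_mul (hP k) (hP'.lamD_pow k)

theorem IsHomogPoly.X_mul {i : ZMod 2} {P : V[X]} (hP : IsHomogPoly i P) :
    IsHomogPoly i (X * P) := fun n => by
  cases n with
  | zero => rw [coeff_X_mul_zero]; exact isHomog_zero _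
  | succ n => rw [coeff_X_mul]; exact hP n

variable {Q}

theorem isHomogPoly_psi {π : T → ZMod 2} (hQ : ∀ u v i j, IsHomog (π i + π j) (Q u v i j)) (u : ℕ)
    (i b : T) : IsHomogPoly (π i + π b) (psi Q u i b) := by
  induction u using Nat.strong_induction_on generalizing i b with
  | _ u ih =>
    cases u with
    | zero => rw [psi]; exact isHomogPoly_ite_one i b
    | succ u =>
      rw [psi]
      refine ((ih u (by omega) i b).lamD.add (isHomogPoly_sum _ fun v _ =>
        isHomogPoly_sum _ fun j _ => ?_)).neg
      rw [← zmod2_add_cancel (π i) (π j) (π b)]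
      exact IsHomogPoly.C_mul (hQ u v i j) (ih v (by omega) j b)

theorem isHomogPoly_chi {π : T → ZMod 2} (hQ : ∀ u v i j, IsHomog (π i + π j) (Q u v i j))
    (N t : ℕ) (a j : T) : IsHomogPoly (π a + π j) (chi Q N t a j) := by
  induction t using Nat.strong_induction_on generalizing a j with
  | _ t ih =>
    cases t with
    | zero => rw [chi]; exact isHomogPoly_ite_one a j
    | succ t =>
      rw [chi]
      refine ((ih t (by omega) a j).X_mul.add (isHomogPoly_sum _ fun s _ =>
        isHomogPoly_sum _ fun h _ => ?_)).neg
      rw [← zmod2_add_cancel (π a) (π h) (π j)]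
      exact IsHomogPoly.act (ih s (by omega) a h) (hQ _ _ h j).C

section Map

variable {W : Type*} [Ring W] [Algebra ℂ W] [DiffSuperalgebra W] (φ : V →ₐ[ℂ] W)

theorem map_lamD (hφ : ∀ a, φ (der a) = der (φ a)) (P : V[X]) :
    (lamD P).map (φ : V →+* W) = lamD (P.map (φ : V →+* W)) := by
  ext n
  rw [coeff_map, coeff_lamD, coeff_lamD, coeff_map, map_add]
  congr 1
  · cases n <;> simp
  · exact hφ _

theorem map_act_lamD (hφ : ∀ a, φ (der a) = der (φ a)) (P P' : V[X]) :
    (act lamD P P').map (φ : V →+* W) =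
      act lamD (P.map (φ : V →+* W)) (P'.map (φ : V →+* W)) := by
  induction P using Polynomial.induction_on' with
  | add P R hP hR => simp only [map_add, LinearMap.add_apply, Polynomial.map_add, hP, hR]
  | monomial k v =>
    have h : ∀ k, ((lamD ^ k) P').map (φ : V →+* W) = (lamD ^ k) (P'.map (φ : V →+* W)) := by
      intro k
      induction k with
      | zero => rfl
      | succ k ih =>
        rw [pow_succ', Module.End.mul_apply, map_lamD φ hφ, ih, pow_succ', Module.End.mul_apply]
    rw [act_monomial, map_monomial, act_monomial, smul_eq_C_mul, smul_eq_C_mul, Polynomial.map_mul,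
      map_C, h]

/-- Homomorphisms of differential algebras commute with `ψ`. -/
theorem map_psi (hφ : ∀ a, φ (der a) = der (φ a)) (u : ℕ) (i b : T) :
    (psi Q u i b).map (φ : V →+* W) = psi (fun u v i j => φ (Q u v i j)) u i b := by
  induction u using Nat.strong_induction_on generalizing i b with
  | _ u ih =>
    cases u with
    | zero => simp only [psi]; split_ifs <;> simp
    | succ u =>
      simp only [psi, Polynomial.map_neg, Polynomial.map_add, map_lamD φ hφ, Polynomial.map_sum,
        Polynomial.map_mul, map_C]
      rw [ih u (by omega)]
      congr 2
      refine Finset.sum_congr rfl fun v _ => Finset.sum_congr rfl fun j _ => ?_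
      rw [ih v (by omega)]
      rfl

theorem map_chi (hφ : ∀ a, φ (der a) = der (φ a)) (N t : ℕ) (a j : T) :
    (chi Q N t a j).map (φ : V →+* W) = chi (fun u v i j => φ (Q u v i j)) N t a j := by
  induction t using Nat.strong_induction_on generalizing a j with
  | _ t ih =>
    cases t with
    | zero => simp only [chi]; split_ifs <;> simp
    | succ t =>
      simp only [chi, Polynomial.map_neg, Polynomial.map_add, map_act_lamD φ hφ,
        Polynomial.map_sum, Polynomial.map_mul, map_C, map_X]
      rw [ih t (by omega)]
      congr 2
      refine Finset.sum_congr rfl fun s _ => Finset.sum_congr rfl fun h _ => ?_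
      rw [ih s (by omega)]
      rfl

end Map

end Hessenberg

namespace MatPDO

/-! ### Submatrices of ⋆-products -/

section Sub

variable {I I' J K K' V : Type*} [Ring V] [Algebra ℂ V] [DiffSuperalgebra V]

theorem star_sub [Fintype J] (A : MatPDO I J V) (B : MatPDO J K V) (c : I' → I) (d : K' → K) :
    (A.star B).sub c d = (A.sub c id).star (B.sub id d) := by
  obtain ⟨M, hA⟩ := A.exists_ordLe
  obtain ⟨M', hB⟩ := B.exists_ordLe
  have hA' : OrdLe M (A.sub c id) := fun n hn => by simp [sub, hA n hn]
  have hB' : OrdLe M' (B.sub id d) := fun n hn => by simp [sub, hB n hn]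
  have hAB : OrdLe (M + M') ((A.star B).sub c d) := fun n hn => by
    simp [sub, hA.star hB n hn]
  refine ext_seq hAB (hA'.star hB') ?_
  rw [seq_star hA' hB']
  have h1 : seq (M + M') ((A.star B).sub c d) = fun k =>
      (seq (M + M') (A.star B) k).submatrix c d := rfl
  have h2 : ∀ k l s j, (derMat ^ l : Module.End ℂ _) (seq M' (B.sub id d) k) s j =
      (derMat ^ l : Module.End ℂ _) (seq M' B k) s (d j) := by
    intro k l s j
    rw [← map_der_pow, ← map_der_pow]
    rfl
  rw [h1, seq_star hA hB]
  ext k i j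
  simp only [seqMul, derPow, Matrix.submatrix_apply, Matrix.sum_apply, Matrix.mul_apply,
    Matrix.smul_apply]
  refine Finset.sum_congr rfl fun p _ => Finset.sum_congr rfl fun s _ => ?_
  congr 1
  refine Finset.sum_congr rfl fun q _ => ?_
  rw [h2]

/-- If the rows of `B` outside the range of `r` vanish, then only the columns of `A` in the range
of `r` contribute to the product. -/
theorem star_eq_sub_star_sub_of_rows [Fintype J] [Fintype I'] (A : MatPDO I J V)
    (B : MatPDO J K V) {r : I' → J} (hr : Function.Injective r)
    (hB : ∀ n x, x ∉ Set.range r → ∀ k, B.coeff n x k = 0) :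
    A.star B = (A.sub id r).star (B.sub r id) := by
  ext1
  ext1 n
  refine finsum_congr fun x => ?_
  congr 1
  ext i k
  simp only [Matrix.mul_apply, sub, Matrix.submatrix_apply, Matrix.map_apply, id]
  refine (Fintype.sum_of_injective r hr _ _ (fun y hy => ?_) fun _ => rfl).symm
  rw [hB _ _ hy, map_zero, mul_zero]

theorem star_eq_sub_star_sub_of_cols [Fintype J] [Fintype I'] (A : MatPDO I J V)
    (B : MatPDO J K V) {c : I' → J} (hc : Function.Injective c)
    (hA : ∀ n x, x ∉ Set.range c → ∀ i, A.coeff n i x = 0) :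
    A.star B = (A.sub id c).star (B.sub c id) := by
  ext1
  ext1 n
  refine finsum_congr fun x => ?_
  congr 1
  ext i k
  simp only [Matrix.mul_apply, sub, Matrix.submatrix_apply, Matrix.map_apply, id]
  refine (Fintype.sum_of_injective c hc _ _ (fun y hy => ?_) fun _ => rfl).symm
  rw [hA _ _ hy, zero_mul]

end Sub

/-! ### The quasi-determinant of a Hessenberg operator -/

section Quasidet

variable {V : Type*} [Ring V] [Algebra ℂ V] [DiffSuperalgebra V]
variable {T : Type*} [Fintype T] [DecidableEq T]

theorem isMonic_hessOp (Q : ℕ → ℕ → T → T → V) (N : ℕ) :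
    IsMonic 1 (ofPoly (hessOp Q (N := N))) := by
  refine ⟨?_, fun n hn => ?_⟩
  · ext x y
    rw [coeff_ofPoly, show (1 : ℤ) = (1 : ℕ) by rfl, coeffZ_natCast, hessOp, Matrix.one_apply]
    split_ifs <;> simp [coeff_one]
  · ext x y
    obtain ⟨k, rfl⟩ := Int.eq_ofNat_of_zero_le (by omega : 0 ≤ n)
    have : k ≠ 0 := by omega
    have h1 : k ≠ 1 := by omega
    rw [coeff_ofPoly, coeffZ_natCast, hessOp, Matrix.zero_apply]
    split_ifs <;> simp [coeff_one, coeff_C, this, coeff_X, h1.symm]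

/-- Multiply the equation of ψ by the inverse from the left and read off the first block: 1 is the
corner block of the inverse times the defect. The equation of χ gives the product in the other
order, with the same defect by `chi_eq_psi`. -/
theorem isQuasidet_hessOp (Q : ℕ → ℕ → T → T → V) {N : ℕ} (hN : 0 < N) :
    IsQuasidet (ofPoly (hessOp Q (N := N))) (fun t : T => ((⟨N - 1, by omega⟩, t) : Fin N × T))
      (fun t : T => ((⟨0, by omega⟩, t) : Fin N × T)) (ofPoly fun i j => -psi Q N i j) := by
  obtain ⟨B, hB⟩ := (isMonic_hessOp Q N).exists_isStarInv
  refine ⟨B, hB, ?_⟩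
  set r := fun t : T => ((⟨N - 1, by omega⟩, t) : Fin N × T) with hr
  set c := fun t : T => ((⟨0, by omega⟩, t) : Fin N × T) with hc
  have hri : Function.Injective r := fun x y h => (Prod.ext_iff.1 h).2
  have hci : Function.Injective c := fun x y h => (Prod.ext_iff.1 h).2
  have hone : ∀ P : T → T → V[X], (∀ i j, P i j = if i = j then 1 else 0) →
      ofPoly P = (one : MatPDO T T V) := fun P h => by
    rw [← ofPoly_one]; congr 1; ext1 i; ext1 j; exact h i j
  constructor
  · have h1 : (ofPoly (hessOp Q (N := N))).star (ofPoly fun y b => psi Q y.1 y.2 b) =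
        ofPoly fun x b => if (x.1 : ℕ) + 1 = N then -psi Q N x.2 b else 0 := by
      rw [ofPoly_star_ofPoly]; congr 1; ext1 x; ext1 b; exact hessOp_psi Q x b
    -- The right-hand side of `h1` is supported in the last block, so only the last block column of
    -- `B` contributes.
    have h2 := congrArg (fun Z => (B.star Z).sub c id) h1
    simp only [← star_assoc, hB.2, one_star] at h2
    rw [star_sub, star_eq_sub_star_sub_of_rows _ _ hri] at h2
    · have e1 : (ofPoly fun (y : Fin N × T) b => psi Q y.1 y.2 b).sub c id = one :=
        hone _ fun i j => by simp only [hc, psi, id]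
      have e2 : ((ofPoly fun (x : Fin N × T) b => if (x.1 : ℕ) + 1 = N then -psi Q N x.2 b
          else 0).sub id id).sub r id = ofPoly fun i j => -psi Q N i j := by
        ext n i j
        show coeffZ n (if (N - 1) + 1 = N then -psi Q N i j else 0) = _
        rw [if_pos (by omega), coeff_ofPoly]
      rw [e1, e2] at h2
      exact h2.symm
    · rintro n ⟨u, i⟩ hx b
      show coeffZ n (if (u : ℕ) + 1 = N then -psi Q N i b else 0) = 0
      rw [if_neg, map_zero]
      intro hu
      exact hx ⟨i, Prod.ext (Fin.ext (show N - 1 = (u : ℕ) by omega)) rfl⟩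
  · have h1 : (ofPoly fun (a : T) (x : Fin N × T) => chi Q N (N - 1 - x.1) a x.2).star
        (ofPoly (hessOp Q (N := N))) =
        ofPoly fun a y => if (y.1 : ℕ) = 0 then -chi Q N N a y.2 else 0 := by
      rw [ofPoly_star_ofPoly]; congr 1; ext1 x; ext1 b; exact chi_hessOp Q x b
    have h2 := congrArg (fun Z => (Z.star B).sub id r) h1
    simp only [star_assoc, hB.1, star_one] at h2
    rw [star_sub, star_eq_sub_star_sub_of_cols _ _ hci] at h2
    · have e1 : (ofPoly fun (a : T) (x : Fin N × T) => chi Q N (N - 1 - x.1) a x.2).sub id r =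
          one :=
        hone _ fun i j => by simp only [hr, Nat.sub_self, chi, id]
      have e2 : ((ofPoly fun a (y : Fin N × T) => if (y.1 : ℕ) = 0 then -chi Q N N a y.2
          else 0).sub id id).sub id c = ofPoly fun i j => -psi Q N i j := by
        ext n i j
        show coeffZ n (if 0 = 0 then -chi Q N N i j else 0) = _
        rw [if_pos rfl, coeff_ofPoly, chi_eq_psi Q hN]
      rw [e1, e2] at h2
      exact h2.symm
    · rintro n ⟨u, i⟩ hx b
      show coeffZ n (if (u : ℕ) = 0 then -chi Q N N b i else 0) = 0
      rw [if_neg, map_zero]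
      intro hu
      exact hx ⟨i, Prod.ext (Fin.ext hu.symm) rfl⟩

end Quasidet

end MatPDO

/-! ### The right-hand side of the Adler identity for differential operators -/

section AdlerSums

variable {V : Type*} [Ring V] [Algebra ℂ V] [DiffSuperalgebra V]

open MatPDO

/-- Apply a linear endomorphism of `V[λ]` to the coefficients of a polynomial over `V[λ]`. -/
def mapOuter (T : Module.End ℂ V[X]) : Module.End ℂ V[X][X] :=
  Polynomial.lsum fun n => ((monomial n : V[X] →ₗ[V[X]] V[X][X]).restrictScalars ℂ) ∘ₗ T

theorem coeff_mapOuter (T : Module.End ℂ V[X]) (F : V[X][X]) (k : ℕ) :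
    (mapOuter T F).coeff k = T (F.coeff k) := by
  induction F using Polynomial.induction_on' with
  | add P Q hP hQ => simp only [map_add, coeff_add, hP, hQ]
  | monomial m a =>
    have : mapOuter T (monomial m a) = monomial m (T a) := by
      rw [mapOuter, lsum_apply, sum_monomial_index _ _ (by simp)]; rfl
    rw [this, coeff_monomial, coeff_monomial]; split_ifs <;> simp

/-- The operator `z - λ - ∂` on `V[λ][z]`. -/
def adjOp : Module.End ℂ V[X][X] := LinearMap.mulLeft ℂ (X : V[X][X]) - mapOuter lamD

theorem adjOp_apply (F : V[X][X]) : adjOp F = X * F - mapOuter lamD F := rfl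

/-- `P^*(λ - z)`, for the differential operator with symbol `P`. -/
def adjSymbol : V[X] →ₗ[ℂ] V[X][X] :=
  Polynomial.lsum fun n => (adjOp ^ n) ∘ₗ (CAlgHom.comp CAlgHom : V →ₐ[ℂ] V[X][X]).toLinearMap

theorem adjSymbol_monomial (n : ℕ) (a : V) :
    adjSymbol (monomial n a) = (adjOp ^ n) (C (C a)) := by
  simp only [adjSymbol, lsum_apply]; rw [sum_monomial_index _ _ (by simp)]; rfl

theorem adjSymbol_C (a : V) : adjSymbol (C a) = C (C a) := by
  rw [← monomial_zero_left, adjSymbol_monomial]; simp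

theorem adjSymbol_X_mul (P : V[X]) : adjSymbol (X * P) = adjOp (adjSymbol P) := by
  induction P using Polynomial.induction_on' with
  | add P Q hP hQ => simp only [mul_add, map_add, hP, hQ]
  | monomial m a =>
    rw [X_mul_monomial, adjSymbol_monomial, adjSymbol_monomial, pow_succ', Module.End.mul_apply]

theorem adjSymbol_eq_sum (P : V[X]) :
    adjSymbol P = P.sum fun n p => (adjOp ^ n) (C (C p)) := by
  simp only [adjSymbol, lsum_apply]; rfl

theorem mapOuter_mul_CC (F : V[X][X]) (g : V) :
    mapOuter lamD F * C (C g) + F * C (C (der g)) = mapOuter lamD (F * C (C g)) := by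
  ext k : 1
  rw [coeff_add, coeff_mul_C, coeff_mul_C, coeff_mapOuter, coeff_mapOuter, coeff_mul_C,
    lamD_mul_right, coeffMap_C]

/-- Under λ ↦ -λ-∂ the operator z-λ-∂ becomes multiplication by z+λ. -/
theorem mapOuter_subNeg_adjOp (F : V[X][X]) :
    mapOuter subNeg (adjOp F) = (X + C X) * mapOuter subNeg F := by
  ext k : 1
  rw [add_mul, coeff_add, coeff_C_mul, coeff_mapOuter, coeff_mapOuter, adjOp_apply, coeff_sub,
    coeff_mapOuter, map_sub, subNeg_lamD, sub_neg_eq_add]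
  cases k with
  | zero => simp
  | succ k => rw [coeff_X_mul, coeff_X_mul, coeff_mapOuter]

theorem adjOp_mul_toOuter (F : V[X][X]) (g : V[X]) :
    adjOp F * toOuter g =
      adjOp (F * toOuter g) + F * toOuter (coeffMap der g) := by
  induction g using Polynomial.induction_on' with
  | add P Q hP hQ => simp only [mul_add, map_add, hP, hQ]; abel
  | monomial m a =>
    have h : ∀ a : V, toOuter (monomial m a) = X ^ m * C (C a) := fun a => by
      rw [toOuter_monomial, ← C_mul_X_pow_eq_monomial, X_pow_mul]
    have hX : ∀ G : V[X][X], mapOuter lamD (X ^ m * G) = X ^ m * mapOuter lamD G := by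
      intro G
      ext k : 1
      rw [coeff_mapOuter, coeff_X_pow_mul', coeff_X_pow_mul']
      split_ifs
      · rw [coeff_mapOuter]
      · simp
    have hc : ∀ G H : V[X][X], G * (X ^ m * H) = X ^ m * (G * H) := fun G H => by
      rw [← mul_assoc, ← X_pow_mul, mul_assoc]
    rw [coeffMap_monomial, h, h, hc, hc, hc, adjOp_apply, adjOp_apply, hX, ← mapOuter_mul_CC,
      sub_mul, mul_sub, mul_add, mul_assoc, ← mul_assoc X (X ^ m), ← mul_assoc (X ^ m) X,
      ← pow_succ', ← pow_succ]
    abel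

theorem bigD_pow_shiftVar_mul (k : ℕ) (F : V[X][X]) :
    (bigD ^ k) ((X + C X) * F) = (X + C X) * (bigD ^ k) F := by
  induction k with
  | zero => rfl
  | succ k ih =>
    rw [pow_succ', Module.End.mul_apply, ih, add_comm X, bigD_shiftVar_mul]; rfl

theorem bigD_toOuter_shiftVar (g : V[X]) :
    bigD (toOuter g) = (X + C X) * toOuter g + toOuter (coeffMap der g) := by
  rw [bigD_toOuter, lamD_apply, map_add toOuter, toOuter_X_mul, ← add_assoc, ← add_mul,
    add_comm (C X)]

theorem CC_mul_shiftVar_mul (a : V) (F : V[X][X]) :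
    C (C a) * ((X + C X) * F) = (X + C X) * (C (C a) * F) := by
  rw [← mul_assoc, ← mul_assoc]
  congr 1
  rw [mul_add, add_mul, X_mul, ← C_mul, ← C_mul, X_mul]

/-- Skew-symmetry exchanges the two shapes in which a symbol enters the Adler identity: P*(λ-z)
multiplied by g(z) and P(z+λ+∂) applied to g(z). -/
theorem mapOuter_subNeg_adjSymbol_mul (P g : V[X]) :
    mapOuter subNeg (adjSymbol P * toOuter g) = act bigD P (toOuter g) := by
  induction P using Polynomial.induction_on' generalizing g with
  | add P Q hP hQ => simp only [add_mul, map_add, hP, hQ, LinearMap.add_apply]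
  | monomial m a =>
    rw [adjSymbol_monomial, act_monomial]
    induction m generalizing g with
    | zero =>
      rw [pow_zero, pow_zero, Module.End.one_apply, Module.End.one_apply, smul_eq_CC_mul]
      ext k : 1
      rw [coeff_mapOuter, coeff_C_mul, toOuter_apply, coeff_map, ← C_mul, subNeg_C]
    | succ m ih =>
      rw [pow_succ' adjOp, Module.End.mul_apply, adjOp_mul_toOuter, map_add,
        mapOuter_subNeg_adjOp, ih, ih, pow_succ bigD, Module.End.mul_apply, bigD_toOuter_shiftVar,
        map_add, bigD_pow_shiftVar_mul, smul_add, smul_eq_CC_mul _ ((X + C X) * _),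
        CC_mul_shiftVar_mul, ← smul_eq_CC_mul]

theorem mapOuter_subNeg_subNeg (F : V[X][X]) : mapOuter subNeg (mapOuter subNeg F) = F := by
  ext k : 1
  rw [coeff_mapOuter, coeff_mapOuter, subNeg_subNeg]

theorem mapOuter_subNeg_act (P g : V[X]) :
    mapOuter subNeg (act bigD P (toOuter g)) = adjSymbol P * toOuter g := by
  rw [← mapOuter_subNeg_adjSymbol_mul, mapOuter_subNeg_subNeg]

/-- The adjoint symbol is the skew image of the operator applied to 1; composing with multiplication
by `q` first amounts to applying the operator to `q`, whose skew image carries `q` as a factor. -/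
theorem adjSymbol_act_C (P : V[X]) (q : V) :
    adjSymbol (act lamD P (C q)) = adjSymbol P * C (C q) := by
  have h : ∀ P : V[X], adjSymbol P = mapOuter subNeg (act bigD P (C (C 1))) := fun P => by
    rw [← toOuter_C, mapOuter_subNeg_act, toOuter_C, C_1, C_1, mul_one]
  rw [h, act_act bigD_smul_V, act_C, ← toOuter_C q, ← mapOuter_subNeg_act, smul_eq_CC_mul,
    toOuter_C, ← C_mul, ← C_mul, mul_one]

/-- `∑ₙ zⁿ gₙ ↦ ∑ₙ (w+λ+∂)ⁿ gₙ`. -/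
def evalBigD : V[X][X] →ₗ[ℂ] V[X][X] :=
  Polynomial.lsum fun n => (bigD ^ n) ∘ₗ (CAlgHom : V[X] →ₐ[ℂ] V[X][X]).toLinearMap

theorem evalBigD_eq_sum (F : V[X][X]) : evalBigD F = F.sum fun n g => (bigD ^ n) (C g) := by
  simp only [evalBigD, lsum_apply]; rfl

theorem evalBigD_monomial (n : ℕ) (g : V[X]) : evalBigD (monomial n g) = (bigD ^ n) (C g) := by
  rw [evalBigD_eq_sum, sum_monomial_index _ _ (by simp)]

theorem bigD_pow_X_mul (k : ℕ) (F : V[X][X]) : (bigD ^ k) (X * F) = X * (bigD ^ k) F := by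
  induction k with
  | zero => rfl
  | succ k ih =>
    rw [pow_succ', Module.End.mul_apply, ih, bigD_X_mul]; rfl

theorem evalBigD_adjOp (F : V[X][X]) : evalBigD (adjOp F) = X * evalBigD F := by
  induction F using Polynomial.induction_on' with
  | add P Q hP hQ => simp only [mul_add, map_add, hP, hQ]
  | monomial m a =>
    have : mapOuter lamD (monomial m a) = monomial m (lamD a) := by
      rw [mapOuter, lsum_apply, sum_monomial_index _ _ (by simp)]; rfl
    rw [adjOp_apply, X_mul_monomial, this, map_sub, evalBigD_monomial, evalBigD_monomial,
      evalBigD_monomial, pow_succ, Module.End.mul_apply, bigD_C, map_add, bigD_pow_X_mul,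
      add_sub_cancel_right]

/-- At z = w+λ+∂ the operator z-λ-∂ becomes multiplication by w. This substitution is responsible
for the cancellation of negative powers of z in the Adler expression. -/
theorem evalBigD_adjSymbol (P : V[X]) : evalBigD (adjSymbol P) = toOuter P := by
  induction P using Polynomial.induction_on' with
  | add P Q hP hQ => simp only [map_add, hP, hQ]
  | monomial m a =>
    rw [adjSymbol_monomial, toOuter_monomial]
    induction m with
    | zero =>
      rw [pow_zero, Module.End.one_apply, ← monomial_zero_left, evalBigD_monomial]; rfl
    | succ m ih => rw [pow_succ', Module.End.mul_apply, evalBigD_adjOp, ih, X_mul_monomial]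

theorem coeffZ_bigD (k : ℤ) (F : V[X][X]) :
    coeffZ k (bigD F) = coeffZ (k - 1) F + lamD (coeffZ k F) := by
  rcases lt_or_ge k 0 with hk | hk
  · rw [coeffZ_of_neg hk, coeffZ_of_neg hk, coeffZ_of_neg (by omega), map_zero, add_zero]
  · obtain ⟨k, rfl⟩ := Int.eq_ofNat_of_zero_le hk
    rw [coeffZ_natCast, coeffZ_natCast, coeff_bigD]
    cases k with
    | zero => rw [coeffZ_of_neg (by simp)]; simp
    | succ k => rw [coeff_X_mul, ← coeffZ_natCast]; simp

theorem coeffZ_adjOp (k : ℤ) (F : V[X][X]) :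
    coeffZ k (adjOp F) = coeffZ (k - 1) F + (-lamD) (coeffZ k F) := by
  rcases lt_or_ge k 0 with hk | hk
  · rw [coeffZ_of_neg hk, coeffZ_of_neg hk, coeffZ_of_neg (by omega), map_zero, add_zero]
  · obtain ⟨k, rfl⟩ := Int.eq_ofNat_of_zero_le hk
    rw [coeffZ_natCast, coeffZ_natCast, adjOp_apply, coeff_sub, coeff_mapOuter, sub_eq_add_neg]
    cases k with
    | zero => rw [coeffZ_of_neg (by simp)]; simp
    | succ k => rw [coeff_X_mul, ← coeffZ_natCast]; simp

theorem coeffZ_C (k : ℤ) (g : V[X]) : coeffZ k (C g) = if k = 0 then g else 0 := by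
  rcases lt_or_ge k 0 with hk | hk
  · rw [coeffZ_of_neg hk, if_neg hk.ne]
  · obtain ⟨k, rfl⟩ := Int.eq_ofNat_of_zero_le hk
    rw [coeffZ_natCast, coeff_C]; simp

section

variable {D : Module.End ℂ V[X][X]} {T : Module.End ℂ V[X]}

theorem coeffZ_pow_C (h : ∀ n P, coeffZ n (D P) = coeffZ (n - 1) P + T (coeffZ n P)) {k c : ℕ}
    {q : ℤ} (hq : q + c = k) (g : V[X]) :
    coeffZ q ((D ^ k) (C g)) = Ring.choose (q + c) c • (T ^ c) g := by
  rw [coeffZ_pow h, hq, Ring.choose_natCast, natCast_zsmul]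
  by_cases hc : c ≤ k
  · rw [Finset.sum_eq_single c]
    · rw [coeffZ_C, if_pos (by omega)]
    · intro l _ hl
      rw [coeffZ_C, if_neg (by omega), map_zero, smul_zero]
    · intro h
      simp at h
      omega
  · rw [Nat.choose_eq_zero_of_lt (by omega), zero_smul]
    refine Finset.sum_eq_zero fun l hl => ?_
    rw [coeffZ_C, if_neg (by simp at hl; omega), map_zero, smul_zero]

theorem coeffZ_pow_C_of_lt (h : ∀ n P, coeffZ n (D P) = coeffZ (n - 1) P + T (coeffZ n P)) {k : ℕ}
    {q : ℤ} (hq : (k : ℤ) < q) (g : V[X]) : coeffZ q ((D ^ k) (C g)) = 0 := by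
  rw [coeffZ_pow h]
  refine Finset.sum_eq_zero fun l hl => ?_
  rw [coeffZ_C, if_neg (by omega), map_zero, smul_zero]

end

theorem finsum_nat_offset {M : Type*} [AddCommMonoid M] (f : ℕ → M) {k K : ℕ}
    (hf : ∀ t < k, f t = 0) (hK : ∀ t, k + K ≤ t → f t = 0) :
    ∑ᶠ t, f t = ∑ t ∈ Finset.range K, f (t + k) := by
  rw [finsum_eq_sum_of_support_subset (s := Finset.range (k + K)), Finset.sum_range_add,
    Finset.sum_eq_zero fun t ht => hf t (Finset.mem_range.1 ht), zero_add]
  · simp only [add_comm k]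
  · intro t ht
    rw [Finset.coe_range, Set.mem_Iio]
    by_contra h
    exact ht (hK t (by omega))

/-- For a differential operator the formal expansion in large z is a polynomial, so the generalised
binomial sum can be replaced by an actual coefficient. -/
theorem adjCoeff_coeffZ (P : V[X]) (q : ℤ) :
    adjCoeff (fun k => coeffZ k P) q = coeffZ q (adjSymbol P) := by
  -- For q < 0 either q + c is negative and the coefficient of the operator is zero, or 0 ≤ q + c <
  -- c and the binomial coefficient is zero.
  have hch : ∀ c : ℕ, q < 0 → Ring.choose (q + c) c •
      (((-lamD) ^ c : Module.End ℂ V[X]) (C (coeffZ (q + c) P))) = 0 := by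
    intro c hq
    rcases lt_or_ge (q + c) 0 with h | h
    · rw [coeffZ_of_neg h, C_0, map_zero, smul_zero]
    · obtain ⟨k, hk⟩ := Int.eq_ofNat_of_zero_le h
      rw [hk, Ring.choose_natCast, Nat.choose_eq_zero_of_lt (by omega), Nat.cast_zero, zero_smul]
  rcases lt_or_ge q 0 with hq | hq
  · rw [coeffZ_of_neg hq]
    exact finsum_eq_zero_of_forall_eq_zero fun c => hch c hq
  · obtain ⟨q, rfl⟩ := Int.eq_ofNat_of_zero_le hq
    have h0 : ∀ k : ℕ, P.natDegree < k → coeffZ (k : ℤ) P = 0 := fun k hk => by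
      rw [coeffZ_natCast]; exact coeff_eq_zero_of_natDegree_lt hk
    rw [adjSymbol_eq_sum, sum_over_range' _ (by simp) (q + (P.natDegree + 1)) (by omega), map_sum,
      Finset.sum_range_add, Finset.sum_eq_zero, zero_add, adjCoeff,
      finsum_nat_offset (k := 0) (K := P.natDegree + 1) _ (by omega)]
    · refine Finset.sum_congr rfl fun c _ => ?_
      rw [coeffZ_pow_C coeffZ_adjOp (k := q + c) (c := c) (by push_cast; ring), add_zero,
        show (q : ℤ) + c = ((q + c : ℕ) : ℤ) by push_cast; ring, coeffZ_natCast]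
    · intro c hc
      rw [show (q : ℤ) + c = ((q + c : ℕ) : ℤ) by push_cast; ring, h0 _ (by omega), C_0, map_zero,
        smul_zero]
    · intro k hk
      exact coeffZ_pow_C_of_lt coeffZ_adjOp (by simpa using hk) _

theorem shiftCoeff_coeffZ (P : V[X]) (t : ℕ) (g : V[X]) (s : ℤ) :
    shiftCoeff (fun k => coeffZ k P) t g s = coeffZ s (act bigD P ((bigD ^ t) (C g))) := by
  rcases lt_or_ge s 0 with hs | hs
  · rw [coeffZ_of_neg hs]
    refine finsum_eq_zero_of_forall_eq_zero fun c => ?_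
    dsimp only
    rcases lt_or_ge (s + c) 0 with h | h
    · rw [coeffZ_of_neg (by omega), C_0, zero_mul, smul_zero]
    · obtain ⟨k, hk⟩ := Int.eq_ofNat_of_zero_le h
      rw [hk, Ring.choose_natCast, Nat.choose_eq_zero_of_lt (by omega), Nat.cast_zero, zero_smul]
  · obtain ⟨s, rfl⟩ := Int.eq_ofNat_of_zero_le hs
    set G : ℕ → V[X] := fun k => C (coeffZ ((k : ℤ) - t) P) * coeffZ (s : ℤ) ((bigD ^ k) (C g))
      with hG
    have h0 : ∀ k : ℕ, t + P.natDegree < k → coeffZ ((k : ℤ) - t) P = 0 := fun k hk => by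
      obtain ⟨l, hl⟩ := Int.eq_ofNat_of_zero_le (show 0 ≤ (k : ℤ) - t by omega)
      rw [hl, coeffZ_natCast]; exact coeff_eq_zero_of_natDegree_lt (by omega)
    have h1 : coeffZ (s : ℤ) (act bigD P ((bigD ^ t) (C g))) = ∑ᶠ k, G k := by
      rw [finsum_nat_offset G (k := t) (K := P.natDegree + 1), act_eq_sum, sum_over_range,
        map_sum]
      · refine Finset.sum_congr rfl fun k _ => ?_
        rw [← Module.End.mul_apply, ← pow_add, smul_eq_CC_mul, ← smul_eq_C_mul (C (P.coeff k)),
          map_smul, hG, smul_eq_mul]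
        simp only
        rw [show ((k + t : ℕ) : ℤ) - t = k by push_cast; ring, coeffZ_natCast, coeffZ_natCast]
      · simp
      · intro k hk
        simp only [hG]
        rw [coeffZ_of_neg (by omega), C_0, zero_mul]
      · intro k hk
        simp only [hG]
        rw [h0 k (by omega), C_0, zero_mul]
    rw [h1, shiftCoeff, finsum_nat_offset G (k := s) (K := t + P.natDegree + 1),
      finsum_nat_offset (k := 0) (K := t + P.natDegree + 1) _ (by omega)]
    · refine Finset.sum_congr rfl fun c _ => ?_
      simp only [hG, add_zero]
      rw [coeffZ_pow_C coeffZ_bigD (k := c + s) (c := c) (by push_cast; ring), mul_smul_comm,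
        show (s : ℤ) + c = ((c + s : ℕ) : ℤ) by push_cast; ring]
    · intro c hc
      rw [show (s : ℤ) + c = ((c + s : ℕ) : ℤ) by push_cast; ring, h0 _ (by omega), C_0, zero_mul,
        smul_zero]
    · intro k hk
      simp only [hG]
      rw [coeffZ_pow_C_of_lt coeffZ_bigD (by exact_mod_cast hk), mul_zero]
    · intro k hk
      simp only [hG]
      rw [h0 k (by omega), C_0, zero_mul]

theorem coeffZ_smul (s : ℤ) (a : V) (F : V[X][X]) : coeffZ s (a • F) = C a * coeffZ s F := by
  rw [smul_eq_CC_mul, ← smul_eq_C_mul (C a), map_smul, smul_eq_mul]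

theorem coeffZ_toOuter (k : ℤ) (R : V[X]) : coeffZ k (toOuter R) = C (coeffZ k R) := by
  rcases lt_or_ge k 0 with hk | hk
  · rw [coeffZ_of_neg hk, coeffZ_of_neg hk, C_0]
  · obtain ⟨k, rfl⟩ := Int.eq_ofNat_of_zero_le hk
    rw [coeffZ_natCast, coeffZ_natCast, toOuter_apply, coeff_map]

theorem adlerPlain_coeffZ (P R : V[X]) (r s : ℤ) :
    adlerPlain (fun k => coeffZ k P) (fun k => coeffZ k R) r s =
      ∑ᶠ t : ℕ, coeffZ s (coeffZ (r + t + 1) P • (bigD ^ t) (toOuter R)) := by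
  refine finsum_congr fun t => ?_
  have h := coeffZ_pow (R := V[X]) (D := bigD) (T := lamD) coeffZ_bigD t s (toOuter R)
  rw [coeffZ_smul, h]
  congr 1
  refine Finset.sum_congr rfl fun c hc => ?_
  rw [coeffZ_toOuter, Nat.cast_sub (by simpa [Nat.lt_succ_iff] using hc)]
  congr 5
  ring

theorem adlerStar_coeffZ (P R : V[X]) (r s : ℤ) :
    adlerStar (fun k => coeffZ k P) (fun k => coeffZ k R) r s =
      ∑ᶠ t : ℕ, coeffZ s (act bigD P ((bigD ^ t) (C (coeffZ (r + t + 1) (adjSymbol R))))) :=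
  finsum_congr fun t => by rw [adjCoeff_coeffZ, shiftCoeff_coeffZ]

/-- The right-hand side of the Adler identity for differential operators, `r ≥ 0`. -/
theorem adler_coeffZ_natCast (P R : V[X]) (r : ℕ) (s : ℤ) {K : ℕ} (hP : P.natDegree < K)
    (hR : (adjSymbol R).natDegree < K) :
    adlerPlain (fun k => coeffZ k P) (fun k => coeffZ k R) r s -
      adlerStar (fun k => coeffZ k P) (fun k => coeffZ k R) r s =
    coeffZ s (∑ t ∈ Finset.range K, P.coeff (r + t + 1) • (bigD ^ t) (toOuter R) -
      act bigD P (∑ t ∈ Finset.range K, (bigD ^ t) (C ((adjSymbol R).coeff (r + t + 1))))) := by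
  have hz : ∀ t : ℕ, (r : ℤ) + t + 1 = ((r + t + 1 : ℕ) : ℤ) := fun t => by push_cast; ring
  rw [adlerPlain_coeffZ, adlerStar_coeffZ, finsum_nat_offset (k := 0) (K := K) _ (by omega),
    finsum_nat_offset (k := 0) (K := K) _ (by omega), map_sub, map_sum, map_sum, map_sum]
  · simp only [hz, coeffZ_natCast, add_zero]
  · intro t ht
    rw [hz, coeffZ_natCast, coeff_eq_zero_of_natDegree_lt (by omega), C_0, map_zero, map_zero,
      map_zero]
  · intro t ht
    rw [hz, coeffZ_natCast, coeff_eq_zero_of_natDegree_lt (by omega), zero_smul, map_zero]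

/-- The right-hand side of the Adler identity for differential operators vanishes for `r < 0`. -/
theorem adler_coeffZ_of_neg (P R : V[X]) {r : ℤ} (hr : r < 0) (s : ℤ) :
    adlerPlain (fun k => coeffZ k P) (fun k => coeffZ k R) r s =
      adlerStar (fun k => coeffZ k P) (fun k => coeffZ k R) r s := by
  obtain ⟨k, rfl⟩ : ∃ k : ℕ, r = -k - 1 := ⟨(-r - 1).toNat, by omega⟩
  have hz : ∀ t : ℕ, -(k : ℤ) - 1 + ((t + k : ℕ) : ℤ) + 1 = t := fun t => by push_cast; ring
  obtain ⟨K, hP, hR⟩ : ∃ K, P.natDegree < K ∧ (adjSymbol R).natDegree < K :=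
    ⟨P.natDegree + (adjSymbol R).natDegree + 1, by omega, by omega⟩
  rw [adlerPlain_coeffZ, adlerStar_coeffZ, finsum_nat_offset (k := k) (K := K),
    finsum_nat_offset (k := k) (K := K)]
  · simp only [hz, coeffZ_natCast, ← map_sum]
    congr 1
    -- Terms with t < k have dropped out, so all coefficients of R*(λ-z) are present and their sum
    -- against powers of w+λ+∂ is the evaluation of `evalBigD_adjSymbol`; an extra k-th power
    -- remains in front.
    have h1 : ∑ t ∈ Finset.range K, (bigD ^ (t + k)) (C ((adjSymbol R).coeff t)) =
        (bigD ^ k) (toOuter R) := by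
      rw [← evalBigD_adjSymbol R, evalBigD_eq_sum, sum_over_range' _ (by simp) K hR, map_sum]
      refine Finset.sum_congr rfl fun t _ => ?_
      rw [add_comm, pow_add]; rfl
    rw [h1, act_eq_sum, sum_over_range' _ (by simp) K hP]
    refine Finset.sum_congr rfl fun t _ => ?_
    rw [pow_add]; rfl
  · intro t ht
    have h0 : coeffZ (-(k : ℤ) - 1 + t + 1) (adjSymbol R) = 0 := coeffZ_of_neg (by omega) _
    rw [h0, C_0, map_zero, map_zero, map_zero]
  · intro t ht
    obtain ⟨l, rfl⟩ := Nat.exists_eq_add_of_le ht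
    rw [show k + K + l = (K + l) + k by ring, hz, coeffZ_natCast,
      coeff_eq_zero_of_natDegree_lt (by omega), C_0, map_zero, map_zero, map_zero]
  · intro t ht
    have h0 : coeffZ (-(k : ℤ) - 1 + t + 1) P = 0 := coeffZ_of_neg (by omega) _
    rw [h0, zero_smul, map_zero]
  · intro t ht
    obtain ⟨l, rfl⟩ := Nat.exists_eq_add_of_le ht
    rw [show k + K + l = (K + l) + k by ring, hz, coeffZ_natCast,
      coeff_eq_zero_of_natDegree_lt (by omega), zero_smul, map_zero]

end AdlerSums

/-! ### Bilinear sums over the left and right solutions of a Hessenberg system -/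

section HessPair

variable {V : Type*} [Ring V] [Algebra ℂ V] [DiffSuperalgebra V]
variable {H T : Type*} [Fintype H] [DecidableEq H] [Fintype T] [DecidableEq T]

/-- `(∂ + b) ∘ ψ = ε e_last ∘ ℓ` and `χ ∘ (∂ + b) = ε ℓ ∘ e_first`, with `ψ = 1` at the first block
and `χ = 1` at the last one. -/
structure IsHessPair (b : H → H → V) (ψ : H → T → V[X]) (χ : T → H → V[X]) (ℓ : T → T → V[X])
    (ε : ℂ) (fst lst : T → H) : Prop where
  eps_mul : ε * ε = 1
  psi_eq : ∀ x c, lamD (ψ x c) + ∑ y, C (b x y) * ψ y c =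
    ∑ t, if x = lst t then ε • ℓ t c else 0
  chi_eq : ∀ a y, X * χ a y + ∑ x, act lamD (χ a x) (C (b x y)) =
    ∑ t, if y = fst t then ε • ℓ a t else 0
  psi_fst : ∀ t c, ψ (fst t) c = if t = c then 1 else 0
  chi_lst : ∀ a t, χ a (lst t) = if a = t then 1 else 0

variable {b : H → H → V} {ψ : H → T → V[X]} {χ : T → H → V[X]} {ℓ : T → T → V[X]} {ε : ℂ}
  {fst lst : T → H}

theorem sum_map_sum_ite {M M' : Type*} [AddCommMonoid M] [AddCommMonoid M'] (f : H → M →+ M')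
    (g : T → H) (Y : T → M) :
    ∑ x, f x (∑ t, if x = g t then Y t else 0) = ∑ t, f (g t) (Y t) := by
  simp only [map_sum]
  rw [Finset.sum_comm]
  refine Finset.sum_congr rfl fun t _ => ?_
  rw [Finset.sum_eq_single (g t)]
  · rw [if_pos rfl]
  · intro x _ hx; rw [if_neg hx, map_zero]
  · simp

theorem act_bigD_X_mul (P : V[X]) (G : V[X][X]) : act bigD (X * P) G = act bigD P (bigD G) := by
  have := act_mul_X_pow bigD P 1 G
  rwa [pow_one, ← X_mul, pow_one] at this

namespace IsHessPair

/-- The row χ is paired with an arbitrary column on which ∂ acts as w+λ+∂; moving ∂+b from the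
column to χ leaves only the first block. -/
theorem sum_act_chi (hp : IsHessPair b ψ χ ℓ ε fst lst) (a : T) (G : H → V[X][X]) :
    ∑ x, act bigD (χ a x) (bigD (G x) + ∑ y, b x y • G y) =
      ε • ∑ t, act bigD (ℓ a t) (G (fst t)) := by
  have h1 : ∑ x, act bigD (χ a x) (bigD (G x) + ∑ y, b x y • G y) =
      ∑ y, act bigD (X * χ a y + ∑ x, act lamD (χ a x) (C (b x y))) (G y) := by
    simp only [map_add, LinearMap.add_apply, Finset.sum_add_distrib, map_sum, LinearMap.sum_apply,
      act_bigD_X_mul, act_act (D := bigD (V := V)) bigD_smul_V, act_C]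
    rw [Finset.sum_comm]
  rw [h1]
  simp only [hp.chi_eq]
  have h2 := sum_map_sum_ite (fun y => ((act bigD).flip (G y) : V[X] →ₗ[ℂ] V[X][X]).toAddMonoidHom)
    fst (fun t => ε • ℓ a t)
  simp only [LinearMap.toAddMonoidHom_coe, LinearMap.flip_apply] at h2
  rw [h2, Finset.smul_sum]
  refine Finset.sum_congr rfl fun t _ => ?_
  rw [map_smul, LinearMap.smul_apply]

end IsHessPair

/-- `∑ₕ χₐₕ(w+λ+∂) pₕ`. -/
def chiSum (χ : T → H → V[X]) (a : T) (p : H → V) : Module.End ℂ V[X][X] :=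
  ∑ h, (act bigD (χ a h)) ∘ₗ Algebra.lsmul ℂ ℂ V[X][X] (p h)

theorem chiSum_apply (a : T) (p : H → V) (G : V[X][X]) :
    chiSum χ a p G = ∑ h, act bigD (χ a h) (p h • G) := by
  simp [chiSum]

/-- The coefficient of `z^e` of `ε ∑ₕ χ_{ch}(w+λ+∂) ψ_{hb}(z)`. -/
def theta (ψ : H → T → V[X]) (χ : T → H → V[X]) (ε : ℂ) (c b : T) (e : ℕ) : Module.End ℂ V[X][X] :=
  ε • chiSum χ c fun h => (ψ h b).coeff e

/-- The coefficient of `z^f` of `ε ∑ₖ (χ_{ak})^*(λ-z) ψ_{kd}(w)`. -/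
def xi (ψ : H → T → V[X]) (χ : T → H → V[X]) (ε : ℂ) (a d : T) (f : ℕ) : V[X][X] :=
  ε • ∑ k, C ((adjSymbol (χ a k)).coeff f) * toOuter (ψ k d)

namespace IsHessPair

/-- Apply `sum_act_chi` to the column of z^e-coefficients of ψ(z) and use the equation of ψ. As a
generating function in z, with D = w+λ+∂, it reads θ(z)(z-D) = ℓ(z) - ℓ(D). -/
theorem chiSum_rec (hp : IsHessPair b ψ χ ℓ ε fst lst) (c d : T) (e : ℕ) (G : V[X][X]) :
    chiSum χ c (fun h => (X * ψ h d).coeff e) G + ε • (if e = 0 then act bigD (ℓ c d) G else 0) =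
      chiSum χ c (fun h => (ψ h d).coeff e) (bigD G) + ε • ((ℓ c d).coeff e • G) := by
  have h := hp.sum_act_chi c fun h => (ψ h d).coeff e • G
  have hx : ∀ x, bigD ((ψ x d).coeff e • G) + ∑ y, b x y • (ψ y d).coeff e • G =
      (ψ x d).coeff e • bigD G + (∑ t, if x = lst t then ε • (ℓ t d).coeff e • G else 0) -
        (X * ψ x d).coeff e • G := by
    intro x
    have hc := congrArg (fun P => P.coeff e • G) (hp.psi_eq x d)
    simp only [coeff_add, coeff_lamD, finsetSum_coeff, coeff_C_mul, add_smul, Finset.sum_smul,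
      mul_smul] at hc
    have hs : ∑ t, (if x = lst t then ε • ℓ t d else 0).coeff e • G =
        ∑ t, if x = lst t then ε • (ℓ t d).coeff e • G else 0 := by
      refine Finset.sum_congr rfl fun t _ => ?_
      split_ifs
      · rw [coeff_smul, smul_assoc]
      · simp
    rw [← hs, ← hc, bigD_smul_V]
    abel
  simp only [hx, map_sub, map_add, Finset.sum_sub_distrib, Finset.sum_add_distrib] at h
  have h2 := sum_map_sum_ite (fun x => (act bigD (χ c x) : V[X][X] →ₗ[ℂ] V[X][X]).toAddMonoidHom)
    lst (fun t => ε • (ℓ t d).coeff e • G)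
  simp only [LinearMap.toAddMonoidHom_coe] at h2
  rw [h2] at h
  have h3 : ∑ t, act bigD (χ c (lst t)) (ε • (ℓ t d).coeff e • G) =
      ε • (ℓ c d).coeff e • G := by
    rw [Finset.sum_eq_single c]
    · rw [hp.chi_lst, if_pos rfl, act_one]
    · intro t _ ht; rw [hp.chi_lst, if_neg ht.symm, map_zero, LinearMap.zero_apply]
    · simp
  have h4 : ∑ t, act bigD (ℓ c t) ((ψ (fst t) d).coeff e • G) =
      if e = 0 then act bigD (ℓ c d) G else 0 := by
    rw [Finset.sum_eq_single d]
    · rw [hp.psi_fst, if_pos rfl, coeff_one]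
      split_ifs <;> simp
    · intro t _ ht; rw [hp.psi_fst, if_neg ht]; simp
    · simp
  rw [h3, h4] at h
  rw [chiSum_apply, chiSum_apply, ← h]
  abel

theorem theta_zero (hp : IsHessPair b ψ χ ℓ ε fst lst) (c d : T) (G : V[X][X]) :
    act bigD (ℓ c d) G = theta ψ χ ε c d 0 (bigD G) + (ℓ c d).coeff 0 • G := by
  have h := congrArg (fun F => ε • F) (hp.chiSum_rec c d 0 G)
  have h0 : chiSum χ c (fun h => (X * ψ h d).coeff 0) G = 0 := by
    simp [chiSum_apply]
  simpa only [h0, zero_add, if_true, smul_add, smul_smul, hp.eps_mul, one_smul,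
    theta, LinearMap.smul_apply] using h

theorem theta_succ (hp : IsHessPair b ψ χ ℓ ε fst lst) (c d : T) (e : ℕ) (G : V[X][X]) :
    theta ψ χ ε c d e G = theta ψ χ ε c d (e + 1) (bigD G) + (ℓ c d).coeff (e + 1) • G := by
  have h := congrArg (fun F => ε • F) (hp.chiSum_rec c d (e + 1) G)
  simpa only [coeff_X_mul, Nat.succ_ne_zero, if_false, smul_zero, add_zero, smul_add, smul_smul,
    hp.eps_mul, one_smul, theta, LinearMap.smul_apply] using h

/-- Iterating the recursion divides by z-D for large z. Since ψ is polynomial in z, the remainder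
vanishes once K is large. -/
theorem theta_closed (hp : IsHessPair b ψ χ ℓ ε fst lst) (c d : T) (e K : ℕ) (G : V[X][X]) :
    theta ψ χ ε c d e G = ∑ t ∈ Finset.range K, (ℓ c d).coeff (e + t + 1) • (bigD ^ t) G +
      theta ψ χ ε c d (e + K) ((bigD ^ K) G) := by
  induction K with
  | zero => simp
  | succ K ih =>
    rw [ih, hp.theta_succ c d (e + K), Finset.sum_range_succ, pow_succ', Module.End.mul_apply,
      add_assoc e K 1]
    abel

theorem bigD_C_mul_toOuter (P g : V[X]) :
    bigD (C P * toOuter g) = C (lamD P) * toOuter g + C P * toOuter (lamD g) := by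
  induction g using Polynomial.induction_on' with
  | add P Q hP hQ => simp only [mul_add, map_add, hP, hQ]; abel
  | monomial m a =>
    rw [toOuter_monomial, C_mul_monomial, bigD_monomial, lamD_apply (monomial m a),
      coeffMap_monomial, X_mul_monomial, map_add toOuter, X_mul_monomial, toOuter_monomial,
      toOuter_monomial, mul_add, C_mul_monomial, C_mul_monomial, C_mul_monomial, lamD_mul_right,
      coeffMap_C, map_add]
    abel

/-- The counterpart of `chiSum_rec`, with the adjoint equation of χ in z and the equation of ψ in w.
It reads (z-D)ξ(z) = ℓ*(λ-z) - ℓ(w). -/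
theorem xi_rec (hp : IsHessPair b ψ χ ℓ ε fst lst) (a d : T) (f : ℕ) :
    ∑ k, C ((X * adjSymbol (χ a k)).coeff f) * toOuter (ψ k d) +
      (if f = 0 then ε • toOuter (ℓ a d) else 0) =
    bigD (∑ k, C ((adjSymbol (χ a k)).coeff f) * toOuter (ψ k d)) +
      ε • C ((adjSymbol (ℓ a d)).coeff f) := by
  have hchi : ∀ y, C ((X * adjSymbol (χ a y)).coeff f) - C (lamD ((adjSymbol (χ a y)).coeff f)) +
      ∑ x, C ((adjSymbol (χ a x)).coeff f) * C (C (b x y)) =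
      ∑ t, if y = fst t then ε • C ((adjSymbol (ℓ a t)).coeff f) else (0 : V[X][X]) := by
    intro y
    have h := congrArg (fun P => C ((adjSymbol P).coeff f)) (hp.chi_eq a y)
    simp only [map_add, map_sum, adjSymbol_X_mul, adjSymbol_act_C, coeff_add, finsetSum_coeff,
      coeff_mul_C, adjOp_apply, coeff_sub, coeff_mapOuter, C_mul, map_sub] at h
    rw [h]
    refine Finset.sum_congr rfl fun t _ => ?_
    split_ifs
    · rw [map_smul, coeff_smul, smul_C]
    · simp
  have hsum : ∑ y, (∑ t, if y = fst t then ε • C ((adjSymbol (ℓ a t)).coeff f) else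
      (0 : V[X][X])) * toOuter (ψ y d) = ε • C ((adjSymbol (ℓ a d)).coeff f) := by
    have h2 := sum_map_sum_ite (fun y => AddMonoidHom.mulRight (toOuter (ψ y d)))
      fst (fun t => ε • C ((adjSymbol (ℓ a t)).coeff f))
    simp only [AddMonoidHom.coe_mulRight] at h2
    rw [h2, Finset.sum_eq_single d]
    · rw [hp.psi_fst, if_pos rfl, ← C_1, toOuter_C, C_1, C_1, mul_one]
    · intro t _ ht; rw [hp.psi_fst, if_neg ht, map_zero, mul_zero]
    · simp
  have hpsi : ∀ x, ∑ y, C (C (b x y)) * toOuter (ψ y d) =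
      (∑ t, if x = lst t then ε • toOuter (ℓ t d) else 0) - toOuter (lamD (ψ x d)) := by
    intro x
    have h := congrArg toOuter (hp.psi_eq x d)
    simp only [map_add, map_sum, toOuter_C_mul] at h
    rw [eq_sub_iff_add_eq, add_comm, h]
    refine Finset.sum_congr rfl fun t _ => ?_
    split_ifs <;> simp
  have hlst : ∑ x, C ((adjSymbol (χ a x)).coeff f) *
      (∑ t, if x = lst t then ε • toOuter (ℓ t d) else 0) =
      if f = 0 then ε • toOuter (ℓ a d) else 0 := by
    have h2 := sum_map_sum_ite (fun x => AddMonoidHom.mulLeft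
      (C ((adjSymbol (χ a x)).coeff f) : V[X][X])) lst (fun t => ε • toOuter (ℓ t d))
    simp only [AddMonoidHom.coe_mulLeft] at h2
    rw [h2, Finset.sum_eq_single a]
    · rw [hp.chi_lst, if_pos rfl, ← C_1, adjSymbol_C, C_1, C_1, coeff_one]
      split_ifs <;> simp
    · intro t _ ht; rw [hp.chi_lst, if_neg ht.symm]; simp
    · simp
  rw [← hsum, ← hlst]
  simp only [← hchi, add_mul, sub_mul, Finset.sum_mul, Finset.sum_add_distrib,
    Finset.sum_sub_distrib, map_sum, bigD_C_mul_toOuter]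
  rw [Finset.sum_comm (f := fun y x => C ((adjSymbol (χ a x)).coeff f) * C (C (b x y)) *
    toOuter (ψ y d))]
  simp only [mul_assoc, ← Finset.mul_sum, hpsi, mul_sub, Finset.sum_sub_distrib]
  abel

theorem xi_zero (hp : IsHessPair b ψ χ ℓ ε fst lst) (a d : T) :
    toOuter (ℓ a d) = bigD (xi ψ χ ε a d 0) + C ((adjSymbol (ℓ a d)).coeff 0) := by
  have h := congrArg (fun F => ε • F) (hp.xi_rec a d 0)
  have h0 : ∑ k, C ((X * adjSymbol (χ a k)).coeff 0) * toOuter (ψ k d) = 0 := by simp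
  simpa only [h0, zero_add, if_true, smul_add, smul_smul, hp.eps_mul, one_smul, xi,
    map_smul] using h

theorem xi_succ (hp : IsHessPair b ψ χ ℓ ε fst lst) (a d : T) (f : ℕ) :
    xi ψ χ ε a d f = bigD (xi ψ χ ε a d (f + 1)) + C ((adjSymbol (ℓ a d)).coeff (f + 1)) := by
  have h := congrArg (fun F => ε • F) (hp.xi_rec a d (f + 1))
  simpa only [coeff_X_mul, Nat.succ_ne_zero, if_false, add_zero, smul_add, smul_smul, hp.eps_mul,
    one_smul, xi, map_smul] using h

theorem xi_closed (hp : IsHessPair b ψ χ ℓ ε fst lst) (a d : T) (f K : ℕ) :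
    xi ψ χ ε a d f = ∑ t ∈ Finset.range K, (bigD ^ t) (C ((adjSymbol (ℓ a d)).coeff (f + t + 1))) +
      (bigD ^ K) (xi ψ χ ε a d (f + K)) := by
  induction K with
  | zero => simp
  | succ K ih =>
    rw [ih, hp.xi_succ a d (f + K), Finset.sum_range_succ, map_add, pow_succ, Module.End.mul_apply,
      add_assoc f K 1]
    abel

/-- Substituting ℓ*(λ-z) = (z-D)ξ + ℓ(w) and θ(z-D) = ℓ(z) - ℓ(D) gives θℓ*(λ-z) - ℓ(z)ξ = θℓ(w) -
ℓ(D)ξ; the proof performs this coefficientwise in z. -/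
theorem sum_theta_sub_xi (hp : IsHessPair b ψ χ ℓ ε fst lst) (a c d j : T) (r : ℕ) :
    ∑ p ∈ Finset.HasAntidiagonal.antidiagonal r,
      (theta ψ χ ε c j p.1 (C ((adjSymbol (ℓ a d)).coeff p.2)) -
        (ℓ c j).coeff p.1 • xi ψ χ ε a d p.2) =
      theta ψ χ ε c j r (toOuter (ℓ a d)) - act bigD (ℓ c j) (xi ψ χ ε a d r) := by
  set Θ := theta ψ χ ε c j
  set Ξ := xi ψ χ ε a d
  have key : ∀ r, ∑ p ∈ Finset.HasAntidiagonal.antidiagonal r,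
      Θ p.1 (C ((adjSymbol (ℓ a d)).coeff p.2)) + ∑ p ∈ Finset.HasAntidiagonal.antidiagonal r,
        Θ p.1 (bigD (Ξ p.2)) = Θ r (toOuter (ℓ a d)) +
        ∑ p ∈ Finset.HasAntidiagonal.antidiagonal r, (if p.2 = 0 then 0 else Θ p.1 (Ξ (p.2 - 1))) := by
    intro r
    rw [← Finset.sum_add_distrib]
    cases r with
    | zero => simp [← map_add, hp.xi_zero a d, add_comm, Θ, Ξ]
    | succ r =>
      rw [Finset.Nat.sum_antidiagonal_succ', Finset.Nat.sum_antidiagonal_succ', if_pos rfl,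
        zero_add, ← map_add, add_comm (C _), ← hp.xi_zero a d]
      congr 1
      refine Finset.sum_congr rfl fun p _ => ?_
      rw [← map_add, add_comm (C _), ← hp.xi_succ a d, if_neg (Nat.succ_ne_zero _)]
      rfl
  have key2 : ∀ r, ∑ p ∈ Finset.HasAntidiagonal.antidiagonal r, (ℓ c j).coeff p.1 • Ξ p.2 +
      ∑ p ∈ Finset.HasAntidiagonal.antidiagonal r, Θ p.1 (bigD (Ξ p.2)) =
        act bigD (ℓ c j) (Ξ r) +
        ∑ p ∈ Finset.HasAntidiagonal.antidiagonal r, (if p.1 = 0 then 0 else Θ (p.1 - 1) (Ξ p.2)) := by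
    intro r
    rw [← Finset.sum_add_distrib]
    cases r with
    | zero => simp [hp.theta_zero c j, add_comm, Θ]
    | succ r =>
      rw [Finset.Nat.sum_antidiagonal_succ, Finset.Nat.sum_antidiagonal_succ, if_pos rfl,
        zero_add, add_comm ((ℓ c j).coeff _ • _), ← hp.theta_zero c j]
      congr 1
      refine Finset.sum_congr rfl fun p _ => ?_
      rw [add_comm (_ • _), ← hp.theta_succ c j, if_neg (Nat.succ_ne_zero _)]
      rfl
  -- Both sums run over the pairs with total r - 1, that is, they are the coefficient of z^r in z
  -- θ(z) ξ(z).
  have key3 : ∀ r, ∑ p ∈ Finset.HasAntidiagonal.antidiagonal r,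
      (if p.2 = 0 then 0 else Θ p.1 (Ξ (p.2 - 1))) =
      ∑ p ∈ Finset.HasAntidiagonal.antidiagonal r, (if p.1 = 0 then 0 else Θ (p.1 - 1) (Ξ p.2)) := by
    intro r
    cases r with
    | zero => simp
    | succ r =>
      rw [Finset.Nat.sum_antidiagonal_succ', Finset.Nat.sum_antidiagonal_succ]
      simp
  rw [Finset.sum_sub_distrib, sub_eq_sub_iff_add_eq_add]
  have h1 := key r
  have h2 := key2 r
  rw [key3 r] at h1
  have h3 := congrArg₂ (· - ·) h1 h2
  simp only [add_sub_add_right_eq_sub] at h3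
  exact sub_eq_sub_iff_add_eq_add.1 h3

/-- Taking `K` above all degrees in z removes both remainders, and the closed forms of θ and ξ are
the expansions occurring in `adler_coeffZ_natCast`. -/
theorem sum_theta_sub_xi_closed (hp : IsHessPair b ψ χ ℓ ε fst lst) (a c d j : T) (r : ℕ) {K : ℕ}
    (hψ : ∀ h, (ψ h j).natDegree < K) (hχ : ∀ h, (adjSymbol (χ a h)).natDegree < K) :
    ∑ p ∈ Finset.HasAntidiagonal.antidiagonal r,
      (theta ψ χ ε c j p.1 (C ((adjSymbol (ℓ a d)).coeff p.2)) -
        (ℓ c j).coeff p.1 • xi ψ χ ε a d p.2) =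
      ∑ t ∈ Finset.range K, (ℓ c j).coeff (r + t + 1) • (bigD ^ t) (toOuter (ℓ a d)) -
      act bigD (ℓ c j)
        (∑ t ∈ Finset.range K, (bigD ^ t) (C ((adjSymbol (ℓ a d)).coeff (r + t + 1)))) := by
  have h1 : theta ψ χ ε c j (r + K) = 0 := by
    refine LinearMap.ext fun G => ?_
    rw [theta, LinearMap.smul_apply, chiSum_apply, Finset.sum_eq_zero, smul_zero,
      LinearMap.zero_apply]
    intro h _
    rw [coeff_eq_zero_of_natDegree_lt (lt_of_lt_of_le (hψ h) (by omega)), zero_smul, map_zero]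
  have h2 : xi ψ χ ε a d (r + K) = 0 := by
    rw [xi, Finset.sum_eq_zero, smul_zero]
    intro h _
    rw [coeff_eq_zero_of_natDegree_lt (lt_of_lt_of_le (hχ h) (by omega)), C_0, zero_mul]
  rw [hp.sum_theta_sub_xi, hp.theta_closed c j r K, hp.xi_closed a d r K, h1, h2,
    LinearMap.zero_apply, add_zero, map_zero, add_zero]

/-- The commutator of b with an elementary matrix, between χ and ψ. The equation of ψ trades b for
w+∂ on ψ, that of χ trades it for w+λ+∂; the difference is λ times the sandwich and cancels against
the last term on the left, which comes from the level. Only boundary terms remain. -/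
theorem variation (hp : IsHessPair b ψ χ ℓ ε fst lst) (c d : T) (i j : H) :
    ∑ y, act bigD (χ c j) (b i y • toOuter (ψ y d)) -
      ∑ x, act bigD (χ c x) (b x j • toOuter (ψ i d)) -
      act bigD (χ c j) (C X * toOuter (ψ i d)) =
    ε • (∑ t, (if i = lst t then act bigD (χ c j) (toOuter (ℓ t d)) else 0) -
      ∑ t, if j = fst t then act bigD (ℓ c t) (toOuter (ψ i d)) else 0) := by
  have h1 : ∑ y, act bigD (χ c j) (b i y • toOuter (ψ y d)) =
      ε • ∑ t, (if i = lst t then act bigD (χ c j) (toOuter (ℓ t d)) else 0) -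
        act bigD (χ c j) (toOuter (lamD (ψ i d))) := by
    have h := congrArg (fun P => act bigD (χ c j) (toOuter P)) (hp.psi_eq i d)
    simp only [map_add, map_sum, toOuter_C_mul, ← smul_eq_CC_mul] at h
    rw [eq_sub_iff_add_eq, add_comm, h, Finset.smul_sum]
    refine Finset.sum_congr rfl fun t _ => ?_
    split_ifs <;> simp
  have h2 : ∑ x, act bigD (χ c x) (b x j • toOuter (ψ i d)) =
      ε • ∑ t, (if j = fst t then act bigD (ℓ c t) (toOuter (ψ i d)) else 0) -
        act bigD (χ c j) (bigD (toOuter (ψ i d))) := by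
    have h := congrArg (fun P => act bigD P (toOuter (ψ i d))) (hp.chi_eq c j)
    simp only [map_add, map_sum, LinearMap.add_apply, LinearMap.sum_apply, act_bigD_X_mul,
      act_act (D := bigD (V := V)) bigD_smul_V, act_C] at h
    rw [eq_sub_iff_add_eq, add_comm, h, Finset.smul_sum]
    refine Finset.sum_congr rfl fun t _ => ?_
    split_ifs <;> simp
  rw [h1, h2, bigD_toOuter, map_add, smul_sub]
  abel

section Parity

variable {π : T → ZMod 2} {ϖ : H → ZMod 2}

theorem coeff_mul_toOuter {i j : ZMod 2} {F : V[X][X]} (hF : ∀ k, IsHomogPoly i (F.coeff k))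
    {P : V[X]} (hP : IsHomogPoly j P) (r : ℕ) : (F * toOuter P).coeff r =
      sgn (i * j) • ∑ p ∈ Finset.HasAntidiagonal.antidiagonal r,
        C (P.coeff p.1) * F.coeff p.2 := by
  rw [coeff_mul, ← Finset.Nat.sum_antidiagonal_swap, Finset.smul_sum]
  refine Finset.sum_congr rfl fun p _ => ?_
  rw [toOuter_apply, coeff_map, C_mul_homog (hP _) (hF _), smul_smul, mul_comm i j, sgn_mul_self,
    one_smul]
  rfl

theorem isHomogPoly_adjSymbol {i : ZMod 2} {P : V[X]} (hP : IsHomogPoly i P) (k : ℕ) :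
    IsHomogPoly i ((adjSymbol P).coeff k) := by
  have hD : ∀ F : V[X][X], (∀ k, IsHomogPoly i (F.coeff k)) →
      ∀ k, IsHomogPoly i ((adjOp F).coeff k) := by
    intro F hF k
    rw [adjOp_apply, coeff_sub, coeff_mapOuter, sub_eq_add_neg]
    refine IsHomogPoly.add ?_ (hF k).lamD.neg
    cases k with
    | zero => rw [coeff_X_mul_zero]; exact fun n => by rw [coeff_zero]; exact isHomog_zero _
    | succ k => rw [coeff_X_mul]; exact hF k
  rw [adjSymbol_eq_sum, sum_def, finsetSum_coeff]
  refine isHomogPoly_sum _ fun l _ => ?_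
  have : ∀ l v, IsHomog i v → ∀ k, IsHomogPoly i (((adjOp ^ l) (C (C v : V[X]))).coeff k) := by
    intro l v hv
    induction l with
    | zero =>
      intro k
      rw [pow_zero, Module.End.one_apply, coeff_C]
      split_ifs
      · exact hv.C
      · exact fun n => by rw [coeff_zero]; exact isHomog_zero _
    | succ l ih => rw [pow_succ', Module.End.mul_apply]; exact hD _ ih
  exact this l _ (hP l) k

/-- The inner factor is the boundary formula for the bracket with a generator. The normalisations of
ψ on the first block and χ on the last collapse the double sum to θ and ξ, and all signs depending
on the summation indices cancel. -/
theorem bracket_sum (hp : IsHessPair b ψ χ ℓ ε fst lst) (hfst : ∀ t, ϖ (fst t) = π t)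
    (hlst : ∀ t, ϖ (lst t) = π t) (hψ : ∀ x c, IsHomogPoly (ϖ x + π c) (ψ x c))
    (hχ : ∀ a x, IsHomogPoly (π a + ϖ x) (χ a x)) (hℓ : ∀ a c, IsHomogPoly (π a + π c) (ℓ a c))
    (a j c d : T) (r : ℕ) :
    ∑ h, ∑ k, act bigD (χ c h) (C (sgn (ϖ k * π j + ϖ h * ϖ k + π a * ϖ h) •
      (∑ t, (if k = fst t then adjSymbol (ℓ a t) * toOuter (ψ h j) else 0) -
        ∑ t, (if h = lst t then adjSymbol (χ a k) * toOuter (ℓ t j) else 0)).coeff r) *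
        toOuter (ψ k d)) =
      (ε * sgn (π a * π j)) • ∑ p ∈ Finset.HasAntidiagonal.antidiagonal r,
        (theta ψ χ ε c j p.1 (C ((adjSymbol (ℓ a d)).coeff p.2)) -
          (ℓ c j).coeff p.1 • xi ψ χ ε a d p.2) := by
  have h1 : ∀ h, ∑ k, act bigD (χ c h) (C (sgn (ϖ k * π j + ϖ h * ϖ k + π a * ϖ h) •
      (∑ t, (if k = fst t then adjSymbol (ℓ a t) * toOuter (ψ h j) else 0)).coeff r) *
        toOuter (ψ k d)) =
      sgn (π a * π j) • ∑ p ∈ Finset.HasAntidiagonal.antidiagonal r,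
        act bigD (χ c h) ((ψ h j).coeff p.1 • C ((adjSymbol (ℓ a d)).coeff p.2)) := by
    intro h
    have e : ∀ k, act bigD (χ c h) (C (sgn (ϖ k * π j + ϖ h * ϖ k + π a * ϖ h) •
        (∑ t, (if k = fst t then adjSymbol (ℓ a t) * toOuter (ψ h j) else 0)).coeff r) *
        toOuter (ψ k d)) = ∑ t, if k = fst t then act bigD (χ c h)
          (C (sgn (π t * π j + ϖ h * π t + π a * ϖ h) •
          (adjSymbol (ℓ a t) * toOuter (ψ h j)).coeff r) * toOuter (ψ (fst t) d)) else 0 := by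
      intro k
      rw [finsetSum_coeff, Finset.smul_sum, map_sum, Finset.sum_mul, map_sum]
      refine Finset.sum_congr rfl fun t _ => ?_
      split_ifs with hk
      · rw [hk, hfst]
      · simp
    simp only [e]
    -- The remaining column factor is ψ at the first block, the identity matrix.
    rw [Finset.sum_comm, Finset.sum_eq_single d]
    · rw [Finset.sum_eq_single (fst d)]
      · rw [if_pos rfl, hp.psi_fst, if_pos rfl, coeff_mul_toOuter
          (isHomogPoly_adjSymbol (hℓ a d)) (hψ h j), smul_smul, ← sgn_add]
        rw [show π d * π j + ϖ h * π d + π a * ϖ h + (π a + π d) * (ϖ h + π j) = π a * π j by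
          generalize π d = x; generalize π j = y; generalize ϖ h = z; generalize π a = w
          revert x y z w; decide]
        rw [← C_1, toOuter_C, C_1, C_1, mul_one, ← smul_C, map_smul, map_sum C, map_sum]
        simp only [smul_eq_CC_mul, C_mul]
      · intro k _ hk; rw [if_neg hk]
      · simp
    · intro t _ ht
      refine Finset.sum_eq_zero fun k _ => ?_
      rw [hp.psi_fst, if_neg ht, map_zero, mul_zero, map_zero, ite_self]
    · simp
  have h2 : ∀ k, ∑ h, act bigD (χ c h) (C (sgn (ϖ k * π j + ϖ h * ϖ k + π a * ϖ h) •
      (∑ t, (if h = lst t then adjSymbol (χ a k) * toOuter (ℓ t j) else 0)).coeff r) *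
        toOuter (ψ k d)) =
      sgn (π a * π j) • ∑ p ∈ Finset.HasAntidiagonal.antidiagonal r,
        (ℓ c j).coeff p.1 • (C ((adjSymbol (χ a k)).coeff p.2) * toOuter (ψ k d)) := by
    intro k
    have e : ∀ h, act bigD (χ c h) (C (sgn (ϖ k * π j + ϖ h * ϖ k + π a * ϖ h) •
        (∑ t, (if h = lst t then adjSymbol (χ a k) * toOuter (ℓ t j) else 0)).coeff r) *
        toOuter (ψ k d)) = ∑ t, if h = lst t then act bigD (χ c (lst t))
          (C (sgn (ϖ k * π j + π t * ϖ k + π a * π t) •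
          (adjSymbol (χ a k) * toOuter (ℓ t j)).coeff r) * toOuter (ψ k d)) else 0 := by
      intro h
      rw [finsetSum_coeff, Finset.smul_sum, map_sum, Finset.sum_mul, map_sum]
      refine Finset.sum_congr rfl fun t _ => ?_
      split_ifs with hk
      · rw [hk, hlst]
      · simp
    simp only [e]
    -- The remaining row factor is χ at the last block, the identity matrix.
    rw [Finset.sum_comm, Finset.sum_eq_single c]
    · rw [Finset.sum_eq_single (lst c)]
      · rw [if_pos rfl, hp.chi_lst, if_pos rfl, act_one, coeff_mul_toOuter
          (isHomogPoly_adjSymbol (hχ a k)) (hℓ c j), smul_smul, ← sgn_add]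
        rw [show ϖ k * π j + π c * ϖ k + π a * π c + (π a + ϖ k) * (π c + π j) = π a * π j by
          generalize π c = x; generalize π j = y; generalize ϖ k = z; generalize π a = w
          revert x y z w; decide]
        rw [← smul_C, smul_mul_assoc, map_sum C, Finset.sum_mul]
        simp only [smul_eq_CC_mul, C_mul, mul_assoc]
      · intro k _ hk; rw [if_neg hk]
      · simp
    · intro t _ ht
      refine Finset.sum_eq_zero fun k _ => ?_
      rw [hp.chi_lst, if_neg ht.symm, map_zero, LinearMap.zero_apply, ite_self]
    · simp
  simp only [coeff_sub, smul_sub, sub_mul, map_sub, Finset.sum_sub_distrib, h1]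
  rw [Finset.sum_comm (f := fun h k => act bigD (χ c h) (C (sgn _ •
      (∑ t, (if h = lst t then adjSymbol (χ a k) * toOuter (ℓ t j) else 0)).coeff r) *
        toOuter (ψ k d)))]
  simp only [h2, ← Finset.smul_sum]
  rw [← smul_sub, ← smul_sub, mul_comm ε, mul_smul, Finset.sum_comm,
    Finset.sum_comm (t := Finset.HasAntidiagonal.antidiagonal r), smul_sub ε, Finset.smul_sum,
    Finset.smul_sum]
  congr 2
  · refine Finset.sum_congr rfl fun p _ => ?_
    rw [theta, LinearMap.smul_apply, chiSum_apply, smul_smul, hp.eps_mul, one_smul]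
  · refine Finset.sum_congr rfl fun p _ => ?_
    rw [xi, smul_comm _ ε, smul_smul, hp.eps_mul, one_smul, Finset.smul_sum]

end Parity

end IsHessPair

end HessPair

/-! ### The operator `L(∂)` -/

section RectOperator

variable (m n N : ℕ)

local notation "ρ" => rho m n N

/-- The block lower triangular part of `ρ(A)`. -/
def rectQ (u v : ℕ) (i j : GlIdx m n) : RectV m n N :=
  if h : v ≤ u ∧ u < N then sgn (innerPar m n i) •
    DiffPoly.gen (glPar (rectPar m n N)) ((⟨u, h.2⟩, i), (⟨v, h.1.trans_lt h.2⟩, j)) 0 else 0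

/-- The matrix `ρ(A) - ∂`. -/
def rectB (x y : RIdx m n N) : RectV m n N :=
  sgn (rectPar m n N x) • ρ (DiffPoly.gen (glPar (rectPar m n N)) (x, y) 0)

/-- The solution of `ρ(A) ψ = 0` in all blocks but the last. -/
def rectPsi (x : RIdx m n N) (c : GlIdx m n) : (RectV m n N)[X] := psi (rectQ m n N) x.1 x.2 c

/-- The solution of `χ ρ(A) = 0` in all blocks but the first. -/
def rectChi (a : GlIdx m n) (x : RIdx m n N) : (RectV m n N)[X] :=
  chi (rectQ m n N) N (N - 1 - x.1) a x.2

/-- The sign `(-1)^{N-1}`. -/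
def rectSign : ℂ := (-1) ^ (N - 1)

/-- The symbol of `L(∂)`. -/
def rectL (i j : GlIdx m n) : (RectV m n N)[X] := rectSign N • -psi (rectQ m n N) N i j

variable {m n N}

theorem rectSign_mul_self : rectSign N * rectSign N = 1 := by
  rw [rectSign, ← mul_pow]; norm_num

theorem hDeg_apply (x y : RIdx m n N) : hDeg m n N (x, y) = 2 * ((y.1 : ℕ) - (x.1 : ℕ)) := by
  simp only [hDeg, hEntry]; ring

theorem isHomog_rectQ (u v : ℕ) (i j : GlIdx m n) :
    IsHomog (innerPar m n i + innerPar m n j) (rectQ m n N u v i j) := by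
  rw [rectQ]
  split_ifs with h
  · exact (DiffPoly.isHomog_gen (p := glPar (rectPar m n N)) _ _).smul _
  · exact isHomog_zero _

theorem rho_rectQ (u v : ℕ) (i j : GlIdx m n) : ρ (rectQ m n N u v i j) = rectQ m n N u v i j := by
  rw [rectQ]
  split_ifs with h
  · rw [map_smul, rho_gen_of_lt]
    rw [hDeg_apply]
    have := h.1
    dsimp only
    omega
  · exact map_zero _

theorem rectQ_of_le {x y : RIdx m n N} (h : (y.1 : ℕ) ≤ x.1) : rectQ m n N x.1 y.1 x.2 y.2 =
    sgn (innerPar m n x.2) • DiffPoly.gen (glPar (rectPar m n N)) (x, y) 0 := by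
  rw [rectQ, dif_pos ⟨h, x.1.2⟩]

/-- On and below the diagonal ρ fixes the generator. Above it ρ gives (f|e_xy), which is nonzero
only just above the diagonal and carries the supertrace sign; the sign in the definition of A turns
it into 1. -/
theorem hessOp_rectQ (x y : RIdx m n N) :
    hessOp (rectQ m n N) x y = (if x = y then X else 0) + C (rectB m n N x y) := by
  rw [hessOp, add_assoc]
  congr 1
  rcases le_or_gt (y.1 : ℕ) x.1 with h | h
  · have hd : hDeg m n N (x, y) < 2 := by rw [hDeg_apply]; omega
    rw [if_pos h, if_neg (by omega), add_zero, rectB, rho_gen_of_lt hd, rectQ_of_le h]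
    rfl
  · have hd : 2 ≤ hDeg m n N (x, y) := by rw [hDeg_apply]; omega
    rw [if_neg (by omega), zero_add, rectB, rho_gen_of_ge hd, if_pos rfl, strForm_eMat]
    simp only [nilF, Matrix.of_apply, rectPar]
    by_cases h2 : (y.1 : ℕ) = x.1 + 1 ∧ x.2 = y.2
    · rw [if_pos h2, if_pos ⟨h2.1, h2.2.symm⟩, mul_one, h2.2]
      rw [Algebra.algebraMap_eq_smul_one, smul_smul, sgn_mul_self, one_smul, C_1]
    · rw [if_neg h2, if_neg (fun h3 => h2 ⟨h3.1, h3.2.symm⟩), mul_zero, map_zero, smul_zero, C_0]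

theorem isHomog_rectB (x y : RIdx m n N) :
    IsHomog (rectPar m n N x + rectPar m n N y) (rectB m n N x y) :=
  ((DiffPoly.isHomog_gen (p := glPar (rectPar m n N)) (x, y) 0).rho).smul _

theorem isHomogPoly_rectPsi (x : RIdx m n N) (c : GlIdx m n) :
    IsHomogPoly (rectPar m n N x + innerPar m n c) (rectPsi m n N x c) :=
  isHomogPoly_psi isHomog_rectQ _ _ _

theorem isHomogPoly_rectChi (a : GlIdx m n) (x : RIdx m n N) :
    IsHomogPoly (innerPar m n a + rectPar m n N x) (rectChi m n N a x) :=
  isHomogPoly_chi isHomog_rectQ _ _ _ _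

theorem isHomogPoly_rectL (a b : GlIdx m n) :
    IsHomogPoly (innerPar m n a + innerPar m n b) (rectL m n N a b) :=
  (isHomogPoly_psi isHomog_rectQ _ _ _).neg.smul _

theorem coeffMap_rho_rectPsi (x : RIdx m n N) (c : GlIdx m n) :
    coeffMap (ρ).toLinearMap (rectPsi m n N x c) = rectPsi m n N x c := by
  rw [coeffMap_algHom, rectPsi, map_psi _ rho_der]
  simp only [rho_rectQ]

theorem coeffMap_rho_rectChi (a : GlIdx m n) (x : RIdx m n N) :
    coeffMap (ρ).toLinearMap (rectChi m n N a x) = rectChi m n N a x := by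
  rw [coeffMap_algHom, rectChi, map_chi _ rho_der]
  simp only [rho_rectQ]

theorem coeffMap_rho_rectL (a b : GlIdx m n) :
    coeffMap (ρ).toLinearMap (rectL m n N a b) = rectL m n N a b := by
  rw [rectL, map_smul, map_neg, coeffMap_algHom, map_psi _ rho_der]
  simp only [rho_rectQ]

/-- Both defects, -ψ_N and -χ_N, are the same operator by `chi_eq_psi`, and multiplying by the sign
ε twice writes them as ε times the symbol of L. -/
theorem isHessPair_rect (hN : 0 < N) : IsHessPair (rectB m n N) (rectPsi m n N) (rectChi m n N)
    (rectL m n N) (rectSign N) (fun t => (⟨0, hN⟩, t)) (fun t => (⟨N - 1, by omega⟩, t)) where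
  eps_mul := rectSign_mul_self
  psi_eq x c := by
    have h := hessOp_psi (rectQ m n N) (N := N) x c
    have h1 : ∀ y : RIdx m n N, act lamD (hessOp (rectQ m n N) x y) (psi (rectQ m n N) y.1 y.2 c) =
        (if x = y then lamD (rectPsi m n N y c) else 0) + C (rectB m n N x y) * rectPsi m n N y c := by
      intro y
      rw [hessOp_rectQ, map_add, LinearMap.add_apply, act_C, smul_eq_C_mul]
      congr 1
      split_ifs
      · exact act_lamD_X _
      · simp
    simp only [h1, Finset.sum_add_distrib, Finset.sum_ite_eq, Finset.mem_univ, if_true] at h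
    rw [h]
    by_cases hx : (x.1 : ℕ) + 1 = N
    · have h2 : ∀ t, x = ((⟨N - 1, by omega⟩, t) : RIdx m n N) ↔ x.2 = t := fun t =>
        ⟨fun h => by rw [h], fun h => Prod.ext (Fin.ext (by simp; omega)) h⟩
      simp only [if_pos hx, h2, Finset.sum_ite_eq, Finset.mem_univ, if_true, rectL, smul_smul,
        rectSign_mul_self, one_smul]
    · rw [if_neg hx, Finset.sum_eq_zero]
      intro t _
      rw [if_neg]
      rintro rfl
      apply hx
      simp only
      omega
  chi_eq a y := by
    have h := chi_hessOp (rectQ m n N) (N := N) a y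
    have h1 : ∀ x : RIdx m n N, act lamD (chi (rectQ m n N) N (N - 1 - x.1) a x.2)
        (hessOp (rectQ m n N) x y) = (if x = y then X * rectChi m n N a x else 0) +
          act lamD (rectChi m n N a x) (C (rectB m n N x y)) := by
      intro x
      rw [hessOp_rectQ, map_add]
      congr 1
      split_ifs
      · exact act_lamD_right_X _
      · simp
    simp only [h1, Finset.sum_add_distrib, Finset.sum_ite_eq', Finset.mem_univ, if_true] at h
    rw [h]
    by_cases hy : (y.1 : ℕ) = 0
    · have h2 : ∀ t, y = ((⟨0, hN⟩, t) : RIdx m n N) ↔ y.2 = t := fun t =>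
        ⟨fun h => by rw [h], fun h => Prod.ext (Fin.ext hy) h⟩
      simp only [if_pos hy, h2, Finset.sum_ite_eq, Finset.mem_univ, if_true, rectL, smul_smul,
        rectSign_mul_self, one_smul, chi_eq_psi _ hN]
    · rw [if_neg hy, Finset.sum_eq_zero]
      intro t _
      rw [if_neg]
      rintro rfl
      exact hy rfl
  psi_fst t c := by simp [rectPsi, psi]
  chi_lst a t := by simp [rectChi, chi]

theorem mapCoeff_rho_affOp : (affOp m n N).mapCoeff ρ = MatPDO.ofPoly (hessOp (rectQ m n N)) := by
  ext k x y
  rw [MatPDO.coeff_ofPoly, hessOp_rectQ]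
  simp only [MatPDO.mapCoeff, affOp, Matrix.map_apply, map_add]
  rcases lt_or_ge k 0 with hk | hk
  · rw [if_neg (by omega), if_neg (by omega), MatPDO.coeffZ_of_neg hk, MatPDO.coeffZ_of_neg hk]
    simp
  · obtain ⟨k, rfl⟩ := Int.eq_ofNat_of_zero_le hk
    rw [MatPDO.coeffZ_natCast, MatPDO.coeffZ_natCast, coeff_C]
    by_cases h1 : k = 1
    · subst h1
      by_cases hxy : x = y
      · subst hxy; simp
      · simp [hxy]
    · by_cases h0 : k = 0
      · subst h0
        simp only [Nat.cast_zero, if_neg (show (0 : ℤ) ≠ 1 by omega), if_true, Matrix.of_apply,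
          map_smul, rectB]
        split_ifs <;> simp
      · rw [if_neg (by omega), if_neg (by omega), if_neg h0]
        split_ifs <;> simp [coeff_X, Ne.symm h1]

theorem ofPoly_rectL : MatPDO.ofPoly (rectL m n N) =
    MatPDO.smul ((-1) ^ (N - 1)) (MatPDO.ofPoly fun i j => -psi (rectQ m n N) N i j) := by
  ext k i j
  simp only [MatPDO.coeff_ofPoly, MatPDO.smul, Matrix.smul_apply, rectL, rectSign]
  rcases lt_or_ge k 0 with hk | hk
  · rw [MatPDO.coeffZ_of_neg hk, MatPDO.coeffZ_of_neg hk, smul_zero]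
  · obtain ⟨k, rfl⟩ := Int.eq_ofNat_of_zero_le hk
    rw [MatPDO.coeffZ_natCast, MatPDO.coeffZ_natCast, coeff_smul]

theorem isRectOperator_rectL (hN : 2 ≤ N) :
    IsRectOperator m n N hN (MatPDO.ofPoly (rectL m n N)) := by
  refine ⟨_, ?_, ofPoly_rectL⟩
  rw [mapCoeff_rho_affOp]
  exact MatPDO.isQuasidet_hessOp (rectQ m n N) (by omega)

/-- A quasi-determinant is obtained by two successive inversions, and each inverse is unique. -/
theorem IsRectOperator.eq_ofPoly {hN : 2 ≤ N} {L : MatPDO (GlIdx m n) (GlIdx m n) (RectV m n N)}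
    (h : IsRectOperator m n N hN L) : L = MatPDO.ofPoly (rectL m n N) := by
  obtain ⟨Q, ⟨B, hB, hQ⟩, rfl⟩ := h
  obtain ⟨Q', ⟨B', hB', hQ'⟩, h'⟩ := isRectOperator_rectL (m := m) (n := n) hN
  rw [h']
  obtain rfl := hB.unique hB'
  rw [hQ.unique hQ']

theorem coeff_rectL_self (hN : 0 < N) (i j : GlIdx m n) :
    (rectL m n N i j).coeff N = if i = j then 1 else 0 := by
  obtain ⟨M, rfl⟩ : ∃ M, N = M + 1 := ⟨N - 1, by omega⟩
  rw [rectL, coeff_smul, coeff_neg, (coeff_psi _ _ _ _).1]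
  split_ifs
  -- The signs (-1)^(N-1), -1 and the leading coefficient (-1)^N of ψ_N multiply to 1.
  · rw [rectSign, Nat.add_sub_cancel, pow_succ, mul_neg_one, neg_neg]
    have : ((-1 : RectV m n (M + 1)) ^ M) = algebraMap ℂ _ ((-1) ^ M) := by simp
    rw [this, Algebra.algebraMap_eq_smul_one, smul_smul, ← mul_pow]
    norm_num
  · simp

theorem coeff_rectL_of_lt {k : ℕ} (hk : N < k) (i j : GlIdx m n) :
    (rectL m n N i j).coeff k = 0 := by
  rw [rectL, coeff_smul, coeff_neg, (coeff_psi _ _ _ _).2 k hk, neg_zero, smul_zero]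

theorem isMonic_rectL (hN : 0 < N) : (MatPDO.ofPoly (rectL m n N)).IsMonic N := by
  refine ⟨?_, fun k hk => ?_⟩
  · ext i j
    rw [MatPDO.coeff_ofPoly, MatPDO.coeffZ_natCast, coeff_rectL_self hN, Matrix.one_apply]
  · obtain ⟨k, rfl⟩ := Int.eq_ofNat_of_zero_le (by omega : 0 ≤ k)
    ext i j
    rw [MatPDO.coeff_ofPoly, MatPDO.coeffZ_natCast, coeff_rectL_of_lt (by exact_mod_cast hk)]
    rfl

theorem isDifferential_rectL : (MatPDO.ofPoly (rectL m n N)).IsDifferential := by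
  intro k hk
  ext i j
  rw [MatPDO.coeff_ofPoly, MatPDO.coeffZ_of_neg hk]
  rfl

end RectOperator

/-! ### The brackets of the coefficients of `L(∂)` -/

theorem zmod2_mul_cancel (a b c : ZMod 2) : a * b + a * (b + c) = a * c := by
  revert a b c; decide

section RectBracket

variable {m n N : ℕ}

local notation "ρ" => rho m n N
local notation "ϖ" => rectPar m n N
local notation "π" => innerPar m n
local notation "B" => rectB m n N
local notation "ψ" => rectPsi m n N
local notation "χ" => rectChi m n N
local notation "ℓ" => rectL m n N
local notation "ε" => rectSign N

/-- The difference of the entries of `A(∂)` and `ρ(A(∂))`. -/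
def rectE (x y : RIdx m n N) : RectV m n N :=
  sgn (ϖ x) • DiffPoly.gen (glPar ϖ) (x, y) 0 - B x y

/-- A lift of the symbol of `L(∂)` along `ρ`, namely `ε χ ∘ A(∂) ∘ ψ`. -/
def rectLift (c d : GlIdx m n) : (RectV m n N)[X] :=
  ℓ c d + ε • ∑ x, ∑ y, act lamD (χ c x) (C (rectE x y) * ψ y d)

theorem rho_rectB (x y : RIdx m n N) : ρ (B x y) = B x y := by
  rw [rectB, map_smul, rho_rho]

theorem rho_rectE (x y : RIdx m n N) : ρ (rectE x y) = 0 := by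
  rw [rectE, map_sub, map_smul, rho_rectB, rectB, sub_self]

theorem isHomog_rectE (x y : RIdx m n N) : IsHomog (ϖ x + ϖ y) (rectE x y) :=
  ((DiffPoly.isHomog_gen (p := glPar ϖ) (x, y) 0).smul _).sub (isHomog_rectB x y)

theorem coeffMap_rho_act (P Q : (RectV m n N)[X]) : coeffMap (ρ).toLinearMap (act lamD P Q) =
    act lamD (coeffMap (ρ).toLinearMap P) (coeffMap (ρ).toLinearMap Q) := by
  rw [coeffMap_algHom, map_act_lamD _ rho_der, ← coeffMap_algHom, ← coeffMap_algHom]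

theorem coeffMap_rho_rectLift (c d : GlIdx m n) :
    coeffMap (ρ).toLinearMap (rectLift c d) = ℓ c d := by
  rw [rectLift, map_add, coeffMap_rho_rectL, map_smul, map_sum, Finset.sum_eq_zero, smul_zero,
    add_zero]
  intro x _
  rw [map_sum, Finset.sum_eq_zero]
  intro y _
  rw [coeffMap_rho_act, coeffMap_algHom_mul, coeffMap_algHom_C, rho_rectE, C_0, zero_mul, map_zero]

theorem rho_coeff_rectLift (c d : GlIdx m n) (k : ℕ) :
    ρ ((rectLift c d).coeff k) = (ℓ c d).coeff k := by
  rw [← coeffMap_rho_rectLift, coeff_coeffMap]; rfl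

theorem isHomogPoly_rectLift (c d : GlIdx m n) : IsHomogPoly (π c + π d) (rectLift (N := N) c d) := by
  refine (isHomogPoly_rectL c d).add (IsHomogPoly.smul _ (isHomogPoly_sum _ fun x _ =>
    isHomogPoly_sum _ fun y _ => ?_))
  have := (isHomogPoly_rectChi c x).act
    (IsHomogPoly.C_mul (isHomog_rectE x y) (isHomogPoly_rectPsi y d))
  rwa [zmod2_add_cancel, zmod2_add_cancel] at this

section Derivation

variable (κ : ℂ) {p : ZMod 2} {f : RectV m n N}

theorem outerMap_wBilin_C_mul (hf : IsHomog p f) (a : RectV m n N) (P : (RectV m n N)[X]) :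
    outerMap (wBilin κ f) (C a * P) = ρ (twistAut p a) • outerMap (wBilin κ f) P +
      C (wBilin κ f a) * toOuter (coeffMap (ρ).toLinearMap P) := by
  induction P using Polynomial.induction_on' with
  | add P Q hP hQ => simp only [mul_add, map_add, hP, hQ, smul_add]; abel
  | monomial k b =>
    rw [C_mul_monomial, outerMap_monomial, outerMap_monomial, coeffMap_monomial, toOuter_monomial,
      wBilin_mul κ hf, map_add, C_mul_monomial, smul_eq_CC_mul, C_mul_monomial]
    rfl

/-- The Leibniz terms that differentiate `P` are multiplied by the image of `Z` under ρ, which is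
zero. -/
theorem outerMap_wBilin_act (hf : IsHomog p f) {q : ZMod 2} {P Z : (RectV m n N)[X]}
    (hP : IsHomogPoly q P) (hZ : coeffMap (ρ).toLinearMap Z = 0) :
    outerMap (wBilin κ f) (act lamD P Z) =
      sgn (p * q) • act bigD (coeffMap (ρ).toLinearMap P) (outerMap (wBilin κ f) Z) := by
  have h1 : ∀ k, outerMap (wBilin κ f) ((lamD ^ k) Z) = (bigD ^ k) (outerMap (wBilin κ f) Z) := by
    intro k
    induction k with
    | zero => rfl
    | succ k ih =>
      rw [pow_succ', Module.End.mul_apply, outerMap_lamD (wBilin_der_right κ f), ih, pow_succ',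
        Module.End.mul_apply]
  have h2 : ∀ k, coeffMap (ρ).toLinearMap ((lamD ^ k) Z) = 0 := fun k => by
    rw [coeffMap_lamD_pow rho_der, hZ, map_zero]
  have h3 : ∀ k v, IsHomog q v → outerMap (wBilin κ f) (act lamD (monomial k v) Z) =
      sgn (p * q) • act bigD (coeffMap (ρ).toLinearMap (monomial k v))
        (outerMap (wBilin κ f) Z) := by
    intro k v hv
    rw [act_monomial, smul_eq_C_mul, outerMap_wBilin_C_mul κ hf, h2, map_zero, mul_zero, add_zero,
      h1, twistAut_homog _ hv, map_smul, coeffMap_monomial, act_monomial, smul_assoc]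
    rfl
  conv_lhs => rw [P.as_sum_range_C_mul_X_pow]
  conv_rhs => rw [P.as_sum_range_C_mul_X_pow]
  simp only [map_sum, LinearMap.sum_apply, Finset.smul_sum, C_mul_X_pow_eq_monomial]
  exact Finset.sum_congr rfl fun k _ => h3 k _ (hP k)

/-- The variation of (∂+B)ψ = ε e_last ℓ, paired with χ. The unknown variation of ψ disappears
because ψ is constant in the first block, the only block that `sum_act_chi` retains. -/
theorem outerMap_wBilin_rectL (hN : 0 < N) (hf : IsHomog p f) (c d : GlIdx m n) :
    sgn (p * π c) • outerMap (wBilin κ f) (ℓ c d) = ε • ∑ x, ∑ y, sgn (p * ϖ x) •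
      act bigD (χ c x) (C (wBilin κ f (B x y)) * toOuter (ψ y d)) := by
  have hp := isHessPair_rect (m := m) (n := n) hN
  -- The row-dependent sign untwists the Leibniz rule: moving the derivation past an entry of B
  -- costs the quotient of the signs of its row and column.
  have h := hp.sum_act_chi c fun x => sgn (p * ϖ x) • outerMap (wBilin κ f) (ψ x d)
  have h0 : ∀ t : GlIdx m n, outerMap (wBilin κ f) (ψ (⟨0, hN⟩, t) d) = 0 := by
    intro t
    rw [hp.psi_fst t d]
    split_ifs
    · rw [← C_1, outerMap_C, ← map_one (algebraMap ℂ (RectV m n N)), wBilin_algebraMap, C_0]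
    · exact map_zero _
  simp only [h0, smul_zero, map_zero, Finset.sum_const_zero] at h
  have hx : ∀ x, bigD (sgn (p * ϖ x) • outerMap (wBilin κ f) (ψ x d)) +
      ∑ y, B x y • sgn (p * ϖ y) • outerMap (wBilin κ f) (ψ y d) =
      (∑ t, if x = (⟨N - 1, by omega⟩, t) then
        (ε * sgn (p * π t)) • outerMap (wBilin κ f) (ℓ t d) else 0) -
        ∑ y, sgn (p * ϖ x) • (C (wBilin κ f (B x y)) * toOuter (ψ y d)) := by
    intro x
    have hc := congrArg (fun P => sgn (p * ϖ x) • outerMap (wBilin κ f) P) (hp.psi_eq x d)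
    simp only [map_add, map_sum, outerMap_lamD (wBilin_der_right κ f), outerMap_wBilin_C_mul κ hf,
      coeffMap_rho_rectPsi, twistAut_homog p (isHomog_rectB _ _), map_smul, rho_rectB,
      Finset.sum_add_distrib, smul_add, Finset.smul_sum, smul_assoc, smul_smul, ← sgn_add] at hc
    rw [eq_sub_iff_add_eq, map_smul]
    refine Eq.trans ?_ (hc.trans ?_)
    · rw [add_assoc]
      congr 2
      refine Finset.sum_congr rfl fun y _ => ?_
      rw [smul_comm (B x y), zmod2_mul_cancel]
    · refine Finset.sum_congr rfl fun t _ => ?_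
      split_ifs with ht
      · rw [ht, map_smul, smul_smul, mul_comm ε]; rfl
      · rw [map_zero, smul_zero]
  simp only [hx, map_sub, Finset.sum_sub_distrib] at h
  have h2 := sum_map_sum_ite (fun x => (act bigD (χ c x) :
    (RectV m n N)[X][X] →ₗ[ℂ] (RectV m n N)[X][X]).toAddMonoidHom)
    (fun t => ((⟨N - 1, by omega⟩, t) : RIdx m n N))
    (fun t => (ε * sgn (p * π t)) • outerMap (wBilin κ f) (ℓ t d))
  simp only [LinearMap.toAddMonoidHom_coe] at h2
  rw [h2, sub_eq_zero, Finset.sum_eq_single c] at h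
  · rw [hp.chi_lst c c, if_pos rfl, act_one] at h
    have h3 := congrArg (fun F => ε • F) h
    simp only [smul_smul, ← mul_assoc, hp.eps_mul, one_mul] at h3
    rw [h3]
    simp only [map_sum, map_smul]
  · intro t _ ht
    rw [hp.chi_lst c t, if_neg ht.symm, map_zero, LinearMap.zero_apply]
  · simp

/-- The correction in the lift is linear in A - ρ(A), which ρ kills, so only the brackets of these
entries contribute. Added to the variation of ρ(A), they complete it to the variation of A. -/
theorem outerMap_wBilin_rectLift (hN : 0 < N) (hf : IsHomog p f) (c d : GlIdx m n) :
    sgn (p * π c) • outerMap (wBilin κ f) (rectLift c d) = ε • ∑ x, ∑ y, act bigD (χ c x)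
      (C ((sgn (p * ϖ x) * sgn (ϖ x)) • wBilin κ f (DiffPoly.gen (glPar ϖ) (x, y) 0)) *
        toOuter (ψ y d)) := by
  rw [rectLift, map_add, smul_add, outerMap_wBilin_rectL κ hN hf, map_smul, smul_comm _ ε,
    ← smul_add]
  congr 1
  rw [map_sum, Finset.smul_sum, ← Finset.sum_add_distrib]
  refine Finset.sum_congr rfl fun x _ => ?_
  rw [map_sum, Finset.smul_sum, ← Finset.sum_add_distrib]
  refine Finset.sum_congr rfl fun y _ => ?_
  have h0 : coeffMap (ρ).toLinearMap (C (rectE x y) * ψ y d) = 0 := by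
    rw [coeffMap_algHom_mul, coeffMap_algHom_C, rho_rectE, C_0, zero_mul]
  rw [outerMap_wBilin_act κ hf (isHomogPoly_rectChi c x) h0, outerMap_wBilin_C_mul κ hf,
    rho_twistAut, rho_rectE, map_zero, zero_smul, zero_add, coeffMap_rho_rectPsi,
    coeffMap_rho_rectChi, smul_smul, ← sgn_add, zmod2_mul_cancel, ← smul_add, ← map_add, ← add_mul, ← C_add,
    ← map_add, rectE, add_sub_cancel, map_smul, ← map_smul, ← smul_mul_assoc, smul_C, smul_smul]

end Derivation

/-- With the signs of A(∂) included, the signs of the affine bracket gather in a prefactor depending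
only on `x`, leaving the purely even commutator formula; the λ-term is subtracted because the level
is -1. -/
theorem wBilin_gen_gen (x y : RIdx m n N × RIdx m n N) :
    (sgn (glPar ϖ x * ϖ y.1) * sgn (ϖ y.1)) • wBilin (-1) (DiffPoly.gen (glPar ϖ) x 0)
      (DiffPoly.gen (glPar ϖ) y 0) = (sgn (ϖ x.1) * sgn (ϖ x.1 * ϖ x.2)) •
      ((if y.1 = x.2 then C (B x.1 y.2) else 0) - (if y.2 = x.1 then C (B y.1 x.2) else 0) -
        if y.1 = x.2 ∧ y.2 = x.1 then X else 0) := by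
  obtain ⟨i, j⟩ := x
  obtain ⟨h, k⟩ := y
  have h1 : ∀ z w : RIdx m n N × RIdx m n N, ρ (qLin ϖ (eMat z * eMat w)) =
      if z.2 = w.1 then sgn (ϖ z.1) • B z.1 w.2 else 0 := by
    intro z w
    rw [eMat_mul]
    split_ifs
    · rw [qLin_eMat, rectB, smul_smul, sgn_mul_self, one_smul]
    · simp
  have h2 : strForm ϖ (eMat (i, j)) (eMat (h, k)) = if h = j ∧ k = i then sgn (ϖ i) else 0 := by
    rw [strForm_eMat]
    by_cases hh : h = j ∧ k = i
    · rw [if_pos hh]; simp [eMat, hh.1, hh.2]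
    · rw [if_neg hh]
      have : ¬ (i = k ∧ j = h) := fun h' => hh ⟨h'.2.symm, h'.1.symm⟩
      simp [eMat, this]
  rw [wBilin_apply, affBilin_gen_gen, affValue, map_add, map_smul, coeffMap_algHom_X,
    coeffMap_algHom_C, ← qLin_apply, glBracket, map_sub, map_smul, map_sub, map_smul, h1, h1, h2]
  simp only [glPar]
  have e1 : j = h → sgn ((ϖ i + ϖ j) * ϖ h) * sgn (ϖ h) * sgn (ϖ i) =
      sgn (ϖ i) * sgn (ϖ i * ϖ j) := by
    rintro rfl
    rw [← sgn_add, ← sgn_add, ← sgn_add]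
    congr 1
    generalize ϖ i = a; generalize ϖ j = b; revert a b; decide
  have e2 : k = i → sgn ((ϖ i + ϖ j) * ϖ h) * sgn (ϖ h) * sgn ((ϖ i + ϖ j) * (ϖ h + ϖ k)) *
      sgn (ϖ h) = sgn (ϖ i) * sgn (ϖ i * ϖ j) := by
    rintro rfl
    rw [← sgn_add, ← sgn_add, ← sgn_add, ← sgn_add]
    congr 1
    generalize ϖ k = a; generalize ϖ j = b; generalize ϖ h = c; revert a b c; decide
  have t1 : (sgn ((ϖ i + ϖ j) * ϖ h) * sgn (ϖ h)) •
      (C (if j = h then sgn (ϖ i) • B i k else 0) : (RectV m n N)[X]) =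
      (sgn (ϖ i) * sgn (ϖ i * ϖ j)) • (if h = j then C (B i k) else 0) := by
    by_cases hj : j = h
    · rw [if_pos hj, if_pos hj.symm, ← smul_C, smul_smul, e1 hj]
    · rw [if_neg hj, if_neg (Ne.symm hj), C_0, smul_zero, smul_zero]
  have t2 : (sgn ((ϖ i + ϖ j) * ϖ h) * sgn (ϖ h)) •
      (C (sgn ((ϖ i + ϖ j) * (ϖ h + ϖ k)) • if k = i then sgn (ϖ h) • B h j else 0) :
        (RectV m n N)[X]) =
      (sgn (ϖ i) * sgn (ϖ i * ϖ j)) • (if k = i then C (B h j) else 0) := by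
    by_cases hk : k = i
    · rw [if_pos hk, if_pos hk, ← smul_C, ← smul_C, smul_smul, smul_smul, e2 hk]
    · rw [if_neg hk, if_neg hk, smul_zero, C_0, smul_zero, smul_zero]
  have t3 : (sgn ((ϖ i + ϖ j) * ϖ h) * sgn (ϖ h)) •
      ((-1 * if h = j ∧ k = i then sgn (ϖ i) else 0) • X : (RectV m n N)[X]) =
      -((sgn (ϖ i) * sgn (ϖ i * ϖ j)) • (if h = j ∧ k = i then X else 0)) := by
    by_cases hh : h = j ∧ k = i
    · rw [if_pos hh, if_pos hh, smul_smul, ← neg_smul]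
      congr 1
      rw [← e1 hh.1.symm]; ring
    · rw [if_neg hh, if_neg hh, mul_zero, zero_smul, smul_zero, smul_zero, neg_zero]
  rw [C_sub, smul_add, smul_sub, t1, t2, t3, smul_sub, smul_sub, sub_eq_add_neg _ (_ • ite _ X _)]

/-- The three Kronecker terms of `wBilin_gen_gen` are precisely the three sums of
`IsHessPair.variation`, and the two factors ε cancel. -/
theorem outerMap_gen_rectLift (hN : 0 < N) (i j : RIdx m n N) (c d : GlIdx m n) :
    sgn ((ϖ i + ϖ j) * π c) • outerMap (wBilin (-1) (DiffPoly.gen (glPar ϖ) (i, j) 0))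
      (rectLift c d) = (sgn (ϖ i) * sgn (ϖ i * ϖ j)) •
      (∑ t, (if i = (⟨N - 1, by omega⟩, t) then act bigD (χ c j) (toOuter (ℓ t d)) else 0) -
        ∑ t, if j = (⟨0, hN⟩, t) then act bigD (ℓ c t) (toOuter (ψ i d)) else 0) := by
  have hp := isHessPair_rect (m := m) (n := n) hN
  have h1 : ∀ h k : RIdx m n N, act bigD (χ c h)
      (C ((sgn ((ϖ i + ϖ j) * ϖ h) * sgn (ϖ h)) • wBilin (-1) (DiffPoly.gen (glPar ϖ) (i, j) 0)
        (DiffPoly.gen (glPar ϖ) (h, k) 0)) * toOuter (ψ k d)) = (sgn (ϖ i) * sgn (ϖ i * ϖ j)) •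
      ((if h = j then act bigD (χ c j) (B i k • toOuter (ψ k d)) else 0) -
        (if k = i then act bigD (χ c h) (B h j • toOuter (ψ i d)) else 0) -
        if h = j then if k = i then act bigD (χ c j) (C X * toOuter (ψ i d)) else 0 else 0) := by
    intro h k
    have := wBilin_gen_gen (i, j) (h, k)
    simp only [glPar] at this
    rw [this, ← smul_C, smul_mul_assoc, map_smul, C_sub, C_sub, sub_mul, sub_mul, map_sub, map_sub]
    congr 3
    · split_ifs with hh
      · rw [hh, smul_eq_CC_mul]
      · simp
    · split_ifs with hh
      · rw [hh, smul_eq_CC_mul]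
      · simp
    · by_cases hh : h = j
      · by_cases hk : k = i
        · rw [if_pos ⟨hh, hk⟩, if_pos hh, if_pos hk, hh, hk]
        · rw [if_neg (fun h' => hk h'.2), if_pos hh, if_neg hk, C_0, zero_mul, map_zero]
      · rw [if_neg (fun h' => hh h'.1), if_neg hh, C_0, zero_mul, map_zero]
  rw [outerMap_wBilin_rectLift (-1) hN (p := ϖ i + ϖ j)
    (DiffPoly.isHomog_gen (p := glPar ϖ) (i, j) 0)]
  simp only [h1, ← Finset.smul_sum, Finset.sum_sub_distrib]
  have s1 : ∑ h, ∑ k, (if h = j then act bigD (χ c j) (B i k • toOuter (ψ k d)) else 0) =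
      ∑ k, act bigD (χ c j) (B i k • toOuter (ψ k d)) := by
    rw [Finset.sum_comm]
    simp
  have s3 : ∑ h : RIdx m n N, ∑ k, (if h = j then
      if k = i then act bigD (χ c j) (C X * toOuter (ψ i d)) else 0 else 0) =
      act bigD (χ c j) (C X * toOuter (ψ i d)) := by
    rw [Finset.sum_comm]
    simp
  rw [s1, s3]
  simp only [Finset.sum_ite_eq', Finset.mem_univ, if_true]
  rw [hp.variation c d i j, smul_comm, smul_smul ε, hp.eps_mul, one_smul]

/-- For e_ij in 𝔫 the block of j lies strictly after the block of i, so i is not in the last block,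
j is not in the first one, and both boundary sums are empty. Passing from the lift to L is harmless
by `wBilin_gen_rho`. -/
theorem coeff_rectL_mem_wAlg (hN : 0 < N) (c d : GlIdx m n) (k : ℕ) :
    (ℓ c d).coeff k ∈ wAlg m n N (-1) := by
  rw [mem_wAlg_iff]
  refine ⟨by conv_rhs => rw [← coeffMap_rho_rectL, coeff_coeffMap, AlgHom.toLinearMap_apply],
    fun x hx => ?_⟩
  obtain ⟨i, j⟩ := x
  have h := outerMap_gen_rectLift hN i j c d
  rw [hDeg_apply] at hx
  have hj := j.1.2
  rw [Finset.sum_eq_zero, Finset.sum_eq_zero, sub_zero, smul_zero] at h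
  · have h2 := congrArg (fun F => (sgn ((ϖ i + ϖ j) * π c) • F).coeff k) h
    simp only [smul_smul, sgn_mul_self, one_smul, smul_zero, coeff_zero, coeff_outerMap] at h2
    rw [← rho_coeff_rectLift, wBilin_gen_rho (-1) (by rw [hDeg_apply]; exact hx), h2]
  · intro t _
    rw [if_neg]
    rintro rfl
    dsimp only at hx
    omega
  · intro t _
    rw [if_neg]
    rintro rfl
    dsimp only at hx
    omega

theorem rho_coeff_rectLift_mem (hN : 0 < N) (c d : GlIdx m n) (k : ℕ) :
    ρ ((rectLift c d).coeff k) ∈ wAlg m n N (-1) := by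
  rw [rho_coeff_rectLift]; exact coeff_rectL_mem_wAlg hN c d k

/-- Skew-symmetry applied to `outerMap_gen_rectLift`, one coefficient at a time;
`mapOuter_subNeg_act` turns the operators in w+λ+∂ into adjoint symbols. -/
theorem wBilin_rectLift_gen (hN : 0 < N) (a b : GlIdx m n) (r : ℕ) (h k : RIdx m n N) :
    (sgn ((π a + π b) * ϖ h) * sgn (ϖ h)) • wBilin (-1) ((rectLift a b).coeff r)
      (DiffPoly.gen (glPar ϖ) (h, k) 0) =
    sgn (ϖ k * π b + ϖ h * ϖ k + π a * ϖ h) •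
      (∑ t, (if k = (⟨0, hN⟩, t) then adjSymbol (ℓ a t) * toOuter (ψ h b) else 0) -
        ∑ t, (if h = (⟨N - 1, by omega⟩, t) then
          adjSymbol (χ a k) * toOuter (ℓ t b) else 0)).coeff r := by
  have h1 := congrArg (fun F => (mapOuter subNeg (sgn ((ϖ h + ϖ k) * π a) • F)).coeff r)
    (outerMap_gen_rectLift hN h k a b)
  simp only [smul_smul, sgn_mul_self, one_smul] at h1
  rw [coeff_mapOuter, coeff_outerMap] at h1
  rw [wBilin_skew (-1) (isHomogPoly_rectLift a b r)
    (DiffPoly.isHomog_gen (p := glPar ϖ) (h, k) 0), h1, map_smul, map_sub, map_sum, map_sum,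
    coeff_smul, smul_neg, smul_smul, smul_smul, ← neg_smul, ← neg_sub, coeff_neg, smul_neg,
    ← neg_smul, neg_neg]
  congr 1
  · simp only [← sgn_add, glPar]
    congr 1
    generalize π a = x; generalize π b = y; generalize ϖ h = z; generalize ϖ k = w
    revert x y z w; decide
  · congr 2
    · refine Finset.sum_congr rfl fun t _ => ?_
      split_ifs
      · rw [mapOuter_subNeg_act]
      · exact map_zero _
    · refine Finset.sum_congr rfl fun t _ => ?_
      split_ifs
      · rw [mapOuter_subNeg_act]
      · exact map_zero _

/-- The variation formula is used twice: first for the derivation given by a coefficient of one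
lift, then, inside it, for the brackets of that coefficient with the generators. `bracket_sum` and
the closed forms of θ and ξ produce the Adler expression. -/
theorem wBilin_rectL (hN : 0 < N) (a b c d : GlIdx m n) (r s : ℕ) :
    wBilin (-1) ((ℓ a b).coeff r) ((ℓ c d).coeff s) =
      sgn (π a * π b + π a * π c + π b * π c) •
        (adlerPlain (fun k => MatPDO.coeffZ k (ℓ c b)) (fun k => MatPDO.coeffZ k (ℓ a d)) r s -
          adlerStar (fun k => MatPDO.coeffZ k (ℓ c b)) (fun k => MatPDO.coeffZ k (ℓ a d)) r s) := by
  have hp := isHessPair_rect (m := m) (n := n) hN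
  obtain ⟨K, hP, hR, hψ, hχ⟩ : ∃ K, (ℓ c b).natDegree < K ∧ (adjSymbol (ℓ a d)).natDegree < K ∧
      (∀ h, (ψ h b).natDegree < K) ∧ ∀ h, (adjSymbol (χ a h)).natDegree < K := by
    refine ⟨(ℓ c b).natDegree + (adjSymbol (ℓ a d)).natDegree + ∑ h, (ψ h b).natDegree +
      ∑ h, (adjSymbol (χ a h)).natDegree + 1, by omega, by omega, fun h => ?_, fun h => ?_⟩
    · have := Finset.single_le_sum (f := fun h => (ψ h b).natDegree) (fun _ _ => Nat.zero_le _)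
        (Finset.mem_univ h)
      omega
    · have := Finset.single_le_sum (f := fun h => (adjSymbol (χ a h)).natDegree)
        (fun _ _ => Nat.zero_le _) (Finset.mem_univ h)
      omega
  have hfst : ∀ t : GlIdx m n, ϖ ((⟨0, hN⟩, t) : RIdx m n N) = π t := fun _ => rfl
  have hlst : ∀ t : GlIdx m n, ϖ ((⟨N - 1, by omega⟩, t) : RIdx m n N) = π t := fun _ => rfl
  have h := outerMap_wBilin_rectLift (-1) hN (isHomogPoly_rectLift (N := N) a b r) c d
  simp only [wBilin_rectLift_gen hN] at h
  rw [hp.bracket_sum hfst hlst isHomogPoly_rectPsi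
    isHomogPoly_rectChi isHomogPoly_rectL, smul_smul, ← mul_assoc, hp.eps_mul, one_mul,
    hp.sum_theta_sub_xi_closed a c d b r hψ hχ] at h
  have h2 := congrArg (fun F => (sgn ((π a + π b) * π c) • F).coeff s) h
  simp only [smul_smul, sgn_mul_self, one_smul, coeff_outerMap] at h2
  -- Both coefficients may be replaced by their lifts, since the images of the lifts under ρ lie in
  -- W.
  rw [adler_coeffZ_natCast _ _ _ _ hP hR, MatPDO.coeffZ_natCast, ← rho_coeff_rectLift a b,
    ← rho_coeff_rectLift c d, wBilin_rho_right (-1) ((rho_rho _).symm ▸ rho_coeff_rectLift_mem hN a b r),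
    wBilin_rho_left (-1) (rho_coeff_rectLift_mem hN c d s), h2, coeff_smul, ← sgn_add]
  congr 2
  ring

theorem isSATO_rectL (hN : 0 < N) : IsSATO π (wBracket m n N (-1)) (MatPDO.ofPoly ℓ) := by
  have h0 : ∀ a : RectV m n N, wBilin (-1) 0 a = 0 ∧ wBilin (-1) a 0 = 0 := fun a => by simp
  refine ⟨fun k i j => ?_, fun i j h k r s => ?_⟩
  · rw [MatPDO.coeff_ofPoly]
    rcases lt_or_ge k 0 with hk | hk
    · rw [MatPDO.coeffZ_of_neg hk]; exact isHomog_zero _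
    · obtain ⟨k, rfl⟩ := Int.eq_ofNat_of_zero_le hk
      rw [MatPDO.coeffZ_natCast]; exact isHomogPoly_rectL i j k
  · rw [wBracket_eq, MatPDO.coeff_ofPoly, MatPDO.coeff_ofPoly]
    change _ = _ • (adlerPlain (fun q => MatPDO.coeffZ q (ℓ h j)) (fun q => MatPDO.coeffZ q (ℓ i k)) r s -
      adlerStar (fun q => MatPDO.coeffZ q (ℓ h j)) (fun q => MatPDO.coeffZ q (ℓ i k)) r s)
    -- For r < 0 the coefficient of L is zero and the two terms on the right agree; for s < 0 the
    -- right-hand side is a coefficient of a polynomial in w.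
    rcases lt_or_ge r 0 with hr | hr
    · rw [MatPDO.coeffZ_of_neg hr, map_zero, LinearMap.zero_apply, adler_coeffZ_of_neg _ _ hr,
        sub_self, smul_zero]
    · obtain ⟨r, rfl⟩ := Int.eq_ofNat_of_zero_le hr
      rcases lt_or_ge s 0 with hs | hs
      · obtain ⟨K, hP, hR⟩ : ∃ K, (ℓ h j).natDegree < K ∧ (adjSymbol (ℓ i k)).natDegree < K :=
          ⟨(ℓ h j).natDegree + (adjSymbol (ℓ i k)).natDegree + 1, by omega, by omega⟩
        rw [MatPDO.coeffZ_of_neg hs, map_zero, adler_coeffZ_natCast _ _ _ _ hP hR,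
          MatPDO.coeffZ_of_neg hs, smul_zero]
      · obtain ⟨s, rfl⟩ := Int.eq_ofNat_of_zero_le hs
        rw [MatPDO.coeffZ_natCast, MatPDO.coeffZ_natCast]
        exact wBilin_rectL hN i j h k r s

end RectBracket

/-! ### Partial derivatives and polynomial degree in some of the variables -/

namespace DiffPoly

variable {ι : Type*} {p : ι → ZMod 2}

/-- The homomorphism of superalgebras with given homogeneous values on the generators. -/
def liftHom {A : Type*} [Ring A] [Algebra ℂ A] (g : ι → ℕ → A)
    (hg : ∀ i j k l, g i k * g j l = sgn (p i * p j) • (g j l * g i k)) : DiffPoly p →ₐ[ℂ] A :=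
  SuperPoly.lift (p := fun x : ι × ℕ => p x.1) (fun x => g x.1 x.2) fun _ _ => hg _ _ _ _

theorem liftHom_gen {A : Type*} [Ring A] [Algebra ℂ A] (g : ι → ℕ → A) (hg) (i : ι) (k : ℕ) :
    liftHom (p := p) g hg (gen p i k) = g i k :=
  SuperPoly.lift_gen _ _ (i, k)

/-! ### The grading by degree in a chosen set of variables -/

section Scale

variable (c : ι → Prop) [DecidablePred c]

/-- Multiply the generators with `c` by an additional variable. -/
def scale : DiffPoly p →ₐ[ℂ] (DiffPoly p)[X] :=
  liftHom (fun i k => monomial (if c i then 1 else 0) (gen p i k)) fun i j k l => by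
    rw [monomial_mul_monomial, monomial_mul_monomial, gen_swap, smul_monomial, add_comm]

/-- The component of degree `s` in the generators with `c`. -/
def comp (s : ℕ) : DiffPoly p →ₗ[ℂ] DiffPoly p :=
  (lcoeff (DiffPoly p) s).restrictScalars ℂ ∘ₗ (scale c).toLinearMap

theorem comp_apply (s : ℕ) (a : DiffPoly p) : comp c s a = (scale c a).coeff s := rfl

theorem scale_gen (i : ι) (k : ℕ) :
    scale c (gen p i k) = monomial (if c i then 1 else 0) (gen p i k) := liftHom_gen _ _ _ _

theorem comp_gen (s : ℕ) (i : ι) (k : ℕ) :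
    comp c s (gen p i k) = if (if c i then 1 else 0) = s then gen p i k else 0 := by
  rw [comp_apply, scale_gen, coeff_monomial]

theorem comp_algebraMap (s : ℕ) (r : ℂ) :
    comp c s (algebraMap ℂ (DiffPoly p) r) = if s = 0 then algebraMap ℂ _ r else 0 := by
  rw [comp_apply, AlgHom.commutes, Polynomial.algebraMap_apply, coeff_C]

theorem comp_mul (s : ℕ) (a b : DiffPoly p) : comp c s (a * b) =
    ∑ x ∈ Finset.HasAntidiagonal.antidiagonal s, comp c x.1 a * comp c x.2 b := by
  simp only [comp_apply, map_mul, coeff_mul]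

theorem scale_comp (s : ℕ) (a : DiffPoly p) : scale c (comp c s a) = monomial s (comp c s a) := by
  induction a using induction generalizing s with
  | hc r =>
    rw [comp_algebraMap]
    split_ifs with hs
    · rw [AlgHom.commutes, hs]; rfl
    · rw [map_zero, map_zero]
  | hg i k =>
    rw [comp_gen]
    by_cases h : (if c i then 1 else 0) = s
    · rw [if_pos h, scale_gen, h]
    · rw [if_neg h, map_zero, map_zero]
  | hadd a b ha hb => rw [map_add, map_add, map_add, ha, hb]
  | hmul a b ha hb =>
    rw [comp_mul, map_sum, map_sum]
    refine Finset.sum_congr rfl fun x hx => ?_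
    rw [map_mul, ha, hb, monomial_mul_monomial, Finset.HasAntidiagonal.mem_antidiagonal.1 hx]

theorem sum_comp {a : DiffPoly p} {M : ℕ} (hM : (scale c a).natDegree < M) :
    ∑ s ∈ Finset.range M, comp c s a = a := by
  -- Putting the auxiliary variable equal to 1 undoes the scaling, so the components add up to the
  -- element.
  have h : ∀ a : DiffPoly p,
      eval₂RingHom' (RingHom.id _) 1 (fun b => Commute.one_right b) (scale c a) = a := by
    intro a
    induction a using induction with
    | hc r =>
      rw [AlgHom.commutes, Polynomial.algebraMap_apply]
      simp [eval₂RingHom']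
    | hg i k =>
      rw [scale_gen]
      simp [eval₂RingHom']
    | hadd a b ha hb => rw [map_add, map_add, ha, hb]
    | hmul a b ha hb => rw [map_mul, map_mul, ha, hb]
  have := h a
  simp only [eval₂RingHom', RingHom.coe_mk, MonoidHom.coe_mk, OneHom.coe_mk,
    eval₂_eq_sum_range' _ hM, one_pow, mul_one, RingHom.id_apply] at this
  exact this

theorem comp_zero_mul (a b : DiffPoly p) : comp c 0 (a * b) = comp c 0 a * comp c 0 b := by
  simp [comp_mul]

theorem comp_zero_der (a : DiffPoly p) : comp c 0 (der a) = der (comp c 0 a) := by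
  induction a using induction with
  | hc r => rw [der_algebraMap, map_zero, comp_algebraMap, if_pos rfl, der_algebraMap]
  | hg i k =>
    rw [der_gen, comp_gen, comp_gen]
    by_cases h : (if c i then 1 else 0) = 0
    · rw [if_pos h, if_pos h, der_gen]
    · rw [if_neg h, if_neg h, map_zero]
  | hadd a b ha hb => rw [map_add, map_add, ha, hb, map_add, map_add]
  | hmul a b ha hb =>
    rw [der_mul, map_add, comp_zero_mul, comp_zero_mul, comp_zero_mul, ha, hb, der_mul]

theorem par_comp (s : ℕ) (a : DiffPoly p) : par (comp c s a) = comp c s (par a) := by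
  induction a using induction generalizing s with
  | hc r =>
    rw [AlgHom.commutes, comp_algebraMap]
    split_ifs
    · rw [AlgHom.commutes]
    · rw [map_zero]
  | hg i k =>
    rw [par_gen, map_smul, comp_gen]
    by_cases h : (if c i then 1 else 0) = s
    · rw [if_pos h, par_gen]
    · rw [if_neg h, map_zero, smul_zero]
  | hadd a b ha hb => rw [map_add, map_add, ha, hb, map_add, map_add]
  | hmul a b ha hb => simp only [map_mul, comp_mul, map_sum, ha, hb]

theorem twistAut_comp (k : ZMod 2) (s : ℕ) (a : DiffPoly p) :
    twistAut k (comp c s a) = comp c s (twistAut k a) := by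
  rcases zmod2_cases k with rfl | rfl
  · simp [twistAut]
  · simpa [twistAut] using par_comp c s a

end Scale

/-! ### Partial derivatives and Euler's identity -/

section Partial

variable [DecidableEq ι]

theorem isHomogPoly_X_pow (V : Type*) [Ring V] [Algebra ℂ V] [DiffSuperalgebra V] (k : ℕ) :
    IsHomogPoly 0 (X ^ k : V[X]) := fun n => by
  rw [coeff_X_pow]
  split_ifs
  · exact isHomog_one
  · exact isHomog_zero _

/-- `∑ₙ λⁿ ∂a/∂u_x^{(n)}`. -/
def partialD (x : ι) : DiffPoly p →ₗ[ℂ] (DiffPoly p)[X] :=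
  twDer (p x) (fun z => if z.1 = x then X ^ z.2 else 0) fun z => by
    split_ifs with h
    · rw [h, CharTwo.add_self_eq_zero]; exact isHomogPoly_X_pow _ _
    · exact fun n => isHomog_zero _

theorem partialD_gen (x i : ι) (k : ℕ) :
    partialD x (gen p i k) = if i = x then X ^ k else 0 := twDer_gen _ _ _ _ _

theorem partialD_mul (x : ι) (a b : DiffPoly p) :
    partialD x (a * b) = C (twistAut (p x) a) * partialD x b + partialD x a * C b := by
  rw [← twist_eq]; exact twDer_mul _ _ _ _ _

theorem partialD_algebraMap (x : ι) (r : ℂ) : partialD x (algebraMap ℂ (DiffPoly p) r) = 0 :=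
  twDer_algebraMap _ _ _ _

/-- `∑ₙ u_x^{(n)} ∂a/∂u_x^{(n)}`. -/
def eulerAt (x : ι) : DiffPoly p →ₗ[ℂ] DiffPoly p :=
  (Polynomial.lsum fun n => LinearMap.mulLeft ℂ (gen p x n)) ∘ₗ partialD x

theorem eulerAt_apply (x : ι) (a : DiffPoly p) :
    eulerAt x a = (partialD x a).sum fun n v => gen p x n * v := by
  rw [eulerAt, LinearMap.comp_apply, lsum_apply]; rfl

/-- The operator is an untwisted derivation: moving the generator past `a` produces the same twist
as the odd partial derivative, and the two cancel. -/
theorem eulerAt_mul (x : ι) (a b : DiffPoly p) :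
    eulerAt x (a * b) = a * eulerAt x b + eulerAt x a * b := by
  have h : ∀ (P Q : (DiffPoly p)[X]) (a b : DiffPoly p),
      (Polynomial.lsum fun n => LinearMap.mulLeft ℂ (gen p x n))
        (C (twistAut (p x) a) * P + Q * C b) =
      a * (Polynomial.lsum fun n => LinearMap.mulLeft ℂ (gen p x n)) P +
        (Polynomial.lsum fun n => LinearMap.mulLeft ℂ (gen p x n)) Q * b := by
    intro P Q a b
    rw [map_add]
    congr 1
    · induction P using Polynomial.induction_on' with
      | add P Q hP hQ => rw [mul_add, map_add, hP, hQ, map_add, mul_add]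
      | monomial n v =>
        have hx : gen p x n * twistAut (p x) a = a * gen p x n := by
          rw [← twistAut_mul_comm (isHomog_gen x n), twistAut_twistAut, CharTwo.add_self_eq_zero]
          simp [twistAut]
        rw [C_mul_monomial, lsum_apply, lsum_apply, sum_monomial_index _ _ (by simp),
          sum_monomial_index _ _ (by simp), LinearMap.mulLeft_apply, LinearMap.mulLeft_apply,
          ← mul_assoc, hx, mul_assoc]
    · induction Q using Polynomial.induction_on' with
      | add P Q hP hQ => rw [add_mul, map_add, hP, hQ, map_add, add_mul]
      | monomial n v =>
        rw [monomial_mul_C, lsum_apply, lsum_apply, sum_monomial_index _ _ (by simp),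
          sum_monomial_index _ _ (by simp), LinearMap.mulLeft_apply, LinearMap.mulLeft_apply,
          mul_assoc]
  rw [eulerAt, LinearMap.comp_apply, partialD_mul, h]; rfl

theorem eulerAt_gen (x i : ι) (k : ℕ) : eulerAt x (gen p i k) = if i = x then gen p i k else 0 := by
  rw [eulerAt_apply, partialD_gen]
  split_ifs with h
  · rw [X_pow_eq_monomial, sum_monomial_index _ _ (by simp), mul_one, h]
  · exact sum_zero_index _

/-- Euler's identity for the component of degree `s` in the variables with `c`. -/
theorem sum_eulerAt_comp [Fintype ι] (c : ι → Prop) [DecidablePred c] (s : ℕ) (a : DiffPoly p) :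
    ∑ x, (if c x then eulerAt x (comp c s a) else 0) = s • comp c s a := by
  induction a using induction generalizing s with
  | hc r =>
    rw [comp_algebraMap]
    split_ifs with h
    · rw [h, zero_smul, Finset.sum_eq_zero]
      intro x _
      rw [eulerAt_apply, partialD_algebraMap, sum_zero_index, ite_self]
    · simp
  | hg i k =>
    rw [comp_gen]
    by_cases h : (if c i then 1 else 0) = s
    · simp only [if_pos h, eulerAt_gen]
      rw [Finset.sum_eq_single i]
      · rw [if_pos rfl, ← h]
        split_ifs <;> simp
      · intro x _ hx; rw [if_neg hx.symm, ite_self]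
      · simp
    · simp [h]
  | hadd a b ha hb =>
    rw [map_add, smul_add, ← ha, ← hb, ← Finset.sum_add_distrib]
    refine Finset.sum_congr rfl fun x _ => ?_
    split_ifs <;> simp
  | hmul a b ha hb =>
    rw [comp_mul, Finset.smul_sum]
    have : ∀ x, (if c x then eulerAt x (∑ y ∈ Finset.HasAntidiagonal.antidiagonal s,
        comp c y.1 a * comp c y.2 b) else 0) = ∑ y ∈ Finset.HasAntidiagonal.antidiagonal s,
        (comp c y.1 a * (if c x then eulerAt x (comp c y.2 b) else 0) +
          (if c x then eulerAt x (comp c y.1 a) else 0) * comp c y.2 b) := by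
      intro x
      split_ifs
      · simp only [map_sum, eulerAt_mul]
      · simp
    simp only [this]
    rw [Finset.sum_comm]
    refine Finset.sum_congr rfl fun y hy => ?_
    rw [Finset.sum_add_distrib, ← Finset.mul_sum, ← Finset.sum_mul, ha, hb,
      ← Finset.HasAntidiagonal.mem_antidiagonal.1 hy, add_smul, mul_smul_comm, smul_mul_assoc,
      add_comm]

/-- An element with vanishing partial derivatives has no component of positive degree. -/
theorem comp_eq_zero_of_partialD [Fintype ι] (c : ι → Prop) [DecidablePred c] {s : ℕ} (hs : s ≠ 0)
    {a : DiffPoly p} (h : ∀ x, c x → partialD x (comp c s a) = 0) : comp c s a = 0 := by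
  have h1 := sum_eulerAt_comp c s a
  rw [Finset.sum_eq_zero] at h1
  -- Euler's identity says s times the component is zero; characteristic 0 allows division by s.
  · rw [← Nat.cast_smul_eq_nsmul ℂ] at h1
    exact (smul_eq_zero.1 h1.symm).resolve_left (Nat.cast_ne_zero.2 hs)
  · intro x _
    split_ifs with hx
    · rw [eulerAt_apply, h x hx, sum_zero_index]
    · rfl

end Partial

/-! ### Lowest-degree parts of derivations -/

section Leading

/-- The polynomials divisible by `X^k`. -/
def IsOrdGe {V : Type*} [Ring V] (k : ℕ) (P : V[X]) : Prop := ∀ q < k, P.coeff q = 0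

theorem IsOrdGe.add {V : Type*} [Ring V] {k : ℕ} {P Q : V[X]} (hP : IsOrdGe k P)
    (hQ : IsOrdGe k Q) : IsOrdGe k (P + Q) := fun q hq => by
  rw [coeff_add, hP q hq, hQ q hq, add_zero]

theorem IsOrdGe.sum {V : Type*} [Ring V] {α : Type*} {k : ℕ} (s : Finset α) {P : α → V[X]}
    (hP : ∀ x ∈ s, IsOrdGe k (P x)) : IsOrdGe k (∑ x ∈ s, P x) := fun q hq => by
  rw [finsetSum_coeff]
  exact Finset.sum_eq_zero fun x hx => hP x hx q hq

theorem IsOrdGe.monomial_mul {V : Type*} [Ring V] {k : ℕ} {P : V[X]} (hP : IsOrdGe k P) (i : ℕ)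
    (v : V) : IsOrdGe (i + k) (monomial i v * P) := fun q hq => by
  rw [← C_mul_X_pow_eq_monomial, mul_assoc, coeff_C_mul, coeff_X_pow_mul']
  split_ifs
  · rw [hP _ (by omega), mul_zero]
  · rw [mul_zero]

theorem IsOrdGe.mul_monomial {V : Type*} [Ring V] {k : ℕ} {P : V[X]} (hP : IsOrdGe k P) (i : ℕ)
    (v : V) : IsOrdGe (k + i) (P * monomial i v) := fun q hq => by
  rw [← C_mul_X_pow_eq_monomial, ← mul_assoc, coeff_mul_X_pow']
  split_ifs
  · rw [coeff_mul_C, hP _ (by omega), zero_mul]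
  · rfl

variable (c : ι → Prop) [DecidablePred c] {k : ZMod 2} {E Δ : DiffPoly p →ₗ[ℂ] DiffPoly p}

/-- If `E` is a twisted derivation on a subalgebra, `E` lowers the degree at most by one on the
generators of the subalgebra, and `Δ` is the corresponding leading part on these generators, then
`Δ` is the leading part of `E`. -/
theorem isOrdGe_of_adjoin {G : Set (DiffPoly p)}
    (hE : ∀ a ∈ Algebra.adjoin ℂ G, ∀ b ∈ Algebra.adjoin ℂ G,
      E (a * b) = twistAut k a * E b + E a * b)
    (hE1 : ∀ r, E (algebraMap ℂ _ r) = 0) (hΔ1 : ∀ r, Δ (algebraMap ℂ _ r) = 0)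
    (hΔ : ∀ a b, Δ (a * b) = twistAut k a * Δ b + Δ a * b)
    (hc : ∀ a ∈ Algebra.adjoin ℂ G, ∀ s, comp c s a ∈ Algebra.adjoin ℂ G)
    (hG : ∀ g ∈ G, ∀ s, IsOrdGe (s + 1) (X * scale c (E (comp c s g)) -
      monomial s (Δ (comp c s g))))
    {a : DiffPoly p} (ha : a ∈ Algebra.adjoin ℂ G) (s : ℕ) :
    IsOrdGe (s + 1) (X * scale c (E (comp c s a)) - monomial s (Δ (comp c s a))) := by
  induction ha using Algebra.adjoin_induction generalizing s with
  | mem g hg => exact hG g hg s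
  | algebraMap r =>
    rw [comp_algebraMap]
    split_ifs
    · rw [hE1, hΔ1]; intro q _; simp
    · intro q _; simp
  | add a b _ _ ha hb =>
    have := (ha s).add (hb s)
    simpa only [map_add, mul_add, add_sub_add_comm] using this
  | mul a b haG hbG ha hb =>
    -- The error for a product is a sum of errors of the factors multiplied by homogeneous
    -- components, and degrees add. The factor `X` in front compensates the lowering of the degree
    -- by one without subtraction.
    have : X * scale c (E (comp c s (a * b))) - monomial s (Δ (comp c s (a * b))) =
        ∑ x ∈ Finset.HasAntidiagonal.antidiagonal s,
          (monomial x.1 (twistAut k (comp c x.1 a)) *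
            (X * scale c (E (comp c x.2 b)) - monomial x.2 (Δ (comp c x.2 b))) +
          (X * scale c (E (comp c x.1 a)) - monomial x.1 (Δ (comp c x.1 a))) *
            monomial x.2 (comp c x.2 b)) := by
      rw [comp_mul]
      simp only [map_sum, Finset.mul_sum]
      rw [← Finset.sum_sub_distrib]
      refine Finset.sum_congr rfl fun x hx => ?_
      rw [hE _ (hc a haG _) _ (hc b hbG _), hΔ, map_add, map_mul, map_mul, twistAut_comp,
        scale_comp, scale_comp, ← Finset.HasAntidiagonal.mem_antidiagonal.1 hx, map_add,
        ← monomial_mul_monomial, ← monomial_mul_monomial, mul_add, mul_sub, sub_mul, ← mul_assoc X,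
        ← mul_assoc X, X_mul, mul_assoc]
      abel
    rw [this]
    refine IsOrdGe.sum _ fun x hx => ?_
    rw [← Finset.HasAntidiagonal.mem_antidiagonal.1 hx]
    refine IsOrdGe.add ?_ ?_
    · rw [add_assoc]; exact (hb x.2).monomial_mul _ _
    · rw [add_right_comm]; exact (ha x.1).mul_monomial _ _

end Leading

end DiffPoly

/-! ### Free generation of the rectangular W-superalgebra -/

section Generation

variable {m n N : ℕ}

local notation "ρ" => rho m n N
local notation "ϖ" => rectPar m n N
local notation "π" => innerPar m n
local notation "B" => rectB m n N
local notation "ℓ" => rectL m n N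
local notation "ε" => rectSign N

/-- The indices of the entries of `𝔭` outside the last block row. -/
def IsTop (x : RIdx m n N × RIdx m n N) : Prop := (x.2.1 : ℕ) ≤ x.1.1 ∧ (x.1.1 : ℕ) + 1 < N

instance : DecidablePred (IsTop (m := m) (n := n) (N := N)) := fun x =>
  inferInstanceAs (Decidable ((x.2.1 : ℕ) ≤ x.1.1 ∧ (x.1.1 : ℕ) + 1 < N))

theorem rectB_of_lt {x y : RIdx m n N} (h : (x.1 : ℕ) < y.1) :
    B x y = if (y.1 : ℕ) = x.1 + 1 ∧ x.2 = y.2 then 1 else 0 := by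
  have h1 := hessOp_rectQ x y
  have hne : x ≠ y := by rintro rfl; exact lt_irrefl _ h
  rw [hessOp, if_neg hne, zero_add, if_neg (not_le.2 h), zero_add] at h1
  have h2 := congrArg (fun P => P.coeff 0) h1
  simp only [zero_add, coeff_C_zero] at h2
  rw [← h2]
  split_ifs <;> simp

/-- Outside the last row all generators on and below the diagonal are top variables, so in degree
zero only the identity blocks survive. -/
theorem comp_zero_rectB {x : RIdx m n N} (hx : (x.1 : ℕ) + 1 < N) (y : RIdx m n N) :
    DiffPoly.comp IsTop 0 (B x y) = if (y.1 : ℕ) = x.1 + 1 ∧ x.2 = y.2 then 1 else 0 := by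
  rcases le_or_gt (y.1 : ℕ) x.1 with h | h
  · have hd : hDeg m n N (x, y) < 2 := by rw [hDeg_apply]; omega
    have ht : IsTop (x, y) := ⟨h, hx⟩
    rw [rectB, rho_gen_of_lt hd, map_smul, DiffPoly.comp_gen, if_pos ht,
      if_neg one_ne_zero, smul_zero, if_neg (by omega)]
  · rw [rectB_of_lt h]
    have h1 : DiffPoly.comp IsTop 0 (1 : RectV m n N) = 1 := by
      rw [← map_one (algebraMap ℂ (RectV m n N)), DiffPoly.comp_algebraMap, if_pos rfl]
    split_ifs
    · exact h1
    · exact map_zero _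

theorem sub_X_mul_sub_leibniz {V : Type*} [Ring V] (c b P P' Q Q' R R' : V[X]) :
    c * P + P' * b - X * (c * Q + Q' * b) - (c * R + R' * b) =
      c * (P - X * Q - R) + (P' - X * Q' - R') * b := by
  simp only [mul_add, mul_sub, sub_mul, ← mul_assoc X, X_mul, mul_assoc]
  abel

/-! ### The lowest-degree action of 𝔫 on the top variables -/

section Leading

variable (u v : Fin N) (hu : (u : ℕ) + 1 < N) (hv : v ≤ u) (i k : GlIdx m n)

/-- The leading part of the derivation `ρ {e_{(v,k),(u+1,i)} _λ ·}`, up to a sign. -/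
def leading : RectV m n N →ₗ[ℂ] (RectV m n N)[X] :=
  (if (u : ℕ) + 2 < N then
    DiffPoly.partialD (((⟨u + 1, hu⟩, i), (⟨v + 1, by omega⟩, k)) : RIdx m n N × RIdx m n N) -
    LinearMap.mulLeft ℂ X ∘ₗ
      DiffPoly.partialD (((⟨u + 1, hu⟩, i), (v, k)) : RIdx m n N × RIdx m n N) else 0) -
    DiffPoly.partialD (((u, i), (v, k)) : RIdx m n N × RIdx m n N)

theorem leading_mul (a b : RectV m n N) : leading u v hu hv i k (a * b) =
    C (twistAut (π i + π k) a) * leading u v hu hv i k b + leading u v hu hv i k a * C b := by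
  have h1 : ∀ (x : RIdx m n N × RIdx m n N), glPar ϖ x = π i + π k →
      DiffPoly.partialD x (a * b) = C (twistAut (π i + π k) a) * DiffPoly.partialD x b +
        DiffPoly.partialD x a * C b := by
    intro x hx; rw [DiffPoly.partialD_mul, hx]
  have h4 : ∀ (w w' : Fin N), DiffPoly.partialD (((w, i), (w', k)) : RIdx m n N × RIdx m n N)
      (a * b) = _ := fun w w' => h1 ((w, i), (w', k)) rfl
  rw [leading]
  split_ifs
  · simp only [LinearMap.sub_apply, LinearMap.comp_apply, LinearMap.mulLeft_apply, h4]
    exact sub_X_mul_sub_leibniz _ _ _ _ _ _ _ _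
  · simp only [LinearMap.neg_apply, zero_sub, h4, mul_neg, neg_mul, neg_add]

theorem leading_algebraMap (r : ℂ) :
    leading u v hu hv i k (algebraMap ℂ (RectV m n N) r) = 0 := by
  rw [leading]
  split_ifs <;> simp [DiffPoly.partialD_algebraMap]

theorem leading_gen_succ (y : RIdx m n N × RIdx m n N) (l : ℕ) :
    leading u v hu hv i k (DiffPoly.gen (glPar ϖ) y (l + 1)) =
      lamD (leading u v hu hv i k (DiffPoly.gen (glPar ϖ) y l)) := by
  have h1 : ∀ x : RIdx m n N × RIdx m n N, DiffPoly.partialD x (DiffPoly.gen (glPar ϖ) y (l + 1)) =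
      lamD (DiffPoly.partialD x (DiffPoly.gen (glPar ϖ) y l)) := by
    intro x
    rw [DiffPoly.partialD_gen, DiffPoly.partialD_gen]
    split_ifs
    · rw [← lamD_pow_one, ← lamD_pow_one, pow_succ', Module.End.mul_apply]
    · rw [map_zero]
  rw [leading]
  split_ifs <;> simp [h1, lamD_X_mul]

theorem leading_gen_of_not_isTop {y : RIdx m n N × RIdx m n N} (hy : ¬ IsTop y) (l : ℕ) :
    leading u v hu hv i k (DiffPoly.gen (glPar ϖ) y l) = 0 := by
  have h1 : ∀ x, IsTop x → DiffPoly.partialD x (DiffPoly.gen (glPar ϖ) y l) = 0 := by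
    intro x hx
    rw [DiffPoly.partialD_gen, if_neg]
    rintro rfl
    exact hy hx
  have hv' : (v : ℕ) ≤ u := hv
  have h2 := h1 ((u, i), (v, k)) ⟨hv', hu⟩
  rw [leading]
  split_ifs with h
  · have h3 := h1 ((⟨u + 1, hu⟩, i), (⟨v + 1, by omega⟩, k)) ⟨by simpa using hv, h⟩
    have h4 := h1 ((⟨u + 1, hu⟩, i), (v, k)) ⟨by dsimp only; omega, h⟩
    simp [h2, h3, h4]
  · simp [h2]

/-- The sign relating `leading` to the bracket. -/
def leadSign : ℂ := sgn (π k) * sgn (π k * π i) * (sgn ((π k + π i) * π i) * sgn (π i))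

theorem leadSign_ne_zero : leadSign i k ≠ 0 := by
  have h : ∀ a, sgn a ≠ 0 := fun a ha => by
    have := sgn_mul_self a
    rw [ha, mul_zero] at this
    exact zero_ne_one this
  exact mul_ne_zero (mul_ne_zero (h _) (h _)) (mul_ne_zero (h _) (h _))

/-- In degree zero the commutator with e_{(v,k),(u+1,i)} meets only identity blocks, so the two
matrix products become shifts of block indices and the level term supplies λ: three Kronecker
deltas, one for each partial derivative. -/
theorem comp_zero_wBilin_gen {y : RIdx m n N × RIdx m n N} (hy : IsTop y) :
    coeffMap (DiffPoly.comp IsTop 0) (wBilin (-1) (DiffPoly.gen (glPar ϖ)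
      ((v, k), (⟨u + 1, hu⟩, i)) 0) (DiffPoly.gen (glPar ϖ) y 0)) =
    leadSign i k • leading u v hu hv i k (DiffPoly.gen (glPar ϖ) y 0) := by
  obtain ⟨h, q⟩ := y
  have hv' : (v : ℕ) ≤ u := hv
  have hX : coeffMap (DiffPoly.comp IsTop 0) (X : (RectV m n N)[X]) = X := by
    have h1 : DiffPoly.comp IsTop 0 (1 : RectV m n N) = 1 := by
      rw [← map_one (algebraMap ℂ (RectV m n N)), DiffPoly.comp_algebraMap, if_pos rfl]
    rw [← monomial_one_one_eq_X, coeffMap_monomial, h1]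
  have h0 := wBilin_gen_gen (m := m) (n := n) ((v, k), (⟨u + 1, hu⟩, i)) (h, q)
  have h1 := congrArg (fun F => coeffMap (DiffPoly.comp IsTop 0)
    ((sgn (glPar ϖ ((v, k), (⟨u + 1, hu⟩, i)) * ϖ h) * sgn (ϖ h)) • F)) h0
  simp only [smul_smul, mul_mul_mul_comm _ _ (sgn (_ * _)) (sgn (ϖ h)), sgn_mul_self, one_mul,
    one_smul] at h1
  rw [h1]
  have e1 : coeffMap (DiffPoly.comp IsTop 0) (if h = (⟨u + 1, hu⟩, i) then C (B (v, k) q) else 0) =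
      if h = (⟨u + 1, hu⟩, i) ∧ q = (⟨v + 1, by omega⟩, k) then 1 else 0 := by
    by_cases hh : h = (⟨u + 1, hu⟩, i)
    · rw [if_pos hh, coeffMap_C, comp_zero_rectB (by dsimp only; omega)]
      have : ((q.1 : ℕ) = (v : ℕ) + 1 ∧ k = q.2) ↔
          (h = (⟨u + 1, hu⟩, i) ∧ q = (⟨v + 1, by omega⟩, k)) := by
        rw [Prod.ext_iff (x := q), Fin.ext_iff]
        exact ⟨fun h' => ⟨hh, h'.1, h'.2.symm⟩, fun h' => ⟨h'.2.1, h'.2.2.symm⟩⟩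
      simp only [this]
      split_ifs <;> simp
    · rw [if_neg hh, if_neg (fun h' => hh h'.1), map_zero]
  have e2 : coeffMap (DiffPoly.comp IsTop 0) (if q = (v, k) then C (B h (⟨u + 1, hu⟩, i)) else 0) =
      if h = (u, i) ∧ q = (v, k) then 1 else 0 := by
    by_cases hq : q = (v, k)
    · rw [if_pos hq, coeffMap_C, comp_zero_rectB hy.2]
      have : ((u : ℕ) + 1 = (h.1 : ℕ) + 1 ∧ h.2 = i) ↔ (h = (u, i) ∧ q = (v, k)) := by
        rw [Prod.ext_iff (x := h), Fin.ext_iff]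
        exact ⟨fun h' => ⟨⟨by dsimp only; omega, h'.2⟩, hq⟩,
          fun h' => ⟨by have := h'.1.1; dsimp only at this; omega, h'.1.2⟩⟩
      simp only [this]
      split_ifs <;> simp
    · rw [if_neg hq, if_neg (fun h' => hq h'.2), map_zero]
  have e3 : coeffMap (DiffPoly.comp IsTop 0) (if h = (⟨u + 1, hu⟩, i) ∧ q = (v, k) then
      (X : (RectV m n N)[X]) else 0) = if h = (⟨u + 1, hu⟩, i) ∧ q = (v, k) then X else 0 := by
    split_ifs
    · exact hX
    · exact map_zero _
  rw [map_smul, map_sub, map_sub, e1, e2, e3]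
  -- If block `u + 1` is the last one, no top variable lies in its row, and the deltas for that row
  -- vanish; hence the case distinction in `leading`.
  have hlast : ¬ ((u : ℕ) + 2 < N) → h ≠ (⟨u + 1, hu⟩, i) := by
    rintro h' rfl
    have := hy.2
    dsimp only at this
    omega
  have hval : (if h = (⟨u + 1, hu⟩, i) ∧ q = (⟨v + 1, by omega⟩, k) then 1 else 0) -
      (if h = (u, i) ∧ q = (v, k) then 1 else 0) -
      (if h = (⟨u + 1, hu⟩, i) ∧ q = (v, k) then X else 0 : (RectV m n N)[X]) =
      leading u v hu hv i k (DiffPoly.gen (glPar ϖ) (h, q) 0) := by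
    rw [leading]
    by_cases hN2 : (u : ℕ) + 2 < N
    · simp only [if_pos hN2, LinearMap.sub_apply, LinearMap.comp_apply, LinearMap.mulLeft_apply,
        DiffPoly.partialD_gen, Prod.mk.injEq, pow_zero, mul_ite, mul_one, mul_zero]
      exact sub_right_comm _ _ _
    · simp only [if_neg hN2, if_neg (fun h' => hlast hN2 (And.left h')), LinearMap.sub_apply,
        LinearMap.zero_apply, DiffPoly.partialD_gen, Prod.mk.injEq, pow_zero, sub_zero]
  rw [← hval]
  -- The sign depends on the parity of the row `h`. It equals `leadSign` as soon as h has inner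
  -- index i, and otherwise every delta is zero.
  by_cases hi : h.2 = i
  · refine congrArg (· • _) ?_
    have hs : ϖ h = π i := by rw [rectPar, hi]
    rw [hs]
    simp only [leadSign, glPar, rectPar]
    ring
  · have h1 : ∀ w, h ≠ (w, i) := by rintro w rfl; exact hi rfl
    simp [h1]

theorem comp_zero_wBilin {y : RIdx m n N × RIdx m n N} (hy : IsTop y) (l : ℕ) :
    coeffMap (DiffPoly.comp IsTop 0) (wBilin (-1) (DiffPoly.gen (glPar ϖ)
      ((v, k), (⟨u + 1, hu⟩, i)) 0) (DiffPoly.gen (glPar ϖ) y l)) =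
    leadSign i k • leading u v hu hv i k (DiffPoly.gen (glPar ϖ) y l) := by
  induction l with
  | zero => exact comp_zero_wBilin_gen u v hu hv i k hy
  | succ l ih =>
    have h1 : ∀ P : (RectV m n N)[X], coeffMap (DiffPoly.comp IsTop 0) (lamD P) =
        lamD (coeffMap (DiffPoly.comp IsTop 0) P) := by
      intro P
      ext q
      rw [coeff_coeffMap, coeff_lamD, coeff_lamD, map_add, DiffPoly.comp_zero_der, coeff_coeffMap]
      congr 1
      cases q with
      | zero => rw [coeff_X_mul_zero, coeff_X_mul_zero, map_zero]
      | succ q => rw [coeff_X_mul, coeff_X_mul, coeff_coeffMap]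
    rw [← DiffPoly.der_gen, wBilin_der_right, h1, ih, DiffPoly.der_gen, leading_gen_succ, map_smul]

end Leading

theorem comp_mem_subVp {a : RectV m n N} (ha : a ∈ subVp m n N) (s : ℕ) :
    DiffPoly.comp IsTop s a ∈ subVp m n N := by
  induction ha using Algebra.adjoin_induction generalizing s with
  | mem g hg =>
    obtain ⟨y, l, hy, rfl⟩ := hg
    rw [DiffPoly.comp_gen]
    by_cases h : (if IsTop y then 1 else 0) = s
    · rw [if_pos h]; exact Algebra.subset_adjoin ⟨y, l, hy, rfl⟩
    · rw [if_neg h]; exact zero_mem _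
  | algebraMap r =>
    rw [DiffPoly.comp_algebraMap]
    split_ifs
    · exact algebraMap_mem _ _
    · exact zero_mem _
  | add a b _ _ ha hb => rw [map_add]; exact add_mem (ha s) (hb s)
  | mul a b _ _ ha hb =>
    rw [DiffPoly.comp_mul]
    exact sum_mem fun x _ => mul_mem (ha _) (hb _)

/-- It suffices to look at generators of 𝒱(𝔭). A top variable loses at most one degree, with leading
part `comp_zero_wBilin`; a last-row generator has degree 0, which cannot drop further, and `leading`
kills it. -/
theorem isOrdGe_wBilin (u v : Fin N) (hu : (u : ℕ) + 1 < N) (hv : v ≤ u) (i k : GlIdx m n) (r : ℕ)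
    {a : RectV m n N} (ha : a ∈ subVp m n N) (s : ℕ) : DiffPoly.IsOrdGe (s + 1)
      (X * DiffPoly.scale IsTop ((wBilin (-1) (DiffPoly.gen (glPar ϖ)
        ((v, k), (⟨u + 1, hu⟩, i)) 0) (DiffPoly.comp IsTop s a)).coeff r) -
      monomial s ((leadSign i k • leading u v hu hv i k (DiffPoly.comp IsTop s a)).coeff r)) := by
  have hf : IsHomog (π i + π k) (DiffPoly.gen (glPar ϖ)
      (((v, k), (⟨u + 1, hu⟩, i)) : RIdx m n N × RIdx m n N) 0) := by
    rw [add_comm]; exact DiffPoly.isHomog_gen _ _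
  refine DiffPoly.isOrdGe_of_adjoin IsTop (k := π i + π k)
    (E := (lcoeff _ r).restrictScalars ℂ ∘ₗ wBilin (-1) (DiffPoly.gen (glPar ϖ)
      ((v, k), (⟨u + 1, hu⟩, i)) 0))
    (Δ := (lcoeff _ r).restrictScalars ℂ ∘ₗ (leadSign i k • leading u v hu hv i k))
    (fun a ha b hb => ?_) (fun c => ?_) (fun c => ?_) (fun a b => ?_)
    (fun a ha s => comp_mem_subVp ha s) ?_ ha s
  · simp only [LinearMap.comp_apply, LinearMap.restrictScalars_apply, lcoeff_apply,
      wBilin_mul (-1) hf, rho_twistAut, coeff_add, coeff_C_mul, coeff_mul_C, mem_subVp_iff.1 ha,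
      mem_subVp_iff.1 hb]
  · simp [wBilin_algebraMap]
  · simp [leading_algebraMap]
  · simp only [LinearMap.comp_apply, LinearMap.restrictScalars_apply, lcoeff_apply,
      LinearMap.smul_apply, leading_mul, smul_add, coeff_add, coeff_smul, coeff_C_mul, coeff_mul_C,
      mul_smul_comm, smul_mul_assoc]
  · rintro _ ⟨y, l, -, rfl⟩ s
    rw [DiffPoly.comp_gen]
    split_ifs with hy hs hs
    · subst hs
      intro q hq
      have h := congrArg (fun P => P.coeff r) (comp_zero_wBilin u v hu hv i k hy l)
      simp only [coeff_coeffMap, DiffPoly.comp_apply] at h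
      simp only [LinearMap.comp_apply, LinearMap.restrictScalars_apply, lcoeff_apply,
        LinearMap.smul_apply, coeff_sub, coeff_monomial]
      interval_cases q
      · rw [coeff_X_mul_zero]; simp
      · rw [coeff_X_mul, h]; simp
    · intro q _; simp
    · subst hs
      intro q hq
      interval_cases q
      simp [leading_gen_of_not_isTop u v hu hv i k hy]
    · intro q _; simp

/-- If the components below degree s vanish, the part of degree s - 1 of each invariance equation
involves only the leading action on the component of degree s. These equations form a triangular
system for its partial derivatives. -/
theorem comp_eq_zero_of_mem_wAlg {a : RectV m n N} (ha : a ∈ wAlg m n N (-1))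
    (h0 : DiffPoly.comp IsTop 0 a = 0) (s : ℕ) : DiffPoly.comp IsTop s a = 0 := by
  induction s using Nat.strong_induction_on with
  | _ s ih =>
    rcases eq_or_ne s 0 with rfl | hs
    · exact h0
    -- Take the coefficient of X^s in the invariance equation: components of lower degree are zero
    -- by induction, and those of higher degree contribute only to higher powers of X.
    have hlead : ∀ (u v : Fin N) (hu : (u : ℕ) + 1 < N) (hv : v ≤ u) (i k : GlIdx m n),
        leading u v hu hv i k (DiffPoly.comp IsTop s a) = 0 := by
      intro u v hu hv i k
      have hD : wBilin (-1) (DiffPoly.gen (glPar ϖ) ((v, k), (⟨u + 1, hu⟩, i)) 0) a = 0 := by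
        refine ((mem_wAlg_iff (-1)).1 ha).2 _ ?_
        have hv' : (v : ℕ) ≤ u := hv
        rw [hDeg_apply]
        dsimp only
        omega
      have hz : leadSign i k • leading u v hu hv i k (DiffPoly.comp IsTop s a) = 0 := by
        ext r
        have hO := isOrdGe_wBilin u v hu hv i k r ha.1
        set M := max (DiffPoly.scale IsTop a).natDegree s + 1
        have hsum := DiffPoly.sum_comp IsTop (a := a) (M := M) (by omega)
        have h1 : ∑ q ∈ Finset.range M, (X * DiffPoly.scale IsTop ((wBilin (-1)
            (DiffPoly.gen (glPar ϖ) ((v, k), (⟨u + 1, hu⟩, i)) 0)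
            (DiffPoly.comp IsTop q a)).coeff r)).coeff s = 0 := by
          rw [← finsetSum_coeff, ← Finset.mul_sum, ← map_sum, ← finsetSum_coeff, ← map_sum, hsum,
            hD, coeff_zero, map_zero, mul_zero, coeff_zero]
        rw [Finset.sum_eq_single s] at h1
        · have h2 := hO s s (by omega)
          rw [coeff_sub, h1, coeff_monomial, if_pos rfl, zero_sub, neg_eq_zero] at h2
          rw [h2, coeff_zero]
        · intro q _ hq
          rcases lt_or_gt_of_ne hq with hq' | hq'
          · rw [ih q hq', map_zero, coeff_zero, map_zero, mul_zero, coeff_zero]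
          · have h2 := hO q s (by omega)
            rwa [coeff_sub, coeff_monomial, if_neg hq, sub_zero] at h2
        · intro hM
          exact absurd (Finset.mem_range.2 (by omega)) hM
      exact (smul_eq_zero.1 hz).resolve_left (leadSign_ne_zero i k)
    -- Descending induction on the block row, with `t` its distance from the end. In the row before
    -- the last, t = 1, the equation is a single partial derivative; above it, the other two
    -- derivatives belong to the next row.
    have hpart : ∀ (t : ℕ) (u v : Fin N), (u : ℕ) + 1 + t = N → (u : ℕ) + 1 < N → v ≤ u →
        ∀ i k : GlIdx m n, DiffPoly.partialD (((u, i), (v, k)) : RIdx m n N × RIdx m n N)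
          (DiffPoly.comp IsTop s a) = 0 := by
      intro t
      induction t with
      | zero => intro u v ht hu; omega
      | succ t iht =>
        intro u v ht hu hv i k
        have h := hlead u v hu hv i k
        have hv' : (v : ℕ) ≤ u := hv
        rw [leading] at h
        split_ifs at h with hN2
        · have h1 := iht ⟨u + 1, hu⟩ ⟨v + 1, by omega⟩ (by dsimp only; omega) hN2
            (by simpa using hv) i k
          have h2 := iht ⟨u + 1, hu⟩ v (by dsimp only; omega) hN2
            (by rw [Fin.le_def]; dsimp only; omega) i k
          simpa only [LinearMap.sub_apply, LinearMap.comp_apply, LinearMap.mulLeft_apply, h1, h2,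
            mul_zero, sub_zero, zero_sub, neg_eq_zero] using h
        · simpa only [zero_sub, LinearMap.neg_apply, neg_eq_zero] using h
    refine DiffPoly.comp_eq_zero_of_partialD IsTop hs fun x hx => ?_
    obtain ⟨⟨u, i⟩, ⟨v, k⟩⟩ := x
    obtain ⟨hv, hu⟩ := hx
    exact hpart (N - (u + 1)) u v (by dsimp only at hu; omega) hu hv i k

/-- An element of W is therefore determined by its restriction to the last block row. -/
theorem eq_zero_of_mem_wAlg {a : RectV m n N} (ha : a ∈ wAlg m n N (-1))
    (h0 : DiffPoly.comp IsTop 0 a = 0) : a = 0 := by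
  rw [← DiffPoly.sum_comp IsTop (a := a) (Nat.lt_succ_self _)]
  exact Finset.sum_eq_zero fun s _ => comp_eq_zero_of_mem_wAlg ha h0 s

end Generation

/-! ### The last block row as free coordinates on the W-superalgebra -/

section Generators

variable {m n N : ℕ}

local notation "ρ" => rho m n N
local notation "ϖ" => rectPar m n N
local notation "π" => innerPar m n
local notation "ℓ" => rectL m n N
local notation "ε" => rectSign N

theorem IsHomog.der_pow {V : Type*} [Ring V] [Algebra ℂ V] [DiffSuperalgebra V] {i : ZMod 2} {a : V}
    (h : IsHomog i a) (k : ℕ) : IsHomog i ((SuperPVA.der ^ k : Module.End ℂ V) a) := by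
  induction k with
  | zero => exact h
  | succ k ih => rw [pow_succ', Module.End.mul_apply]; exact ih.der

variable (m n N) in
/-- The parity of the generator `w_{ij;k}`. -/
def wPar (x : Fin N × GlIdx m n × GlIdx m n) : ZMod 2 := π x.2.1 + π x.2.2

/-- With no entries in the first rows the recursion just multiplies by -∂. -/
theorem psi_eq_monomial {V : Type*} [Ring V] [Algebra ℂ V] [DiffSuperalgebra V]
    {T : Type*} [Fintype T] [DecidableEq T] {Q : ℕ → ℕ → T → T → V} {M : ℕ}
    (hQ : ∀ u < M, ∀ v i j, Q u v i j = 0) {u : ℕ} (hu : u ≤ M) (i b : T) :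
    psi Q u i b = if i = b then monomial u ((-1) ^ u) else 0 := by
  induction u generalizing i b with
  | zero => simp [psi]
  | succ u ih =>
    have h0 : der ((-1 : V) ^ u) = 0 := by
      have : ((-1 : V) ^ u) = algebraMap ℂ _ ((-1) ^ u) := by simp
      rw [this, der_algebraMap]
    simp only [psi, hQ u (by omega), C_0, zero_mul, Finset.sum_const_zero, add_zero]
    rw [ih (by omega)]
    split_ifs
    · rw [lamD_apply, coeffMap_monomial, h0, map_zero, add_zero, X_mul_monomial, ← map_neg,
        pow_succ, mul_neg_one]
    · rw [map_zero, neg_zero]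

/-- If only the last row of Q is nonzero, ψ_N is affine in it without derivatives, so each entry of
that row appears as one coefficient, up to sign. -/
theorem coeff_psi_last {V : Type*} [Ring V] [Algebra ℂ V] [DiffSuperalgebra V]
    {T : Type*} [Fintype T] [DecidableEq T] {Q : ℕ → ℕ → T → T → V} {M : ℕ}
    (hQ : ∀ u < M, ∀ v i j, Q u v i j = 0) {k : ℕ} (hk : k ≤ M) (i b : T) :
    (psi Q (M + 1) i b).coeff k = -(Q M k i b * (-1) ^ k) := by
  have h0 : der ((-1 : V) ^ M) = 0 := by
    have : ((-1 : V) ^ M) = algebraMap ℂ _ ((-1) ^ M) := by simp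
    rw [this, der_algebraMap]
  have h1 : ∀ v : Fin (M + 1), ∑ j, C (Q M v i j) * psi Q v j b =
      monomial v (Q M v i b * (-1) ^ (v : ℕ)) := by
    intro v
    rw [Finset.sum_eq_single b]
    · rw [psi_eq_monomial hQ (by omega), if_pos rfl, C_mul_monomial]
    · intro j _ hj
      rw [psi_eq_monomial hQ (by omega), if_neg hj, mul_zero]
    · simp
  have h2 : (lamD (psi Q M i b)).coeff k = 0 := by
    rw [psi_eq_monomial hQ le_rfl]
    split_ifs
    · rw [lamD_apply, coeffMap_monomial, h0, map_zero, add_zero, X_mul_monomial, coeff_monomial,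
        if_neg (by omega)]
    · rw [map_zero, coeff_zero]
  rw [psi, coeff_neg, coeff_add, h2, zero_add]
  simp only [h1]
  rw [finsetSum_coeff, Finset.sum_eq_single ⟨k, by omega⟩]
  · rw [coeff_monomial, if_pos rfl]
  · intro v _ hv
    rw [coeff_monomial, if_neg]
    intro h
    exact hv (Fin.ext h)
  · simp

/-- The sign of the entry of the last block row corresponding to `w_{ij;k}`. -/
def wSign (x : Fin N × GlIdx m n × GlIdx m n) : ℂ :=
  (-1) ^ (N - 1) * (-1) ^ (x.1 : ℕ) * sgn (π x.2.1)

theorem wSign_mul_self (x : Fin N × GlIdx m n × GlIdx m n) : wSign x * wSign x = 1 := by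
  rw [wSign, mul_mul_mul_comm, sgn_mul_self, mul_one, mul_mul_mul_comm, ← mul_pow, ← mul_pow]
  norm_num

/-- The restriction to the last block row. -/
def lastRow : RectV m n N →ₐ[ℂ] DiffPoly (wPar m n N) :=
  DiffPoly.liftHom (fun x k => if (x.1.1 : ℕ) + 1 = N then
    wSign (x.2.1, x.1.2, x.2.2) • DiffPoly.gen (wPar m n N) (x.2.1, x.1.2, x.2.2) k else 0)
    fun x y k l => by
      have h : ∀ (x : RIdx m n N × RIdx m n N) k, IsHomog (glPar ϖ x)
          (if (x.1.1 : ℕ) + 1 = N then wSign (x.2.1, x.1.2, x.2.2) •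
            DiffPoly.gen (wPar m n N) (x.2.1, x.1.2, x.2.2) k else 0) := by
        intro x k
        split_ifs
        · exact (DiffPoly.isHomog_gen (p := wPar m n N) _ _).smul _
        · exact isHomog_zero _
      exact DiffSuperalgebra.supercomm _ _ _ _ (h x k) (h y l)

theorem lastRow_gen (x : RIdx m n N × RIdx m n N) (k : ℕ) :
    lastRow (DiffPoly.gen (glPar ϖ) x k) = if (x.1.1 : ℕ) + 1 = N then
      wSign (x.2.1, x.1.2, x.2.2) • DiffPoly.gen (wPar m n N) (x.2.1, x.1.2, x.2.2) k else 0 :=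
  DiffPoly.liftHom_gen _ _ _ _

theorem DiffPoly.algHom_der {ι : Type*} {p : ι → ZMod 2} {W : Type*} [Ring W] [Algebra ℂ W]
    [DiffSuperalgebra W] (φ : DiffPoly p →ₐ[ℂ] W)
    (h : ∀ i k, φ (DiffPoly.gen p i (k + 1)) = der (φ (DiffPoly.gen p i k))) (a : DiffPoly p) :
    φ (der a) = der (φ a) := by
  induction a using DiffPoly.induction with
  | hc r => rw [der_algebraMap, map_zero, AlgHom.commutes, der_algebraMap]
  | hg i k => rw [DiffPoly.der_gen, h]
  | hadd a b ha hb => simp only [map_add, ha, hb]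
  | hmul a b ha hb => simp only [der_mul, map_add, map_mul, ha, hb]

theorem lastRow_der (a : RectV m n N) : lastRow (der a) = der (lastRow a) := by
  refine DiffPoly.algHom_der _ (fun x k => ?_) a
  rw [lastRow_gen, lastRow_gen]
  split_ifs
  · rw [map_smul, DiffPoly.der_gen]
  · rw [map_zero]

/-- The sign `wSign` combines ε, the factor (-1)^k from `coeff_psi_last` and the sign in A(∂), so
that the restriction of a coefficient of L is exactly a free generator. -/
theorem lastRow_coeff_rectL (k : Fin N) (i j : GlIdx m n) :
    lastRow ((ℓ i j).coeff k) = DiffPoly.gen (wPar m n N) (k, i, j) 0 := by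
  obtain ⟨M, rfl⟩ : ∃ M, N = M + 1 := ⟨N - 1, by have := k.2; omega⟩
  have hk := k.2
  have hQ : ∀ u < M, ∀ v i j, lastRow (rectQ m n (M + 1) u v i j) = 0 := by
    intro u hu v i j
    rw [rectQ]
    split_ifs
    · rw [map_smul, lastRow_gen, if_neg (by dsimp only; omega), smul_zero]
    · exact map_zero _
  have h1 : lastRow ((psi (rectQ m n (M + 1)) (M + 1) i j).coeff k) =
      (psi (fun u v i j => lastRow (rectQ m n (M + 1) u v i j)) (M + 1) i j).coeff k := by
    rw [← map_psi _ lastRow_der, coeff_map]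
    rfl
  have h2 : lastRow (rectQ m n (M + 1) M k i j) = ((-1) ^ M * (-1) ^ (k : ℕ) : ℂ) •
      DiffPoly.gen (wPar m n (M + 1)) (k, i, j) 0 := by
    rw [rectQ, dif_pos ⟨by omega, by omega⟩, map_smul, lastRow_gen, if_pos rfl, smul_smul, wSign,
      mul_comm, mul_assoc, sgn_mul_self, mul_one]
    rfl
  have h3 : ((-1 : DiffPoly (wPar m n (M + 1))) ^ (k : ℕ)) = algebraMap ℂ _ ((-1) ^ (k : ℕ)) := by
    simp
  rw [rectL, coeff_smul, coeff_neg, map_smul, map_neg, h1, coeff_psi_last hQ (by omega), neg_neg, h2,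
    rectSign, h3, ← Algebra.commutes, ← Algebra.smul_def, smul_smul, smul_smul, Nat.add_sub_cancel]
  have h4 : ((-1 : ℂ) ^ M * (-1) ^ (k : ℕ) * ((-1) ^ M * (-1) ^ (k : ℕ))) = 1 := by
    rw [mul_mul_mul_comm, ← mul_pow, ← mul_pow]
    norm_num
  rw [h4, one_smul]

/-- On 𝒱(𝔭), putting the top variables to zero factors through `lastRow`, because every generator of
𝔭 is either a top variable or in the last row. -/
theorem comp_zero_eq_zero_of_lastRow (hN : 0 < N) {a : RectV m n N} (ha : a ∈ subVp m n N)
    (h : lastRow a = 0) : DiffPoly.comp IsTop 0 a = 0 := by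
  -- The reinsertion of the last-row variables, with the same signs as in `lastRow`, since these
  -- square to 1.
  let σ : DiffPoly (wPar m n N) →ₐ[ℂ] RectV m n N := DiffPoly.liftHom (fun x k =>
    wSign x • DiffPoly.gen (glPar ϖ) ((⟨N - 1, by omega⟩, x.2.1), (x.1, x.2.2)) k)
    fun x y k l => DiffSuperalgebra.supercomm _ _ _ _
      ((DiffPoly.isHomog_gen (p := glPar ϖ) ((⟨N - 1, by omega⟩, x.2.1), (x.1, x.2.2)) k).smul _)
      ((DiffPoly.isHomog_gen (p := glPar ϖ) ((⟨N - 1, by omega⟩, y.2.1), (y.1, y.2.2)) l).smul _)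
  have hσ : ∀ x k, σ (DiffPoly.gen (wPar m n N) x k) = wSign x •
      DiffPoly.gen (glPar ϖ) ((⟨N - 1, by omega⟩, x.2.1), (x.1, x.2.2)) k :=
    fun x k => DiffPoly.liftHom_gen _ _ _ _
  have key : DiffPoly.comp IsTop 0 a = σ (lastRow a) := by
    clear h
    induction ha using Algebra.adjoin_induction with
    | mem g hg =>
      obtain ⟨⟨x, y⟩, k, hx, rfl⟩ := hg
      rw [hDeg_apply] at hx
      rw [DiffPoly.comp_gen, lastRow_gen]
      by_cases hl : (x.1 : ℕ) + 1 = N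
      · have hnt : ¬ IsTop (x, y) := fun h => absurd h.2 (by dsimp only; omega)
        have hx1 : (⟨N - 1, by omega⟩ : Fin N) = x.1 := Fin.ext (by dsimp only; omega)
        rw [if_neg hnt, if_pos rfl, if_pos hl, map_smul, hσ, smul_smul, wSign_mul_self, one_smul]
        simp only [hx1]
      · have ht : IsTop (x, y) := ⟨by dsimp only; omega, by have := x.1.2; dsimp only; omega⟩
        rw [if_pos ht, if_neg one_ne_zero, if_neg hl, map_zero]
    | algebraMap r => rw [DiffPoly.comp_algebraMap, if_pos rfl, AlgHom.commutes, AlgHom.commutes]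
    | add a b _ _ ha hb => simp only [map_add, ha, hb]
    | mul a b _ _ ha hb => rw [DiffPoly.comp_zero_mul, ha, hb, map_mul, map_mul]
  rw [key, h, map_zero]

/-- The homomorphism sending the generators to the coefficients of `L(∂)`. -/
def wHom : DiffPoly (wPar m n N) →ₐ[ℂ] RectV m n N :=
  DiffPoly.liftHom (fun x k => (der ^ k : Module.End ℂ (RectV m n N)) ((ℓ x.2.1 x.2.2).coeff x.1))
    fun x y k l => DiffSuperalgebra.supercomm _ _ _ _
      (IsHomog.der_pow (isHomogPoly_rectL x.2.1 x.2.2 x.1) k)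
      (IsHomog.der_pow (isHomogPoly_rectL y.2.1 y.2.2 y.1) l)

theorem wHom_gen (x : Fin N × GlIdx m n × GlIdx m n) (k : ℕ) :
    wHom (DiffPoly.gen (wPar m n N) x k) =
      (der ^ k : Module.End ℂ (RectV m n N)) ((ℓ x.2.1 x.2.2).coeff x.1) :=
  DiffPoly.liftHom_gen _ _ _ _

/-- This left inverse gives differential algebraic independence at once, and also the candidate
preimage `lastRow a` for generation. -/
theorem lastRow_wHom (a : DiffPoly (wPar m n N)) : lastRow (wHom a) = a := by
  have : (lastRow (m := m) (n := n) (N := N)).comp wHom = AlgHom.id ℂ _ := by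
    refine DiffPoly.algHom_ext fun x k => ?_
    rw [AlgHom.comp_apply, wHom_gen, AlgHom.id_apply]
    induction k with
    | zero => exact lastRow_coeff_rectL _ _ _
    | succ k ih => rw [pow_succ', Module.End.mul_apply, lastRow_der, ih, DiffPoly.der_gen]
  exact DFunLike.congr_fun this a

theorem wHom_mem_diffClosure (a : DiffPoly (wPar m n N)) :
    wHom a ∈ diffClosure (MatPDO.ofPoly ℓ) := by
  induction a using DiffPoly.induction with
  | hc r => rw [AlgHom.commutes]; exact algebraMap_mem _ _
  | hg x k =>
    refine Algebra.subset_adjoin ⟨k, (x.1 : ℕ), x.2.1, x.2.2, ?_⟩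
    rw [wHom_gen, MatPDO.coeff_ofPoly, MatPDO.coeffZ_natCast]
  | hadd a b ha hb => rw [map_add]; exact add_mem ha hb
  | hmul a b ha hb => rw [map_mul]; exact mul_mem ha hb

theorem coeff_ofPoly_rectL_mem (hN : 0 < N) (k : ℤ) (i j : GlIdx m n) :
    (MatPDO.ofPoly ℓ).coeff k i j ∈ wAlg m n N (-1) := by
  rw [MatPDO.coeff_ofPoly]
  rcases lt_or_ge k 0 with hk | hk
  · rw [MatPDO.coeffZ_of_neg hk, ← map_zero (algebraMap ℂ (RectV m n N))]
    exact algebraMap_mem_wAlg _ _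
  · obtain ⟨k, rfl⟩ := Int.eq_ofNat_of_zero_le hk
    rw [MatPDO.coeffZ_natCast]
    exact coeff_rectL_mem_wAlg hN i j k

theorem diffClosure_rectL (hN : 0 < N) :
    (diffClosure (MatPDO.ofPoly ℓ) : Set (RectV m n N)) = wAlg m n N (-1) := by
  have hle : diffClosure (MatPDO.ofPoly ℓ) ≤ wSubalgebra (m := m) (n := n) (N := N) (-1) := by
    refine Algebra.adjoin_le ?_
    rintro _ ⟨l, k, i, j, rfl⟩
    have : ∀ l, (der ^ l : Module.End ℂ (RectV m n N)) ((MatPDO.ofPoly ℓ).coeff k i j) ∈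
        wAlg m n N (-1) := by
      intro l
      induction l with
      | zero => exact coeff_ofPoly_rectL_mem hN k i j
      | succ l ih => rw [pow_succ', Module.End.mul_apply]; exact der_mem_wAlg _ ih
    exact this l
  refine Set.Subset.antisymm hle fun a ha => ?_
  have h1 : wHom (lastRow a) ∈ wAlg m n N (-1) := hle (wHom_mem_diffClosure _)
  -- The difference lies in W and restricts to zero on the last row, so it vanishes by the rigidity
  -- of `eq_zero_of_mem_wAlg`.
  have h2 : a - wHom (lastRow a) ∈ wAlg m n N (-1) :=
    (wSubalgebra (-1)).sub_mem ha h1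
  have h3 : a - wHom (lastRow a) = 0 := by
    refine eq_zero_of_mem_wAlg h2 (comp_zero_eq_zero_of_lastRow hN h2.1 ?_)
    rw [map_sub, lastRow_wHom, sub_self]
  rw [sub_eq_zero.1 h3]
  exact wHom_mem_diffClosure _

theorem diffAlgIndep_rectL :
    DiffAlgIndep (fun x : Fin N × GlIdx m n × GlIdx m n => π x.2.1 + π x.2.2)
      (fun x => (MatPDO.ofPoly ℓ).coeff (x.1 : ℕ) x.2.1 x.2.2) := by
  refine ⟨wHom, fun x k => ?_, Function.LeftInverse.injective lastRow_wHom⟩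
  exact (wHom_gen x k).trans (congrArg _ (MatPDO.coeffZ_natCast _ _).symm)

end Generators

end
end SuperPVA

open SuperPVA

theorem theorem4p8 (m n N : ℕ) (hN : 2 ≤ N) :
    (∃! L : MatPDO (GlIdx m n) (GlIdx m n) (RectV m n N), IsRectOperator m n N hN L) ∧
    ∀ L : MatPDO (GlIdx m n) (GlIdx m n) (RectV m n N), IsRectOperator m n N hN L →
      L.IsDifferential ∧ L.IsMonic N ∧
      (∀ k i j, L.coeff k i j ∈ wAlg m n N (-1)) ∧
      IsSATO (innerPar m n) (wBracket m n N (-1)) L ∧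
      IsAdlerTypePVsA (innerPar m n) (wAlg m n N (-1)) (wBracket m n N (-1)) N L := by
  have h0 : 0 < N := by omega
  refine ⟨⟨_, isRectOperator_rectL hN, fun L hL => hL.eq_ofPoly⟩, fun L hL => ?_⟩
  rw [hL.eq_ofPoly]
  exact ⟨isDifferential_rectL, isMonic_rectL h0, coeff_ofPoly_rectL_mem h0, isSATO_rectL h0,
    isPVsA_wAlg (-1), diffClosure_rectL h0, diffAlgIndep_rectL, isSATO_rectL h0⟩
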